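/- **Data.** Let $l,T>0$, $0<\alpha_1,\beta_1<1$, $1<\alpha_2,\beta_2<2$, $0\le\mu_1\le 1$, $0<\mu_2\le 1$, and put $\gamma_i=\beta_i+\mu_i(i-\beta_i)$, $\delta_i=\beta_i+\mu_i(\alpha_i-\beta_i)$ for $i=1,2$, and $\lambda_n=(n\pi/l)^2$. For $a>0$ let $$I_{0+}^{a}g(t)=\frac1{\Gamma(a)}\int_0^t (t-z)^{a-1}g(z)\,dz\ (t>0),\qquad I_{0-}^{a}g(t)=\frac1{\Gamma(a)}\int_t^0 (z-t)^{a-1}g(z)\,dz\ (t<0),$$ $I^0_{0\pm}=\mathrm{id}$, and let $$D_{0\pm}^{(\alpha_i,\beta_i)\mu_i}g=I_{0\pm}^{\mu_i(i-\alpha_i)}\Big(\pm\frac{d}{dt}\Big)^{i}I_{0\pm}^{(1-\mu_i)(i-\beta_i)}g$$ be the bi-ordinal Hilfer derivatives. Let $E_{a,b}(z)=\sum_{k\ge0}z^k/\Gamma(ak+b)$, $\Omega_1=(0,l)\times(0,T)$, $\Omega_2=(0,l)\times(-T,0)$. **Problem B.** Given $f$ on $[0,l]\times[-T,T]$ and $\psi$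 on $[0,l]$, find $u$ on $[0,l]\times([-T,0)\cup(0,T])$ such that $t^{1-\gamma_1}u$ and $t^{1-\gamma_1}D_{0+}^{(\alpha_1,\beta_1)\mu_1}u$ are (extend to) continuous functions on $\overline{\Omega}_1$, $(-t)^{2-\gamma_2}u$ and $(-t)^{2-\gamma_2}D_{0-}^{(\alpha_2,\beta_2)\mu_2}u$ are (extend to) continuous functions on $\overline{\Omega}_2$, $u_{xx}\in C(\Omega_1\cup\Omega_2)$, and $$D_{0+}^{(\alpha_1,\beta_1)\mu_1}u-u_{xx}=f\ \text{ in }\Omega_1,\qquad D_{0-}^{(\alpha_2,\beta_2)\mu_2}u-u_{xx}=f\ \text{ in }\Omega_2,$$ $$u(0,t)=u(l,t)=0,\quad t\in[-T,0)\cup(0,T];\qquad u(x,-T)=u(x,T)+\psi(x),\quad 0\le x\le l,$$ $$\lim_{t\to+0}I_{0+}^{1-\gamma_1}u(x,t)=\lim_{t\to-0}I_{0-}^{2-\gamma_2}u(x,t),\quad 0\le x\le l,$$ $$\lim_{t\to+0}t^{1-\delta_1}\frac{\partial}{\partial t}I_{0+}^{1-\gamma_1}u(x,t)=\lim_{t\to-0}\frac{\partial}{\partial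 t}I_{0-}^{2-\gamma_2}u(x,t),\quad 0<x<l,$$ all these limits existing and being finite. **Theorem.** Assume that for every $n\ge1$ $$\Delta_n=T^{\gamma_2-2}E_{\delta_2,\gamma_2-1}(-\lambda_nT^{\delta_2})+\frac{\lambda_nT^{\gamma_2-1}}{\Gamma(\delta_1)}E_{\delta_2,\gamma_2}(-\lambda_nT^{\delta_2})-T^{\gamma_1-1}E_{\delta_1,\gamma_1}(-\lambda_nT^{\delta_1})\ne0;$$ that $\psi\in C[0,l]\cap C^4(0,l)$, that $\psi,\psi'',\psi^{(4)}$ vanish at $0$ and $l$ (for the derivatives: in the sense of one-sided limits) and $\psi^{(5)}\in L_2(0,l)$ (weak derivative); and that $f\in C^{2,1}([0,l]\times[-T,T])$ (that is, $f,f_x,f_{xx},f_t$ are continuous up to the boundary), that $f$ and $f_{xx}$ vanish for $x=0$ and $x=l$, and $\partial_x^3f(\cdot,t)\in L_2(0,l)$ (weak derivative) for every $t\in(-T,T)$. Then Problem B has exactly one solution $u$. Moreover there are real sequences $(\tau_n),(\nu_n)$ such that $u(x,t)=\sum_{n\ge1}u_n(t)\sin(\sqrt{\lambda_n}x)$ for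 all $x\in[0,l]$ and $0<|t|\le T$, where, with $f_n(s)=\frac2l\int_0^l f(x,s)\sin(\sqrt{\lambda_n}x)\,dx$, $$u_n(t)=\tau_nt^{\gamma_1-1}E_{\delta_1,\gamma_1}(-\lambda_nt^{\delta_1})+\int_0^t(t-s)^{\delta_1-1}E_{\delta_1,\delta_1}(-\lambda_n(t-s)^{\delta_1})f_n(s)\,ds,\quad t>0,$$ $$u_n(t)=\tau_n(-t)^{\gamma_2-2}E_{\delta_2,\gamma_2-1}(-\lambda_n(-t)^{\delta_2})-\nu_n(-t)^{\gamma_2-1}E_{\delta_2,\gamma_2}(-\lambda_n(-t)^{\delta_2})+\int_t^0(s-t)^{\delta_2-1}E_{\delta_2,\delta_2}(-\lambda_n(s-t)^{\delta_2})f_n(s)\,ds,\quad t<0.$$ -/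

import Mathlib

open Set Filter Topology MeasureTheory

noncomputable section

namespace MixedHilfer

/-- Two-parameter Mittag-Leffler function `E_{a,b}(z) = ∑ z^k / Γ(a k + b)`. -/
def mittagLeffler (a b z : ℝ) : ℝ := ∑' k : ℕ, z ^ k / Real.Gamma (a * k + b)

/-- Left-sided Riemann-Liouville integral `I_{0+}^a g (t)`, `t > 0`; order `0` is the identity. -/
def leftInt (a : ℝ) (g : ℝ → ℝ) (t : ℝ) : ℝ :=
  if a = 0 then g t else (1 / Real.Gamma a) * ∫ z in (0 : ℝ)..t, (t - z) ^ (a - 1) * g z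

/-- Right-sided Riemann-Liouville integral `I_{0-}^a g (t)`, `t < 0`; order `0` is the identity. -/
def rightInt (a : ℝ) (g : ℝ → ℝ) (t : ℝ) : ℝ :=
  if a = 0 then g t else (1 / Real.Gamma a) * ∫ z in t..(0 : ℝ), (z - t) ^ (a - 1) * g z

/-- Left-sided bi-ordinal Hilfer derivative
`I_{0+}^{μ(n-α)} (d/dt)^n I_{0+}^{(1-μ)(n-β)} g`. -/
def leftHilfer (n : ℕ) (α β μ : ℝ) (g : ℝ → ℝ) (t : ℝ) : ℝ :=
  leftInt (μ * (n - α)) (iteratedDeriv n (leftInt ((1 - μ) * (n - β)) g)) t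

/-- Right-sided bi-ordinal Hilfer derivative
`I_{0-}^{μ(n-α)} (-d/dt)^n I_{0-}^{(1-μ)(n-β)} g`. -/
def rightHilfer (n : ℕ) (α β μ : ℝ) (g : ℝ → ℝ) (t : ℝ) : ℝ :=
  rightInt (μ * (n - α))
    (fun s => (-1) ^ n * iteratedDeriv n (rightInt ((1 - μ) * (n - β)) g) s) t

/-- The left-sided bi-ordinal Hilfer derivative of `g` exists at every point of `(0, T)`: all the
integrals converge absolutely and the inner function is `n` times differentiable on `(0, T)`. -/
def LeftHilferExists (n : ℕ) (α β μ T : ℝ) (g : ℝ → ℝ) : Prop :=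
  (∀ t ∈ Ioo 0 T, (1 - μ) * (n - β) = 0 ∨
    IntervalIntegrable (fun z => (t - z) ^ ((1 - μ) * (n - β) - 1) * g z) volume 0 t) ∧
  (∀ k < n, ∀ t ∈ Ioo 0 T,
    DifferentiableAt ℝ (iteratedDeriv k (leftInt ((1 - μ) * (n - β)) g)) t) ∧
  (∀ t ∈ Ioo 0 T, μ * (n - α) = 0 ∨
    IntervalIntegrable (fun z => (t - z) ^ (μ * (n - α) - 1) *
      iteratedDeriv n (leftInt ((1 - μ) * (n - β)) g) z) volume 0 t)

/-- The right-sided bi-ordinal Hilfer derivative of `g` exists at every point of `(-T, 0)`. -/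
def RightHilferExists (n : ℕ) (α β μ T : ℝ) (g : ℝ → ℝ) : Prop :=
  (∀ t ∈ Ioo (-T) 0, (1 - μ) * (n - β) = 0 ∨
    IntervalIntegrable (fun z => (z - t) ^ ((1 - μ) * (n - β) - 1) * g z) volume t 0) ∧
  (∀ k < n, ∀ t ∈ Ioo (-T) 0,
    DifferentiableAt ℝ (iteratedDeriv k (rightInt ((1 - μ) * (n - β)) g)) t) ∧
  (∀ t ∈ Ioo (-T) 0, μ * (n - α) = 0 ∨
    IntervalIntegrable (fun z => (z - t) ^ (μ * (n - α) - 1) *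
      iteratedDeriv n (rightInt ((1 - μ) * (n - β)) g) z) volume t 0)

/-- `γ = β + μ (n - β)`. -/
def gam (n : ℕ) (β μ : ℝ) : ℝ := β + μ * (n - β)

/-- `δ = β + μ (α - β)`. -/
def del (α β μ : ℝ) : ℝ := β + μ * (α - β)

/-- Eigenvalue `λ_n = (nπ/l)²`. -/
def eig (l : ℝ) (n : ℕ) : ℝ := (n * Real.pi / l) ^ 2

/-- Eigenfunction `sin(√λ_n x) = sin(nπx/l)`. -/
def mode (l : ℝ) (n : ℕ) (x : ℝ) : ℝ := Real.sin (n * Real.pi / l * x)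

/-- `n`-th Fourier sine coefficient on `(0, l)`. -/
def sineCoeff (l : ℝ) (n : ℕ) (g : ℝ → ℝ) : ℝ := (2 / l) * ∫ x in (0 : ℝ)..l, g x * mode l n x

/-- The numbers `Δ_n`. -/
def Delta (l T α₁ β₁ μ₁ α₂ β₂ μ₂ : ℝ) (n : ℕ) : ℝ :=
  T ^ (gam 2 β₂ μ₂ - 2) *
      mittagLeffler (del α₂ β₂ μ₂) (gam 2 β₂ μ₂ - 1) (-eig l n * T ^ del α₂ β₂ μ₂)
    + eig l n * T ^ (gam 2 β₂ μ₂ - 1) / Real.Gamma (del α₁ β₁ μ₁) *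
      mittagLeffler (del α₂ β₂ μ₂) (gam 2 β₂ μ₂) (-eig l n * T ^ del α₂ β₂ μ₂)
    - T ^ (gam 1 β₁ μ₁ - 1) *
      mittagLeffler (del α₁ β₁ μ₁) (gam 1 β₁ μ₁) (-eig l n * T ^ del α₁ β₁ μ₁)

/-- `h` has a weak derivative in `L₂(0, l)`, i.e. `h` is a primitive of an `L₂` function. -/
def HasL2Deriv (l : ℝ) (h : ℝ → ℝ) : Prop :=
  ∃ g : ℝ → ℝ, MemLp g 2 (volume.restrict (Ioo 0 l)) ∧
    ∀ x ∈ Ioo 0 l, ∀ y ∈ Ioo 0 l, h y - h x = ∫ z in x..y, g z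

/-- `ψ ∈ C[0,l] ∩ C⁴(0,l)`, `ψ, ψ'', ψ⁗` vanish at `0` and `l`, and `ψ⁽⁵⁾ ∈ L₂(0,l)`. -/
structure AdmissiblePsi (l : ℝ) (ψ : ℝ → ℝ) : Prop where
  cont : ContinuousOn ψ (Icc 0 l)
  contDiff : ContDiffOn ℝ 4 ψ (Ioo 0 l)
  zero_left : ψ 0 = 0
  zero_right : ψ l = 0
  d2_left : Tendsto (iteratedDeriv 2 ψ) (𝓝[>] 0) (𝓝 0)
  d2_right : Tendsto (iteratedDeriv 2 ψ) (𝓝[<] l) (𝓝 0)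
  d4_left : Tendsto (iteratedDeriv 4 ψ) (𝓝[>] 0) (𝓝 0)
  d4_right : Tendsto (iteratedDeriv 4 ψ) (𝓝[<] l) (𝓝 0)
  d5 : HasL2Deriv l (iteratedDeriv 4 ψ)

/-- `f ∈ C^{2,1}([0,l] × [-T,T])` (`f`, `f_x`, `f_xx`, `f_t` continuous up to the boundary), `f` and
`f_xx` vanish for `x = 0` and `x = l`, and `∂³_x f(·,t) ∈ L₂(0,l)`. -/
def AdmissibleF (l T : ℝ) (f : ℝ → ℝ → ℝ) : Prop :=
  ∃ fx fxx ft : ℝ → ℝ → ℝ,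
    ContinuousOn (fun p : ℝ × ℝ => f p.1 p.2) (Icc 0 l ×ˢ Icc (-T) T) ∧
    ContinuousOn (fun p : ℝ × ℝ => fx p.1 p.2) (Icc 0 l ×ˢ Icc (-T) T) ∧
    ContinuousOn (fun p : ℝ × ℝ => fxx p.1 p.2) (Icc 0 l ×ˢ Icc (-T) T) ∧
    ContinuousOn (fun p : ℝ × ℝ => ft p.1 p.2) (Icc 0 l ×ˢ Icc (-T) T) ∧
    (∀ x ∈ Ioo 0 l, ∀ t ∈ Ioo (-T) T,
      HasDerivAt (fun y => f y t) (fx x t) x ∧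
      HasDerivAt (fun y => fx y t) (fxx x t) x ∧
      HasDerivAt (fun s => f x s) (ft x t) t) ∧
    (∀ t ∈ Icc (-T) T, f 0 t = 0 ∧ f l t = 0 ∧ fxx 0 t = 0 ∧ fxx l t = 0) ∧
    (∀ t ∈ Ioo (-T) T, HasL2Deriv l (fun x => fxx x t))

/-- `g`, given on `S`, extends to a continuous function on `K`. -/
def ExtendsCont (S K : Set (ℝ × ℝ)) (g : ℝ → ℝ → ℝ) : Prop :=
  ∃ G : ℝ × ℝ → ℝ, ContinuousOn G K ∧ ∀ p ∈ S, G p = g p.1 p.2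

/-- `u` solves the nonlocal problem. Only the values of `u` on `[0,l] × ([-T,0) ∪ (0,T])` matter.
Here `i - γ_i = (1 - μ_i)(i - β_i)`. -/
structure IsSolution (l T α₁ β₁ μ₁ α₂ β₂ μ₂ : ℝ) (f : ℝ → ℝ → ℝ) (ψ : ℝ → ℝ)
    (u : ℝ → ℝ → ℝ) : Prop where
  /-- `t^{1-γ₁} u ∈ C` on the closure of `Ω₁`. -/
  reg_u_pos : ExtendsCont (Icc 0 l ×ˢ Ioc 0 T) (Icc 0 l ×ˢ Icc 0 T)
    (fun x t => t ^ (1 - gam 1 β₁ μ₁) * u x t)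
  /-- `(-t)^{2-γ₂} u ∈ C` on the closure of `Ω₂`. -/
  reg_u_neg : ExtendsCont (Icc 0 l ×ˢ Ico (-T) 0) (Icc 0 l ×ˢ Icc (-T) 0)
    (fun x t => (-t) ^ (2 - gam 2 β₂ μ₂) * u x t)
  exists_D_pos : ∀ x ∈ Ioo 0 l, LeftHilferExists 1 α₁ β₁ μ₁ T (u x)
  exists_D_neg : ∀ x ∈ Ioo 0 l, RightHilferExists 2 α₂ β₂ μ₂ T (u x)
  reg_D_pos : ExtendsCont (Ioo 0 l ×ˢ Ioo 0 T) (Icc 0 l ×ˢ Icc 0 T)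
    (fun x t => t ^ (1 - gam 1 β₁ μ₁) * leftHilfer 1 α₁ β₁ μ₁ (u x) t)
  reg_D_neg : ExtendsCont (Ioo 0 l ×ˢ Ioo (-T) 0) (Icc 0 l ×ˢ Icc (-T) 0)
    (fun x t => (-t) ^ (2 - gam 2 β₂ μ₂) * rightHilfer 2 α₂ β₂ μ₂ (u x) t)
  /-- `u_xx` exists and is continuous on `Ω₁ ∪ Ω₂`. -/
  diff_x : ∀ x ∈ Ioo 0 l, ∀ t ∈ Ioo (-T) 0 ∪ Ioo 0 T,
    DifferentiableAt ℝ (fun y => u y t) x ∧ DifferentiableAt ℝ (deriv (fun y => u y t)) x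
  cont_xx : ContinuousOn (fun p : ℝ × ℝ => iteratedDeriv 2 (fun y => u y p.2) p.1)
    (Ioo 0 l ×ˢ (Ioo (-T) 0 ∪ Ioo 0 T))
  eq_pos : ∀ x ∈ Ioo 0 l, ∀ t ∈ Ioo 0 T,
    leftHilfer 1 α₁ β₁ μ₁ (u x) t - iteratedDeriv 2 (fun y => u y t) x = f x t
  eq_neg : ∀ x ∈ Ioo 0 l, ∀ t ∈ Ioo (-T) 0,
    rightHilfer 2 α₂ β₂ μ₂ (u x) t - iteratedDeriv 2 (fun y => u y t) x = f x t
  bdry : ∀ t ∈ Ico (-T) 0 ∪ Ioc 0 T, u 0 t = 0 ∧ u l t = 0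
  nonlocal : ∀ x ∈ Icc 0 l, u x (-T) = u x T + ψ x
  conj₀ : ∀ x ∈ Icc 0 l, ∃ c : ℝ,
    Tendsto (fun t => leftInt (1 - gam 1 β₁ μ₁) (u x) t) (𝓝[>] 0) (𝓝 c) ∧
    Tendsto (fun t => rightInt (2 - gam 2 β₂ μ₂) (u x) t) (𝓝[<] 0) (𝓝 c)
  conj₁ : ∀ x ∈ Ioo 0 l, ∃ c : ℝ,
    Tendsto (fun t => t ^ (1 - del α₁ β₁ μ₁) * deriv (leftInt (1 - gam 1 β₁ μ₁) (u x)) t)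
      (𝓝[>] 0) (𝓝 c) ∧
    Tendsto (fun t => deriv (rightInt (2 - gam 2 β₂ μ₂) (u x)) t) (𝓝[<] 0) (𝓝 c)

/-- Time coefficient for `t > 0`:
`τ t^{γ₁-1} E_{δ₁,γ₁}(-λ_n t^{δ₁}) + ∫₀ᵗ (t-s)^{δ₁-1} E_{δ₁,δ₁}(-λ_n (t-s)^{δ₁}) f_n(s) ds`. -/
def coeffPos (l α β μ : ℝ) (f : ℝ → ℝ → ℝ) (n : ℕ) (τ t : ℝ) : ℝ :=
  τ * t ^ (gam 1 β μ - 1) * mittagLeffler (del α β μ) (gam 1 β μ) (-eig l n * t ^ del α β μ)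
    + ∫ s in (0 : ℝ)..t, (t - s) ^ (del α β μ - 1) *
        mittagLeffler (del α β μ) (del α β μ) (-eig l n * (t - s) ^ del α β μ) *
        sineCoeff l n (fun x => f x s)

/-- Time coefficient for `t < 0`:
`φ (-t)^{γ₂-2} E_{δ₂,γ₂-1}(-λ_n (-t)^{δ₂}) - ν (-t)^{γ₂-1} E_{δ₂,γ₂}(-λ_n (-t)^{δ₂})
  + ∫ₜ⁰ (s-t)^{δ₂-1} E_{δ₂,δ₂}(-λ_n (s-t)^{δ₂}) f_n(s) ds`. -/
def coeffNeg (l α β μ : ℝ) (f : ℝ → ℝ → ℝ) (n : ℕ) (φ ν t : ℝ) : ℝ :=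
  φ * (-t) ^ (gam 2 β μ - 2) *
      mittagLeffler (del α β μ) (gam 2 β μ - 1) (-eig l n * (-t) ^ del α β μ)
    - ν * (-t) ^ (gam 2 β μ - 1) *
      mittagLeffler (del α β μ) (gam 2 β μ) (-eig l n * (-t) ^ del α β μ)
    + ∫ s in t..(0 : ℝ), (s - t) ^ (del α β μ - 1) *
        mittagLeffler (del α β μ) (del α β μ) (-eig l n * (s - t) ^ del α β μ) *
        sineCoeff l n (fun x => f x s)

/-- `u` is the sum of a Fourier sine series with Mittag-Leffler time coefficients; the coefficient
sequences of `I_{0+}^{1-γ₁}u` and `I_{0-}^{2-γ₂}u` at `t = 0` agree. -/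
def IsSineSeries (l T α₁ β₁ μ₁ α₂ β₂ μ₂ : ℝ) (f u : ℝ → ℝ → ℝ) : Prop :=
  ∃ τ ν : ℕ → ℝ, ∀ x ∈ Icc 0 l,
    (∀ t ∈ Ioc 0 T,
      HasSum (fun n : ℕ => coeffPos l α₁ β₁ μ₁ f (n + 1) (τ (n + 1)) t * mode l (n + 1) x)
        (u x t)) ∧
    (∀ t ∈ Ico (-T) 0,
      HasSum (fun n : ℕ =>
        coeffNeg l α₂ β₂ μ₂ f (n + 1) (τ (n + 1)) (ν (n + 1)) t * mode l (n + 1) x)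
        (u x t))

end MixedHilfer

end

namespace MixedHilfer

/-! Everything is reduced to the time coefficients of the sine modes. The reflection t ↦ -t
(`rightInt_eq`, `isSolution_iff`) turns the lower half of the problem into a left-sided one, so both
halves are problems on (0, T] of order N = 1 or N = 2, with forcing g(x, t) = f(x, ±t). Write I^a
for the left-sided fractional integral.

Uniqueness. Integrated in time, the equation reads I^{N-γ} v = P + Q t + I^{N-γ+δ} (v_xx + g),
without Q when N = 1. In mode n, v_xx becomes -λ_n v_n. Cancelling the injective operator I^{N-γ}
leaves an Abel-Volterra equation v_n = powers of t + I^δ (g_n - λ_n v_n), whose only solution is the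
Mittag-Leffler formula (`volterra_solution`, `coeff_of_integrated`). The first conjugation condition
gives both halves the same τ_n. The second one forces ν_n = (-λ_n τ_n + s_n) / Γ(δ₁), where s_n =
f_n(0) if γ₁ = 1 and s_n = 0 otherwise (`HalfSolution.nu_coeff`). The nonlocal condition then
becomes τ_n Δ_n = data (`nonlocal_iff`), so Δ_n ≠ 0 fixes τ_n, and completeness of the sines
(`eqOn_of_sineCoeff_eq`) gives uniqueness.

Existence. The series with these coefficients is the solution; three facts carry the proof.

(1) |E_{a,b}(-z)| ≤ C / (1 + z) for z ≥ 0 when 0 < a < 2 and 0 < b < a + 1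
(`exists_abs_mittagLeffler_le`). It is read off from a representation of E by integrals over two
rays, which is identified by comparing Laplace transforms. By interpolation the kernel t^{b-1}
E_{a,b}(-λ t^a) is at most C λ^{-θ} t^{b-aθ-1} for every θ in [0, 1].

(2) Δ_n stays away from 0: the recurrence for E shows that it tends to T^{γ₂-δ₂-1} / (Γ(δ₁)
Γ(γ₂-δ₂)), which is nonzero because δ₂ < γ₂, and this is where μ₂ > 0 enters. Hence τ_n =
O(λ_n^{-1-θ}) and ν_n = O(λ_n^{-θ}) for every θ < 1 (`exists_coeff_bounds`).

(3) The Hilfer derivative is not taken term by term. Instead a source h is constructed with I^{N-γ}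
v = polynomial + I^N h and I^{γ-δ} h = v_xx + g, both identities being checked on sine coefficients
(`leftInt_eq_of_coeff`). The delicate part of h is the convolution of t^{b-1} E_{δ,b}(-λ_n t^δ), b =
δ+1-γ, with the coefficients of ∂_t g, for which only a uniform bound is available. In the parabolic
half b > 3δ/4 and the series converges absolutely. In the hyperbolic half b may be too small for
that; there E_{δ,b}(-ξ²) is the cosine transform of an integrable function (`exists_cosine_kernel`),
so the multiplier is an average of translates of the odd periodic extension of ∂_t g, and no series
is summed. -/

/-! ### Convolutions with power singularities at t = 0 -/

/-- The Riemann-Liouville kernel `t^(a-1) / Γ(a)`. -/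
noncomputable def powKer (a t : ℝ) : ℝ := t ^ (a - 1) / Real.Gamma a

/-- Convolution on the half-line. -/
noncomputable def conv (k g : ℝ → ℝ) (t : ℝ) : ℝ := ∫ s in (0 : ℝ)..t, k (t - s) * g s

/-- `g` is continuous on `(0, T]` and `O(t^(c-1))` there. -/
def PowBdd (T c : ℝ) (g : ℝ → ℝ) : Prop :=
  ContinuousOn g (Ioc 0 T) ∧ ∃ C, ∀ t ∈ Ioc 0 T, |g t| ≤ C * t ^ (c - 1)

lemma beta_integral {a b t : ℝ} (ha : 0 < a) (hb : 0 < b) (ht : 0 < t) :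
    ∫ s in (0 : ℝ)..t, (t - s) ^ (a - 1) * s ^ (b - 1) =
      Real.Gamma a * Real.Gamma b / Real.Gamma (a + b) * t ^ (a + b - 1) := by
  have h := Complex.betaIntegral_scaled (b : ℂ) (a : ℂ) ht
  rw [Complex.betaIntegral_eq_Gamma_mul_div _ _ (by simpa) (by simpa)] at h
  have h1 : ∫ x in (0 : ℝ)..t, (x : ℂ) ^ ((b : ℂ) - 1) * ((t : ℂ) - x) ^ ((a : ℂ) - 1) =
      ∫ x in (0 : ℝ)..t, (((t - x) ^ (a - 1) * x ^ (b - 1) : ℝ) : ℂ) := by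
    apply intervalIntegral.integral_congr
    intro x hx
    rw [uIcc_of_le ht.le] at hx
    have h1 : (x : ℂ) ^ ((b : ℂ) - 1) = ((x ^ (b - 1) : ℝ) : ℂ) := by
      rw [Complex.ofReal_cpow hx.1]; push_cast; rfl
    have h2 : ((t : ℂ) - x) ^ ((a : ℂ) - 1) = (((t - x) ^ (a - 1) : ℝ) : ℂ) := by
      rw [Complex.ofReal_cpow (by linarith [hx.2])]; push_cast; rfl
    simp only [h1, h2]; push_cast; ring
  rw [h1, intervalIntegral.integral_ofReal, Complex.Gamma_ofReal, Complex.Gamma_ofReal,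
    ← Complex.ofReal_add, Complex.Gamma_ofReal] at h
  have h2 : (t : ℂ) ^ (((b + a : ℝ) : ℂ) - 1) = ((t ^ (b + a - 1) : ℝ) : ℂ) := by
    rw [Complex.ofReal_cpow ht.le]; push_cast; rfl
  rw [h2] at h
  have h3 := congrArg Complex.re h
  norm_cast at h3
  rw [h3, add_comm b a]; ring

lemma beta_intervalIntegrable {a b t : ℝ} (ha : 0 < a) (hb : 0 < b) (ht : 0 < t) :
    IntervalIntegrable (fun s => (t - s) ^ (a - 1) * s ^ (b - 1)) volume 0 t := by
  -- A non-integrable function has integral 0 by convention, so the positive value of the Beta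
  -- integral proves integrability.
  apply intervalIntegral.intervalIntegrable_of_integral_ne_zero
  rw [beta_integral ha hb ht]
  have := Real.Gamma_pos_of_pos ha
  have := Real.Gamma_pos_of_pos hb
  have := Real.Gamma_pos_of_pos (add_pos ha hb)
  positivity

/-- The constant in the convolution estimate. -/
noncomputable def betaC (a b : ℝ) : ℝ := Real.Gamma a * Real.Gamma b / Real.Gamma (a + b)

lemma betaC_pos {a b : ℝ} (ha : 0 < a) (hb : 0 < b) : 0 < betaC a b := by
  have := Real.Gamma_pos_of_pos ha
  have := Real.Gamma_pos_of_pos hb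
  have := Real.Gamma_pos_of_pos (add_pos ha hb)
  unfold betaC; positivity

lemma PowBdd.mono {T T' c : ℝ} {g : ℝ → ℝ} (h : PowBdd T c g) (hT : T' ≤ T) : PowBdd T' c g :=
  ⟨h.1.mono (Ioc_subset_Ioc_right hT), h.2.imp fun _ hC t ht => hC t ⟨ht.1, ht.2.trans hT⟩⟩

lemma PowBdd.congr {T c : ℝ} {g g' : ℝ → ℝ} (h : PowBdd T c g)
    (hg : ∀ t ∈ Ioc 0 T, g' t = g t) : PowBdd T c g' :=
  ⟨h.1.congr hg, h.2.imp fun _ hC t ht => by rw [hg t ht]; exact hC t ht⟩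

lemma PowBdd.add {T c : ℝ} {g g' : ℝ → ℝ} (h : PowBdd T c g) (h' : PowBdd T c g') :
    PowBdd T c (fun t => g t + g' t) := by
  obtain ⟨hc, C, hC⟩ := h
  obtain ⟨hc', C', hC'⟩ := h'
  refine ⟨hc.add hc', C + C', fun t ht => ?_⟩
  have := abs_add_le (g t) (g' t)
  linarith [hC t ht, hC' t ht, add_mul C C' (t ^ (c - 1))]

lemma PowBdd.const_mul {T c : ℝ} {g : ℝ → ℝ} (h : PowBdd T c g) (A : ℝ) :
    PowBdd T c (fun t => A * g t) := by
  obtain ⟨hc, C, hC⟩ := h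
  refine ⟨continuousOn_const.mul hc, |A| * C, fun t ht => ?_⟩
  rw [abs_mul, mul_assoc]
  exact mul_le_mul_of_nonneg_left (hC t ht) (abs_nonneg A)

lemma PowBdd.weaken {T c c' : ℝ} {g : ℝ → ℝ} (h : PowBdd T c g) (hc : c' ≤ c) :
    PowBdd T c' g := by
  obtain ⟨hg, C, hC⟩ := h
  refine ⟨hg, |C| * T ^ (c - c'), fun t ht => (hC t ht).trans ?_⟩
  have h1 : t ^ (c - 1) = t ^ (c - c') * t ^ (c' - 1) := by
    rw [← Real.rpow_add ht.1]; ring_nf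
  have h2 : t ^ (c - c') ≤ T ^ (c - c') :=
    Real.rpow_le_rpow ht.1.le ht.2 (by linarith)
  rw [h1, mul_assoc]
  have h3 : (0 : ℝ) ≤ t ^ (c' - 1) := Real.rpow_nonneg ht.1.le _
  have h4 : (0 : ℝ) ≤ t ^ (c - c') := Real.rpow_nonneg ht.1.le _
  exact mul_le_mul (le_abs_self C) (mul_le_mul_of_nonneg_right h2 h3) (by positivity)
    (abs_nonneg C)

lemma powBdd_rpow (T c : ℝ) : PowBdd T c (fun t => t ^ (c - 1)) := by
  refine ⟨fun t ht => ?_, 1, fun t ht => ?_⟩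
  · exact (Real.continuousAt_rpow_const _ _ (Or.inl ht.1.ne')).continuousWithinAt
  · rw [abs_of_nonneg (Real.rpow_nonneg ht.1.le _), one_mul]

lemma powBdd_powKer (T c : ℝ) : PowBdd T c (powKer c) :=
  ((powBdd_rpow T c).const_mul (1 / Real.Gamma c)).congr fun t _ => by
    unfold powKer; ring

lemma powBdd_of_continuousOn {T : ℝ} {g : ℝ → ℝ} (hg : ContinuousOn g (Icc 0 T)) :
    PowBdd T 1 g := by
  obtain ⟨C, hC⟩ := isCompact_Icc.exists_bound_of_continuousOn hg
  refine ⟨hg.mono Ioc_subset_Icc_self, C, fun t ht => ?_⟩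
  simpa using hC t (Ioc_subset_Icc_self ht)

lemma abs_convolution_integrand_le {t a b A B : ℝ} {p k : ℝ → ℝ}
    (hp : ∀ s ∈ Ioo 0 t, |p s| ≤ A * s ^ (a - 1)) (hk : ∀ s ∈ Ioo 0 t, |k s| ≤ B * s ^ (b - 1))
    {s : ℝ} (hs : s ∈ Ioo 0 t) :
    |p (t - s) * k s| ≤ A * B * ((t - s) ^ (a - 1) * s ^ (b - 1)) := by
  have h1 := hp (t - s) ⟨by linarith [hs.2], by linarith [hs.1]⟩
  have h2 := hk s hs
  rw [abs_mul]
  calc _ ≤ (A * (t - s) ^ (a - 1)) * (B * s ^ (b - 1)) :=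
        mul_le_mul h1 h2 (abs_nonneg _) ((abs_nonneg _).trans h1)
    _ = _ := by ring

lemma intervalIntegrable_iff_Ioo {f : ℝ → ℝ} {a b : ℝ} (hab : a ≤ b) :
    IntervalIntegrable f volume a b ↔ IntegrableOn f (Ioo a b) := by
  rw [intervalIntegrable_iff_integrableOn_Ioc_of_le hab, integrableOn_Ioc_iff_integrableOn_Ioo]

lemma integral_eq_Ioo {f : ℝ → ℝ} {a b : ℝ} (hab : a ≤ b) :
    ∫ s in a..b, f s = ∫ s in Ioo a b, f s := by
  rw [intervalIntegral.integral_of_le hab, integral_Ioc_eq_integral_Ioo]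

lemma conv_intervalIntegrable_of_bound {t a b A B : ℝ} (ha : 0 < a) (hb : 0 < b) (ht : 0 < t)
    {p k : ℝ → ℝ} (hpc : ContinuousOn p (Ioo 0 t)) (hkc : ContinuousOn k (Ioo 0 t))
    (hp : ∀ s ∈ Ioo 0 t, |p s| ≤ A * s ^ (a - 1)) (hk : ∀ s ∈ Ioo 0 t, |k s| ≤ B * s ^ (b - 1)) :
    IntervalIntegrable (fun s => p (t - s) * k s) volume 0 t := by
  rw [intervalIntegrable_iff_Ioo ht.le]
  have hi := (intervalIntegrable_iff_Ioo ht.le).1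
    ((beta_intervalIntegrable ha hb ht).const_mul (A * B))
  refine Integrable.mono' hi ?_ ?_
  · refine ContinuousOn.aestronglyMeasurable ?_ measurableSet_Ioo
    refine (hpc.comp (by fun_prop) fun s hs => ?_).mul hkc
    exact ⟨by linarith [hs.2], by linarith [hs.1]⟩
  · filter_upwards [ae_restrict_mem measurableSet_Ioo] with s hs
    exact abs_convolution_integrand_le hp hk hs

lemma abs_conv_le {t a b A B : ℝ} (ha : 0 < a) (hb : 0 < b) (ht : 0 < t)
    {p k : ℝ → ℝ}
    (hp : ∀ s ∈ Ioo 0 t, |p s| ≤ A * s ^ (a - 1)) (hk : ∀ s ∈ Ioo 0 t, |k s| ≤ B * s ^ (b - 1)) :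
    |conv p k t| ≤ A * B * betaC a b * t ^ (a + b - 1) := by
  have hi := (beta_intervalIntegrable ha hb ht).const_mul (A * B)
  unfold conv
  rw [integral_eq_Ioo ht.le, ← Real.norm_eq_abs]
  refine (norm_integral_le_of_norm_le ((intervalIntegrable_iff_Ioo ht.le).1 hi) ?_).trans ?_
  · filter_upwards [ae_restrict_mem measurableSet_Ioo] with s hs
    exact abs_convolution_integrand_le hp hk hs
  · rw [← integral_eq_Ioo ht.le, intervalIntegral.integral_const_mul, beta_integral ha hb ht]
    unfold betaC
    exact le_of_eq (by ring)

lemma PowBdd.intervalIntegrable_conv {t a b : ℝ} (ha : 0 < a) (hb : 0 < b) (ht : 0 < t)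
    {p k : ℝ → ℝ} (hp : PowBdd t a p) (hk : PowBdd t b k) :
    IntervalIntegrable (fun s => p (t - s) * k s) volume 0 t := by
  obtain ⟨hpc, A, hA⟩ := hp
  obtain ⟨hkc, B, hB⟩ := hk
  exact conv_intervalIntegrable_of_bound ha hb ht (hpc.mono Ioo_subset_Ioc_self)
    (hkc.mono Ioo_subset_Ioc_self) (fun s hs => hA s (Ioo_subset_Ioc_self hs))
    (fun s hs => hB s (Ioo_subset_Ioc_self hs))

lemma PowBdd.intervalIntegrable {t b : ℝ} (hb : 0 < b) (ht : 0 < t)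
    {k : ℝ → ℝ} (hk : PowBdd t b k) : IntervalIntegrable k volume 0 t := by
  have h : PowBdd t 1 (fun _ => (1 : ℝ)) := powBdd_of_continuousOn continuousOn_const
  simpa using h.intervalIntegrable_conv one_pos hb ht hk

lemma conv_congr {t : ℝ} (ht : 0 < t) {p p' k k' : ℝ → ℝ} (hp : ∀ s ∈ Ioo 0 t, p s = p' s)
    (hk : ∀ s ∈ Ioo 0 t, k s = k' s) : conv p k t = conv p' k' t := by
  unfold conv
  rw [integral_eq_Ioo ht.le, integral_eq_Ioo ht.le]
  refine setIntegral_congr_fun measurableSet_Ioo fun s hs => ?_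
  rw [hk s hs, hp (t - s) ⟨by linarith [hs.2], by linarith [hs.1]⟩]

lemma conv_comm (p k : ℝ → ℝ) (t : ℝ) : conv p k t = conv k p t := by
  unfold conv
  have h := intervalIntegral.integral_comp_sub_left (fun s => k (t - s) * p s) t (a := 0) (b := t)
  simp only [sub_sub_cancel, sub_self, sub_zero] at h
  rw [← h]
  exact intervalIntegral.integral_congr fun s _ => by simp only [mul_comm]

lemma conv_const_one (g : ℝ → ℝ) (t : ℝ) : conv (fun _ => 1) g t = ∫ s in (0 : ℝ)..t, g s := by
  simp [conv]

lemma conv_scaled (p k : ℝ → ℝ) (t : ℝ) :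
    conv p k t = t * ∫ σ in (0 : ℝ)..1, p (t * (1 - σ)) * k (t * σ) := by
  unfold conv
  have h := intervalIntegral.mul_integral_comp_mul_left (f := fun s => p (t - s) * k s) (c := t)
    (a := 0) (b := 1)
  simp only [mul_zero, mul_one] at h
  rw [← h]
  congr 1
  exact intervalIntegral.integral_congr fun s _ => by simp only [mul_sub, mul_one]

/-- The bound is the Beta integral. For continuity the convolution is rescaled to the fixed interval
(0, 1) by `conv_scaled`, so that t enters only through the integrand and dominated convergence
applies. -/
lemma PowBdd.conv {T a b : ℝ} (ha : 0 < a) (hb : 0 < b)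
    {p k : ℝ → ℝ} (hp : PowBdd T a p) (hk : PowBdd T b k) : PowBdd T (a + b) (conv p k) := by
  obtain ⟨hpc, A, hA⟩ := hp
  obtain ⟨hkc, B, hB⟩ := hk
  refine ⟨?_, A * B * betaC a b, fun t ht => abs_conv_le ha hb ht.1
    (fun s hs => hA s ⟨hs.1, hs.2.le.trans ht.2⟩) (fun s hs => hB s ⟨hs.1, hs.2.le.trans ht.2⟩)⟩
  intro t₀ ht₀
  have h1 : ContinuousWithinAt (fun t => ∫ σ in (0 : ℝ)..1, p (t * (1 - σ)) * k (t * σ))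
      (Ioc 0 T) t₀ := by
    -- On (t₀/2, T] every power of t is bounded by the larger of its two end values, which makes the
    -- dominating function independent of t.
    have hmem : Ioc (t₀ / 2) T ∈ 𝓝[Ioc 0 T] t₀ := by
      have : Ioi (t₀ / 2) ∈ 𝓝 t₀ := Ioi_mem_nhds (by linarith [ht₀.1])
      filter_upwards [self_mem_nhdsWithin, mem_nhdsWithin_of_mem_nhds this] with t h1 h2
      exact ⟨h2, h1.2⟩
    have hT : 0 < T := ht₀.1.trans_le ht₀.2
    have hmax : ∀ e : ℝ, ∀ t ∈ Ioc (t₀ / 2) T, t ^ e ≤ max ((t₀ / 2) ^ e) (T ^ e) := by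
      intro e t ht
      rcases le_total 0 e with he | he
      · exact le_max_of_le_right (Real.rpow_le_rpow (by linarith [ht.1, ht₀.1]) ht.2 he)
      · exact le_max_of_le_left
          (Real.rpow_le_rpow_of_nonpos (by linarith [ht₀.1]) ht.1.le he)
    set M := max ((t₀ / 2) ^ (a + b - 2)) (T ^ (a + b - 2)) with hM
    refine intervalIntegral.continuousWithinAt_of_dominated_interval
      (bound := fun σ => |A * B| * M * ((1 - σ) ^ (a - 1) * σ ^ (b - 1))) ?_ ?_ ?_ ?_
    · filter_upwards [hmem] with t ht
      have ht0 : 0 < t := by linarith [ht.1, ht₀.1]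
      rw [uIoc_of_le zero_le_one]
      rw [← restrict_Ioo_eq_restrict_Ioc]
      refine ContinuousOn.aestronglyMeasurable ?_ measurableSet_Ioo
      refine (hpc.comp (by fun_prop) fun s hs => ?_).mul (hkc.comp (by fun_prop) fun s hs => ?_)
      · exact ⟨mul_pos ht0 (by linarith [hs.2]), by nlinarith [hs.1, ht.2]⟩
      · exact ⟨mul_pos ht0 hs.1, by nlinarith [hs.2, ht.2]⟩
    · filter_upwards [hmem] with t ht
      have ht0 : 0 < t := by linarith [ht.1, ht₀.1]
      have hne : ∀ᵐ σ : ℝ, σ ≠ 1 := by simp [ae_iff, measure_singleton]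
      filter_upwards [hne] with σ hσ1 hσ
      rw [uIoc_of_le zero_le_one] at hσ
      have h1 : 0 < 1 - σ := by
        have := lt_of_le_of_ne hσ.2 hσ1
        linarith
      have e1 := hA (t * (1 - σ)) ⟨mul_pos ht0 h1, by nlinarith [hσ.1, ht.2]⟩
      have e2 := hB (t * σ) ⟨mul_pos ht0 hσ.1, by nlinarith [hσ.2, ht.2]⟩
      rw [Real.norm_eq_abs, abs_mul]
      rw [Real.mul_rpow ht0.le h1.le] at e1
      rw [Real.mul_rpow ht0.le hσ.1.le] at e2
      have h2 : 0 < (1 - σ) ^ (a - 1) * σ ^ (b - 1) :=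
        mul_pos (Real.rpow_pos_of_pos h1 _) (Real.rpow_pos_of_pos hσ.1 _)
      have h3 : t ^ (a - 1) * t ^ (b - 1) = t ^ (a + b - 2) := by
        rw [← Real.rpow_add ht0]; ring_nf
      calc _ ≤ (A * (t ^ (a - 1) * (1 - σ) ^ (a - 1))) * (B * (t ^ (b - 1) * σ ^ (b - 1))) :=
            mul_le_mul e1 e2 (abs_nonneg _) ((abs_nonneg _).trans e1)
        _ = (A * B) * t ^ (a + b - 2) * ((1 - σ) ^ (a - 1) * σ ^ (b - 1)) := by
            rw [← h3]; ring
        _ ≤ _ := by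
            refine mul_le_mul_of_nonneg_right ?_ h2.le
            exact mul_le_mul (le_abs_self _) (hmax _ t ht) (Real.rpow_nonneg ht0.le _)
              (abs_nonneg _)
    · exact (beta_intervalIntegrable ha hb one_pos).const_mul _
    · have hne : ∀ᵐ σ : ℝ, σ ≠ 1 := by simp [ae_iff, measure_singleton]
      filter_upwards [hne] with σ hσ1 hσ
      rw [uIoc_of_le zero_le_one] at hσ
      have h1 : 0 < 1 - σ := by
        have := lt_of_le_of_ne hσ.2 hσ1
        linarith
      have c1 : ContinuousOn (fun t => p (t * (1 - σ))) (Ioc 0 T) :=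
        hpc.comp (by fun_prop) fun t ht => ⟨mul_pos ht.1 h1, by nlinarith [hσ.1, ht.1, ht.2]⟩
      have c2 : ContinuousOn (fun t => k (t * σ)) (Ioc 0 T) :=
        hkc.comp (by fun_prop) fun t ht => ⟨mul_pos ht.1 hσ.1, by nlinarith [hσ.2, ht.1, ht.2]⟩
      exact (c1.mul c2) t₀ ht₀
  have h2 := (continuousWithinAt_id (s := Ioc 0 T) (x := t₀)).mul h1
  refine h2.congr (fun t _ => conv_scaled p k t) (conv_scaled p k t₀)

/-- Fubini on the triangle r < s < t, with p and k extended by zero so that both integrals run over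
(0, t). The factor g is only measurable with the weighted integrability that |p| * |k| requires:
this generality is needed to invert a fractional integral of a derivative about which nothing else
is known. -/
lemma conv_assoc {t a b : ℝ} (ha : 0 < a) (hb : 0 < b) (ht : 0 < t) {p k g : ℝ → ℝ}
    (hp : PowBdd t a p) (hk : PowBdd t b k)
    (hg : AEStronglyMeasurable g (volume.restrict (Ioo 0 t)))
    (hgi : IntegrableOn (fun s => (t - s) ^ (a + b - 1) * g s) (Ioo 0 t)) :
    conv p (conv k g) t = conv (conv p k) g t := by
  classical
  set μ : Measure ℝ := volume.restrict (Ioo 0 t) with hμ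
  set P : ℝ → ℝ := (Ioc 0 t).piecewise p 0 with hP
  set K : ℝ → ℝ := (Ioc 0 t).piecewise k 0 with hK
  have hPm : Measurable P := hp.1.measurable_piecewise continuousOn_const measurableSet_Ioc
  have hKm : Measurable K := hk.1.measurable_piecewise continuousOn_const measurableSet_Ioc
  have hPe : ∀ s ∈ Ioc 0 t, P s = p s := fun s hs => piecewise_eq_of_mem _ _ _ hs
  have hKe : ∀ s ∈ Ioc 0 t, K s = k s := fun s hs => piecewise_eq_of_mem _ _ _ hs
  have hK0 : ∀ s ≤ 0, K s = 0 := fun s hs =>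
    piecewise_eq_of_notMem _ _ _ fun h => absurd h.1 hs.not_gt
  obtain ⟨hpc, A, hA⟩ := hp
  obtain ⟨hkc, B, hB⟩ := hk
  set F : ℝ → ℝ → ℝ := fun s r => P (t - s) * K (s - r) * g r with hF
  have hinner : ∀ r ∈ Ioo 0 t, IntegrableOn (fun s => P (t - s) * K (s - r)) (Ioo 0 t) ∧
      ∫ s in Ioo 0 t, P (t - s) * K (s - r) = conv p k (t - r) ∧
      ∫ s in Ioo 0 t, ‖P (t - s) * K (s - r)‖ ≤ A * B * betaC a b * (t - r) ^ (a + b - 1) := by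
    intro r hr
    have hrt : 0 < t - r := by linarith [hr.2]
    have hsub : Ioo r t ⊆ Ioo 0 t := Ioo_subset_Ioo_left hr.1.le
    have hzero : ∀ s ∈ Ioo 0 t \ Ioo r t, P (t - s) * K (s - r) = 0 := by
      intro s hs
      have : s ≤ r := by
        by_contra h
        exact hs.2 ⟨not_le.1 h, hs.1.2⟩
      rw [hK0 _ (by linarith), mul_zero]
    have heq : ∀ s ∈ Ioo r t, P (t - s) * K (s - r) = p ((t - r) - (s - r)) * k (s - r) := by
      intro s hs
      rw [hPe _ ⟨by linarith [hs.2], by linarith [hs.1, hr.1]⟩,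
        hKe _ ⟨by linarith [hs.1], by linarith [hs.2, hr.1]⟩]
      ring_nf
    have i1 : IntervalIntegrable (fun s => p ((t - r) - s) * k s) volume 0 (t - r) :=
      conv_intervalIntegrable_of_bound ha hb hrt
        (hpc.mono fun s hs => ⟨hs.1, by linarith [hs.2, hr.1]⟩)
        (hkc.mono fun s hs => ⟨hs.1, by linarith [hs.2, hr.1]⟩)
        (fun s hs => hA s ⟨hs.1, by linarith [hs.2, hr.1]⟩)
        (fun s hs => hB s ⟨hs.1, by linarith [hs.2, hr.1]⟩)
    have i2 := i1.comp_sub_right r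
    rw [zero_add, sub_add_cancel, intervalIntegrable_iff_Ioo hr.2.le] at i2
    have i3 : IntegrableOn (fun s => P (t - s) * K (s - r)) (Ioo r t) :=
      i2.congr_fun (fun s hs => (heq s hs).symm) measurableSet_Ioo
    refine ⟨i3.of_forall_sdiff_eq_zero measurableSet_Ioo hzero, ?_, ?_⟩
    · rw [setIntegral_eq_of_subset_of_forall_sdiff_eq_zero measurableSet_Ioo hsub hzero,
        setIntegral_congr_fun measurableSet_Ioo heq, ← integral_eq_Ioo hr.2.le,
        intervalIntegral.integral_comp_sub_right (fun s => p ((t - r) - s) * k s) r, sub_self]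
      rfl
    · rw [setIntegral_eq_of_subset_of_forall_sdiff_eq_zero measurableSet_Ioo hsub
        (fun s hs => by rw [hzero s hs, norm_zero]),
        setIntegral_congr_fun measurableSet_Ioo (fun s hs => by rw [heq s hs]),
        ← integral_eq_Ioo hr.2.le,
        intervalIntegral.integral_comp_sub_right (fun s => ‖p ((t - r) - s) * k s‖) r, sub_self]
      have i4 := (beta_intervalIntegrable ha hb hrt).const_mul (A * B)
      calc _ ≤ ∫ s in (0:ℝ)..(t - r), A * B * ((t - r - s) ^ (a - 1) * s ^ (b - 1)) := by
            refine intervalIntegral.integral_mono_on_of_le_Ioo hrt.le i1.norm i4 fun s hs => ?_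
            exact abs_convolution_integrand_le (fun s hs => hA s ⟨hs.1, by linarith [hs.2, hr.1]⟩)
              (fun s hs => hB s ⟨hs.1, by linarith [hs.2, hr.1]⟩) hs
        _ = _ := by
            rw [intervalIntegral.integral_const_mul, beta_integral ha hb hrt]
            unfold betaC; ring
  have hFm : AEStronglyMeasurable (Function.uncurry F) (μ.prod μ) := by
    refine AEStronglyMeasurable.mul ?_ hg.comp_snd
    refine Measurable.aestronglyMeasurable ?_
    exact (hPm.comp (measurable_const.sub measurable_fst)).mul
      (hKm.comp (measurable_fst.sub measurable_snd))
  have hFi : Integrable (Function.uncurry F) (μ.prod μ) := by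
    rw [integrable_prod_iff' hFm]
    constructor
    · filter_upwards [ae_restrict_mem measurableSet_Ioo] with r hr
      exact (hinner r hr).1.mul_const (g r)
    · refine Integrable.mono' (hgi.norm.const_mul (|A * B * betaC a b|)) ?_ ?_
      · exact (hFm.norm.prod_swap).integral_prod_right'
      · filter_upwards [ae_restrict_mem measurableSet_Ioo] with r hr
        have h0 : ∀ s, ‖F s r‖ = ‖P (t - s) * K (s - r)‖ * ‖g r‖ := fun s => norm_mul _ _
        simp only [Function.uncurry, h0]
        rw [integral_mul_const, Real.norm_eq_abs, abs_mul, abs_of_nonneg (integral_nonneg fun _ =>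
          norm_nonneg _), abs_of_nonneg (norm_nonneg _), norm_mul, ← mul_assoc]
        refine mul_le_mul_of_nonneg_right ((hinner r hr).2.2.trans ?_) (norm_nonneg _)
        have : 0 ≤ (t - r) ^ (a + b - 1) := Real.rpow_nonneg (by linarith [hr.2]) _
        rw [Real.norm_of_nonneg this]
        exact mul_le_mul_of_nonneg_right (le_abs_self _) this
  have hswap := integral_integral_swap hFi
  have hL : conv p (conv k g) t = ∫ s, ∫ r, F s r ∂μ ∂μ := by
    unfold conv
    rw [integral_eq_Ioo ht.le]
    refine setIntegral_congr_fun measurableSet_Ioo fun s hs => ?_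
    have hsub : Ioo 0 s ⊆ Ioo 0 t := Ioo_subset_Ioo_right hs.2.le
    have hz : ∀ r ∈ Ioo 0 t \ Ioo 0 s, F s r = 0 := by
      intro r hr
      have : s ≤ r := by
        by_contra h
        exact hr.2 ⟨hr.1.1, not_le.1 h⟩
      simp only [hF]
      rw [hK0 _ (by linarith), mul_zero, zero_mul]
    simp only [hμ]
    rw [setIntegral_eq_of_subset_of_forall_sdiff_eq_zero measurableSet_Ioo hsub hz,
      integral_eq_Ioo hs.1.le, ← integral_const_mul]
    refine setIntegral_congr_fun measurableSet_Ioo fun r hr => ?_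
    simp only [hF]
    rw [hPe _ ⟨by linarith [hs.2], by linarith [hs.1]⟩,
        hKe _ ⟨by linarith [hr.2], by linarith [hr.1, hs.2]⟩]
    ring
  have hR : conv (conv p k) g t = ∫ r, ∫ s, F s r ∂μ ∂μ := by
    rw [conv, integral_eq_Ioo ht.le]
    refine setIntegral_congr_fun measurableSet_Ioo fun r hr => ?_
    simp only [hF]
    rw [integral_mul_const, (hinner r hr).2.1]
  rw [hL, hR, hswap]

lemma PowBdd.aestronglyMeasurable {t c : ℝ} {g : ℝ → ℝ} (hg : PowBdd t c g) :
    AEStronglyMeasurable g (volume.restrict (Ioo 0 t)) :=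
  (hg.1.mono Ioo_subset_Ioc_self).aestronglyMeasurable measurableSet_Ioo

lemma PowBdd.conv_assoc {t a b c : ℝ} (ha : 0 < a) (hb : 0 < b) (hc : 0 < c) (ht : 0 < t)
    {p k g : ℝ → ℝ} (hp : PowBdd t a p) (hk : PowBdd t b k) (hg : PowBdd t c g) :
    MixedHilfer.conv p (MixedHilfer.conv k g) t = MixedHilfer.conv (MixedHilfer.conv p k) g t :=
  MixedHilfer.conv_assoc ha hb ht hp hk hg.aestronglyMeasurable
    ((intervalIntegrable_iff_Ioo ht.le).1
      ((powBdd_rpow t (a + b)).intervalIntegrable_conv (add_pos ha hb) hc ht hg))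

lemma conv_add {t : ℝ} {k g g' : ℝ → ℝ}
    (h : IntervalIntegrable (fun s => k (t - s) * g s) volume 0 t)
    (h' : IntervalIntegrable (fun s => k (t - s) * g' s) volume 0 t) :
    conv k (fun s => g s + g' s) t = conv k g t + conv k g' t := by
  unfold conv
  rw [← intervalIntegral.integral_add h h']
  simp only [mul_add]

lemma conv_const_mul (k g : ℝ → ℝ) (A t : ℝ) :
    conv k (fun s => A * g s) t = A * conv k g t := by
  unfold conv
  rw [← intervalIntegral.integral_const_mul]
  exact intervalIntegral.integral_congr fun s _ => by ring

lemma conv_powKer {a b t : ℝ} (ha : 0 < a) (hb : 0 < b) (ht : 0 < t) :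
    conv (powKer a) (powKer b) t = powKer (a + b) t := by
  have := Real.Gamma_pos_of_pos ha
  have := Real.Gamma_pos_of_pos hb
  have h : ∀ s, powKer a (t - s) * powKer b s =
      (1 / (Real.Gamma a * Real.Gamma b)) * ((t - s) ^ (a - 1) * s ^ (b - 1)) := by
    intro s; unfold powKer; field_simp
  unfold conv
  simp only [h]
  rw [intervalIntegral.integral_const_mul, beta_integral ha hb ht]
  unfold powKer
  field_simp

lemma powKer_one : powKer 1 = fun _ => 1 := by
  ext t; simp [powKer]

lemma leftInt_eq_conv {a : ℝ} (ha : 0 < a) (g : ℝ → ℝ) : leftInt a g = conv (powKer a) g := by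
  ext t
  unfold leftInt conv
  rw [if_neg ha.ne', ← intervalIntegral.integral_const_mul]
  refine intervalIntegral.integral_congr fun s _ => ?_
  simp only [powKer]; ring

lemma leftInt_zero (g : ℝ → ℝ) : leftInt 0 g = g := by
  ext t; simp [leftInt]

lemma hasDerivAt_integral_of_powBdd {T c : ℝ} (hc : 0 < c) {g : ℝ → ℝ} (hg : PowBdd T c g)
    {t : ℝ} (ht : t ∈ Ioo 0 T) : HasDerivAt (fun t => ∫ s in (0 : ℝ)..t, g s) (g t) t := by
  have h := (hg.mono ht.2.le).intervalIntegrable hc ht.1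
  have hopen : ContinuousOn g (Ioo 0 T) := hg.1.mono Ioo_subset_Ioc_self
  exact intervalIntegral.integral_hasDerivAt_right h
    (hopen.stronglyMeasurableAtFilter isOpen_Ioo t ht)
    (hopen.continuousAt (isOpen_Ioo.mem_nhds ht))

/-! ### Mittag-Leffler functions and kernels -/

/-- Keep only the part t > M of Euler's integral, where t^{x-1} ≥ M^{x-1}. Since M is arbitrary, Γ
outgrows every geometric sequence. -/
lemma rpow_mul_exp_le_Gamma {M x : ℝ} (hM : 0 < M) (hx : 1 ≤ x) :
    M ^ (x - 1) * Real.exp (-M) ≤ Real.Gamma x := by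
  rw [Real.Gamma_eq_integral (by linarith)]
  have hi := Real.GammaIntegral_convergent (show 0 < x by linarith)
  have hsub : Ioi M ⊆ Ioi (0 : ℝ) := Ioi_subset_Ioi hM.le
  calc M ^ (x - 1) * Real.exp (-M) = ∫ t in Ioi M, Real.exp (-t) * M ^ (x - 1) := by
        rw [integral_mul_const, integral_exp_neg_Ioi]; ring
    _ ≤ ∫ t in Ioi M, Real.exp (-t) * t ^ (x - 1) := by
        refine setIntegral_mono_on ((integrableOn_exp_neg_Ioi M).mul_const _)
          (hi.mono_set hsub) measurableSet_Ioi fun t ht => ?_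
        exact mul_le_mul_of_nonneg_left
          (Real.rpow_le_rpow hM.le (le_of_lt ht) (by linarith)) (Real.exp_pos _).le
    _ ≤ _ := by
        refine setIntegral_mono_set hi ?_ (LE.le.eventuallyLE hsub)
        filter_upwards [ae_restrict_mem measurableSet_Ioi] with t ht
        exact mul_nonneg (Real.exp_pos _).le (Real.rpow_nonneg (le_of_lt ht) _)

lemma summable_pow_div_Gamma {a b : ℝ} (ha : 0 < a) (z : ℝ) :
    Summable (fun k : ℕ => z ^ k / Real.Gamma (a * k + b)) := by
  -- Chosen so that M^a = 2(|z| + 1): the k-th term is then at most a constant times 2^{-k}.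
  set M : ℝ := (2 * (|z| + 1)) ^ (1 / a) with hMdef
  have hz : 0 < 2 * (|z| + 1) := by positivity
  have hM : 0 < M := Real.rpow_pos_of_pos hz _
  have hMa : M ^ a = 2 * (|z| + 1) := by
    rw [hMdef, ← Real.rpow_mul hz.le, one_div_mul_cancel ha.ne', Real.rpow_one]
  have hgeo : Summable (fun k : ℕ => (Real.exp M / M ^ (b - 1)) * (1 / 2 : ℝ) ^ k) :=
    (summable_geometric_of_lt_one (by norm_num) (by norm_num)).mul_left _
  refine Summable.of_norm_bounded_eventually_nat hgeo ?_
  have hev : ∀ᶠ k : ℕ in atTop, (1 - b) / a ≤ k :=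
    (tendsto_natCast_atTop_atTop (R := ℝ)).eventually_ge_atTop _
  filter_upwards [hev] with k hk
  have hx : 1 ≤ a * k + b := by
    rw [div_le_iff₀ ha] at hk; linarith
  have hG := rpow_mul_exp_le_Gamma hM hx
  have hMk : M ^ (a * k + b - 1) = (2 * (|z| + 1)) ^ k * M ^ (b - 1) := by
    rw [← hMa, ← Real.rpow_natCast, ← Real.rpow_mul hM.le, ← Real.rpow_add hM]
    ring_nf
  have hMb : 0 < M ^ (b - 1) := Real.rpow_pos_of_pos hM _
  have hpos : 0 < M ^ (a * k + b - 1) * Real.exp (-M) :=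
    mul_pos (Real.rpow_pos_of_pos hM _) (Real.exp_pos _)
  rw [norm_div, norm_pow, Real.norm_eq_abs, Real.norm_eq_abs, abs_of_pos (hpos.trans_le hG)]
  have e1 : |z| ^ k ≤ (|z| + 1) ^ k := pow_le_pow_left₀ (abs_nonneg z) (by linarith) k
  calc |z| ^ k / Real.Gamma (a * k + b) ≤ (|z| + 1) ^ k / (M ^ (a * k + b - 1) * Real.exp (-M)) :=
        div_le_div₀ (by positivity) e1 hpos hG
    _ = _ := by
        rw [hMk, mul_pow, Real.exp_neg, one_div, inv_pow]
        have : 0 < (|z| + 1) ^ k := by positivity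
        field_simp

lemma hasSum_mittagLeffler {a : ℝ} (ha : 0 < a) (b z : ℝ) :
    HasSum (fun k : ℕ => z ^ k / Real.Gamma (a * k + b)) (mittagLeffler a b z) :=
  (summable_pow_div_Gamma ha z).hasSum

lemma mittagLeffler_recurrence {a : ℝ} (ha : 0 < a) (b z : ℝ) :
    mittagLeffler a b z = 1 / Real.Gamma b + z * mittagLeffler a (a + b) z := by
  rw [mittagLeffler, (summable_pow_div_Gamma ha z).tsum_eq_zero_add]
  simp only [pow_zero, Nat.cast_zero, mul_zero, zero_add]
  congr 1
  rw [mittagLeffler, ← tsum_mul_left]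
  refine tsum_congr fun k => ?_
  have : a * ((k + 1 : ℕ) : ℝ) + b = a * k + (a + b) := by push_cast; ring
  rw [this]; ring

lemma mittagLeffler_zero {a : ℝ} (ha : 0 < a) (b : ℝ) :
    mittagLeffler a b 0 = 1 / Real.Gamma b := by
  rw [mittagLeffler_recurrence ha]; simp

lemma abs_mittagLeffler_le {a b z R : ℝ} (ha : 0 < a) (hb : 0 < b) (hz : |z| ≤ R) :
    |mittagLeffler a b z| ≤ mittagLeffler a b R := by
  have hG : ∀ k : ℕ, 0 < Real.Gamma (a * k + b) := fun k => Real.Gamma_pos_of_pos (by positivity)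
  have := tsum_of_norm_bounded (hasSum_mittagLeffler ha b R)
    (f := fun k : ℕ => z ^ k / Real.Gamma (a * k + b)) fun k => by
      rw [norm_div, norm_pow, Real.norm_eq_abs, Real.norm_eq_abs, abs_of_pos (hG k)]
      exact div_le_div_of_nonneg_right (pow_le_pow_left₀ (abs_nonneg z) hz k) (hG k).le
  exact this

lemma continuous_mittagLeffler {a b : ℝ} (ha : 0 < a) (hb : 0 < b) :
    Continuous (mittagLeffler a b) := by
  have hG : ∀ k : ℕ, 0 < Real.Gamma (a * k + b) := fun k => Real.Gamma_pos_of_pos (by positivity)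
  rw [continuous_iff_continuousAt]
  intro z
  have h : ContinuousOn (mittagLeffler a b) (Metric.ball 0 (|z| + 1)) := by
    refine continuousOn_tsum (u := fun k : ℕ => (|z| + 1) ^ k / Real.Gamma (a * k + b))
      (fun k => by fun_prop) (summable_pow_div_Gamma ha _) fun k y hy => ?_
    rw [norm_div, norm_pow, Real.norm_eq_abs (Real.Gamma _), abs_of_pos (hG k)]
    rw [mem_ball_zero_iff] at hy
    exact div_le_div_of_nonneg_right (pow_le_pow_left₀ (norm_nonneg y) hy.le k) (hG k).le
  exact h.continuousAt (Metric.isOpen_ball.mem_nhds (by simp))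

/-- The Mittag-Leffler kernel `t^(b-1) E_{a,b}(-λ t^a)`. -/
noncomputable def mlKer (a lam b t : ℝ) : ℝ := t ^ (b - 1) * mittagLeffler a b (-lam * t ^ a)

lemma powBdd_mlKer {a b : ℝ} (T lam : ℝ) (ha : 0 < a) (hb : 0 < b) :
    PowBdd T b (mlKer a lam b) := by
  refine ⟨?_, mittagLeffler a b (|lam| * T ^ a), fun t ht => ?_⟩
  · refine (powBdd_rpow T b).1.mul ((continuous_mittagLeffler ha hb).comp_continuousOn ?_)
    exact continuousOn_const.mul fun t ht =>
      (Real.continuousAt_rpow_const _ _ (Or.inl ht.1.ne')).continuousWithinAt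
  · unfold mlKer
    rw [abs_mul, abs_of_nonneg (Real.rpow_nonneg ht.1.le _), mul_comm]
    refine mul_le_mul_of_nonneg_right ?_ (Real.rpow_nonneg ht.1.le _)
    refine abs_mittagLeffler_le ha hb ?_
    rw [abs_mul, abs_neg, abs_of_nonneg (Real.rpow_nonneg ht.1.le _)]
    exact mul_le_mul_of_nonneg_left (Real.rpow_le_rpow ht.1.le ht.2 ha.le) (abs_nonneg _)

/-- Splitting off the first term of the series trades a factor λ for a shift of b by a. This
identity verifies the mode equations, yields the Volterra resolvent and gives the limit of the
determinant. -/
lemma mlKer_eq {a t : ℝ} (lam b : ℝ) (ha : 0 < a) (ht : 0 < t) :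
    mlKer a lam b t = powKer b t - lam * mlKer a lam (a + b) t := by
  unfold mlKer powKer
  rw [mittagLeffler_recurrence ha]
  have : t ^ (a + b - 1) = t ^ (b - 1) * t ^ a := by
    rw [← Real.rpow_add ht]; ring_nf
  rw [this]; ring

lemma hasSum_mlKer {a t : ℝ} (lam b : ℝ) (ha : 0 < a) (ht : 0 < t) :
    HasSum (fun k : ℕ => (-lam) ^ k * powKer (a * k + b) t) (mlKer a lam b t) := by
  have h := (hasSum_mittagLeffler ha b (-lam * t ^ a)).mul_left (t ^ (b - 1))
  refine h.congr_fun fun k => ?_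
  have : t ^ (a * k + b - 1) = t ^ (b - 1) * (t ^ a) ^ k := by
    rw [← Real.rpow_natCast, ← Real.rpow_mul ht.le, ← Real.rpow_add ht]; ring_nf
  unfold powKer
  rw [this, mul_pow]; ring

lemma powKer_nonneg {a t : ℝ} (ha : 0 < a) (ht : 0 ≤ t) : 0 ≤ powKer a t :=
  div_nonneg (Real.rpow_nonneg ht _) (Real.Gamma_pos_of_pos ha).le

/-- The series is integrated term by term, each term being a product of two power kernels. The
interchange is allowed because the integrals of the norms sum to the kernel with -|λ| in place of λ.
-/
lemma conv_powKer_mlKer {a b c t : ℝ} (lam : ℝ) (ha : 0 < a) (hb : 0 < b) (hc : 0 < c)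
    (ht : 0 < t) : conv (powKer c) (mlKer a lam b) t = mlKer a lam (c + b) t := by
  have hk : ∀ k : ℕ, 0 < a * k + b := fun k => by positivity
  set F : ℕ → ℝ → ℝ := fun k s => powKer c (t - s) * ((-lam) ^ k * powKer (a * k + b) s) with hF
  have hi : ∀ (k : ℕ) (A : ℝ), IntervalIntegrable
      (fun s => powKer c (t - s) * (A * powKer (a * k + b) s)) volume 0 t := fun k A =>
    (powBdd_powKer t c).intervalIntegrable_conv hc (hk k) ht ((powBdd_powKer t _).const_mul A)
  have hv : ∀ (k : ℕ) (A : ℝ), ∫ s in Ioo 0 t, powKer c (t - s) * (A * powKer (a * k + b) s) =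
      A * powKer (a * k + (c + b)) t := by
    intro k A
    rw [← integral_eq_Ioo ht.le]
    change conv (powKer c) (fun s => A * powKer (a * k + b) s) t = _
    rw [conv_const_mul, conv_powKer hc (hk k) ht]
    ring_nf
  have hn : ∀ k : ℕ, ∫ s in Ioo 0 t, ‖F k s‖ = |lam| ^ k * powKer (a * k + (c + b)) t := by
    intro k
    rw [← hv k (|lam| ^ k)]
    refine setIntegral_congr_fun measurableSet_Ioo fun s hs => ?_
    simp only [hF]
    rw [norm_mul, norm_mul, norm_pow, norm_neg, Real.norm_eq_abs, Real.norm_eq_abs lam,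
      Real.norm_eq_abs, abs_of_nonneg (powKer_nonneg hc (by linarith [hs.2])),
      abs_of_nonneg (powKer_nonneg (hk k) hs.1.le)]
  have h := hasSum_integral_of_summable_integral_norm (μ := volume.restrict (Ioo 0 t)) (F := F)
    (fun k => (intervalIntegrable_iff_Ioo ht.le).1 (hi k _)) (by
      simp only [hn]
      have := (hasSum_mlKer (-|lam|) (c + b) ha ht).summable
      simpa using this)
  have h2 : HasSum (fun k => ∫ s in Ioo 0 t, F k s) (mlKer a lam (c + b) t) := by
    simp only [hF, hv]
    exact hasSum_mlKer lam (c + b) ha ht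
  rw [conv, integral_eq_Ioo ht.le, ← h.unique h2]
  refine setIntegral_congr_fun measurableSet_Ioo fun s hs => ?_
  simp only [hF]
  rw [tsum_mul_left, (hasSum_mlKer lam b ha hs.1).tsum_eq]

lemma leftInt_mlKer {a b c t : ℝ} (lam : ℝ) (ha : 0 < a) (hb : 0 < b) (hc : 0 ≤ c)
    (ht : 0 < t) : leftInt c (mlKer a lam b) t = mlKer a lam (c + b) t := by
  rcases hc.eq_or_lt with rfl | hc
  · rw [leftInt_zero, zero_add]
  · rw [leftInt_eq_conv hc, conv_powKer_mlKer lam ha hb hc ht]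

lemma integral_mlKer {a b t : ℝ} (lam : ℝ) (ha : 0 < a) (hb : 0 < b) (ht : 0 < t) :
    ∫ s in (0 : ℝ)..t, mlKer a lam b s = mlKer a lam (b + 1) t := by
  rw [← conv_const_one, ← powKer_one, conv_powKer_mlKer lam ha hb one_pos ht, add_comm]

/-! ### Uniqueness for the Laplace transform -/

/-- Lerch's theorem. The values of the transform at p = c + n are the moments of e^{-ct} v in the
variable e^{-t}, so every polynomial in e^{-t} integrates to zero against it. By Weierstrass
approximation so does every test function; hence v = 0 almost everywhere, and everywhere by
continuity. -/
lemma eqOn_zero_of_laplace_eq_zero {v : ℝ → ℝ} {c : ℝ} (hv : ContinuousOn v (Ioi 0))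
    (hi : IntegrableOn (fun t => Real.exp (-c * t) * v t) (Ioi 0))
    (h0 : ∀ p ≥ c, ∫ t in Ioi (0 : ℝ), Real.exp (-p * t) * v t = 0) :
    ∀ t ∈ Ioi (0 : ℝ), v t = 0 := by
  have hb : ∀ t ∈ Ioi (0 : ℝ), Real.exp (-t) ∈ Icc (0 : ℝ) 1 := fun t ht =>
    ⟨(Real.exp_pos _).le, Real.exp_le_one_iff.2 (by simpa using le_of_lt ht)⟩
  have hinteg : ∀ q : ℝ → ℝ, Continuous q → (∃ C, ∀ t ∈ Ioi (0 : ℝ), ‖q t‖ ≤ C) →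
      IntegrableOn (fun t => q t * (Real.exp (-c * t) * v t)) (Ioi 0) := by
    rintro q hq ⟨C, hC⟩
    refine Integrable.bdd_mul (c := C) hi hq.aestronglyMeasurable ?_
    filter_upwards [ae_restrict_mem measurableSet_Ioi] with t ht using hC t ht
  have hpoly : ∀ P : Polynomial ℝ,
      ∫ t in Ioi (0 : ℝ), P.eval (Real.exp (-t)) * (Real.exp (-c * t) * v t) = 0 := by
    intro P
    induction P using Polynomial.induction_on' with
    | add P Q hP hQ =>
      have hbd : ∀ P : Polynomial ℝ, ∃ C, ∀ t ∈ Ioi (0 : ℝ), ‖P.eval (Real.exp (-t))‖ ≤ C := by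
        intro P
        obtain ⟨C, hC⟩ := (isCompact_Icc (a := (0 : ℝ)) (b := 1)).exists_bound_of_continuousOn
          P.continuous.continuousOn
        exact ⟨C, fun t ht => hC _ (hb t ht)⟩
      simp only [Polynomial.eval_add, add_mul]
      have hiP : ∀ P : Polynomial ℝ, IntegrableOn
          (fun t => P.eval (Real.exp (-t)) * (Real.exp (-c * t) * v t)) (Ioi 0) := fun P =>
        hinteg (fun t => P.eval (Real.exp (-t))) (P.continuous.comp (by fun_prop)) (hbd P)
      rw [integral_add (hiP P) (hiP Q), hP, hQ, add_zero]
    | monomial n a =>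
      simp only [Polynomial.eval_monomial]
      have : ∀ t : ℝ, a * Real.exp (-t) ^ n * (Real.exp (-c * t) * v t) =
          a * (Real.exp (-(c + n) * t) * v t) := by
        intro t
        rw [← Real.exp_nat_mul, mul_assoc, ← mul_assoc (Real.exp _), ← Real.exp_add]
        ring_nf
      simp only [this]
      rw [integral_const_mul, h0 (c + n) (by simp), mul_zero]
  have hloc : LocallyIntegrableOn v (Ioi 0) volume := hv.locallyIntegrableOn measurableSet_Ioi
  have hae : ∀ᵐ t, t ∈ Ioi (0 : ℝ) → v t = 0 := by
    refine isOpen_Ioi.ae_eq_zero_of_integral_contDiff_smul_eq_zero hloc fun g hg hgc hgs => ?_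
    set q : ℝ → ℝ := fun t => Real.exp (c * t) * g t with hq
    have hqc : Continuous q := by
      have := hg.continuous; fun_prop
    have hqs : tsupport q ⊆ tsupport g := closure_mono fun t ht => by
      simp only [hq, Function.mem_support] at ht ⊢
      exact right_ne_zero_of_mul ht
    have hqcs : HasCompactSupport q := hgc.mono' (subset_tsupport q |>.trans hqs)
    have hq0 : ∀ t ≤ 0, q t = 0 := fun t ht => by
      have : t ∉ tsupport q := fun h => absurd (hgs (hqs h)) (not_lt.2 ht)
      exact image_eq_zero_of_notMem_tsupport this
    -- The test function in the variable x = e^{-t}. Its value at x = 0 is right because `Real.log 0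
    -- = 0` and q vanishes at 0; it is zero near x = 0 because q has compact support.
    set H : ℝ → ℝ := fun x => q (-Real.log x) with hH
    have hHc : ContinuousOn H (Icc 0 1) := by
      intro x hx
      rcases hx.1.eq_or_lt with rfl | hx0
      · have h1 : H =ᶠ[𝓝 0] fun _ => 0 := by
          obtain ⟨R, hR⟩ := hqcs.isCompact.isBounded.subset_closedBall (0 : ℝ)
          have h2 : ∀ᶠ x in 𝓝[≠] (0 : ℝ), Real.log x < -(max R 0) :=
            Real.tendsto_log_nhdsNE_zero.eventually_lt_atBot _
          rw [eventually_nhdsWithin_iff] at h2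
          filter_upwards [h2] with x hx
          by_cases hx0 : x = 0
          · simp [hH, hx0, hq0 0 le_rfl]
          · have h3 := hx hx0
            simp only [hH]
            apply image_eq_zero_of_notMem_tsupport
            intro h4
            have h5 := hR h4
            rw [mem_closedBall_zero_iff, Real.norm_eq_abs] at h5
            have := le_abs_self (-Real.log x)
            have := le_max_left R 0
            linarith
        exact ((continuousAt_const (y := (0 : ℝ))).congr h1.symm).continuousWithinAt
      · exact (hqc.continuousAt.comp (Real.continuousAt_log hx0.ne').neg).continuousWithinAt
    have hHq : ∀ t, H (Real.exp (-t)) = q t := fun t => by simp [hH]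
    obtain ⟨Cq, hCq⟩ := hqcs.exists_bound_of_continuous hqc
    have hiq := hinteg q hqc ⟨Cq, fun t _ => hCq t⟩
    have e1 : ∫ t, g t • v t = ∫ t in Ioi (0 : ℝ), q t * (Real.exp (-c * t) * v t) := by
      rw [← integral_indicator measurableSet_Ioi]
      congr 1
      ext t
      by_cases ht : t ∈ Ioi (0 : ℝ)
      · rw [indicator_of_mem ht]
        simp only [hq, smul_eq_mul]
        have : Real.exp (c * t) * Real.exp (-c * t) = 1 := by rw [← Real.exp_add]; simp
        linear_combination (-(g t * v t)) * this
      · rw [indicator_of_notMem ht]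
        have : t ∉ tsupport g := fun h => ht (hgs h)
        rw [image_eq_zero_of_notMem_tsupport this, zero_smul]
    rw [e1]
    by_contra hne
    set I := ∫ t in Ioi (0 : ℝ), q t * (Real.exp (-c * t) * v t) with hI
    set N := ∫ t in Ioi (0 : ℝ), ‖Real.exp (-c * t) * v t‖ with hN
    have hN0 : 0 ≤ N := integral_nonneg fun _ => norm_nonneg _
    have hIpos : 0 < |I| := abs_pos.2 hne
    obtain ⟨P, hP⟩ := exists_polynomial_near_of_continuousOn 0 1 H hHc (|I| / (N + 1))
      (by positivity)
    obtain ⟨C, hC⟩ := (isCompact_Icc (a := (0 : ℝ)) (b := 1)).exists_bound_of_continuousOn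
      P.continuous.continuousOn
    have hiP := hinteg (fun t => P.eval (Real.exp (-t))) (P.continuous.comp (by fun_prop))
      ⟨C, fun t ht => hC _ (hb t ht)⟩
    have e2 : I = ∫ t in Ioi (0 : ℝ),
        (q t - P.eval (Real.exp (-t))) * (Real.exp (-c * t) * v t) := by
      simp only [sub_mul]
      rw [integral_sub hiq hiP, hpoly P, sub_zero]
    have e3 : |I| ≤ |I| / (N + 1) * N := by
      conv_lhs => rw [e2]
      rw [← Real.norm_eq_abs, hN, ← integral_const_mul]
      refine norm_integral_le_of_norm_le (hi.norm.const_mul _) ?_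
      filter_upwards [ae_restrict_mem measurableSet_Ioi] with t ht
      rw [norm_mul]
      refine mul_le_mul_of_nonneg_right ?_ (norm_nonneg _)
      have := hP _ (hb t ht)
      rw [hHq] at this
      rw [Real.norm_eq_abs, abs_sub_comm]
      exact this.le
    have e4 : |I| / (N + 1) * N < |I| := by
      rw [div_mul_eq_mul_div, div_lt_iff₀ (by linarith)]
      nlinarith
    linarith
  have hae2 : v =ᵐ[volume.restrict (Ioi 0)] fun _ => 0 :=
    (ae_restrict_iff' measurableSet_Ioi).2 hae
  intro t ht
  exact Measure.eqOn_of_ae_eq hae2 hv continuousOn_const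
    (by rw [interior_Ioi]; exact subset_closure) ht

/-! ### Cauchy's formula on a strip -/

lemma integral_poisson {A : ℝ} (hA : 0 < A) :
    Integrable (fun x : ℝ => A / (x ^ 2 + A ^ 2)) ∧ ∫ x : ℝ, A / (x ^ 2 + A ^ 2) = Real.pi := by
  have h : (fun x : ℝ => A / (x ^ 2 + A ^ 2)) = fun x => A⁻¹ * (1 + (A⁻¹ * x) ^ 2)⁻¹ := by
    ext x; field_simp; ring
  rw [h]
  constructor
  · exact ((integrable_comp_mul_left_iff (fun x : ℝ => (1 + x ^ 2)⁻¹)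
      (inv_ne_zero hA.ne')).2 integrable_inv_one_add_sq).const_mul _
  · rw [integral_const_mul, Measure.integral_comp_mul_left (fun x : ℝ => (1 + x ^ 2)⁻¹),
      integral_univ_inv_one_add_sq, inv_inv, abs_of_pos hA, smul_eq_mul]
    field_simp

/-- Cauchy's integral formula on a horizontal strip, for a real point. -/
lemma cauchy_strip {F : ℂ → ℂ} {φ φ' : ℝ} (hφ : 0 < φ) (hφ' : φ < φ') (x₀ : ℝ)
    (hF : DifferentiableOn ℂ F {w | |w.im| < φ'})
    (hplus : Integrable fun x : ℝ => F (x + φ * Complex.I) / (x + φ * Complex.I - x₀))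
    (hminus : Integrable fun x : ℝ => F (x + (-φ : ℝ) * Complex.I) / (x + (-φ : ℝ) * Complex.I - x₀))
    {B : ℝ → ℝ} (hB : Tendsto B atTop (𝓝 0))
    (hBr : ∀ᶠ R : ℝ in atTop, ∀ y ∈ Icc (-φ) φ,
      ‖F (R + y * Complex.I) / (R + y * Complex.I - x₀)‖ ≤ B R ∧
      ‖F ((-R : ℝ) + y * Complex.I) / ((-R : ℝ) + y * Complex.I - x₀)‖ ≤ B R) :
    (∫ x : ℝ, F (x + (-φ : ℝ) * Complex.I) / (x + (-φ : ℝ) * Complex.I - x₀)) -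
      ∫ x : ℝ, F (x + φ * Complex.I) / (x + φ * Complex.I - x₀) =
      2 * Real.pi * Complex.I * F x₀ := by
  set G : ℂ → ℂ := fun w => F w / (w - x₀) with hG
  have hopen : IsOpen {w : ℂ | |w.im| < φ'} :=
    isOpen_lt (by fun_prop) continuous_const
  have hx₀ : {w : ℂ | |w.im| < φ'} ∈ 𝓝 (x₀ : ℂ) := hopen.mem_nhds (by simp; linarith)
  -- `dslope F x₀` is (F w - F x₀) / (w - x₀) with the singularity removed, so Cauchy's theorem on
  -- rectangles applies to it. The residue comes back from the explicit integrals of 1 / (w - x₀)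
  -- over the two horizontal lines, whose difference is a Poisson kernel.
  have hds : DifferentiableOn ℂ (dslope F x₀) {w | |w.im| < φ'} :=
    (Complex.differentiableOn_dslope hx₀).2 hF
  have hrect : ∀ R : ℝ, |x₀| < R →
      ((∫ x in (-R)..R, G (x + (-φ : ℝ) * Complex.I)) - ∫ x in (-R)..R, G (x + φ * Complex.I)) +
        (Complex.I * ∫ y in (-φ)..φ, (G (R + y * Complex.I) - F x₀ / (R + y * Complex.I - x₀))) -
        (Complex.I * ∫ y in (-φ)..φ,
          (G ((-R : ℝ) + y * Complex.I) - F x₀ / ((-R : ℝ) + y * Complex.I - x₀))) =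
      F x₀ * ∫ x in (-R)..R, ((((2 : ℝ) * (φ / ((x - x₀) ^ 2 + φ ^ 2)) : ℝ) : ℂ) * Complex.I) := by
    intro R hR
    have hR0 : 0 < R := (abs_nonneg _).trans_lt hR
    have hdsl : ∀ w : ℂ, w ≠ x₀ → dslope F x₀ w = G w - F x₀ / (w - x₀) := by
      intro w hw
      rw [dslope_of_ne _ hw, slope_def_field, hG]; ring
    have h := Complex.integral_boundary_rect_eq_zero_of_differentiableOn (dslope F x₀)
      (⟨-R, -φ⟩ : ℂ) (⟨R, φ⟩ : ℂ) (hds.mono ?_)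
    swap
    · intro w hw
      rw [Complex.mem_reProdIm] at hw
      have h2 := hw.2
      simp only at h2
      rw [uIcc_of_le (by linarith)] at h2
      exact (abs_le.2 h2).trans_lt hφ'
    simp only [smul_eq_mul] at h
    have n1 : ∀ (x : ℝ) (s : ℝ), s ≠ 0 → ((x : ℂ) + s * Complex.I) ≠ x₀ := by
      intro x s hs heq
      have := congrArg Complex.im heq
      simp at this
      exact hs this
    have n2 : ∀ (y s : ℝ), s ≠ x₀ → ((s : ℂ) + y * Complex.I) ≠ x₀ := by
      intro y s hs heq
      have := congrArg Complex.re heq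
      simp at this
      exact hs this
    have hRx : R ≠ x₀ := fun h => by rw [← h, abs_of_pos hR0] at hR; exact lt_irrefl _ hR
    have hRx' : -R ≠ x₀ := fun h => by
      rw [← h, abs_neg, abs_of_pos hR0] at hR; exact lt_irrefl _ hR
    have r1 : ∀ s : ℝ, s ≠ 0 → ∫ x in (-R)..R, dslope F x₀ ((x : ℂ) + s * Complex.I) =
        ∫ x in (-R)..R, (G (x + s * Complex.I) - F x₀ / (x + s * Complex.I - x₀)) := fun s hs =>
      intervalIntegral.integral_congr fun x _ => hdsl _ (n1 x s hs)
    have r2 : ∀ s : ℝ, s ≠ x₀ → ∫ y in (-φ)..φ, dslope F x₀ ((s : ℂ) + (y : ℝ) * Complex.I) =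
        ∫ y in (-φ)..φ, (G (s + y * Complex.I) - F x₀ / (s + y * Complex.I - x₀)) := fun s hs =>
      intervalIntegral.integral_congr fun y _ => hdsl _ (n2 y s hs)
    have hc : ∀ s : ℝ, s ≠ 0 → IntervalIntegrable
        (fun x : ℝ => F x₀ / ((x : ℂ) + s * Complex.I - x₀)) volume (-R) R := fun s hs =>
      Continuous.intervalIntegrable (Continuous.div continuous_const (by fun_prop)
        fun x => sub_ne_zero.2 (n1 x s hs)) _ _
    rw [r1 _ (by simpa using hφ.ne'), r1 _ hφ.ne', r2 _ hRx, r2 _ hRx',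
      intervalIntegral.integral_sub hminus.intervalIntegrable (hc _ (by simpa using hφ.ne')),
      intervalIntegral.integral_sub hplus.intervalIntegrable (hc _ hφ.ne')] at h
    have hlast : (∫ x in (-R)..R, F x₀ / ((x : ℂ) + (-φ : ℝ) * Complex.I - x₀)) -
        ∫ x in (-R)..R, F x₀ / ((x : ℂ) + φ * Complex.I - x₀) =
        F x₀ * ∫ x in (-R)..R, ((((2 : ℝ) * (φ / ((x - x₀) ^ 2 + φ ^ 2)) : ℝ) : ℂ) *
          Complex.I) := by
      rw [← intervalIntegral.integral_sub (hc _ (by simpa using hφ.ne')) (hc _ hφ.ne'),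
        ← intervalIntegral.integral_const_mul]
      refine intervalIntegral.integral_congr fun x _ => ?_
      have m1 : (x : ℂ) + (-φ : ℝ) * Complex.I - x₀ ≠ 0 :=
        sub_ne_zero.2 (n1 x _ (by simpa using hφ.ne'))
      have m2 : (x : ℂ) + φ * Complex.I - x₀ ≠ 0 := sub_ne_zero.2 (n1 x _ hφ.ne')
      have m3 : (((x - x₀) ^ 2 + φ ^ 2 : ℝ) : ℂ) =
          ((x : ℂ) + (-φ : ℝ) * Complex.I - x₀) * ((x : ℂ) + φ * Complex.I - x₀) := by
        push_cast
        linear_combination ((φ : ℂ) ^ 2) * Complex.I_sq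
      have m4 : ((x : ℂ) + φ * Complex.I - x₀) - ((x : ℂ) + (-φ : ℝ) * Complex.I - x₀) =
          2 * φ * Complex.I := by push_cast; ring
      simp only [Complex.ofReal_mul, Complex.ofReal_div, m3]
      generalize (x : ℂ) + (-φ : ℝ) * Complex.I - x₀ = u at *
      generalize (x : ℂ) + φ * Complex.I - x₀ = v at *
      rw [div_sub_div _ _ m1 m2]
      field_simp
      push_cast
      linear_combination F x₀ * m4
    rw [← hlast]
    linear_combination h
  have hP := integral_poisson hφ
  have lim1 := (intervalIntegral_tendsto_integral hminus tendsto_neg_atTop_atBot tendsto_id).sub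
    (intervalIntegral_tendsto_integral hplus tendsto_neg_atTop_atBot tendsto_id)
  have hPi : Integrable fun x : ℝ => ((((2 : ℝ) * (φ / ((x - x₀) ^ 2 + φ ^ 2)) : ℝ) : ℂ) *
      Complex.I) := ((hP.1.comp_sub_right x₀).const_mul 2).ofReal.mul_const _
  have lim2 := (intervalIntegral_tendsto_integral hPi tendsto_neg_atTop_atBot
    tendsto_id).const_mul (F x₀)
  have hvert : ∀ s : ℝ → ℝ, (∀ R, |s R| = |R|) →
      (∀ᶠ R : ℝ in atTop, ∀ y ∈ Icc (-φ) φ,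
        ‖F (s R + y * Complex.I) / (s R + y * Complex.I - x₀)‖ ≤ B R) →
      Tendsto (fun R : ℝ => Complex.I * ∫ y in (-φ)..φ,
        (G (s R + y * Complex.I) - F x₀ / (s R + y * Complex.I - x₀))) atTop (𝓝 0) := by
    intro s hs hsB
    have hlim : Tendsto (fun R : ℝ => (B R + ‖F x₀‖ / (R - |x₀|)) * |φ - -φ|) atTop (𝓝 0) := by
      have : Tendsto (fun R : ℝ => ‖F x₀‖ / (R - |x₀|)) atTop (𝓝 0) :=
        Tendsto.div_atTop tendsto_const_nhds (tendsto_atTop_add_const_right _ _ tendsto_id)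
      simpa using (hB.add this).mul_const (|φ - -φ|)
    refine squeeze_zero_norm' ?_ hlim
    filter_upwards [hsB, eventually_gt_atTop |x₀|] with R hR hRx
    rw [norm_mul, Complex.norm_I, one_mul]
    refine intervalIntegral.norm_integral_le_of_norm_le_const fun y hy => ?_
    rw [uIoc_of_le (by linarith)] at hy
    refine (norm_sub_le _ _).trans (add_le_add (hR y (Ioc_subset_Icc_self hy)) ?_)
    rw [norm_div]
    refine div_le_div_of_nonneg_left (norm_nonneg _) (by linarith) ?_
    have h1 : |s R - x₀| ≤ ‖(s R : ℂ) + y * Complex.I - x₀‖ := by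
      have := Complex.abs_re_le_norm ((s R : ℂ) + y * Complex.I - x₀)
      simpa using this
    have h2 : |s R| - |x₀| ≤ |s R - x₀| := abs_sub_abs_le_abs_sub _ _
    rw [hs, abs_of_pos ((abs_nonneg _).trans_lt hRx)] at h2
    linarith
  have v1 := hvert (fun R => R) (fun R => rfl) (hBr.mono fun R h y hy => (h y hy).1)
  have v2 := hvert (fun R => -R) (fun R => abs_neg R) (hBr.mono fun R h y hy => (h y hy).2)
  have lim3 := (lim1.add v1).sub v2
  have heq := tendsto_nhds_unique (lim2.congr' ?_) lim3
  swap
  · filter_upwards [eventually_gt_atTop |x₀|] with R hR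
    exact (hrect R hR).symm
  rw [add_zero, sub_zero] at heq
  rw [← heq, integral_mul_const, integral_complex_ofReal, integral_const_mul,
    integral_sub_right_eq_self (fun x : ℝ => φ / (x ^ 2 + φ ^ 2)) x₀, hP.2]
  push_cast; ring

lemma integrable_of_exp_bound {E : Type*} [NormedAddCommGroup E] {f : ℝ → E} {α β C : ℝ}
    (hα : 0 < α) (hβ : 0 < β)
    (hf : AEStronglyMeasurable f volume) (h1 : ∀ x ≤ 0, ‖f x‖ ≤ C * Real.exp (α * x))
    (h2 : ∀ x ≥ 0, ‖f x‖ ≤ C * Real.exp (-β * x)) : Integrable f := by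
  have i1 : IntegrableOn f (Iic 0) := by
    refine Integrable.mono' ((integrableOn_exp_mul_Iic hα 0).const_mul C) hf.restrict ?_
    filter_upwards [ae_restrict_mem measurableSet_Iic] with x hx using h1 x hx
  have i2 : IntegrableOn f (Ioi 0) := by
    refine Integrable.mono' ((exp_neg_integrableOn_Ioi 0 hβ).const_mul C) hf.restrict ?_
    filter_upwards [ae_restrict_mem measurableSet_Ioi] with x hx using h2 x (le_of_lt hx)
  rw [← integrableOn_univ, ← Iic_union_Ioi (a := (0 : ℝ))]
  exact i1.union i2

/-- In the variable s = e^x this is a Gamma integral. At -∞ the factor e^{αx} decays; at +∞ a single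
term of the exponential series, of degree m > α, provides the decay. -/
lemma integrable_exp_mul_exp_neg_exp {α k : ℝ} (hα : 0 < α) (hk : 0 < k) :
    Integrable fun x : ℝ => Real.exp (α * x) * Real.exp (-(k * Real.exp x)) := by
  obtain ⟨m, hm⟩ := exists_nat_gt α
  have hm0 : (0 : ℝ) < m.factorial := by exact_mod_cast m.factorial_pos
  refine integrable_of_exp_bound (C := max 1 (m.factorial / k ^ m)) hα (sub_pos.2 hm)
    (by fun_prop) (fun x hx => ?_) (fun x hx => ?_)
  · rw [norm_mul, Real.norm_of_nonneg (Real.exp_pos _).le, Real.norm_of_nonneg (Real.exp_pos _).le]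
    have h1 : Real.exp (-(k * Real.exp x)) ≤ 1 := Real.exp_le_one_iff.2 (by
      have := Real.exp_pos x; nlinarith)
    rw [mul_comm]
    exact mul_le_mul_of_nonneg_right (h1.trans (le_max_left _ _)) (Real.exp_pos _).le
  · rw [norm_mul, Real.norm_of_nonneg (Real.exp_pos _).le, Real.norm_of_nonneg (Real.exp_pos _).le]
    have h1 := Real.pow_div_factorial_le_exp (k * Real.exp x) (by positivity) m
    have h2 : Real.exp (-(k * Real.exp x)) ≤ m.factorial / k ^ m * Real.exp (-(m * x)) := by
      rw [Real.exp_neg, inv_le_comm₀ (Real.exp_pos _) (by positivity)]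
      refine le_trans (le_of_eq ?_) h1
      rw [mul_pow, ← Real.exp_nat_mul, Real.exp_neg]
      field_simp
    calc _ ≤ Real.exp (α * x) * (m.factorial / k ^ m * Real.exp (-(m * x))) :=
          mul_le_mul_of_nonneg_left h2 (Real.exp_pos _).le
      _ = m.factorial / k ^ m * Real.exp (-(m - α) * x) := by
          rw [show -(m - α) * x = α * x + -(m * x) by ring, Real.exp_add]; ring
      _ ≤ _ := mul_le_mul_of_nonneg_right (le_max_right _ _) (Real.exp_pos _).le

/-! ### The Mittag-Leffler function as a contour integral -/

/-- The function `s^(a-b+1) / (s^a + λ)` in the logarithmic coordinate `s = e^w`. -/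
noncomputable def rayNum (a b lam : ℝ) (w : ℂ) : ℂ :=
  Complex.exp ((a - b + 1 : ℝ) * w) / (Complex.exp (a * w) + lam)

/-- Admissible opening angles of the contour. -/
structure RayAngle (a φ : ℝ) : Prop where
  a_pos : 0 < a
  gt : Real.pi / 2 < φ
  lt : φ < Real.pi
  mul_lt : a * φ < Real.pi

/-- An angle beyond π/2 makes e^{ts} decay along the rays, while aφ < π keeps s^a off the negative
half-line in the sector between them. The two are compatible because a < 2. -/
lemma exists_rayAngle {a : ℝ} (h0 : 0 < a) (h2 : a < 2) : ∃ φ, RayAngle a φ := by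
  have hpi := Real.pi_pos
  have h : Real.pi / 2 < min Real.pi (Real.pi / a) := by
    refine lt_min (by linarith) ?_
    exact div_lt_div_of_pos_left hpi h0 h2
  obtain ⟨φ, h1, h3⟩ := exists_between h
  refine ⟨φ, h0, h1, h3.trans_le (min_le_left _ _), ?_⟩
  have := h3.trans_le (min_le_right _ _)
  rw [lt_div_iff₀ h0] at this
  linarith

lemma RayAngle.pos {a φ : ℝ} (h : RayAngle a φ) : 0 < φ := lt_trans (by have := Real.pi_pos; positivity) h.gt

lemma RayAngle.cos_neg {a φ : ℝ} (h : RayAngle a φ) : Real.cos φ < 0 :=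
  Real.cos_neg_of_pi_div_two_lt_of_lt h.gt (by linarith [h.lt, Real.pi_pos])

lemma RayAngle.cos_half_pos {a φ : ℝ} (h : RayAngle a φ) : 0 < Real.cos (a * φ / 2) :=
  Real.cos_pos_of_mem_Ioo ⟨by
    have := mul_pos h.a_pos h.pos
    have := Real.pi_pos
    linarith, by linarith [h.mul_lt]⟩

/-- With r = |s^a| and ϑ its argument, |r e^{iϑ} + λ|² exceeds cos²(ϑ/2) (r + λ)² by exactly
sin²(ϑ/2) (r - λ)², and |ϑ/2| ≤ aφ/2 < π/2. -/
lemma norm_exp_add_ge {a φ lam : ℝ} (h : RayAngle a φ) (hl : 0 ≤ lam) {w : ℂ} (hw : |w.im| ≤ φ) :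
    Real.cos (a * φ / 2) * (Real.exp (a * w.re) + lam) ≤ ‖Complex.exp (a * w) + lam‖ := by
  set c := Real.cos (a * φ / 2) with hc
  have hc0 : 0 < c := h.cos_half_pos
  set r := Real.exp (a * w.re) with hr
  have hr0 : 0 < r := Real.exp_pos _
  set θ := a * w.im with hθ
  have hcos : c ≤ Real.cos (θ / 2) := by
    rw [← Real.cos_abs (θ / 2)]
    have h1 : |θ / 2| ≤ a * φ / 2 := by
      rw [hθ, abs_div, abs_mul, abs_of_pos h.a_pos, abs_of_pos (two_pos (α := ℝ))]
      have := mul_le_mul_of_nonneg_left hw h.a_pos.le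
      linarith
    exact Real.cos_le_cos_of_nonneg_of_le_pi (abs_nonneg _)
      (by linarith [h.mul_lt, Real.pi_pos]) h1
  have hz : Complex.exp (a * w) + lam =
      ((r * Real.cos θ + lam : ℝ) : ℂ) + ((r * Real.sin θ : ℝ) : ℂ) * Complex.I := by
    apply Complex.ext
    · simp only [Complex.add_re, Complex.exp_re, Complex.re_ofReal_mul, Complex.im_ofReal_mul,
        Complex.ofReal_re, Complex.I_re, hr, hθ]
      ring
    · simp only [Complex.add_im, Complex.exp_im, Complex.re_ofReal_mul, Complex.im_ofReal_mul,
        Complex.ofReal_im, Complex.I_im, hr, hθ]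
      ring
  have hsq : ‖Complex.exp (a * w) + lam‖ ^ 2 = r ^ 2 + lam ^ 2 + 2 * r * lam * Real.cos θ := by
    rw [hz, ← Complex.normSq_eq_norm_sq, Complex.normSq_add_mul_I]
    have := Real.sin_sq_add_cos_sq θ
    linear_combination r ^ 2 * this
  have hcd : Real.cos θ = 2 * Real.cos (θ / 2) ^ 2 - 1 := by
    rw [← Real.cos_two_mul]; ring_nf
  have hc1 : c ≤ 1 := Real.cos_le_one _
  refine abs_le_of_sq_le_sq' ?_ (norm_nonneg _) |>.2
  rw [hsq, hcd]
  have h2 : c ^ 2 ≤ Real.cos (θ / 2) ^ 2 := pow_le_pow_left₀ hc0.le hcos 2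
  have h3 : 0 ≤ (1 - c ^ 2) * (r - lam) ^ 2 :=
    mul_nonneg (by nlinarith) (sq_nonneg _)
  nlinarith [mul_nonneg (mul_nonneg hr0.le hl) (sub_nonneg.2 h2)]

lemma exp_add_ne_zero {a φ lam : ℝ} (h : RayAngle a φ) (hl : 0 ≤ lam) {w : ℂ} (hw : |w.im| ≤ φ) :
    Complex.exp (a * w) + lam ≠ 0 := by
  have h1 := norm_exp_add_ge h hl hw
  have h2 : 0 < Real.cos (a * φ / 2) * (Real.exp (a * w.re) + lam) :=
    mul_pos h.cos_half_pos (add_pos_of_pos_of_nonneg (Real.exp_pos _) hl)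
  exact norm_pos_iff.1 (h2.trans_le h1)

lemma norm_rayNum_le {a b φ lam : ℝ} (h : RayAngle a φ) (hl : 0 ≤ lam) {w : ℂ}
    (hw : |w.im| ≤ φ) : ‖rayNum a b lam w‖ ≤
      Real.exp ((a - b + 1) * w.re) / (Real.cos (a * φ / 2) * (Real.exp (a * w.re) + lam)) := by
  unfold rayNum
  rw [norm_div, Complex.norm_exp]
  have h2 : 0 < Real.cos (a * φ / 2) * (Real.exp (a * w.re) + lam) :=
    mul_pos h.cos_half_pos (add_pos_of_pos_of_nonneg (Real.exp_pos _) hl)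
  have : (((a - b + 1 : ℝ) : ℂ) * w).re = (a - b + 1) * w.re := by
    rw [Complex.re_ofReal_mul]
  rw [this]
  exact div_le_div_of_nonneg_left (Real.exp_pos _).le h2 (norm_exp_add_ge h hl hw)

lemma differentiableOn_rayNum {a b φ lam : ℝ} (h : RayAngle a φ) (hl : 0 ≤ lam) :
    DifferentiableOn ℂ (rayNum a b lam) {w | |w.im| ≤ φ} := by
  unfold rayNum
  refine DifferentiableOn.div (by fun_prop) (by fun_prop) fun w hw => exp_add_ne_zero h hl hw

lemma RayAngle.exists_larger {a φ : ℝ} (h : RayAngle a φ) : ∃ φ', φ < φ' ∧ RayAngle a φ' := by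
  have h1 : φ < min Real.pi (Real.pi / a) :=
    lt_min h.lt ((lt_div_iff₀ h.a_pos).2 (by linarith [h.mul_lt]))
  obtain ⟨φ', h2, h3⟩ := exists_between h1
  refine ⟨φ', h2, h.a_pos, h.gt.trans h2, h3.trans_le (min_le_left _ _), ?_⟩
  have := (lt_div_iff₀ h.a_pos).1 (h3.trans_le (min_le_right _ _))
  linarith

lemma continuous_rayNum_line {a b φ lam θ : ℝ} (h : RayAngle a φ) (hl : 0 ≤ lam) (hθ : |θ| ≤ φ) :
    Continuous fun x : ℝ => rayNum a b lam (x + θ * Complex.I) := by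
  rw [← continuousOn_univ]
  exact (differentiableOn_rayNum h hl).continuousOn.comp (by fun_prop) fun x _ => by simpa using hθ

lemma re_exp_line (x θ : ℝ) :
    (Complex.exp (x + θ * Complex.I)).re = Real.exp x * Real.cos θ := by
  simp [Complex.exp_re]

lemma le_norm_sub_exp {p x θ : ℝ} :
    p - Real.exp x * Real.cos θ ≤ ‖(p : ℂ) - Complex.exp (x + θ * Complex.I)‖ := by
  refine le_trans (le_of_eq ?_) (Complex.re_le_norm _)
  rw [Complex.sub_re, re_exp_line, Complex.ofReal_re]

lemma RayAngle.cos_eq {a φ θ : ℝ} (_h : RayAngle a φ) (hθ : |θ| = φ) : Real.cos θ = Real.cos φ := by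
  rw [← hθ, Real.cos_abs]

/-- At -∞ the integrand is O(e^{(a-b+1)x}), because s^a + λ is bounded below; at +∞ it is
O(e^{-bx}). This is where 0 < b < a + 1 comes from. -/
lemma integrable_rayNum_div {a b φ lam p θ : ℝ} (h : RayAngle a φ) (hl : 0 < lam) (hb : 0 < b)
    (hba : b < a + 1) (hp : 0 < p) (hθ : |θ| = φ) :
    Integrable (fun x : ℝ => ‖rayNum a b lam (x + θ * Complex.I)‖ *
      (p - Real.exp x * Real.cos φ)⁻¹) := by
  have hc := h.cos_half_pos
  have hκ := h.cos_neg
  set c := Real.cos (a * φ / 2)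
  set κ := -Real.cos φ with hκd
  have hκ0 : 0 < κ := by linarith
  have hd : ∀ x, 0 < p - Real.exp x * Real.cos φ := fun x => by
    have := Real.exp_pos x; nlinarith
  refine integrable_of_exp_bound (α := a - b + 1) (β := b)
    (C := max (1 / (c * lam * p)) (1 / (c * κ))) (by linarith) hb ?_ (fun x hx => ?_)
    (fun x hx => ?_)
  · refine Continuous.aestronglyMeasurable ?_
    exact (continuous_rayNum_line h hl.le hθ.le).norm.mul
      (Continuous.inv₀ (by fun_prop) fun x => (hd x).ne')
  all_goals
    have hN := norm_rayNum_le (b := b) h hl.le (w := x + θ * Complex.I) (by simpa using hθ.le)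
    simp only [Complex.add_re, Complex.ofReal_re, Complex.mul_re, Complex.I_re, mul_zero,
      Complex.ofReal_im, Complex.I_im, mul_one, sub_self, add_zero] at hN
    have hex := Real.exp_pos x
    rw [norm_mul, norm_norm, norm_inv, Real.norm_of_nonneg (hd x).le]
  · have e1 : c * lam ≤ c * (Real.exp (a * x) + lam) :=
      mul_le_mul_of_nonneg_left (by linarith [Real.exp_pos (a * x)]) hc.le
    have e2 : p ≤ p - Real.exp x * Real.cos φ := by nlinarith
    calc _ ≤ Real.exp ((a - b + 1) * x) / (c * lam) * p⁻¹ := by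
          refine mul_le_mul (hN.trans ?_) ?_ (inv_nonneg.2 (hd x).le) (by positivity)
          · exact div_le_div_of_nonneg_left (Real.exp_pos _).le (by positivity) e1
          · exact inv_anti₀ hp e2
      _ = 1 / (c * lam * p) * Real.exp ((a - b + 1) * x) := by field_simp
      _ ≤ _ := mul_le_mul_of_nonneg_right (le_max_left _ _) (Real.exp_pos _).le
  · have e1 : c * Real.exp (a * x) ≤ c * (Real.exp (a * x) + lam) :=
      mul_le_mul_of_nonneg_left (by linarith) hc.le
    have e2 : κ * Real.exp x ≤ p - Real.exp x * Real.cos φ := by rw [hκd]; linarith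
    calc _ ≤ Real.exp ((a - b + 1) * x) / (c * Real.exp (a * x)) * (κ * Real.exp x)⁻¹ := by
          refine mul_le_mul (hN.trans ?_) ?_ (inv_nonneg.2 (hd x).le) (by positivity)
          · exact div_le_div_of_nonneg_left (Real.exp_pos _).le (by positivity) e1
          · exact inv_anti₀ (by positivity) e2
      _ = 1 / (c * κ) * Real.exp (-b * x) := by
          rw [show (a - b + 1) * x = a * x + x + -b * x by ring, Real.exp_add, Real.exp_add]
          field_simp
      _ ≤ _ := mul_le_mul_of_nonneg_right (le_max_right _ _) (Real.exp_pos _).le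

lemma integrable_rayNum_div' {a b φ lam p θ : ℝ} (h : RayAngle a φ) (hl : 0 < lam) (hb : 0 < b)
    (hba : b < a + 1) (hp : 0 < p) (hθ : |θ| = φ) :
    Integrable (fun x : ℝ => rayNum a b lam (x + θ * Complex.I) /
      (p - Complex.exp (x + θ * Complex.I))) := by
  have hκ := h.cos_neg
  have hd : ∀ x, 0 < p - Real.exp x * Real.cos φ := fun x => by
    have := Real.exp_pos x; nlinarith
  have hle : ∀ x : ℝ, p - Real.exp x * Real.cos φ ≤ ‖(p : ℂ) - Complex.exp (x + θ * Complex.I)‖ :=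
    fun x => by rw [← h.cos_eq hθ]; exact le_norm_sub_exp
  refine (integrable_rayNum_div h hl hb hba hp hθ).mono' ?_ ?_
  · refine Continuous.aestronglyMeasurable ?_
    refine (continuous_rayNum_line h hl.le hθ.le).div (by fun_prop) fun x => ?_
    exact norm_pos_iff.1 ((hd x).trans_le (hle x))
  · refine Eventually.of_forall fun x => ?_
    rw [norm_div, div_eq_mul_inv]
    exact mul_le_mul_of_nonneg_left (inv_anti₀ (hd x) (hle x)) (norm_nonneg _)

/-- In the strip |Im w| < π the equation e^w = e^{x₀} has only the solution w = x₀. Dividing by this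
difference quotient therefore turns the kernel 1 / (p - e^w) into the simple Cauchy kernel at x₀ =
log p. -/
lemma dslope_exp_ne_zero {x₀ : ℝ} {w : ℂ} (hw : |w.im| < Real.pi) :
    dslope Complex.exp x₀ w ≠ 0 := by
  by_cases hwx : w = x₀
  · rw [hwx, dslope_same, Complex.deriv_exp]
    exact Complex.exp_ne_zero _
  · rw [dslope_of_ne _ hwx, slope_def_field]
    refine div_ne_zero (sub_ne_zero.2 fun heq => hwx ?_) (sub_ne_zero.2 hwx)
    obtain ⟨n, hn⟩ := Complex.exp_eq_exp_iff_exists_int.1 heq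
    have him := congrArg Complex.im hn
    simp at him
    have hn0 : n = 0 := by
      have hpi := Real.pi_pos
      rw [him, abs_mul, abs_of_pos (by positivity : 0 < 2 * Real.pi)] at hw
      have : |(n : ℝ)| < 1 := by nlinarith
      exact Int.abs_lt_one_iff.1 (by exact_mod_cast this)
    rw [hn, hn0]; simp

/-- Residue theorem in the coordinate s = e^w, where ds = s dw accounts for the extra power of s in
`rayNum`: the only pole between the two rays is s = p, and it contributes the Laplace transform of
the Mittag-Leffler kernel. -/
lemma ray_cauchy {a b φ lam p : ℝ} (h : RayAngle a φ) (hl : 0 < lam) (hb : 0 < b)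
    (hba : b < a + 1) (hp : 0 < p) :
    (∫ x : ℝ, rayNum a b lam (x + φ * Complex.I) / (p - Complex.exp (x + φ * Complex.I))) -
      ∫ x : ℝ, rayNum a b lam (x + (-φ : ℝ) * Complex.I) /
        (p - Complex.exp (x + (-φ : ℝ) * Complex.I)) =
      2 * Real.pi * Complex.I * ((p ^ (a - b) / (p ^ a + lam) : ℝ) : ℂ) := by
  obtain ⟨φ', hφ', h'⟩ := h.exists_larger
  set x₀ := Real.log p with hx₀
  have hex₀ : Complex.exp x₀ = p := by rw [← Complex.ofReal_exp, Real.exp_log hp]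
  set F : ℂ → ℂ := fun w => rayNum a b lam w / dslope Complex.exp x₀ w with hF
  have hFd : DifferentiableOn ℂ F {w | |w.im| < φ'} := by
    refine DifferentiableOn.div ?_ ?_ fun w hw => dslope_exp_ne_zero (hw.trans h'.lt)
    · exact (differentiableOn_rayNum h' hl.le).mono fun w hw => show |w.im| ≤ φ' from le_of_lt hw
    · exact ((Complex.differentiableOn_dslope univ_mem).2
        Complex.differentiable_exp.differentiableOn).mono (subset_univ _)
  have hFe : ∀ w : ℂ, w ≠ x₀ → F w / (w - x₀) = -(rayNum a b lam w / (p - Complex.exp w)) := by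
    intro w hw
    simp only [hF]
    rw [dslope_of_ne _ hw, slope_def_field, hex₀, div_div, div_mul_cancel₀ _ (sub_ne_zero.2 hw),
      ← div_neg, neg_sub]
  have n1 : ∀ (x : ℝ) (s : ℝ), s ≠ 0 → ((x : ℂ) + s * Complex.I) ≠ x₀ := by
    intro x s hs heq
    have := congrArg Complex.im heq
    simp at this
    exact hs this
  have hφ0 := h.pos
  have hline : ∀ s : ℝ, s ≠ 0 → (fun x : ℝ => F (x + s * Complex.I) / (x + s * Complex.I - x₀)) =
      fun x : ℝ => -(rayNum a b lam (x + s * Complex.I) / (p - Complex.exp (x + s * Complex.I))) :=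
    fun s hs => funext fun x => hFe _ (n1 x s hs)
  have hc := h.cos_half_pos
  set c := Real.cos (a * φ / 2) with hcd
  have key := cauchy_strip (F := F) hφ0 hφ' x₀ hFd
    (by
      rw [hline _ hφ0.ne']
      exact (integrable_rayNum_div' h hl hb hba hp (abs_of_pos hφ0)).neg)
    (by
      rw [hline _ (by simpa using hφ0.ne')]
      exact (integrable_rayNum_div' h hl hb hba hp (by rw [abs_neg, abs_of_pos hφ0])).neg)
    (B := fun R => 2 / c * Real.exp (-b * R) + 2 / (c * lam * p) * Real.exp (-(a - b + 1) * R))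
    (by
      have t1 : ∀ q : ℝ, 0 < q → Tendsto (fun R : ℝ => Real.exp (-q * R)) atTop (𝓝 0) := by
        intro q hq
        refine Real.tendsto_exp_atBot.comp ?_
        exact tendsto_id.const_mul_atTop_of_neg (by linarith)
      simpa using ((t1 b hb).const_mul (2 / c)).add
        ((t1 (a - b + 1) (by linarith)).const_mul (2 / (c * lam * p))))
    (by
      filter_upwards [eventually_gt_atTop |x₀|, eventually_ge_atTop (Real.log (2 * p)),
        eventually_ge_atTop (-Real.log (p / 2))] with R hR hR1 hR2 y hy
      have hR1' : 2 * p ≤ Real.exp R := by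
        rwa [← Real.log_le_iff_le_exp (by positivity)]
      have hR2' : Real.exp (-R) ≤ p / 2 := by
        rw [← Real.le_log_iff_exp_le (by positivity)]; linarith
      have hne : ∀ s : ℝ, |s| = R → ((s : ℂ) + y * Complex.I) ≠ x₀ := by
        intro s hs heq
        have := congrArg Complex.re heq
        simp at this
        rw [this] at hs
        linarith
      have hR0 : 0 < R := (abs_nonneg _).trans_lt hR
      have hnorm : ∀ s : ℝ, ‖Complex.exp (s + y * Complex.I)‖ = Real.exp s := by
        intro s; rw [Complex.norm_exp]; simp
      have hN : ∀ s : ℝ, ‖rayNum a b lam (s + y * Complex.I)‖ ≤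
          Real.exp ((a - b + 1) * s) / (c * (Real.exp (a * s) + lam)) := by
        intro s
        have := norm_rayNum_le (b := b) h hl.le (w := s + y * Complex.I)
          (by simpa using abs_le.2 hy)
        simpa using this
      constructor
      · rw [hFe _ (hne R (abs_of_pos hR0)), norm_neg, norm_div]
        have e1 : Real.exp R / 2 ≤ ‖(p : ℂ) - Complex.exp (R + y * Complex.I)‖ := by
          have := norm_sub_norm_le (Complex.exp (R + y * Complex.I)) (p : ℂ)
          rw [hnorm, norm_sub_rev, Complex.norm_of_nonneg hp.le] at this
          linarith
        have e2 : ‖rayNum a b lam (R + y * Complex.I)‖ ≤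
            Real.exp ((a - b + 1) * R) / (c * Real.exp (a * R)) :=
          (hN R).trans (div_le_div_of_nonneg_left (Real.exp_pos _).le (by positivity)
            (mul_le_mul_of_nonneg_left (by linarith) hc.le))
        calc _ ≤ Real.exp ((a - b + 1) * R) / (c * Real.exp (a * R)) / (Real.exp R / 2) :=
              div_le_div₀ (by positivity) e2 (by positivity) e1
          _ = 2 / c * Real.exp (-b * R) := by
              rw [show (a - b + 1) * R = a * R + R + -b * R by ring, Real.exp_add, Real.exp_add]
              field_simp
          _ ≤ _ := le_add_of_nonneg_right (by positivity)
      · rw [hFe _ (hne (-R) (by rw [abs_neg, abs_of_pos hR0])), norm_neg, norm_div]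
        have e1 : p / 2 ≤ ‖(p : ℂ) - Complex.exp ((-R : ℝ) + y * Complex.I)‖ := by
          have := norm_sub_norm_le (p : ℂ) (Complex.exp ((-R : ℝ) + y * Complex.I))
          rw [hnorm, Complex.norm_of_nonneg hp.le] at this
          linarith
        have e2 : ‖rayNum a b lam ((-R : ℝ) + y * Complex.I)‖ ≤
            Real.exp ((a - b + 1) * (-R)) / (c * lam) :=
          (hN (-R)).trans (div_le_div_of_nonneg_left (Real.exp_pos _).le (by positivity)
            (mul_le_mul_of_nonneg_left (by linarith [Real.exp_pos (a * -R)]) hc.le))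
        calc _ ≤ Real.exp ((a - b + 1) * (-R)) / (c * lam) / (p / 2) :=
              div_le_div₀ (by positivity) e2 (by positivity) e1
          _ = 2 / (c * lam * p) * Real.exp (-(a - b + 1) * R) := by
              rw [show (a - b + 1) * (-R) = -(a - b + 1) * R by ring]
              field_simp
          _ ≤ _ := le_add_of_nonneg_left (by positivity))
  rw [hline _ hφ0.ne', hline _ (by simpa using hφ0.ne'), integral_neg, integral_neg] at key
  have hval : F x₀ = ((p ^ (a - b) / (p ^ a + lam) : ℝ) : ℂ) := by
    simp only [hF, dslope_same, Complex.deriv_exp, hex₀, rayNum]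
    have e1 : ∀ q : ℝ, Complex.exp ((q : ℂ) * x₀) = ((p ^ q : ℝ) : ℂ) := by
      intro q
      rw [Real.rpow_def_of_pos hp, Complex.ofReal_exp, hx₀]
      push_cast; ring_nf
    rw [e1, e1]
    have e2 : p ^ (a - b + 1) = p ^ (a - b) * p := by
      rw [Real.rpow_add hp, Real.rpow_one]
    rw [e2]
    push_cast
    have : (p : ℂ) ≠ 0 := by exact_mod_cast hp.ne'
    field_simp
  rw [← hval, ← key]
  ring

lemma laplace_powKer {a p : ℝ} (ha : 0 < a) (hp : 0 < p) :
    ∫ t in Ioi (0 : ℝ), Real.exp (-p * t) * powKer a t = p ^ (-a) := by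
  have h := Real.integral_rpow_mul_exp_neg_mul_Ioi ha hp
  have hG := Real.Gamma_pos_of_pos ha
  have h1 : ∀ t : ℝ, Real.exp (-p * t) * powKer a t =
      (1 / Real.Gamma a) * (t ^ (a - 1) * Real.exp (-(p * t))) := by
    intro t; unfold powKer; rw [neg_mul]; ring
  simp only [h1]
  rw [integral_const_mul, h, one_div p, Real.inv_rpow hp.le, Real.rpow_neg hp.le]
  field_simp

lemma laplace_powKer_integrable {a p : ℝ} (ha : 0 < a) (hp : 0 < p) :
    IntegrableOn (fun t => Real.exp (-p * t) * powKer a t) (Ioi (0 : ℝ)) := by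
  by_contra hn
  have := integral_undef hn
  rw [laplace_powKer ha hp] at this
  exact (Real.rpow_pos_of_pos hp _).ne' this

/-- Term by term the transform is a geometric series in -λ / p^a, hence the restriction on p.
Integrability is again inferred from the nonzero value of the integral. -/
lemma laplace_mlKer {a b lam p : ℝ} (ha : 0 < a) (hb : 0 < b) (hp : 0 < p) (hl : 0 < lam)
    (hlp : lam < p ^ a) :
    IntegrableOn (fun t => Real.exp (-p * t) * mlKer a lam b t) (Ioi (0 : ℝ)) ∧
    ∫ t in Ioi (0 : ℝ), Real.exp (-p * t) * mlKer a lam b t = p ^ (a - b) / (p ^ a + lam) := by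
  have hk : ∀ k : ℕ, 0 < a * k + b := fun k => by positivity
  have hpa : 0 < p ^ a := Real.rpow_pos_of_pos hp _
  set F : ℕ → ℝ → ℝ := fun k t => (-lam) ^ k * (Real.exp (-p * t) * powKer (a * k + b) t) with hF
  have hpow : ∀ k : ℕ, p ^ (-(a * k + b)) = p ^ (-b) * (1 / p ^ a) ^ k := by
    intro k
    rw [one_div, inv_pow, ← Real.rpow_natCast (p ^ a), ← Real.rpow_mul hp.le,
      ← Real.rpow_neg hp.le, ← Real.rpow_add hp]
    ring_nf
  have hFi : ∀ k, Integrable (F k) (volume.restrict (Ioi 0)) := fun k =>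
    (laplace_powKer_integrable (hk k) hp).const_mul _
  have hn : ∀ k, ∫ t in Ioi (0 : ℝ), ‖F k t‖ = p ^ (-b) * (lam / p ^ a) ^ k := by
    intro k
    have : ∀ t ∈ Ioi (0 : ℝ), ‖F k t‖ = lam ^ k * (Real.exp (-p * t) * powKer (a * k + b) t) := by
      intro t ht
      simp only [hF]
      rw [norm_mul, norm_pow, norm_neg, Real.norm_of_nonneg hl.le, Real.norm_of_nonneg]
      exact mul_nonneg (Real.exp_pos _).le (powKer_nonneg (hk k) (le_of_lt ht))
    rw [setIntegral_congr_fun measurableSet_Ioi this, integral_const_mul, laplace_powKer (hk k) hp,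
      hpow, div_eq_mul_one_div lam, mul_pow]
    ring
  have hlt : lam / p ^ a < 1 := (div_lt_one hpa).2 hlp
  have hsum : Summable fun k => ∫ t in Ioi (0 : ℝ), ‖F k t‖ := by
    simp only [hn]
    exact (summable_geometric_of_lt_one (by positivity) hlt).mul_left _
  have hpt : ∀ t ∈ Ioi (0 : ℝ), ∑' k, F k t = Real.exp (-p * t) * mlKer a lam b t := by
    intro t ht
    have := (hasSum_mlKer lam b ha (mem_Ioi.1 ht)).mul_left (Real.exp (-p * t))
    rw [← this.tsum_eq]
    exact tsum_congr fun k => by simp only [hF]; ring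
  have hS := hasSum_integral_of_summable_integral_norm hFi hsum
  suffices hval : ∫ t in Ioi (0 : ℝ), Real.exp (-p * t) * mlKer a lam b t =
      p ^ (a - b) / (p ^ a + lam) by
    refine ⟨?_, hval⟩
    by_contra hni
    have h0 : p ^ (a - b) / (p ^ a + lam) = 0 := hval.symm.trans (integral_undef hni)
    have : 0 < p ^ (a - b) / (p ^ a + lam) :=
      div_pos (Real.rpow_pos_of_pos hp _) (by linarith)
    linarith
  · rw [← setIntegral_congr_fun measurableSet_Ioi hpt]
    have hv : ∀ k, ∫ t in Ioi (0 : ℝ), F k t = p ^ (-b) * (-(lam / p ^ a)) ^ k := by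
      intro k
      simp only [hF]
      rw [integral_const_mul, laplace_powKer (hk k) hp, hpow, div_eq_mul_one_div lam,
        ← neg_mul, mul_pow]
      ring
    simp only [hv] at hS
    have hg := (hasSum_geometric_of_abs_lt_one (r := -(lam / p ^ a))
      (by rw [abs_neg, abs_of_nonneg (by positivity)]; exact hlt)).mul_left (p ^ (-b))
    rw [hS.unique hg, Real.rpow_sub hp, Real.rpow_neg hp.le]
    have : 0 < p ^ b := Real.rpow_pos_of_pos hp _
    have h3 : p ^ a + lam ≠ 0 := by positivity
    rw [sub_neg_eq_add, show 1 + lam / p ^ a = (p ^ a + lam) / p ^ a by field_simp, inv_div]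
    field_simp

/-- Integral over the ray of angle `θ`. -/
noncomputable def rayInt (a b lam θ t : ℝ) : ℂ :=
  ∫ x : ℝ, Complex.exp (t * Complex.exp (x + θ * Complex.I)) * rayNum a b lam (x + θ * Complex.I)

lemma norm_exp_mul_exp {φ a θ : ℝ} (h : RayAngle a φ) (hθ : |θ| = φ) (t x : ℝ) :
    ‖Complex.exp (t * Complex.exp (x + θ * Complex.I))‖ =
      Real.exp (-(t * (-Real.cos φ) * Real.exp x)) := by
  rw [Complex.norm_exp, Complex.re_ofReal_mul, re_exp_line, h.cos_eq hθ]
  ring_nf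

lemma norm_rayNum_le' {a b φ lam θ : ℝ} (h : RayAngle a φ) (hl : 0 < lam) (hθ : |θ| = φ) (x : ℝ) :
    ‖rayNum a b lam (x + θ * Complex.I)‖ ≤
      1 / (Real.cos (a * φ / 2) * lam) * Real.exp ((a - b + 1) * x) := by
  have hc := h.cos_half_pos
  have := norm_rayNum_le (b := b) h hl.le (w := x + θ * Complex.I) (by simpa using hθ.le)
  simp only [Complex.add_re, Complex.ofReal_re, Complex.mul_re, Complex.I_re, mul_zero,
      Complex.ofReal_im, Complex.I_im, mul_one, sub_self, add_zero] at this
  refine this.trans ?_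
  rw [one_div_mul_eq_div]
  exact div_le_div_of_nonneg_left (Real.exp_pos _).le (by positivity)
    (mul_le_mul_of_nonneg_left (by linarith [Real.exp_pos (a * x)]) hc.le)

lemma rayInt_bound {a b φ lam θ t₀ t : ℝ} (h : RayAngle a φ) (hl : 0 < lam) (hθ : |θ| = φ)
    (ht : t₀ ≤ t) (x : ℝ) :
    ‖Complex.exp (t * Complex.exp (x + θ * Complex.I)) * rayNum a b lam (x + θ * Complex.I)‖ ≤
      1 / (Real.cos (a * φ / 2) * lam) *
        (Real.exp ((a - b + 1) * x) * Real.exp (-(t₀ * (-Real.cos φ) * Real.exp x))) := by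
  rw [norm_mul, norm_exp_mul_exp h hθ, mul_comm, ← mul_assoc]
  have hc := h.cos_neg
  refine mul_le_mul (norm_rayNum_le' h hl hθ x) ?_ (Real.exp_pos _).le
    (mul_nonneg (by have := h.cos_half_pos; positivity) (Real.exp_pos _).le)
  refine Real.exp_le_exp.2 (neg_le_neg ?_)
  have := Real.exp_pos x
  exact mul_le_mul_of_nonneg_right (mul_le_mul_of_nonneg_right ht (by linarith)) this.le

lemma rayInt_bound_integrable {a b φ : ℝ} (lam : ℝ) {t₀ : ℝ} (h : RayAngle a φ)
    (hba : b < a + 1) (ht : 0 < t₀) : Integrable fun x : ℝ =>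
      1 / (Real.cos (a * φ / 2) * lam) *
        (Real.exp ((a - b + 1) * x) * Real.exp (-(t₀ * (-Real.cos φ) * Real.exp x))) :=
  (integrable_exp_mul_exp_neg_exp (by linarith)
    (mul_pos ht (by linarith [h.cos_neg]))).const_mul _

lemma continuousOn_rayInt {a b φ lam θ : ℝ} (h : RayAngle a φ) (hl : 0 < lam) (hθ : |θ| = φ)
    (hba : b < a + 1) : ContinuousOn (rayInt a b lam θ) (Ioi 0) := by
  intro t₀ ht₀
  have ht₀' : 0 < t₀ / 2 := half_pos ht₀
  refine ContinuousAt.continuousWithinAt ?_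
  refine continuousAt_of_dominated (bound := fun x => 1 / (Real.cos (a * φ / 2) * lam) *
        (Real.exp ((a - b + 1) * x) * Real.exp (-((t₀ / 2) * (-Real.cos φ) * Real.exp x))))
    ?_ ?_ (rayInt_bound_integrable lam h hba ht₀') ?_
  · refine Eventually.of_forall fun t => Continuous.aestronglyMeasurable ?_
    exact Continuous.mul (by fun_prop) (continuous_rayNum_line h hl.le hθ.le)
  · filter_upwards [Ioi_mem_nhds (show t₀ / 2 < t₀ by linarith)] with t ht
    exact Eventually.of_forall fun x => rayInt_bound h hl hθ (le_of_lt ht) x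
  · refine Eventually.of_forall fun x => ?_
    fun_prop

/-- Fubini together with ∫ e^{-pt} e^{ts} dt = 1 / (p - s), valid because Re s < p on the ray;
absolute integrability is `integrable_rayNum_div`. -/
lemma laplace_rayInt {a b φ lam θ p : ℝ} (h : RayAngle a φ) (hl : 0 < lam) (hθ : |θ| = φ)
    (hb : 0 < b) (hba : b < a + 1) (hp : 0 < p) :
    IntegrableOn (fun t : ℝ => (Real.exp (-p * t) : ℂ) * rayInt a b lam θ t) (Ioi 0) ∧
    ∫ t in Ioi (0 : ℝ), (Real.exp (-p * t) : ℂ) * rayInt a b lam θ t =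
      ∫ x : ℝ, rayNum a b lam (x + θ * Complex.I) / (p - Complex.exp (x + θ * Complex.I)) := by
  set μ : Measure ℝ := volume.restrict (Ioi 0) with hμ
  set N : ℝ → ℂ := fun x => rayNum a b lam (x + θ * Complex.I) with hN
  set e : ℝ → ℂ := fun x => Complex.exp (x + θ * Complex.I) - p with he
  have hNc : Continuous N := continuous_rayNum_line h hl.le hθ.le
  have hec : Continuous e := by fun_prop
  set F : ℝ → ℝ → ℂ := fun t x => Complex.exp (e x * t) * N x with hF
  have hre : ∀ x, (e x).re = -(p - Real.exp x * Real.cos φ) := by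
    intro x
    simp only [he]
    rw [Complex.sub_re, re_exp_line, h.cos_eq hθ, Complex.ofReal_re]; ring
  have hd : ∀ x, 0 < p - Real.exp x * Real.cos φ := fun x => by
    have := Real.exp_pos x
    have := h.cos_neg
    nlinarith
  have hre0 : ∀ x, (e x).re < 0 := fun x => by rw [hre]; linarith [hd x]
  have hFi : Integrable (Function.uncurry F) (μ.prod volume) := by
    have hm : AEStronglyMeasurable (Function.uncurry F) (μ.prod volume) := by
      refine Continuous.aestronglyMeasurable ?_
      simp only [Function.uncurry_def, hF]
      fun_prop
    rw [integrable_prod_iff' hm]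
    constructor
    · refine Eventually.of_forall fun x => ?_
      have h1 : Integrable (fun t : ℝ => Complex.exp (e x * t)) μ :=
        integrableOn_exp_mul_complex_Ioi (hre0 x) 0
      exact h1.mul_const (N x)
    · refine (integrable_rayNum_div h hl hb hba hp hθ).congr (Eventually.of_forall fun x => ?_)
      simp only [Function.uncurry, hF, norm_mul]
      rw [integral_mul_const, mul_comm]
      congr 1
      have : ∀ t : ℝ, ‖Complex.exp (e x * t)‖ = Real.exp ((e x).re * t) := fun t => by
        rw [Complex.norm_exp, Complex.re_mul_ofReal]
      simp only [this, hμ]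
      rw [integral_exp_mul_Ioi (hre0 x), mul_zero, Real.exp_zero, hre]
      rw [neg_div_neg_eq, one_div]
  have hinner : ∀ t : ℝ, (Real.exp (-p * t) : ℂ) * rayInt a b lam θ t = ∫ x, F t x := by
    intro t
    unfold rayInt
    rw [← integral_const_mul]
    refine integral_congr_ae (Eventually.of_forall fun x => ?_)
    simp only [hF, hN, he]
    rw [← mul_assoc]
    congr 1
    rw [Complex.ofReal_exp, ← Complex.exp_add]
    congr 1
    push_cast; ring
  simp only [hinner]
  refine ⟨hFi.integral_prod_left, ?_⟩
  rw [integral_integral_swap hFi]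
  refine integral_congr_ae (Eventually.of_forall fun x => ?_)
  simp only [hF, hμ]
  rw [integral_mul_const, integral_exp_mul_complex_Ioi (hre0 x)]
  simp only [Complex.ofReal_zero, mul_zero, Complex.exp_zero, he, hN]
  rw [neg_div, ← div_neg, neg_sub]
  ring

/-- Representation of the Mittag-Leffler function by integrals over two rays. -/
lemma mittagLeffler_eq_rayInt {a b φ lam : ℝ} (h : RayAngle a φ) (hl : 0 < lam)
    (hb : 0 < b) (hba : b < a + 1) :
    mittagLeffler a b (-lam) =
      ((rayInt a b lam φ 1 - rayInt a b lam (-φ) 1) / (2 * Real.pi * Complex.I)).re := by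
  have hφ := h.pos
  have hθ1 : |φ| = φ := abs_of_pos hφ
  have hθ2 : |-φ| = φ := by rw [abs_neg, hθ1]
  set S : ℝ → ℂ := fun t => (rayInt a b lam φ t - rayInt a b lam (-φ) t) /
    (2 * Real.pi * Complex.I) with hS
  have hSc : ContinuousOn S (Ioi 0) :=
    ((continuousOn_rayInt h hl hθ1 hba).sub (continuousOn_rayInt h hl hθ2 hba)).div_const _
  have hpi : (2 * Real.pi * Complex.I : ℂ) ≠ 0 := by
    simp [Real.pi_ne_zero]
  have hSl : ∀ p : ℝ, 0 < p →
      IntegrableOn (fun t : ℝ => (Real.exp (-p * t) : ℂ) * S t) (Ioi 0) ∧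
      ∫ t in Ioi (0 : ℝ), (Real.exp (-p * t) : ℂ) * S t =
        ((p ^ (a - b) / (p ^ a + lam) : ℝ) : ℂ) := by
    intro p hp
    obtain ⟨i1, e1⟩ := laplace_rayInt h hl hθ1 hb hba hp
    obtain ⟨i2, e2⟩ := laplace_rayInt h hl hθ2 hb hba hp
    have heq : ∀ t : ℝ, (Real.exp (-p * t) : ℂ) * S t =
        ((Real.exp (-p * t) : ℂ) * rayInt a b lam φ t -
          (Real.exp (-p * t) : ℂ) * rayInt a b lam (-φ) t) / (2 * Real.pi * Complex.I) := by
      intro t; simp only [hS]; ring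
    simp only [heq]
    refine ⟨(i1.sub i2).div_const _, ?_⟩
    rw [integral_div, integral_sub i1 i2, e1, e2, ray_cauchy h hl hb hba hp,
      mul_div_cancel_left₀ _ hpi]
  have hSr : ∀ p : ℝ, 0 < p →
      IntegrableOn (fun t : ℝ => Real.exp (-p * t) * (S t).re) (Ioi 0) ∧
      ∫ t in Ioi (0 : ℝ), Real.exp (-p * t) * (S t).re = p ^ (a - b) / (p ^ a + lam) := by
    intro p hp
    obtain ⟨i1, e1⟩ := hSl p hp
    have heq : ∀ t : ℝ, Real.exp (-p * t) * (S t).re = ((Real.exp (-p * t) : ℂ) * S t).re :=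
      fun t => by rw [Complex.re_ofReal_mul]
    simp only [heq]
    refine ⟨i1.re, ?_⟩
    have := integral_re (μ := volume.restrict (Ioi (0 : ℝ))) i1
    simp only [RCLike.re_eq_complex_re] at this
    rw [this, e1, Complex.ofReal_re]
  set c : ℝ := (lam + 1) ^ (1 / a) with hc
  have hc0 : 0 < c := Real.rpow_pos_of_pos (by linarith) _
  have hca : ∀ p ≥ c, lam < p ^ a := by
    intro p hp
    have h1 : c ^ a = lam + 1 := by
      rw [hc, ← Real.rpow_mul (by linarith), one_div_mul_cancel h.a_pos.ne', Real.rpow_one]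
    have := Real.rpow_le_rpow hc0.le hp h.a_pos.le
    linarith
  -- The kernel and the contour integral are continuous in t > 0 and have the same transform p^{a-b}
  -- / (p^a + λ) for large p, hence coincide; the claim is their equality at t = 1.
  have hzero := eqOn_zero_of_laplace_eq_zero (v := fun t => mlKer a lam b t - (S t).re) (c := c)
    (by
      refine ContinuousOn.sub (fun t ht => ?_) (Complex.continuous_re.comp_continuousOn hSc)
      have := ((powBdd_mlKer (2 * t) lam h.a_pos hb).1.mono Ioo_subset_Ioc_self).continuousAt
        (Ioo_mem_nhds (mem_Ioi.1 ht) (by linarith [mem_Ioi.1 ht] : t < 2 * t))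
      exact this.continuousWithinAt)
    (by
      simp only [mul_sub]
      exact (laplace_mlKer h.a_pos hb hc0 hl (hca c le_rfl)).1.sub (hSr c hc0).1)
    (by
      intro p hp
      have hp0 := hc0.trans_le hp
      have h1 := laplace_mlKer h.a_pos hb hp0 hl (hca p hp)
      have h2 := hSr p hp0
      simp only [mul_sub]
      rw [integral_sub h1.1 h2.1, h1.2, h2.2, sub_self])
    1 (mem_Ioi.2 one_pos)
  have h1 : mlKer a lam b 1 = mittagLeffler a b (-lam) := by simp [mlKer]
  rw [h1] at hzero
  linarith

/-- For z ≥ 1 both ray integrals are O(1/z), since |s^a + z| ≥ cos(aφ/2) z on the rays uniformly in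
s; for z ≤ 1 the power series is bounded by its value at 1. -/
lemma exists_abs_mittagLeffler_le {a b : ℝ} (ha : 0 < a) (ha2 : a < 2) (hb : 0 < b)
    (hba : b < a + 1) : ∃ C, 0 ≤ C ∧ ∀ z, 0 ≤ z → |mittagLeffler a b (-z)| ≤ C / (1 + z) := by
  obtain ⟨φ, h⟩ := exists_rayAngle ha ha2
  have hφ := h.pos
  have hc := h.cos_half_pos
  set I := ∫ x : ℝ, (Real.exp ((a - b + 1) * x) * Real.exp (-(1 * (-Real.cos φ) * Real.exp x)))
    with hI
  have hI0 : 0 ≤ I := integral_nonneg fun x => by positivity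
  set M := I / (Real.pi * Real.cos (a * φ / 2)) with hM
  have hpi := Real.pi_pos
  have hM0 : 0 ≤ M := by positivity
  have hbig : ∀ z, 0 < z → |mittagLeffler a b (-z)| ≤ M / z := by
    intro z hz
    have hr : ∀ θ, |θ| = φ → ‖rayInt a b z θ 1‖ ≤ 1 / (Real.cos (a * φ / 2) * z) * I := by
      intro θ hθ
      rw [hI, ← integral_const_mul]
      exact norm_integral_le_of_norm_le (rayInt_bound_integrable z h hba one_pos)
        (Eventually.of_forall fun x => rayInt_bound h hz hθ le_rfl x)
    rw [mittagLeffler_eq_rayInt h hz hb hba]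
    refine (Complex.abs_re_le_norm _).trans ?_
    rw [norm_div]
    have h2 : ‖(2 * Real.pi * Complex.I : ℂ)‖ = 2 * Real.pi := by
      simp [abs_of_pos hpi]
    rw [h2, div_le_iff₀ (by positivity)]
    have := (norm_sub_le (rayInt a b z φ 1) (rayInt a b z (-φ) 1)).trans
      (add_le_add (hr φ (abs_of_pos hφ)) (hr (-φ) (by rw [abs_neg, abs_of_pos hφ])))
    refine this.trans (le_of_eq ?_)
    rw [hM]
    field_simp
    ring
  set K := mittagLeffler a b 1 with hK
  have hsmall : ∀ z, 0 ≤ z → z ≤ 1 → |mittagLeffler a b (-z)| ≤ K := fun z h0 h1 =>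
    abs_mittagLeffler_le ha hb (by rw [abs_neg, abs_of_nonneg h0]; exact h1)
  have hK0 : 0 ≤ K := (abs_nonneg _).trans (hsmall 0 le_rfl zero_le_one)
  refine ⟨2 * (K + M), by positivity, fun z hz => ?_⟩
  rw [le_div_iff₀ (by linarith)]
  rcases le_total z 1 with h1 | h1
  · have := mul_le_mul (hsmall z hz h1) (show 1 + z ≤ 2 by linarith) (by linarith) hK0
    linarith
  · have h3 := hbig z (by linarith)
    rw [le_div_iff₀ (by linarith)] at h3
    nlinarith [abs_nonneg (mittagLeffler a b (-z))]

/-- Interpolation between boundedness of E (θ = 0) and its decay 1/z (θ = 1): a power λ^{-θ} is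
bought at the price of a time singularity t^{-aθ}. Most series estimates below amount to a choice of
θ. -/
lemma exists_abs_mlKer_le {a b : ℝ} (ha : 0 < a) (ha2 : a < 2) (hb : 0 < b)
    (hba : b < a + 1) : ∃ C, 0 ≤ C ∧ ∀ lam θ t : ℝ, 0 < lam → 0 ≤ θ → θ ≤ 1 → 0 < t →
      |mlKer a lam b t| ≤ C * lam ^ (-θ) * t ^ (b - a * θ - 1) := by
  obtain ⟨C, hC0, hC⟩ := exists_abs_mittagLeffler_le ha ha2 hb hba
  refine ⟨C, hC0, fun lam θ t hl h0 h1 ht => ?_⟩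
  have hta : 0 < t ^ a := Real.rpow_pos_of_pos ht _
  set z := lam * t ^ a with hz
  have hz0 : 0 < z := by positivity
  have h2 : z ^ θ ≤ 1 + z := by
    rcases le_total z 1 with hz1 | hz1
    · exact (Real.rpow_le_one hz0.le hz1 h0).trans (by linarith)
    · calc z ^ θ ≤ z ^ (1 : ℝ) := Real.rpow_le_rpow_of_exponent_le hz1 h1
        _ ≤ 1 + z := by rw [Real.rpow_one]; linarith
  have h3 := hC z hz0.le
  have hzθ : 0 < z ^ θ := Real.rpow_pos_of_pos hz0 _
  have h4 : C / (1 + z) ≤ C / z ^ θ := div_le_div_of_nonneg_left hC0 hzθ h2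
  unfold mlKer
  rw [abs_mul, abs_of_pos (Real.rpow_pos_of_pos ht _), neg_mul, ← hz]
  have e : C * lam ^ (-θ) * t ^ (b - a * θ - 1) = t ^ (b - 1) * (C / z ^ θ) := by
    rw [hz, Real.mul_rpow hl.le hta.le, ← Real.rpow_mul ht.le, Real.rpow_neg hl.le,
      show b - a * θ - 1 = (b - 1) - a * θ by ring, Real.rpow_sub ht]
    field_simp
  rw [e]
  exact mul_le_mul_of_nonneg_left (h3.trans h4) (Real.rpow_nonneg ht.le _)

/-! ### The Mittag-Leffler function as a cosine transform -/

lemma integral_exp_mul_cos {k : ℂ} (hk : 0 < k.re) (ξ : ℝ) :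
    ∫ y in Ioi (0 : ℝ), Complex.exp (-k * y) * (Real.cos (ξ * y) : ℂ) = k / (k ^ 2 + ξ ^ 2) := by
  have h1 : (-k + ξ * Complex.I).re < 0 := by simpa using hk
  have h2 : (-k - ξ * Complex.I).re < 0 := by simpa using hk
  have e : ∀ y : ℝ, Complex.exp (-k * y) * (Real.cos (ξ * y) : ℂ) =
      (1 / 2) * (Complex.exp ((-k + ξ * Complex.I) * y) +
        Complex.exp ((-k - ξ * Complex.I) * y)) := by
    intro y
    rw [Complex.ofReal_cos, Complex.cos, add_mul, sub_mul, Complex.exp_add, sub_eq_add_neg,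
      Complex.exp_add]
    push_cast
    ring_nf
  simp only [e]
  rw [integral_const_mul, integral_add (integrableOn_exp_mul_complex_Ioi h1 0)
    (integrableOn_exp_mul_complex_Ioi h2 0), integral_exp_mul_complex_Ioi h1,
    integral_exp_mul_complex_Ioi h2]
  have n1 : -k + ξ * Complex.I ≠ 0 := fun h => by rw [h] at h1; simp at h1
  have n2 : -k - ξ * Complex.I ≠ 0 := fun h => by rw [h] at h2; simp at h2
  have e3 : k ^ 2 + (ξ : ℂ) ^ 2 = (-k + ξ * Complex.I) * (-k - ξ * Complex.I) := by
    linear_combination (ξ : ℂ) ^ 2 * Complex.I_sq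
  rw [e3]
  simp only [Complex.ofReal_zero, mul_zero, Complex.exp_zero]
  field_simp
  ring

/-- For `0 < b < 1` the function `ξ ↦ E_{a,b}(-ξ²)` is the cosine transform of an integrable
function. -/
lemma exists_cosine_kernel {a b : ℝ} (ha : 0 < a) (ha2 : a < 2) (hb : 0 < b) (hb1 : b < 1) :
    ∃ Φ : ℝ → ℝ, IntegrableOn Φ (Ioi 0) ∧ ∀ ξ : ℝ, 0 < ξ →
      ∫ y in Ioi (0 : ℝ), Φ y * Real.cos (ξ * y) = mittagLeffler a b (-ξ ^ 2) := by
  obtain ⟨φ, h⟩ := exists_rayAngle ha ha2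
  have hφ := h.pos
  have hc := h.cos_half_pos
  set c := Real.cos (a * φ / 2) with hcd
  set μ : Measure ℝ := volume.restrict (Ioi 0) with hμ
  -- With λ = ξ² the denominator of the ray integrand is k² + ξ², where k = e^{aw/2} has positive
  -- real part because aφ < π. Then k / (k² + ξ²) is itself the cosine transform of e^{-ky}, and N
  -- is what remains of the integrand after k is split off.
  let k : ℝ → ℝ → ℂ := fun θ x => Complex.exp ((a / 2 : ℝ) * (x + θ * Complex.I))
  let N : ℝ → ℝ → ℂ := fun θ x => Complex.exp ((1 : ℝ) * Complex.exp (x + θ * Complex.I)) *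
    Complex.exp ((a / 2 - b + 1 : ℝ) * (x + θ * Complex.I))
  let F : ℝ → ℝ → ℝ → ℂ := fun θ y x => Complex.exp (-k θ x * y) * N θ x
  let Θ : ℝ → ℝ → ℂ := fun θ y => ∫ x, F θ y x
  have hkre : ∀ θ, |θ| = φ → ∀ x, (k θ x).re = Real.exp (a / 2 * x) * c := by
    intro θ hθ x
    simp only [k]
    rw [Complex.exp_re, Complex.re_ofReal_mul, Complex.im_ofReal_mul]
    simp only [Complex.add_re, Complex.ofReal_re, Complex.mul_re, Complex.I_re, mul_zero,
      Complex.ofReal_im, Complex.I_im, mul_one, sub_self, add_zero, Complex.add_im,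
      Complex.mul_im, zero_add]
    congr 1
    rw [← Real.cos_abs, abs_mul, hθ, abs_of_pos (by positivity : 0 < a / 2), hcd]
    ring_nf
  have hkpos : ∀ θ, |θ| = φ → ∀ x, 0 < (k θ x).re := fun θ hθ x => by
    rw [hkre θ hθ]; have := Real.exp_pos (a / 2 * x); positivity
  have hNn : ∀ θ, |θ| = φ → ∀ x, ‖N θ x‖ =
      Real.exp ((a / 2 - b + 1) * x) * Real.exp (-((-Real.cos φ) * Real.exp x)) := by
    intro θ hθ x
    simp only [N]
    rw [norm_mul, norm_exp_mul_exp h hθ, Complex.norm_exp, Complex.re_ofReal_mul, mul_comm]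
    simp
  have hFi : ∀ θ, |θ| = φ → ∀ g : ℝ → ℝ, Continuous g → (∀ y, |g y| ≤ 1) →
      Integrable (Function.uncurry fun y x => F θ y x * (g y : ℂ)) (μ.prod volume) := by
    intro θ hθ g hg hg1
    have hm : AEStronglyMeasurable (Function.uncurry fun y x => F θ y x * (g y : ℂ))
        (μ.prod volume) := by
      refine Continuous.aestronglyMeasurable ?_
      simp only [Function.uncurry_def, F, k, N]
      fun_prop
    have hbound : Integrable (Function.uncurry fun y x => F θ y x) (μ.prod volume) := by
      have hm : AEStronglyMeasurable (Function.uncurry fun y x => F θ y x) (μ.prod volume) := by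
        refine Continuous.aestronglyMeasurable ?_
        simp only [Function.uncurry_def, F, k, N]
        fun_prop
      have hneg : ∀ x, (-k θ x).re < 0 := fun x => by
        rw [Complex.neg_re]; linarith [hkpos θ hθ x]
      rw [integrable_prod_iff' hm]
      constructor
      · refine Eventually.of_forall fun x => ?_
        have h1 : Integrable (fun y : ℝ => Complex.exp (-k θ x * y)) μ :=
          integrableOn_exp_mul_complex_Ioi (hneg x) 0
        exact h1.mul_const (N θ x)
      -- Integrating |e^{-ky}| over y costs 1 / Re k, that is e^{-ax/2} / c. What is left behaves
      -- like e^{(1-b)x} at -∞, which is why b < 1 is required.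
      · have hinteg := (integrable_exp_mul_exp_neg_exp (α := 1 - b) (k := -Real.cos φ)
          (by linarith) (by linarith [h.cos_neg])).const_mul (1 / c)
        refine hinteg.congr (Eventually.of_forall fun x => ?_)
        simp only [Function.uncurry, F, norm_mul]
        rw [integral_mul_const, hNn θ hθ]
        have : ∀ y : ℝ, ‖Complex.exp (-k θ x * y)‖ = Real.exp ((-k θ x).re * y) := fun y => by
          rw [Complex.norm_exp, Complex.re_mul_ofReal]
        simp only [this, hμ]
        rw [integral_exp_mul_Ioi (hneg x), mul_zero, Real.exp_zero, Complex.neg_re, hkre θ hθ,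
          neg_div_neg_eq, show (a / 2 - b + 1) * x = a / 2 * x + (1 - b) * x by ring, Real.exp_add]
        have := Real.exp_pos (a / 2 * x)
        field_simp
    refine hbound.norm.mono' hm (Eventually.of_forall fun z => ?_)
    simp only [Function.uncurry]
    rw [norm_mul, Complex.norm_real]
    exact mul_le_of_le_one_right (norm_nonneg _) (hg1 _)
  have hΘi : ∀ θ, |θ| = φ → Integrable (Θ θ) μ := by
    intro θ hθ
    have := (hFi θ hθ (fun _ => 1) continuous_const (by simp)).integral_prod_left
    simpa [Function.uncurry] using this
  have hΘcos : ∀ θ, |θ| = φ → ∀ ξ : ℝ, 0 < ξ →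
      Integrable (fun y => Θ θ y * (Real.cos (ξ * y) : ℂ)) μ ∧
      ∫ y, Θ θ y * (Real.cos (ξ * y) : ℂ) ∂μ = rayInt a b (ξ ^ 2) θ 1 := by
    intro θ hθ ξ hξ
    have hi := hFi θ hθ (fun y => Real.cos (ξ * y)) (by fun_prop) (fun y => Real.abs_cos_le_one _)
    have hin : ∀ y, Θ θ y * (Real.cos (ξ * y) : ℂ) = ∫ x, F θ y x * (Real.cos (ξ * y) : ℂ) :=
      fun y => (integral_mul_const _ _).symm
    simp only [hin]
    refine ⟨hi.integral_prod_left, ?_⟩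
    rw [integral_integral_swap hi]
    unfold rayInt
    refine integral_congr_ae (Eventually.of_forall fun x => ?_)
    simp only [F]
    have e1 : ∀ y : ℝ, Complex.exp (-k θ x * y) * N θ x * (Real.cos (ξ * y) : ℂ) =
        N θ x * (Complex.exp (-k θ x * y) * (Real.cos (ξ * y) : ℂ)) := fun y => by ring
    simp only [e1]
    rw [integral_const_mul, hμ, integral_exp_mul_cos (hkpos θ hθ x)]
    simp only [N, rayNum]
    rw [mul_assoc]
    congr 1
    have e2 : k θ x ^ 2 = Complex.exp (a * (x + θ * Complex.I)) := by
      simp only [k]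
      rw [← Complex.exp_nat_mul]
      congr 1
      push_cast; ring
    rw [e2, mul_div_assoc']
    congr 1
    · simp only [k]
      rw [← Complex.exp_add]
      congr 1
      push_cast; ring
    · push_cast; rfl
  have hθ1 : |φ| = φ := abs_of_pos hφ
  have hθ2 : |-φ| = φ := by rw [abs_neg, hθ1]
  refine ⟨fun y => ((Θ φ y - Θ (-φ) y) / (2 * Real.pi * Complex.I)).re, ?_, fun ξ hξ => ?_⟩
  · exact (((hΘi φ hθ1).sub (hΘi (-φ) hθ2)).div_const _).re
  · obtain ⟨i1, e1⟩ := hΘcos φ hθ1 ξ hξ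
    obtain ⟨i2, e2⟩ := hΘcos (-φ) hθ2 ξ hξ
    rw [mittagLeffler_eq_rayInt h (by positivity : 0 < ξ ^ 2) hb (by linarith), ← e1, ← e2,
      ← integral_sub i1 i2, ← integral_div]
    have := integral_re (μ := μ) ((i1.sub i2).div_const (2 * Real.pi * Complex.I))
    simp only [RCLike.re_eq_complex_re] at this
    refine Eq.trans ?_ this
    refine integral_congr_ae (Eventually.of_forall fun y => ?_)
    simp only [Pi.sub_apply]
    rw [← sub_mul, mul_div_right_comm, Complex.re_mul_ofReal]

/-! ### Sine modes and sine coefficients -/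

lemma continuous_mode (l : ℝ) (n : ℕ) : Continuous (mode l n) := by
  unfold mode; fun_prop

lemma abs_mode_le (l : ℝ) (n : ℕ) (x : ℝ) : |mode l n x| ≤ 1 := Real.abs_sin_le_one _

lemma mode_zero (l : ℝ) (n : ℕ) : mode l n 0 = 0 := by simp [mode]

lemma mode_end {l : ℝ} (hl : 0 < l) (n : ℕ) : mode l n l = 0 := by
  unfold mode
  rw [div_mul_cancel₀ _ hl.ne', Real.sin_nat_mul_pi]

lemma eig_pos {l : ℝ} (hl : 0 < l) (n : ℕ) : 0 < eig l (n + 1) := by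
  unfold eig
  have := Real.pi_pos
  positivity

lemma exists_bound_of_deriv_bound {l M : ℝ} {q q' : ℝ → ℝ}
    (hq : ∀ x ∈ Ioo 0 l, HasDerivAt q (q' x) x) (hM : ∀ x ∈ Ioo 0 l, |q' x| ≤ M) :
    ∃ C, ∀ x ∈ Ioo 0 l, |q x| ≤ C := by
  rcases le_or_gt l 0 with hl | hl
  · exact ⟨0, fun x hx => absurd (hx.1.trans hx.2) (not_lt.2 hl)⟩
  have hmid : l / 2 ∈ Ioo 0 l := ⟨by linarith, by linarith⟩
  refine ⟨|q (l / 2)| + M * l, fun x hx => ?_⟩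
  have h := (convex_Ioo 0 l).norm_image_sub_le_of_norm_hasDerivWithin_le
    (fun y hy => (hq y hy).hasDerivWithinAt) hM hmid hx
  have hM0 : 0 ≤ M := (abs_nonneg _).trans (hM _ hmid)
  have h2 : ‖x - l / 2‖ ≤ l := by
    rw [Real.norm_eq_abs, abs_le]; constructor <;> linarith [hx.1, hx.2]
  have h3 := mul_le_mul_of_nonneg_left h2 hM0
  have h4 := abs_sub_abs_le_abs_sub (q x) (q (l / 2))
  rw [Real.norm_eq_abs] at h
  linarith

lemma intervalIntegrable_of_bdd {l C : ℝ} (hl : 0 ≤ l) {q : ℝ → ℝ} (hc : ContinuousOn q (Ioo 0 l))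
    (hC : ∀ x ∈ Ioo 0 l, |q x| ≤ C) : IntervalIntegrable q volume 0 l := by
  rw [intervalIntegrable_iff_Ioo hl]
  refine Integrable.of_bound (hc.aestronglyMeasurable measurableSet_Ioo) C ?_
  filter_upwards [ae_restrict_mem measurableSet_Ioo] with x hx using hC x hx

lemma intervalIntegrable_mul_mode {l : ℝ} {q : ℝ → ℝ} (n : ℕ)
    (h : IntervalIntegrable q volume 0 l) :
    IntervalIntegrable (fun x => q x * mode l n x) volume 0 l :=
  h.mul_continuousOn (continuous_mode l n).continuousOn

lemma sineCoeff_add {l : ℝ} {q r : ℝ → ℝ} (n : ℕ) (hq : IntervalIntegrable q volume 0 l)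
    (hr : IntervalIntegrable r volume 0 l) :
    sineCoeff l n (fun x => q x + r x) = sineCoeff l n q + sineCoeff l n r := by
  unfold sineCoeff
  simp only [add_mul]
  rw [intervalIntegral.integral_add (intervalIntegrable_mul_mode n hq)
    (intervalIntegrable_mul_mode n hr)]
  ring

lemma sineCoeff_const_mul {l : ℝ} (n : ℕ) (A : ℝ) (q : ℝ → ℝ) :
    sineCoeff l n (fun x => A * q x) = A * sineCoeff l n q := by
  unfold sineCoeff
  simp only [mul_assoc]
  rw [intervalIntegral.integral_const_mul]
  ring

lemma sineCoeff_congr {l : ℝ} (hl : 0 < l) {q r : ℝ → ℝ} (n : ℕ) (h : ∀ x ∈ Ioo 0 l, q x = r x) :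
    sineCoeff l n q = sineCoeff l n r := by
  unfold sineCoeff
  rw [integral_eq_Ioo hl.le, integral_eq_Ioo hl.le,
    setIntegral_congr_fun measurableSet_Ioo fun x hx => by rw [h x hx]]

lemma abs_sineCoeff_le {l C : ℝ} (hl : 0 < l) {q : ℝ → ℝ} (n : ℕ)
    (hC : ∀ x ∈ Ioo 0 l, |q x| ≤ C) : |sineCoeff l n q| ≤ 2 * C := by
  unfold sineCoeff
  have h : ‖∫ x in (0 : ℝ)..l, q x * mode l n x‖ ≤ C * |l - 0| := by
    rw [integral_eq_Ioo hl.le]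
    refine (norm_setIntegral_le_of_norm_le_const (C := C) (by simp) fun x hx => ?_).trans ?_
    · rw [norm_mul]
      exact (mul_le_of_le_one_right (norm_nonneg _) (abs_mode_le l n x)).trans (hC x hx)
    · simp [abs_of_pos hl, hl.le]
  rw [abs_mul, abs_of_pos (by positivity : 0 < 2 / l)]
  rw [sub_zero, abs_of_pos hl, Real.norm_eq_abs] at h
  calc _ ≤ 2 / l * (C * l) := mul_le_mul_of_nonneg_left h (by positivity)
    _ = 2 * C := by field_simp

/-- Two integrations by parts. At the end points q' times the mode vanishes because q' is bounded
(its derivative is), and q times the cosine vanishes because q does; q' need not extend continuously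
to the boundary. -/
lemma sineCoeff_second_deriv {l M : ℝ} (hl : 0 < l) (n : ℕ) {q q' r : ℝ → ℝ}
    (hq : ∀ x ∈ Ioo 0 l, HasDerivAt q (q' x) x) (hq' : ∀ x ∈ Ioo 0 l, HasDerivAt q' (r x) x)
    (h0 : Tendsto q (𝓝[>] 0) (𝓝 0)) (h1 : Tendsto q (𝓝[<] l) (𝓝 0))
    (hr : ContinuousOn r (Ioo 0 l)) (hM : ∀ x ∈ Ioo 0 l, |r x| ≤ M) :
    sineCoeff l n r = -eig l n * sineCoeff l n q := by
  obtain ⟨C', hC'⟩ := exists_bound_of_deriv_bound hq' hM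
  obtain ⟨C, hC⟩ := exists_bound_of_deriv_bound hq hC'
  have hqc : ContinuousOn q (Ioo 0 l) := fun x hx => (hq x hx).continuousAt.continuousWithinAt
  have iq := intervalIntegrable_mul_mode n (intervalIntegrable_of_bdd hl.le hqc hC)
  have ir := intervalIntegrable_mul_mode n (intervalIntegrable_of_bdd hl.le hr hM)
  set k := n * Real.pi / l with hk
  have hmd : ∀ x, HasDerivAt (mode l n) (k * Real.cos (k * x)) x := by
    intro x
    have := (Real.hasDerivAt_sin (k * x)).comp x ((hasDerivAt_id x).const_mul k)
    refine (this.congr_deriv ?_).congr_of_eventuallyEq (Eventually.of_forall fun y => rfl)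
    simp [mul_comm]
  have hcd : ∀ x, HasDerivAt (fun x => k * Real.cos (k * x)) (-(k ^ 2) * mode l n x) x := by
    intro x
    have := ((Real.hasDerivAt_cos (k * x)).comp x ((hasDerivAt_id x).const_mul k)).const_mul k
    refine (this.congr_deriv ?_).congr_of_eventuallyEq (Eventually.of_forall fun y => by simp)
    simp only [mode, ← hk]; ring
  have hlim : ∀ {F : Filter ℝ} {x₀ : ℝ}, F ≤ 𝓝 x₀ → F ≤ 𝓟 (Ioo 0 l) → mode l n x₀ = 0 →
      Tendsto q F (𝓝 0) →
      Tendsto (fun x => q' x * mode l n x - q x * (k * Real.cos (k * x))) F (𝓝 0) := by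
    intro F x₀ hF hF2 hm hq0
    have a1 : Tendsto (fun x => q' x * mode l n x) F (𝓝 0) := by
      have : Tendsto (mode l n) F (𝓝 0) := by
        rw [← hm]; exact ((continuous_mode l n).tendsto x₀).mono_left hF
      refine isBoundedUnder_le_mul_tendsto_zero ⟨C', ?_⟩ this
      have : ∀ᶠ x in F, x ∈ Ioo 0 l := le_principal_iff.1 hF2
      simp only [eventually_map]
      filter_upwards [this] with x hx using hC' x hx
    have a2 : Tendsto (fun x => q x * (k * Real.cos (k * x))) F (𝓝 (0 * (k * Real.cos (k * x₀)))) :=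
      hq0.mul (((by fun_prop : Continuous fun x => k * Real.cos (k * x)).tendsto x₀).mono_left hF)
    simpa using a1.sub a2
  have hev0 : 𝓝[>] (0 : ℝ) ≤ 𝓟 (Ioo 0 l) := le_principal_iff.2 (Ioo_mem_nhdsGT hl)
  have hev1 : 𝓝[<] l ≤ 𝓟 (Ioo 0 l) := le_principal_iff.2 (Ioo_mem_nhdsLT hl)
  have hinteg : IntervalIntegrable (fun x => r x * mode l n x + k ^ 2 * (q x * mode l n x))
      volume 0 l := ir.add (iq.const_mul _)
  have key := intervalIntegral.integral_eq_sub_of_hasDerivAt_of_tendsto hl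
    (f := fun x => q' x * mode l n x - q x * (k * Real.cos (k * x)))
    (f' := fun x => r x * mode l n x + k ^ 2 * (q x * mode l n x))
    (fun x hx => by
      have := ((hq' x hx).mul (hmd x)).sub ((hq x hx).mul (hcd x))
      refine this.congr_deriv ?_
      ring) hinteg
    (hlim nhdsWithin_le_nhds hev0 (mode_zero l n) h0)
    (hlim nhdsWithin_le_nhds hev1 (mode_end hl n) h1)
  rw [intervalIntegral.integral_add ir (iq.const_mul _), intervalIntegral.integral_const_mul] at key
  unfold sineCoeff eig
  rw [← hk]
  linear_combination (2 / l) * key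

lemma integral_cos_int {l : ℝ} (hl : 0 < l) {j : ℤ} (hj : j ≠ 0) :
    ∫ x in (0 : ℝ)..l, Real.cos (j * Real.pi / l * x) = 0 := by
  have hk : (j : ℝ) * Real.pi / l ≠ 0 := by
    have : (j : ℝ) ≠ 0 := by exact_mod_cast hj
    have := Real.pi_ne_zero
    positivity
  rw [intervalIntegral.integral_comp_mul_left (fun x => Real.cos x) hk, integral_cos,
    div_mul_cancel₀ _ hl.ne', Real.sin_int_mul_pi]
  simp

lemma sineCoeff_mode {l : ℝ} (hl : 0 < l) (m n : ℕ) :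
    sineCoeff l (n + 1) (mode l (m + 1)) = if m = n then 1 else 0 := by
  unfold sineCoeff
  have h : ∀ x, mode l (m + 1) x * mode l (n + 1) x =
      (1 / 2) * Real.cos (((m : ℤ) - n : ℤ) * Real.pi / l * x) -
      (1 / 2) * Real.cos (((m : ℤ) + n + 2 : ℤ) * Real.pi / l * x) := by
    intro x
    unfold mode
    have h1 := Real.cos_sub (((m + 1 : ℕ) : ℝ) * Real.pi / l * x) (((n + 1 : ℕ) : ℝ) * Real.pi / l * x)
    have h2 := Real.cos_add (((m + 1 : ℕ) : ℝ) * Real.pi / l * x) (((n + 1 : ℕ) : ℝ) * Real.pi / l * x)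
    have e1 : (((m : ℤ) - n : ℤ) : ℝ) * Real.pi / l * x =
      ((m + 1 : ℕ) : ℝ) * Real.pi / l * x - ((n + 1 : ℕ) : ℝ) * Real.pi / l * x := by
      push_cast; ring
    have e2 : (((m : ℤ) + n + 2 : ℤ) : ℝ) * Real.pi / l * x =
      ((m + 1 : ℕ) : ℝ) * Real.pi / l * x + ((n + 1 : ℕ) : ℝ) * Real.pi / l * x := by
      push_cast; ring
    rw [e1, e2, h1, h2]; ring
  simp only [h]
  rw [intervalIntegral.integral_sub (Continuous.intervalIntegrable (by fun_prop) _ _)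
    (Continuous.intervalIntegrable (by fun_prop) _ _), intervalIntegral.integral_const_mul,
    intervalIntegral.integral_const_mul, integral_cos_int hl (j := (m : ℤ) + n + 2) (by positivity)]
  split_ifs with hmn
  · subst hmn
    simp
    field_simp
  · rw [integral_cos_int hl (by omega)]
    simp

lemma summable_mul_mode {l : ℝ} {c : ℕ → ℝ} (hc : Summable fun n => |c n|) (x : ℝ) :
    Summable fun n => c n * mode l (n + 1) x := by
  refine Summable.of_norm_bounded hc fun n => ?_
  rw [norm_mul]
  exact mul_le_of_le_one_right (abs_nonneg _) (abs_mode_le _ _ _)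

lemma continuous_tsum_mode {l : ℝ} {c : ℕ → ℝ} (hc : Summable fun n => |c n|) :
    Continuous fun x => ∑' n, c n * mode l (n + 1) x := by
  refine continuous_tsum (fun n => continuous_const.mul (continuous_mode l (n + 1))) hc
    fun n x => ?_
  rw [norm_mul]
  exact mul_le_of_le_one_right (abs_nonneg _) (abs_mode_le _ _ _)

lemma sineCoeff_tsum {l : ℝ} (hl : 0 < l) {c : ℕ → ℝ} (hc : Summable fun n => |c n|) (m : ℕ) :
    sineCoeff l (m + 1) (fun x => ∑' n, c n * mode l (n + 1) x) = c m := by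
  set F : ℕ → ℝ → ℝ := fun n x => c n * (mode l (n + 1) x * mode l (m + 1) x) with hF
  have hFi : ∀ n, Integrable (F n) (volume.restrict (Ioo 0 l)) := fun n => by
    have : Continuous (F n) :=
      continuous_const.mul ((continuous_mode _ _).mul (continuous_mode _ _))
    exact (intervalIntegrable_iff_Ioo hl.le).1 (this.intervalIntegrable 0 l)
  have hsum : Summable fun n => ∫ x in Ioo 0 l, ‖F n x‖ := by
    refine Summable.of_nonneg_of_le (fun n => integral_nonneg fun _ => norm_nonneg _) (fun n => ?_)
      (hc.mul_right l)
    have h1 : ∫ x in Ioo 0 l, ‖F n x‖ ≤ ∫ _x in Ioo 0 l, |c n| := by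
      refine integral_mono (hFi n).norm (by simp) fun x => ?_
      simp only [hF]
      rw [norm_mul, norm_mul]
      refine mul_le_of_le_one_right (abs_nonneg _) ?_
      exact mul_le_one₀ (abs_mode_le _ _ _) (abs_nonneg _) (abs_mode_le _ _ _)
    refine h1.trans (le_of_eq ?_)
    rw [setIntegral_const]
    simp [hl.le, mul_comm]
  have hS := hasSum_integral_of_summable_integral_norm hFi hsum
  have e1 : ∀ n, ∫ x in Ioo 0 l, F n x = c n * (l / 2 * (if n = m then 1 else 0)) := by
    intro n
    simp only [hF]
    rw [integral_const_mul, ← integral_eq_Ioo hl.le, ← sineCoeff_mode hl n m]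
    unfold sineCoeff
    field_simp
  simp only [e1] at hS
  have hS2 : HasSum (fun n => c n * (l / 2 * (if n = m then 1 else 0))) (c m * (l / 2)) := by
    have := hasSum_single (f := fun n => c n * (l / 2 * (if n = m then 1 else 0))) m
      (fun n hn => by simp [hn])
    simpa using this
  have hv := hS.unique hS2
  unfold sineCoeff
  rw [integral_eq_Ioo hl.le]
  have e2 : ∀ x, (∑' n, c n * mode l (n + 1) x) * mode l (m + 1) x = ∑' n, F n x := by
    intro x
    rw [← tsum_mul_right]
    exact tsum_congr fun n => by simp only [hF]; ring
  simp only [e2]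
  rw [hv]
  field_simp

/-! ### Odd periodic extension and completeness of the sines -/

/-- The odd `2l`-periodic extension of a function on `[0, l]`. -/
noncomputable def oddExt (l : ℝ) (q : ℝ → ℝ) (x : ℝ) : ℝ :=
  (SignType.sign (Real.sin (Real.pi / l * x)) : ℝ) *
    q (l / Real.pi * Real.arccos (Real.cos (Real.pi / l * x)))

lemma fold_mem {l : ℝ} (hl : 0 < l) (x : ℝ) :
    l / Real.pi * Real.arccos (Real.cos (Real.pi / l * x)) ∈ Icc 0 l := by
  have hpi := Real.pi_pos
  constructor
  · exact mul_nonneg (by positivity) (Real.arccos_nonneg _)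
  · calc _ ≤ l / Real.pi * Real.pi := mul_le_mul_of_nonneg_left (Real.arccos_le_pi _) (by positivity)
      _ = l := by field_simp

lemma abs_sign_le (y : ℝ) : |((SignType.sign y : SignType) : ℝ)| ≤ 1 := by
  rcases lt_trichotomy y 0 with h | h | h
  · simp [sign_neg h]
  · simp [h]
  · simp [sign_pos h]

lemma abs_oddExt_le {l C : ℝ} (hl : 0 < l) {q : ℝ → ℝ} (hC : ∀ x ∈ Icc 0 l, |q x| ≤ C) (x : ℝ) :
    |oddExt l q x| ≤ C := by
  unfold oddExt
  rw [abs_mul]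
  exact (mul_le_of_le_one_left (abs_nonneg _) (abs_sign_le _)).trans (hC _ (fold_mem hl x))

lemma oddExt_eq {l : ℝ} (hl : 0 < l) {q : ℝ → ℝ} (h0 : q 0 = 0) (h1 : q l = 0) {x : ℝ}
    (hx : x ∈ Icc 0 l) : oddExt l q x = q x := by
  have hpi := Real.pi_pos
  unfold oddExt
  have e1 : Real.pi / l * x ∈ Icc 0 Real.pi := by
    constructor
    · exact mul_nonneg (by positivity) hx.1
    · calc _ ≤ Real.pi / l * l := mul_le_mul_of_nonneg_left hx.2 (by positivity)
        _ = Real.pi := by field_simp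
  rw [Real.arccos_cos e1.1 e1.2]
  have e2 : l / Real.pi * (Real.pi / l * x) = x := by field_simp
  rw [e2]
  rcases hx.1.eq_or_lt with rfl | hx0
  · simp [h0]
  rcases hx.2.eq_or_lt with rfl | hxl
  · rw [h1, mul_zero]
  have : 0 < Real.sin (Real.pi / l * x) := by
    refine Real.sin_pos_of_pos_of_lt_pi (by positivity) ?_
    calc _ < Real.pi / l * l := mul_lt_mul_of_pos_left hxl (by positivity)
      _ = Real.pi := by field_simp
  rw [sign_pos this]; simp

lemma oddExt_neg (l : ℝ) (q : ℝ → ℝ) (x : ℝ) : oddExt l q (-x) = -oddExt l q x := by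
  unfold oddExt
  rw [mul_neg, Real.sin_neg, Real.cos_neg, Left.sign_neg]
  push_cast
  ring

lemma oddExt_periodic {l : ℝ} (hl : 0 < l) (q : ℝ → ℝ) :
    Function.Periodic (oddExt l q) (2 * l) := by
  intro x
  unfold oddExt
  have : Real.pi / l * (x + 2 * l) = Real.pi / l * x + 2 * Real.pi := by field_simp
  rw [this, Real.sin_add_two_pi, Real.cos_add_two_pi]

/-- The sign factor jumps only where sin(πx/l) = 0, that is where the folded point is 0 or l, and
there q vanishes. -/
lemma continuousOn_oddExt {l : ℝ} (hl : 0 < l) {q : ℝ → ℝ → ℝ} {S : Set ℝ}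
    (hq : ContinuousOn (fun p : ℝ × ℝ => q p.1 p.2) (Icc 0 l ×ˢ S))
    (h0 : ∀ s ∈ S, q 0 s = 0) (h1 : ∀ s ∈ S, q l s = 0) :
    ContinuousOn (fun p : ℝ × ℝ => oddExt l (fun x => q x p.2) p.1) (univ ×ˢ S) := by
  have hpi := Real.pi_pos
  have hfold : ContinuousOn (fun p : ℝ × ℝ =>
      q (l / Real.pi * Real.arccos (Real.cos (Real.pi / l * p.1))) p.2) (univ ×ˢ S) := by
    refine hq.comp (f := fun p : ℝ × ℝ =>
      ((l / Real.pi * Real.arccos (Real.cos (Real.pi / l * p.1)), p.2) : ℝ × ℝ)) ?_ ?_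
    · refine Continuous.continuousOn ?_
      have := Real.continuous_arccos
      fun_prop
    · rintro ⟨x, s⟩ ⟨_, hs⟩
      exact ⟨fold_mem hl x, hs⟩
  rintro ⟨x₀, s₀⟩ hp
  have hs₀ : s₀ ∈ S := hp.2
  by_cases hsin : Real.sin (Real.pi / l * x₀) = 0
  · have hval : q (l / Real.pi * Real.arccos (Real.cos (Real.pi / l * x₀))) s₀ = 0 := by
      have hcos : Real.cos (Real.pi / l * x₀) = 1 ∨ Real.cos (Real.pi / l * x₀) = -1 := by
        have := Real.sin_sq_add_cos_sq (Real.pi / l * x₀)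
        rw [hsin] at this
        exact mul_self_eq_one_iff.1 (by linarith)
      rcases hcos with h | h
      · rw [h, Real.arccos_one, mul_zero, h0 _ hs₀]
      · rw [h, Real.arccos_neg_one, div_mul_cancel₀ _ hpi.ne', h1 _ hs₀]
    have hf := hfold (x₀, s₀) hp
    unfold ContinuousWithinAt at hf ⊢
    simp only [hval] at hf
    have e : oddExt l (fun x => q x s₀) x₀ = 0 := by
      unfold oddExt; simp only [hval, mul_zero]
    simp only [e]
    refine squeeze_zero_norm (fun p => ?_) (tendsto_zero_iff_norm_tendsto_zero.1 hf)
    unfold oddExt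
    rw [norm_mul]
    exact mul_le_of_le_one_left (norm_nonneg _) (abs_sign_le _)
  · refine ContinuousWithinAt.mul ?_ (hfold (x₀, s₀) hp)
    refine ContinuousAt.continuousWithinAt ?_
    have h2 : ContinuousAt (fun p : ℝ × ℝ => Real.sin (Real.pi / l * p.1)) (x₀, s₀) := by fun_prop
    have h3 : ContinuousAt SignType.sign (Real.sin (Real.pi / l * x₀)) :=
      continuousAt_sign_of_ne_zero hsin
    have h4 : Continuous (fun s : SignType => (s : ℝ)) := continuous_of_discreteTopology
    exact h4.continuousAt.comp (ContinuousAt.comp (f := fun p : ℝ × ℝ =>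
      Real.sin (Real.pi / l * p.1)) (x := (x₀, s₀)) h3 h2)

lemma continuous_oddExt {l : ℝ} (hl : 0 < l) {q : ℝ → ℝ} (hq : ContinuousOn q (Icc 0 l))
    (h0 : q 0 = 0) (h1 : q l = 0) : Continuous (oddExt l q) := by
  have h := continuousOn_oddExt hl (q := fun x _ => q x) (S := univ)
    (hq.comp continuous_fst.continuousOn fun p hp => hp.1) (fun _ _ => h0) (fun _ _ => h1)
  have h2 : ContinuousOn (fun x : ℝ => oddExt l q x) univ :=
    h.comp (f := fun x : ℝ => ((x, 0) : ℝ × ℝ)) (by fun_prop) (fun x _ => by simp)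
  exact continuousOn_univ.1 h2

lemma integral_symm {l : ℝ} {E : Type*} [NormedAddCommGroup E] [NormedSpace ℝ E] {h : ℝ → E}
    (hh : Continuous h) : ∫ x in (-l)..l, h x = ∫ x in (0 : ℝ)..l, (h x + h (-x)) := by
  have hn : Continuous fun x => h (-x) := hh.comp continuous_neg
  rw [← intervalIntegral.integral_add_adjacent_intervals (b := 0) (hh.intervalIntegrable _ _)
    (hh.intervalIntegrable _ _), intervalIntegral.integral_add (hh.intervalIntegrable _ _)
    (hn.intervalIntegrable _ _), add_comm]
  congr 1
  rw [intervalIntegral.integral_comp_neg]; simp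

/-- All Fourier coefficients of the continuous odd extension vanish: the sine part by hypothesis,
the cosine part by oddness. A zero sequence is summable, so the Fourier series converges pointwise
to the extension, which is therefore 0. -/
lemma eqOn_zero_of_sineCoeff_eq_zero {l : ℝ} (hl : 0 < l) {q : ℝ → ℝ}
    (hq : ContinuousOn q (Icc 0 l)) (h0 : q 0 = 0) (h1 : q l = 0)
    (hn : ∀ n, sineCoeff l (n + 1) q = 0) : ∀ x ∈ Icc 0 l, q x = 0 := by
  have hQc := continuous_oddExt hl hq h0 h1
  have hQp := oddExt_periodic hl q
  set Q := oddExt l q with hQ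
  have : Fact (0 < 2 * l) := ⟨by linarith⟩
  have hgp : Function.Periodic (fun x => (Q x : ℂ)) (2 * l) := fun x => by simp only [hQp x]
  let g : C(AddCircle (2 * l), ℂ) := ⟨hgp.lift, continuous_coinduced_dom.2
    (Complex.continuous_ofReal.comp hQc)⟩
  have hmodes : ∀ j : ℤ, ∫ x in (0 : ℝ)..l, Q x * Real.sin (j * Real.pi / l * x) = 0 := by
    have hnat : ∀ n : ℕ, ∫ x in (0 : ℝ)..l, Q x * Real.sin (n * Real.pi / l * x) = 0 := by
      intro n
      rcases n with _ | n
      · simp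
      · have h2 := hn n
        unfold sineCoeff mode at h2
        have h3 : (2 / l) ≠ 0 := by positivity
        refine Eq.trans (intervalIntegral.integral_congr fun x hx => ?_)
          ((mul_eq_zero.1 h2).resolve_left h3)
        rw [uIcc_of_le hl.le] at hx
        rw [hQ, oddExt_eq hl h0 h1 hx]
    intro j
    rcases Int.eq_nat_or_neg j with ⟨n, rfl | rfl⟩
    · exact_mod_cast hnat n
    · have := hnat n
      have e : ∀ x, Q x * Real.sin (((-(n : ℤ) : ℤ) : ℝ) * Real.pi / l * x) =
          -(Q x * Real.sin (n * Real.pi / l * x)) := by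
        intro x
        rw [show (((-(n : ℤ) : ℤ) : ℝ) * Real.pi / l * x) = -(n * Real.pi / l * x) by
          push_cast; ring, Real.sin_neg]
        ring
      simp only [e]
      rw [intervalIntegral.integral_neg, this, neg_zero]
  have hcoef : ∀ j : ℤ, fourierCoeff g j = 0 := by
    intro j
    rw [fourierCoeff_eq_intervalIntegral g j (-l), show -l + 2 * l = l by ring]
    have hcont : Continuous fun x : ℝ => fourier (-j) (x : AddCircle (2 * l)) • g x :=
      ((map_continuous (fourier (-j))).comp (AddCircle.continuous_mk' _)).smul
        (g.continuous.comp (AddCircle.continuous_mk' _))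
    rw [integral_symm hcont]
    have e : ∀ x : ℝ, fourier (-j) (x : AddCircle (2 * l)) • g x +
        fourier (-j) ((-x : ℝ) : AddCircle (2 * l)) • g ((-x : ℝ) : AddCircle (2 * l)) =
        (-2 * Complex.I) * ((Q x * Real.sin (j * Real.pi / l * x) : ℝ) : ℂ) := by
      intro x
      have g1 : ∀ y : ℝ, g (y : AddCircle (2 * l)) = (Q y : ℂ) := fun y => rfl
      rw [g1, g1, fourier_coe_apply, fourier_coe_apply, hQ, oddExt_neg]
      have a1 : 2 * (Real.pi : ℂ) * Complex.I * ((-j : ℤ) : ℂ) * (x : ℂ) / ((2 * l : ℝ) : ℂ) =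
          -(((j * Real.pi / l * x : ℝ) : ℂ) * Complex.I) := by
        have : (l : ℂ) ≠ 0 := by exact_mod_cast hl.ne'
        push_cast; field_simp
      have a2 : 2 * (Real.pi : ℂ) * Complex.I * ((-j : ℤ) : ℂ) * ((-x : ℝ) : ℂ) /
          ((2 * l : ℝ) : ℂ) = ((j * Real.pi / l * x : ℝ) : ℂ) * Complex.I := by
        have : (l : ℂ) ≠ 0 := by exact_mod_cast hl.ne'
        push_cast; field_simp
      rw [a1, a2, smul_eq_mul, smul_eq_mul, Complex.ofReal_mul (oddExt l q x), Complex.ofReal_sin,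
        Complex.sin, Complex.ofReal_neg]
      generalize ((j * Real.pi / l * x : ℝ) : ℂ) = θ
      rw [neg_mul θ]
      linear_combination ((oddExt l q x : ℂ) * (Complex.exp (-(θ * Complex.I)) -
        Complex.exp (θ * Complex.I))) * Complex.I_sq
    simp only [e]
    rw [intervalIntegral.integral_const_mul, intervalIntegral.integral_ofReal, hmodes j]
    simp
  intro x hx
  have hsum := has_pointwise_sum_fourier_series_of_summable (f := g)
    (by simp only [funext hcoef]; exact summable_zero) (x : AddCircle (2 * l))
  simp only [hcoef, zero_smul] at hsum
  have h2 := hsum.unique hasSum_zero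
  have h3 : (Q x : ℂ) = 0 := h2
  rw [← oddExt_eq hl h0 h1 hx]
  exact_mod_cast h3

/-- By oddness and periodicity, averaging the translates by ±c multiplies the n-th coefficient by
cos(nπc/l). Cosine multipliers are thus realised by an operation that does not increase the sup
norm. -/
lemma integral_oddExt_shift {l : ℝ} (hl : 0 < l) {q : ℝ → ℝ} (hq : ContinuousOn q (Icc 0 l))
    (h0 : q 0 = 0) (h1 : q l = 0) (n : ℕ) (c : ℝ) :
    sineCoeff l n (fun x => (oddExt l q (x - c) + oddExt l q (x + c)) / 2) =
      Real.cos (n * Real.pi / l * c) * sineCoeff l n q := by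
  have hQc := continuous_oddExt hl hq h0 h1
  have hQp := oddExt_periodic hl q
  have hQn := oddExt_neg l q
  have hqe : sineCoeff l n q = sineCoeff l n (oddExt l q) :=
    sineCoeff_congr hl n fun x hx => (oddExt_eq hl h0 h1 (Ioo_subset_Icc_self hx)).symm
  rw [hqe]
  set Q := oddExt l q with hQ
  set k := n * Real.pi / l with hk
  have hm := continuous_mode l n
  have hper : Function.Periodic (mode l n) (2 * l) := by
    intro x
    unfold mode
    rw [show (n : ℝ) * Real.pi / l * (x + 2 * l) = n * Real.pi / l * x + n * (2 * Real.pi) by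
      field_simp, Real.sin_add_nat_mul_two_pi]
  have e1 : ∫ x in (0 : ℝ)..l, (Q (x - c) + Q (x + c)) / 2 * mode l n x =
      (1 / 2) * ∫ x in (-l)..l, Q (x + c) * mode l n x := by
    rw [integral_symm (by fun_prop), ← intervalIntegral.integral_const_mul]
    refine intervalIntegral.integral_congr fun x _ => ?_
    have m1 : mode l n (-x) = -mode l n x := by
      unfold mode; rw [mul_neg, Real.sin_neg]
    simp only [m1]
    rw [show -x + c = -(x - c) by ring, hQn]
    ring
  have e2 : ∫ x in (-l)..l, Q (x + c) * mode l n x = ∫ x in (-l)..l, Q x * mode l n (x - c) := by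
    have h2 : Function.Periodic (fun x => Q x * mode l n (x - c)) (2 * l) := fun x => by
      simp only [hQp x]
      rw [show x + 2 * l - c = (x - c) + 2 * l by ring, hper]
    have h3 := intervalIntegral.integral_comp_add_right (fun x => Q x * mode l n (x - c)) c
      (a := -l) (b := l)
    simp only [add_sub_cancel_right] at h3
    rw [h3, show l + c = (-l + c) + 2 * l by ring,
      h2.intervalIntegral_add_eq (-l + c) (-l), show -l + 2 * l = l by ring]
  have e3 : ∫ x in (-l)..l, Q x * mode l n (x - c) =
      2 * Real.cos (k * c) * ∫ x in (0 : ℝ)..l, Q x * mode l n x := by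
    rw [integral_symm (by fun_prop), ← intervalIntegral.integral_const_mul]
    refine intervalIntegral.integral_congr fun x _ => ?_
    simp only [hQn, mode, ← hk]
    rw [show k * (x - c) = k * x - k * c by ring, show k * (-x - c) = -(k * x + k * c) by ring,
      Real.sin_neg, Real.sin_sub, Real.sin_add]
    ring
  unfold sineCoeff
  rw [e1, e2, e3]
  ring

/-! ### Fractional integrals of sums, multiples and convolutions -/

lemma leftInt_congr {κ t : ℝ} (hκ : 0 ≤ κ) (ht : 0 < t) {g g' : ℝ → ℝ}
    (h : ∀ s ∈ Ioc 0 t, g s = g' s) : leftInt κ g t = leftInt κ g' t := by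
  rcases hκ.eq_or_lt with rfl | hκ
  · rw [leftInt_zero, leftInt_zero, h t ⟨ht, le_rfl⟩]
  · rw [leftInt_eq_conv hκ, leftInt_eq_conv hκ]
    exact conv_congr ht (fun _ _ => rfl) fun s hs => h s (Ioo_subset_Ioc_self hs)

lemma leftInt_add {κ t c : ℝ} (hκ : 0 ≤ κ) (ht : 0 < t) (hc : 0 < c) {g g' : ℝ → ℝ}
    (hg : PowBdd t c g) (hg' : PowBdd t c g') :
    leftInt κ (fun s => g s + g' s) t = leftInt κ g t + leftInt κ g' t := by
  rcases hκ.eq_or_lt with rfl | hκ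
  · simp only [leftInt_zero]
  · rw [leftInt_eq_conv hκ, leftInt_eq_conv hκ, leftInt_eq_conv hκ]
    exact conv_add ((powBdd_powKer t κ).intervalIntegrable_conv hκ hc ht hg)
      ((powBdd_powKer t κ).intervalIntegrable_conv hκ hc ht hg')

lemma leftInt_const_mul (κ A t : ℝ) (g : ℝ → ℝ) :
    leftInt κ (fun s => A * g s) t = A * leftInt κ g t := by
  unfold leftInt
  split_ifs
  · rfl
  · have : ∀ z, (t - z) ^ (κ - 1) * (A * g z) = A * ((t - z) ^ (κ - 1) * g z) := fun z => by ring
    simp only [this]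
    rw [intervalIntegral.integral_const_mul]; ring

lemma leftInt_conv_mlKer {δ lam κ b c t : ℝ} (hδ : 0 < δ) (hκ : 0 ≤ κ) (hb : 0 < b) (hc : 0 < c)
    (ht : 0 < t) {q : ℝ → ℝ} (hq : PowBdd t c q) :
    leftInt κ (conv (mlKer δ lam b) q) t = conv (mlKer δ lam (κ + b)) q t := by
  rcases hκ.eq_or_lt with rfl | hκ
  · rw [leftInt_zero, zero_add]
  · rw [leftInt_eq_conv hκ, (powBdd_powKer t κ).conv_assoc hκ hb hc ht (powBdd_mlKer t lam hδ hb) hq]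
    exact conv_congr ht (fun s hs => conv_powKer_mlKer lam hδ hb hκ hs.1) fun _ _ => rfl

lemma leftInt_one (g : ℝ → ℝ) (t : ℝ) : leftInt 1 g t = ∫ s in (0 : ℝ)..t, g s := by
  rw [leftInt_eq_conv one_pos, powKer_one, conv_const_one]

/-- Integration by parts in time, phrased as associativity: g = g(0) + 1 * g', and convolution with
the constant 1 raises the second parameter of the kernel by one. -/
lemma conv_mlKer_primitive {δ lam b t : ℝ} (hδ : 0 < δ) (hb : 0 < b) (ht : 0 < t) {g g' : ℝ → ℝ}
    (hg' : ContinuousOn g' (Icc 0 t))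
    (hg : ∀ s ∈ Icc 0 t, g s = g 0 + ∫ r in (0 : ℝ)..s, g' r) :
    conv (mlKer δ lam b) g t = g 0 * mlKer δ lam (b + 1) t + conv (mlKer δ lam (b + 1)) g' t := by
  have hk := powBdd_mlKer t lam hδ hb
  have hone : PowBdd t 1 (fun _ => (1 : ℝ)) := powBdd_of_continuousOn continuousOn_const
  have hg1 := powBdd_of_continuousOn hg'
  have e1 : conv (mlKer δ lam b) g t =
      conv (mlKer δ lam b) (fun s => g 0 * 1 + conv (fun _ => 1) g' s) t := by
    refine conv_congr ht (fun _ _ => rfl) fun s hs => ?_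
    rw [conv_const_one, mul_one, hg s (Ioo_subset_Icc_self hs)]
  have e2 : ∀ s, 0 < s → conv (mlKer δ lam b) (fun _ => 1) s = mlKer δ lam (b + 1) s := by
    intro s hs
    rw [conv_comm, conv_const_one, integral_mlKer lam hδ hb hs]
  rw [e1, conv_add (hk.intervalIntegrable_conv hb one_pos ht (hone.const_mul (g 0)))
    (hk.intervalIntegrable_conv hb (by norm_num : (0 : ℝ) < 1 + 1) ht
      (hone.conv one_pos one_pos hg1)), conv_const_mul, e2 t ht,
    hk.conv_assoc hb one_pos one_pos ht hone hg1]
  congr 1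
  exact conv_congr ht (fun s hs => e2 s hs.1) fun _ _ => rfl

/-! ### Functions of (x, t) with a power singularity at t = 0 -/

/-- `W` is continuous on `[0, l] × (0, T]` and `O(t^(c-1))` there. -/
def XPowBdd (l T c : ℝ) (W : ℝ → ℝ → ℝ) : Prop :=
  ContinuousOn (fun p : ℝ × ℝ => W p.1 p.2) (Icc 0 l ×ˢ Ioc 0 T) ∧
    ∃ C, ∀ x ∈ Icc 0 l, ∀ t ∈ Ioc 0 T, |W x t| ≤ C * t ^ (c - 1)

lemma XPowBdd.powBdd {l T c : ℝ} {W : ℝ → ℝ → ℝ} (h : XPowBdd l T c W) {x : ℝ} (hx : x ∈ Icc 0 l) :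
    PowBdd T c (W x) :=
  ⟨h.1.comp (f := fun t : ℝ => ((x, t) : ℝ × ℝ)) (by fun_prop) fun _ ht => ⟨hx, ht⟩,
    h.2.imp fun _ hC t ht => hC x hx t ht⟩

lemma XPowBdd.continuousOn_left {l T c : ℝ} {W : ℝ → ℝ → ℝ} (h : XPowBdd l T c W) {t : ℝ}
    (ht : t ∈ Ioc 0 T) : ContinuousOn (fun x => W x t) (Icc 0 l) :=
  h.1.comp (f := fun x : ℝ => ((x, t) : ℝ × ℝ)) (by fun_prop) fun _ hx => ⟨hx, ht⟩

lemma XPowBdd.add {l T c : ℝ} {W W' : ℝ → ℝ → ℝ} (h : XPowBdd l T c W) (h' : XPowBdd l T c W') :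
    XPowBdd l T c (fun x t => W x t + W' x t) := by
  obtain ⟨hc, C, hC⟩ := h
  obtain ⟨hc', C', hC'⟩ := h'
  refine ⟨hc.add hc', C + C', fun x hx t ht => ?_⟩
  have := abs_add_le (W x t) (W' x t)
  linarith [hC x hx t ht, hC' x hx t ht, add_mul C C' (t ^ (c - 1))]

lemma XPowBdd.weaken {l T c c' : ℝ} {W : ℝ → ℝ → ℝ} (h : XPowBdd l T c W) (hc : c' ≤ c) :
    XPowBdd l T c' W := by
  obtain ⟨hg, C, hC⟩ := h
  refine ⟨hg, |C| * T ^ (c - c'), fun x hx t ht => (hC x hx t ht).trans ?_⟩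
  have h1 : t ^ (c - 1) = t ^ (c - c') * t ^ (c' - 1) := by
    rw [← Real.rpow_add ht.1]; ring_nf
  have h2 : t ^ (c - c') ≤ T ^ (c - c') :=
    Real.rpow_le_rpow ht.1.le ht.2 (by linarith)
  rw [h1, mul_assoc]
  have h3 : (0 : ℝ) ≤ t ^ (c' - 1) := Real.rpow_nonneg ht.1.le _
  have h4 : (0 : ℝ) ≤ t ^ (c - c') := Real.rpow_nonneg ht.1.le _
  exact mul_le_mul (le_abs_self C) (mul_le_mul_of_nonneg_right h2 h3) (by positivity)
    (abs_nonneg C)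

lemma XPowBdd.powBdd_sineCoeff {l T c : ℝ} (hl : 0 < l) {W : ℝ → ℝ → ℝ} (h : XPowBdd l T c W)
    (n : ℕ) : PowBdd T c (fun t => sineCoeff l n (fun x => W x t)) := by
  obtain ⟨hW, C, hC⟩ := id h
  refine ⟨?_, 2 * C, fun t ht => ?_⟩
  · unfold sineCoeff
    refine continuousOn_const.mul fun t₀ ht₀ => ?_
    have hmem : Ioc (t₀ / 2) T ∈ 𝓝[Ioc 0 T] t₀ := by
      have : Ioi (t₀ / 2) ∈ 𝓝 t₀ := Ioi_mem_nhds (by linarith [ht₀.1])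
      filter_upwards [self_mem_nhdsWithin, mem_nhdsWithin_of_mem_nhds this] with t h1 h2
      exact ⟨h2, h1.2⟩
    obtain ⟨M, hM⟩ := (isCompact_Icc.prod (isCompact_Icc (a := t₀ / 2) (b := T))).exists_bound_of_continuousOn
      (hW.mono (prod_mono (subset_refl (Icc 0 l)) fun t ht => ⟨by linarith [ht.1, ht₀.1], ht.2⟩))
    refine intervalIntegral.continuousWithinAt_of_dominated_interval (bound := fun _ => M)
      ?_ ?_ (by simp) ?_
    · filter_upwards [self_mem_nhdsWithin] with t ht
      rw [uIoc_of_le hl.le]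
      exact (((h.continuousOn_left ht).mono Ioc_subset_Icc_self).mul
        (continuous_mode l n).continuousOn).aestronglyMeasurable measurableSet_Ioc
    · filter_upwards [hmem] with t ht
      refine Eventually.of_forall fun x hx => ?_
      rw [uIoc_of_le hl.le] at hx
      rw [norm_mul]
      exact (mul_le_of_le_one_right (norm_nonneg _) (abs_mode_le l n x)).trans
        (hM (x, t) ⟨Ioc_subset_Icc_self hx, ⟨ht.1.le, ht.2⟩⟩)
    · refine Eventually.of_forall fun x hx => ?_
      rw [uIoc_of_le hl.le] at hx
      exact ((h.powBdd (Ioc_subset_Icc_self hx)).1 t₀ ht₀).mul continuousWithinAt_const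
  · have := abs_sineCoeff_le hl n (q := fun x => W x t) (C := C * t ^ (c - 1))
      fun x hx => hC x (Ioo_subset_Icc_self hx) t ht
    linarith

lemma XPowBdd.continuousOn_leftInt {l T c κ t : ℝ} (hκ : 0 ≤ κ) (hc : 0 < c) {W : ℝ → ℝ → ℝ}
    (h : XPowBdd l T c W) (ht : t ∈ Ioc 0 T) :
    ContinuousOn (fun x => leftInt κ (W x) t) (Icc 0 l) := by
  rcases hκ.eq_or_lt with rfl | hκ
  · simp only [leftInt_zero]; exact h.continuousOn_left ht
  obtain ⟨hW, C, hC⟩ := id h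
  simp only [leftInt_eq_conv hκ]
  intro x₀ hx₀
  unfold conv
  have hb := (((powBdd_powKer t κ).intervalIntegrable_conv hκ hc ht.1
    (powBdd_rpow t c)).norm).const_mul C
  refine intervalIntegral.continuousWithinAt_of_dominated_interval
    (bound := fun s => C * ‖powKer κ (t - s) * s ^ (c - 1)‖) ?_ ?_ hb ?_
  · filter_upwards [self_mem_nhdsWithin] with x hx
    rw [uIoc_of_le ht.1.le]
    exact ((powBdd_powKer t κ).intervalIntegrable_conv hκ hc ht.1
      ((h.powBdd hx).mono ht.2)).1.aestronglyMeasurable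
  · filter_upwards [self_mem_nhdsWithin] with x hx
    refine Eventually.of_forall fun s hs => ?_
    rw [uIoc_of_le ht.1.le] at hs
    rw [norm_mul, norm_mul, Real.norm_of_nonneg (Real.rpow_nonneg hs.1.le _)]
    have := mul_le_mul_of_nonneg_left (hC x hx s ⟨hs.1, hs.2.trans ht.2⟩)
      (norm_nonneg (powKer κ (t - s)))
    rw [Real.norm_eq_abs (W x s)]
    linarith
  · refine Eventually.of_forall fun s hs => ?_
    rw [uIoc_of_le ht.1.le] at hs
    exact continuousWithinAt_const.mul (h.continuousOn_left ⟨hs.1, hs.2.trans ht.2⟩ x₀ hx₀)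

lemma XPowBdd.sineCoeff_leftInt {l T c κ t : ℝ} (hl : 0 < l) (hκ : 0 ≤ κ) (hc : 0 < c)
    {W : ℝ → ℝ → ℝ} (h : XPowBdd l T c W) (ht : t ∈ Ioc 0 T) (n : ℕ) :
    sineCoeff l n (fun x => leftInt κ (W x) t) =
      leftInt κ (fun s => sineCoeff l n (fun x => W x s)) t := by
  rcases hκ.eq_or_lt with rfl | hκ
  · simp only [leftInt_zero]
  obtain ⟨hW, C, hC⟩ := id h
  simp only [leftInt_eq_conv hκ]
  set μ : Measure ℝ := volume.restrict (Ioo 0 l) with hμ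
  set ν : Measure ℝ := volume.restrict (Ioo 0 t) with hν
  set F : ℝ → ℝ → ℝ := fun x s => powKer κ (t - s) * W x s * mode l n x with hF
  have hFi : Integrable (Function.uncurry F) (μ.prod ν) := by
    have hb := (intervalIntegrable_iff_Ioo ht.1.le).1
      ((((powBdd_powKer t κ).intervalIntegrable_conv hκ hc ht.1
        (powBdd_rpow t c)).norm).const_mul C)
    refine Integrable.mono' (Integrable.comp_snd hb μ) ?_ ?_
    · rw [hμ, hν, Measure.prod_restrict]
      refine ContinuousOn.aestronglyMeasurable ?_ (measurableSet_Ioo.prod measurableSet_Ioo)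
      refine ContinuousOn.mul (ContinuousOn.mul ?_ ?_) ?_
      · refine (powBdd_powKer t κ).1.comp (f := fun p : ℝ × ℝ => t - p.2) (by fun_prop) ?_
        rintro ⟨x, s⟩ ⟨_, hs⟩
        exact ⟨by linarith [hs.2], by linarith [hs.1]⟩
      · exact hW.mono (prod_mono Ioo_subset_Icc_self fun s hs => ⟨hs.1, hs.2.le.trans ht.2⟩)
      · exact ((continuous_mode l n).comp continuous_fst).continuousOn
    · rw [hμ, hν, Measure.prod_restrict]
      filter_upwards [ae_restrict_mem (measurableSet_Ioo.prod measurableSet_Ioo)] with p hp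
      have hs := hp.2
      have hx := hp.1
      simp only [Function.uncurry, hF]
      rw [norm_mul, norm_mul, norm_mul, Real.norm_of_nonneg (Real.rpow_nonneg hs.1.le _)]
      refine (mul_le_of_le_one_right (by positivity) (abs_mode_le l n p.1)).trans ?_
      have := mul_le_mul_of_nonneg_left (hC p.1 (Ioo_subset_Icc_self hx) p.2
        ⟨hs.1, hs.2.le.trans ht.2⟩) (norm_nonneg (powKer κ (t - p.2)))
      rw [Real.norm_eq_abs (W p.1 p.2)]
      linarith
  have hswap := integral_integral_swap hFi
  have e1 : ∫ x, ∫ s, F x s ∂ν ∂μ = ∫ x in (0 : ℝ)..l, conv (powKer κ) (W x) t * mode l n x := by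
    rw [integral_eq_Ioo hl.le]
    refine integral_congr_ae (Eventually.of_forall fun x => ?_)
    simp only [hF, conv]
    rw [integral_mul_const, integral_eq_Ioo ht.1.le]
  have e2 : (2 / l) * ∫ s, ∫ x, F x s ∂μ ∂ν =
      conv (powKer κ) (fun s => sineCoeff l n (fun x => W x s)) t := by
    rw [← integral_const_mul, conv, integral_eq_Ioo ht.1.le]
    refine integral_congr_ae (Eventually.of_forall fun s => ?_)
    simp only [hF, sineCoeff]
    rw [integral_eq_Ioo hl.le]
    have : ∀ x, powKer κ (t - s) * W x s * mode l n x = powKer κ (t - s) * (W x s * mode l n x) :=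
      fun x => by ring
    simp only [this]
    rw [integral_const_mul]
    ring
  rw [sineCoeff, ← e1, hswap, e2]

lemma eqOn_of_sineCoeff_eq {l : ℝ} (hl : 0 < l) {q r : ℝ → ℝ}
    (hq : ContinuousOn q (Icc 0 l)) (hr : ContinuousOn r (Icc 0 l)) (h0 : q 0 = 0) (h1 : q l = 0)
    (h0' : r 0 = 0) (h1' : r l = 0) (hn : ∀ n, sineCoeff l (n + 1) q = sineCoeff l (n + 1) r) :
    ∀ x ∈ Icc 0 l, q x = r x := by
  have hz := eqOn_zero_of_sineCoeff_eq_zero hl (q := fun x => q x + (-1) * r x)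
    (hq.add (hr.const_smul (-1 : ℝ))) (by simp [h0, h0']) (by simp [h1, h1']) (fun n => by
      have hu : uIcc 0 l = Icc 0 l := uIcc_of_le hl.le
      rw [sineCoeff_add _ (ContinuousOn.intervalIntegrable (by rwa [hu]))
        (ContinuousOn.intervalIntegrable (by rw [hu]; exact hr.const_smul (-1 : ℝ))),
        sineCoeff_const_mul, hn]
      ring)
  intro x hx
  linarith [hz x hx]

/-! ### Reflection of time -/

lemma rightInt_eq (a : ℝ) (g : ℝ → ℝ) (t : ℝ) :
    rightInt a g t = leftInt a (fun s => g (-s)) (-t) := by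
  unfold rightInt leftInt
  split_ifs with h
  · simp
  · congr 1
    have := intervalIntegral.integral_comp_neg (a := 0) (b := -t)
      (f := fun z => (z - t) ^ (a - 1) * g z)
    rw [neg_neg, neg_zero] at this
    rw [← this]
    exact intervalIntegral.integral_congr fun z _ => by ring_nf

lemma intervalIntegrable_reflect {p t : ℝ} {g : ℝ → ℝ} :
    IntervalIntegrable (fun z => (z - t) ^ p * g z) volume t 0 ↔
      IntervalIntegrable (fun z => (-t - z) ^ p * g (-z)) volume 0 (-t) := by
  rw [IntervalIntegrable.iff_comp_neg, neg_zero]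
  have : (fun x => (-x - t) ^ p * g (-x)) = fun z => (-t - z) ^ p * g (-z) := by
    ext z; ring_nf
  rw [this]
  exact ⟨IntervalIntegrable.symm, IntervalIntegrable.symm⟩

lemma rightHilfer_two_eq (α β μ : ℝ) (g : ℝ → ℝ) (t : ℝ) :
    rightHilfer 2 α β μ g t = leftHilfer 2 α β μ (fun s => g (-s)) (-t) := by
  unfold rightHilfer leftHilfer
  have h : rightInt ((1 - μ) * ((2 : ℕ) - β)) g =
      fun t => leftInt ((1 - μ) * ((2 : ℕ) - β)) (fun s => g (-s)) (-t) :=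
    funext fun t => rightInt_eq _ g t
  rw [rightInt_eq, h]
  simp only [iteratedDeriv_comp_neg]
  simp

lemma rightHilferExists_iff (α β μ T : ℝ) (g : ℝ → ℝ) :
    RightHilferExists 2 α β μ T g ↔ LeftHilferExists 2 α β μ T (fun s => g (-s)) := by
  have h : rightInt ((1 - μ) * ((2 : ℕ) - β)) g =
      fun t => leftInt ((1 - μ) * ((2 : ℕ) - β)) (fun s => g (-s)) (-t) :=
    funext fun t => rightInt_eq _ g t
  have hneg : ∀ P : ℝ → Prop, (∀ t ∈ Ioo (-T) 0, P (-t)) ↔ ∀ t ∈ Ioo 0 T, P t := fun P =>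
    ⟨fun H t ht => by
      have := H (-t) ⟨by linarith [ht.2], by linarith [ht.1]⟩
      rwa [neg_neg] at this, fun H t ht => H (-t) ⟨by linarith [ht.2], by linarith [ht.1]⟩⟩
  unfold RightHilferExists LeftHilferExists
  rw [h]
  refine and_congr ?_ (and_congr ?_ ?_)
  · rw [← hneg]
    exact forall₂_congr fun t _ => or_congr Iff.rfl intervalIntegrable_reflect
  · refine forall₂_congr fun k _ => ?_
    rw [← hneg]
    refine forall₂_congr fun t _ => ?_
    have : iteratedDeriv k (fun t => leftInt ((1 - μ) * ((2 : ℕ) - β)) (fun s => g (-s)) (-t)) =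
        fun a => (-1 : ℝ) ^ k •
          (fun b => iteratedDeriv k (leftInt ((1 - μ) * ((2 : ℕ) - β)) (fun s => g (-s))) (-b)) a :=
      funext fun a => iteratedDeriv_comp_neg _ _ _
    rw [this, ← differentiableAt_comp_neg
      (f := iteratedDeriv k (leftInt ((1 - μ) * ((2 : ℕ) - β)) (fun s => g (-s))))]
    refine ⟨fun H => ?_, fun H => H.const_smul ((-1 : ℝ) ^ k)⟩
    have := H.const_smul ((-1 : ℝ) ^ k)
    refine this.congr_of_eventuallyEq (Eventually.of_forall fun x => ?_)
    simp only [Pi.smul_apply, smul_smul, ← mul_pow]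
    norm_num
  · rw [← hneg]
    refine forall₂_congr fun t _ => or_congr Iff.rfl ?_
    rw [intervalIntegrable_reflect]
    simp only [iteratedDeriv_comp_neg]
    simp

lemma tendsto_reflect {F : ℝ → ℝ} {c : ℝ} :
    Tendsto (fun t => F (-t)) (𝓝[<] 0) (𝓝 c) ↔ Tendsto F (𝓝[>] 0) (𝓝 c) := by
  have h1 : Tendsto (fun t : ℝ => -t) (𝓝[<] 0) (𝓝[>] 0) := by
    simpa using tendsto_neg_nhdsLT (a := (0 : ℝ))
  have h2 : Tendsto (fun t : ℝ => -t) (𝓝[>] 0) (𝓝[<] 0) := by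
    simpa using tendsto_neg_nhdsGT (a := (0 : ℝ))
  refine ⟨fun H => ?_, fun H => H.comp h1⟩
  simpa [Function.comp_def] using H.comp h2

/-! ### Hilfer derivatives read off from an integral representation -/

lemma intervalIntegrable_frac {κ t c : ℝ} (hκ : 0 ≤ κ) (hc : 0 < c) (ht : 0 < t) {v : ℝ → ℝ}
    (hv : PowBdd t c v) :
    κ = 0 ∨ IntervalIntegrable (fun z => (t - z) ^ (κ - 1) * v z) volume 0 t :=
  hκ.eq_or_lt.imp (fun h => h.symm) fun h =>
    (powBdd_rpow t κ).intervalIntegrable_conv h hc ht hv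

lemma tendsto_integral_of_powBdd {T c : ℝ} (hT : 0 < T) (hc : 0 < c) {h : ℝ → ℝ}
    (hh : PowBdd T c h) : Tendsto (fun t => ∫ s in (0 : ℝ)..t, h s) (𝓝[>] 0) (𝓝 0) := by
  have h1 := intervalIntegral.continuousOn_primitive_interval (a := 0) (b := T) (μ := volume)
    (f := h) (by
      rw [uIcc_of_le hT.le, integrableOn_Icc_iff_integrableOn_Ioo]
      exact (intervalIntegrable_iff_Ioo hT.le).1 (hh.intervalIntegrable hc hT))
  have h2 := h1 0 (by rw [uIcc_of_le hT.le]; exact ⟨le_rfl, hT.le⟩)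
  unfold ContinuousWithinAt at h2
  simp only [] at h2
  rw [intervalIntegral.integral_same, uIcc_of_le hT.le] at h2
  refine h2.mono_left (nhdsWithin_le_iff.2 ?_)
  filter_upwards [Ioo_mem_nhdsGT hT] with t ht using Ioo_subset_Icc_self ht

section One
variable {T κ c c' α β μ P : ℝ} {v h : ℝ → ℝ}

lemma deriv_leftInt_one (hc : 0 < c) (hh : PowBdd T c h)
    (hV : ∀ t ∈ Ioo 0 T, leftInt κ v t = P + ∫ s in (0 : ℝ)..t, h s) {t : ℝ} (ht : t ∈ Ioo 0 T) :
    HasDerivAt (leftInt κ v) (h t) t := by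
  refine ((hasDerivAt_integral_of_powBdd hc hh ht).const_add P).congr_of_eventuallyEq ?_
  filter_upwards [isOpen_Ioo.mem_nhds ht] with s hs using hV s hs

/-- If the inner fractional integral is known to be a constant plus the primitive of h, its
derivative is h and the Hilfer derivative is the outer fractional integral of h. A series for v thus
never has to be differentiated in time. -/
lemma leftHilferExists_one (hc : 0 < c) (hc' : 0 < c') (hh : PowBdd T c h) (hv : PowBdd T c' v)
    (hκ₀ : 0 ≤ (1 - μ) * ((1 : ℕ) - β)) (hκ₁ : 0 ≤ μ * ((1 : ℕ) - α))
    (hV : ∀ t ∈ Ioo 0 T, leftInt ((1 - μ) * ((1 : ℕ) - β)) v t = P + ∫ s in (0 : ℝ)..t, h s) :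
    LeftHilferExists 1 α β μ T v ∧
      ∀ t ∈ Ioo 0 T, leftHilfer 1 α β μ v t = leftInt (μ * ((1 : ℕ) - α)) h t := by
  have hd : ∀ t ∈ Ioo 0 T, iteratedDeriv 1 (leftInt ((1 - μ) * ((1 : ℕ) - β)) v) t = h t :=
    fun t ht => by rw [iteratedDeriv_one]; exact (deriv_leftInt_one hc hh hV ht).deriv
  have hsub : ∀ {t}, t ∈ Ioo 0 T → ∀ s ∈ Ioc 0 t, s ∈ Ioo 0 T :=
    fun ht s hs => ⟨hs.1, hs.2.trans_lt ht.2⟩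
  refine ⟨⟨fun t ht => intervalIntegrable_frac hκ₀ hc' ht.1 (hv.mono ht.2.le), ?_, ?_⟩, ?_⟩
  · intro k hk t ht
    obtain rfl : k = 0 := by omega
    rw [iteratedDeriv_zero]
    exact (deriv_leftInt_one hc hh hV ht).differentiableAt
  · intro t ht
    exact intervalIntegrable_frac hκ₁ hc ht.1
      ((hh.mono ht.2.le).congr fun s hs => hd s (hsub ht s hs))
  · intro t ht
    exact leftInt_congr hκ₁ ht.1 fun s hs => hd s (hsub ht s hs)

end One

section Two
variable {T κ c c' α β μ P B : ℝ} {v h : ℝ → ℝ}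

lemma powBdd_integral (hc : 0 < c) (hh : PowBdd T c h) :
    PowBdd T 1 (fun t => ∫ s in (0 : ℝ)..t, h s) := by
  have := ((powBdd_of_continuousOn (T := T) (g := fun _ => (1 : ℝ)) continuousOn_const).conv
    one_pos hc hh).weaken (c' := 1) (by linarith)
  exact this.congr fun t _ => (conv_const_one h t).symm

lemma deriv_leftInt_two (hc : 0 < c) (hh : PowBdd T c h)
    (hV : ∀ t ∈ Ioo 0 T, leftInt κ v t =
      P + B * t + ∫ r in (0 : ℝ)..t, ∫ s in (0 : ℝ)..r, h s) {t : ℝ} (ht : t ∈ Ioo 0 T) :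
    HasDerivAt (leftInt κ v) (B + ∫ s in (0 : ℝ)..t, h s) t := by
  have h1 := hasDerivAt_integral_of_powBdd one_pos
    (powBdd_integral hc hh) ht
  refine ((((hasDerivAt_id t).const_mul B).const_add P).add h1).congr_deriv (by simp)
    |>.congr_of_eventuallyEq ?_
  filter_upwards [isOpen_Ioo.mem_nhds ht] with s hs using hV s hs

lemma deriv_deriv_leftInt_two (hc : 0 < c) (hh : PowBdd T c h)
    (hV : ∀ t ∈ Ioo 0 T, leftInt κ v t =
      P + B * t + ∫ r in (0 : ℝ)..t, ∫ s in (0 : ℝ)..r, h s) {t : ℝ} (ht : t ∈ Ioo 0 T) :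
    HasDerivAt (deriv (leftInt κ v)) (h t) t := by
  refine ((hasDerivAt_integral_of_powBdd hc hh ht).const_add B).congr_of_eventuallyEq ?_
  filter_upwards [isOpen_Ioo.mem_nhds ht] with s hs using (deriv_leftInt_two hc hh hV hs).deriv

lemma leftHilferExists_two (hc : 0 < c) (hc' : 0 < c') (hh : PowBdd T c h) (hv : PowBdd T c' v)
    (hκ₀ : 0 ≤ (1 - μ) * ((2 : ℕ) - β)) (hκ₁ : 0 ≤ μ * ((2 : ℕ) - α))
    (hV : ∀ t ∈ Ioo 0 T, leftInt ((1 - μ) * ((2 : ℕ) - β)) v t =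
      P + B * t + ∫ r in (0 : ℝ)..t, ∫ s in (0 : ℝ)..r, h s) :
    LeftHilferExists 2 α β μ T v ∧
      ∀ t ∈ Ioo 0 T, leftHilfer 2 α β μ v t = leftInt (μ * ((2 : ℕ) - α)) h t := by
  have hd : ∀ t ∈ Ioo 0 T, iteratedDeriv 2 (leftInt ((1 - μ) * ((2 : ℕ) - β)) v) t = h t :=
    fun t ht => by
      rw [iteratedDeriv_succ, iteratedDeriv_one]; exact (deriv_deriv_leftInt_two hc hh hV ht).deriv
  have hsub : ∀ {t}, t ∈ Ioo 0 T → ∀ s ∈ Ioc 0 t, s ∈ Ioo 0 T :=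
    fun ht s hs => ⟨hs.1, hs.2.trans_lt ht.2⟩
  refine ⟨⟨fun t ht => intervalIntegrable_frac hκ₀ hc' ht.1 (hv.mono ht.2.le), ?_, ?_⟩, ?_⟩
  · intro k hk t ht
    rcases (show k = 0 ∨ k = 1 by omega) with rfl | rfl
    · rw [iteratedDeriv_zero]
      exact (deriv_leftInt_two hc hh hV ht).differentiableAt
    · rw [iteratedDeriv_one]
      exact (deriv_deriv_leftInt_two hc hh hV ht).differentiableAt
  · intro t ht
    exact intervalIntegrable_frac hκ₁ hc ht.1
      ((hh.mono ht.2.le).congr fun s hs => hd s (hsub ht s hs))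
  · intro t ht
    exact leftInt_congr hκ₁ ht.1 fun s hs => hd s (hsub ht s hs)

end Two

/-! ### Equations satisfied by the time coefficients -/

lemma coeffPos_eq (l α β μ : ℝ) (f : ℝ → ℝ → ℝ) (n : ℕ) (τ t : ℝ) :
    coeffPos l α β μ f n τ t = τ * mlKer (del α β μ) (eig l n) (gam 1 β μ) t +
      conv (mlKer (del α β μ) (eig l n) (del α β μ)) (fun s => sineCoeff l n fun x => f x s) t := by
  unfold coeffPos conv mlKer
  rw [mul_assoc]

lemma coeffNeg_eq (l α β μ : ℝ) (f : ℝ → ℝ → ℝ) (n : ℕ) (φ ν t : ℝ) :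
    coeffNeg l α β μ f n φ ν t = φ * mlKer (del α β μ) (eig l n) (gam 2 β μ - 1) (-t) +
      (-ν) * mlKer (del α β μ) (eig l n) (gam 2 β μ) (-t) +
      conv (mlKer (del α β μ) (eig l n) (del α β μ))
        (fun s => sineCoeff l n fun x => f x (-s)) (-t) := by
  unfold coeffNeg conv mlKer
  have := intervalIntegral.integral_comp_neg (a := 0) (b := -t)
    (f := fun s => (s - t) ^ (del α β μ - 1) *
        mittagLeffler (del α β μ) (del α β μ) (-eig l n * (s - t) ^ del α β μ) *
        sineCoeff l n (fun x => f x s))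
  rw [neg_neg, neg_zero] at this
  rw [← this]
  have e : ∀ s : ℝ, -s - t = -t - s := fun s => by ring
  simp only [e]
  rw [show gam 2 β μ - 1 - 1 = gam 2 β μ - 2 by ring]
  ring

lemma Delta_eq (l T α₁ β₁ μ₁ α₂ β₂ μ₂ : ℝ) (n : ℕ) :
    Delta l T α₁ β₁ μ₁ α₂ β₂ μ₂ n =
      mlKer (del α₂ β₂ μ₂) (eig l n) (gam 2 β₂ μ₂ - 1) T +
      eig l n / Real.Gamma (del α₁ β₁ μ₁) * mlKer (del α₂ β₂ μ₂) (eig l n) (gam 2 β₂ μ₂) T -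
      mlKer (del α₁ β₁ μ₁) (eig l n) (gam 1 β₁ μ₁) T := by
  unfold Delta mlKer
  rw [show gam 2 β₂ μ₂ - 1 - 1 = gam 2 β₂ μ₂ - 2 by ring]
  ring

lemma leftInt_add_of_powBdd {κ t c c' : ℝ} (hκ : 0 ≤ κ) (ht : 0 < t) (hc : 0 < c) (hc' : 0 < c')
    {g g' : ℝ → ℝ} (hg : PowBdd t c g) (hg' : PowBdd t c' g') :
    leftInt κ (fun s => g s + g' s) t = leftInt κ g t + leftInt κ g' t :=
  leftInt_add hκ ht (lt_min hc hc') (hg.weaken (min_le_left c c')) (hg'.weaken (min_le_right c c'))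

/-- The kernel with b = 1 equals 1 - λ times the kernel with b = δ + 1, so the forcing part of the
source splits into g itself and -λ times the forcing part of the time coefficient, as the equation
demands. -/
lemma conv_mlKer_one_primitive {δ lam t : ℝ} (hδ : 0 < δ) (ht : 0 < t) {g g' : ℝ → ℝ}
    (hg' : ContinuousOn g' (Icc 0 t))
    (hg : ∀ s ∈ Icc 0 t, g s = g 0 + ∫ r in (0 : ℝ)..s, g' r) :
    g 0 * mlKer δ lam 1 t + conv (mlKer δ lam 1) g' t =
      g t - lam * conv (mlKer δ lam δ) g t := by
  have hp := powBdd_of_continuousOn hg'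
  have e : conv (mlKer δ lam 1) g' t = (∫ r in (0 : ℝ)..t, g' r) +
      (-lam) * conv (mlKer δ lam (δ + 1)) g' t := by
    rw [conv_comm (mlKer δ lam 1), conv_comm (mlKer δ lam (δ + 1)), ← conv_const_one,
      conv_comm (fun _ => 1), ← conv_const_mul,
      ← conv_add (hp.intervalIntegrable_conv one_pos one_pos ht
          (powBdd_of_continuousOn continuousOn_const))
        (hp.intervalIntegrable_conv one_pos (by linarith : 0 < δ + 1) ht
          ((powBdd_mlKer t lam hδ (by linarith)).const_mul _))]
    refine conv_congr ht (fun _ _ => rfl) fun s hs => ?_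
    rw [mlKer_eq lam 1 hδ hs.1, powKer_one]; ring
  rw [conv_mlKer_primitive hδ hδ ht hg' hg, e, hg t ⟨ht.le, le_rfl⟩, mlKer_eq lam 1 hδ ht,
    powKer_one]
  ring

section Modes
variable {δ γ lam t : ℝ} {g g' : ℝ → ℝ}

/-- Identifies the derivative of I^{1-γ} of a time coefficient. The forcing contributes the kernel
of order δ+1-γ convolved with g; differentiating that kernel would give order δ-γ, which is not
positive when δ ≤ γ, so the derivative is moved onto g at the price of a term in g(0). -/
lemma leftInt_mode_one (hδ : 0 < δ) (hγ : 0 < γ) (hγ1 : γ ≤ 1) (τ : ℝ) (ht : 0 < t)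
    (hg' : ContinuousOn g' (Icc 0 t))
    (hg : ∀ s ∈ Icc 0 t, g s = g 0 + ∫ r in (0 : ℝ)..s, g' r) (hgb : PowBdd t 1 g) :
    leftInt (1 - γ) (fun s => τ * mlKer δ lam γ s + conv (mlKer δ lam δ) g s) t =
      τ + leftInt 1 (fun s => ((-lam * τ) * mlKer δ lam δ s + g 0 * mlKer δ lam (δ + 1 - γ) s) +
        conv (mlKer δ lam (δ + 1 - γ)) g' s) t := by
  have hb : 0 < δ + 1 - γ := by linarith
  have hp := powBdd_of_continuousOn hg'
  have k1 := powBdd_mlKer t lam hδ hδ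
  have k2 := powBdd_mlKer t lam hδ hb
  have k3 := powBdd_mlKer t lam hδ hγ
  rw [leftInt_add_of_powBdd (by linarith) ht hγ (by linarith : 0 < δ + 1) (k3.const_mul τ)
    (k1.conv hδ one_pos hgb), leftInt_const_mul, leftInt_mlKer lam hδ hγ (by linarith) ht,
    leftInt_conv_mlKer hδ (by linarith) hδ one_pos ht hgb,
    leftInt_add_of_powBdd zero_le_one ht (lt_min hδ hb) (by linarith : 0 < δ + 1 - γ + 1)
      (((k1.const_mul _).weaken (min_le_left _ _)).add ((k2.const_mul _).weaken (min_le_right _ _)))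
      (k2.conv hb one_pos hp),
    leftInt_add_of_powBdd zero_le_one ht hδ hb (k1.const_mul _) (k2.const_mul _),
    leftInt_const_mul, leftInt_const_mul, leftInt_mlKer lam hδ hδ zero_le_one ht,
    leftInt_mlKer lam hδ hb zero_le_one ht, leftInt_conv_mlKer hδ zero_le_one hb one_pos ht hp,
    show 1 - γ + δ = δ + 1 - γ by ring, conv_mlKer_primitive hδ hb ht hg' hg,
    show 1 - γ + γ = 1 by ring, mlKer_eq lam 1 hδ ht, powKer_one, add_comm 1 δ,
    add_comm 1 (δ + 1 - γ)]
  ring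

/-- The outer integral I^{γ-δ} raises the orders δ and δ+1-γ of the source to γ and 1. The first
reproduces -λ times the homogeneous part of the coefficient; the second is
`conv_mlKer_one_primitive`. -/
lemma leftInt_modeSource_one (hδ : 0 < δ) (hδγ : δ ≤ γ) (hγ1 : γ ≤ 1) (τ : ℝ) (ht : 0 < t)
    (hg' : ContinuousOn g' (Icc 0 t))
    (hg : ∀ s ∈ Icc 0 t, g s = g 0 + ∫ r in (0 : ℝ)..s, g' r) :
    leftInt (γ - δ) (fun s => ((-lam * τ) * mlKer δ lam δ s + g 0 * mlKer δ lam (δ + 1 - γ) s) +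
        conv (mlKer δ lam (δ + 1 - γ)) g' s) t =
      -lam * (τ * mlKer δ lam γ t + conv (mlKer δ lam δ) g t) + g t := by
  have hb : 0 < δ + 1 - γ := by linarith
  have hκ : 0 ≤ γ - δ := by linarith
  have hp := powBdd_of_continuousOn hg'
  have k1 := powBdd_mlKer t lam hδ hδ
  have k2 := powBdd_mlKer t lam hδ hb
  rw [leftInt_add_of_powBdd hκ ht (lt_min hδ hb) (by linarith : 0 < δ + 1 - γ + 1)
      (((k1.const_mul _).weaken (min_le_left _ _)).add ((k2.const_mul _).weaken (min_le_right _ _)))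
      (k2.conv hb one_pos hp),
    leftInt_add_of_powBdd hκ ht hδ hb (k1.const_mul _) (k2.const_mul _),
    leftInt_const_mul, leftInt_const_mul, leftInt_mlKer lam hδ hδ hκ ht,
    leftInt_mlKer lam hδ hb hκ ht, leftInt_conv_mlKer hδ hκ hb one_pos ht hp,
    show γ - δ + δ = γ by ring, show γ - δ + (δ + 1 - γ) = 1 by ring]
  have := conv_mlKer_one_primitive (lam := lam) hδ ht hg' hg
  linarith

/-- As in the first-order case with two free constants. The term belonging to A now has order δ-1,
which is positive because δ > 1. -/
lemma leftInt_mode_two (hδ : 1 < δ) (hγ : 1 < γ) (hγ2 : γ ≤ 2) (A B : ℝ) (ht : 0 < t)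
    (hg' : ContinuousOn g' (Icc 0 t))
    (hg : ∀ s ∈ Icc 0 t, g s = g 0 + ∫ r in (0 : ℝ)..s, g' r) (hgb : PowBdd t 1 g) :
    leftInt (2 - γ) (fun s => (A * mlKer δ lam (γ - 1) s + B * mlKer δ lam γ s) +
        conv (mlKer δ lam δ) g s) t =
      A + B * t + leftInt 2 (fun s => (((-lam * A) * mlKer δ lam (δ - 1) s +
        (-lam * B) * mlKer δ lam δ s) + g 0 * mlKer δ lam (δ + 1 - γ) s) +
        conv (mlKer δ lam (δ + 1 - γ)) g' s) t := by
  have hδ0 : 0 < δ := by linarith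
  have hδ1 : 0 < δ - 1 := by linarith
  have hγ0 : 0 < γ := by linarith
  have hγ1 : 0 < γ - 1 := by linarith
  have hb : 0 < δ + 1 - γ := by linarith
  have hp := powBdd_of_continuousOn hg'
  have k0 := powBdd_mlKer t lam hδ0 hδ1
  have k1 := powBdd_mlKer t lam hδ0 hδ0
  have k2 := powBdd_mlKer t lam hδ0 hb
  have k3 := powBdd_mlKer t lam hδ0 hγ0
  have k4 := powBdd_mlKer t lam hδ0 hγ1
  have hκ : 0 ≤ 2 - γ := by linarith
  have h2 : (0 : ℝ) ≤ 2 := by norm_num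
  have hA := (k4.const_mul A).add ((k3.const_mul B).weaken (by linarith : γ - 1 ≤ γ))
  have hX := (k0.const_mul (-lam * A)).add ((k1.const_mul (-lam * B)).weaken
    (by linarith : δ - 1 ≤ δ))
  have hY := (hX.weaken (min_le_left (δ - 1) (δ + 1 - γ))).add
    ((k2.const_mul (g 0)).weaken (min_le_right (δ - 1) (δ + 1 - γ)))
  have hpk2 : powKer 2 t = t := by
    unfold powKer; rw [Real.Gamma_two]; norm_num
  rw [leftInt_add_of_powBdd hκ ht hγ1 (by linarith : 0 < δ + 1) hA
      (k1.conv hδ0 one_pos hgb),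
    leftInt_add_of_powBdd hκ ht hγ1 hγ0 (k4.const_mul A) (k3.const_mul B),
    leftInt_const_mul, leftInt_const_mul, leftInt_mlKer lam hδ0 hγ1 hκ ht,
    leftInt_mlKer lam hδ0 hγ0 hκ ht,
    leftInt_conv_mlKer hδ0 hκ hδ0 one_pos ht hgb,
    leftInt_add_of_powBdd h2 ht (lt_min hδ1 hb) (by linarith : 0 < δ + 1 - γ + 1) hY
      (k2.conv hb one_pos hp),
    leftInt_add_of_powBdd h2 ht hδ1 hb hX (k2.const_mul _),
    leftInt_add_of_powBdd h2 ht hδ1 hδ0 (k0.const_mul _) (k1.const_mul _),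
    leftInt_const_mul, leftInt_const_mul, leftInt_const_mul, leftInt_mlKer lam hδ0 hδ1 h2 ht,
    leftInt_mlKer lam hδ0 hδ0 h2 ht,
    leftInt_mlKer lam hδ0 hb h2 ht, leftInt_conv_mlKer hδ0 h2 hb one_pos ht hp,
    show 2 - γ + δ = (δ + 1 - γ) + 1 by ring,
    conv_mlKer_primitive hδ0 (by linarith : 0 < δ + 1 - γ + 1) ht hg' hg,
    show 2 - γ + (γ - 1) = 1 by ring, show 2 - γ + γ = 2 by ring, mlKer_eq lam 1 hδ0 ht,
    mlKer_eq lam 2 hδ0 ht, powKer_one, hpk2, show 2 + (δ - 1) = δ + 1 by ring, add_comm 2 δ,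
    show 2 + (δ + 1 - γ) = (δ + 1 - γ) + 1 + 1 by ring]
  ring

lemma leftInt_modeSource_two (hδ : 1 < δ) (hδγ : δ ≤ γ) (hγ2 : γ ≤ 2) (A B : ℝ) (ht : 0 < t)
    (hg' : ContinuousOn g' (Icc 0 t))
    (hg : ∀ s ∈ Icc 0 t, g s = g 0 + ∫ r in (0 : ℝ)..s, g' r) :
    leftInt (γ - δ) (fun s => (((-lam * A) * mlKer δ lam (δ - 1) s +
        (-lam * B) * mlKer δ lam δ s) + g 0 * mlKer δ lam (δ + 1 - γ) s) +
        conv (mlKer δ lam (δ + 1 - γ)) g' s) t =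
      -lam * ((A * mlKer δ lam (γ - 1) t + B * mlKer δ lam γ t) +
        conv (mlKer δ lam δ) g t) + g t := by
  have hδ0 : 0 < δ := by linarith
  have hδ1 : 0 < δ - 1 := by linarith
  have hb : 0 < δ + 1 - γ := by linarith
  have hp := powBdd_of_continuousOn hg'
  have k0 := powBdd_mlKer t lam hδ0 hδ1
  have k1 := powBdd_mlKer t lam hδ0 hδ0
  have k2 := powBdd_mlKer t lam hδ0 hb
  have hκ : 0 ≤ γ - δ := by linarith
  have hX := (k0.const_mul (-lam * A)).add ((k1.const_mul (-lam * B)).weaken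
    (by linarith : δ - 1 ≤ δ))
  have hY := (hX.weaken (min_le_left (δ - 1) (δ + 1 - γ))).add
    ((k2.const_mul (g 0)).weaken (min_le_right (δ - 1) (δ + 1 - γ)))
  rw [leftInt_add_of_powBdd hκ ht (lt_min hδ1 hb) (by linarith : 0 < δ + 1 - γ + 1) hY
      (k2.conv hb one_pos hp),
    leftInt_add_of_powBdd hκ ht hδ1 hb hX (k2.const_mul _),
    leftInt_add_of_powBdd hκ ht hδ1 hδ0 (k0.const_mul _) (k1.const_mul _),
    leftInt_const_mul, leftInt_const_mul, leftInt_const_mul, leftInt_mlKer lam hδ0 hδ1 hκ ht,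
    leftInt_mlKer lam hδ0 hδ0 hκ ht,
    leftInt_mlKer lam hδ0 hb hκ ht, leftInt_conv_mlKer hδ0 hκ hb one_pos ht hp,
    show γ - δ + δ = γ by ring, show γ - δ + (δ + 1 - γ) = 1 by ring,
    show γ - δ + (δ - 1) = γ - 1 by ring]
  have := conv_mlKer_one_primitive (lam := lam) hδ0 ht hg' hg
  linarith

end Modes

/-! ### Convergence and differentiation of sine series -/

lemma eig_eq (l : ℝ) (n : ℕ) : eig l (n + 1) = (((n + 1 : ℕ) : ℝ) * Real.pi / l) ^ 2 := rfl

lemma freq_ge {l : ℝ} (hl : 0 < l) (n : ℕ) :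
    Real.pi / l ≤ ((n + 1 : ℕ) : ℝ) * Real.pi / l := by
  have : (1 : ℝ) ≤ ((n + 1 : ℕ) : ℝ) := by push_cast; linarith [n.cast_nonneg (α := ℝ)]
  rw [mul_div_assoc]
  exact le_mul_of_one_le_left (by positivity) this

lemma eig_ge {l : ℝ} (hl : 0 < l) (n : ℕ) : (Real.pi / l) ^ 2 ≤ eig l (n + 1) := by
  rw [eig_eq]
  exact pow_le_pow_left₀ (by positivity) (freq_ge hl n) 2

lemma summable_eig_rpow {l θ : ℝ} (hl : 0 < l) (hθ : 1 / 2 < θ) :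
    Summable fun n : ℕ => eig l (n + 1) ^ (-θ) := by
  have h : Summable fun n : ℕ => ((n : ℝ)) ^ (-(2 * θ)) :=
    Real.summable_nat_rpow.2 (by linarith)
  have h2 := ((summable_nat_add_iff 1).2 h).mul_right ((Real.pi / l) ^ (-(2 * θ)))
  refine h2.congr fun n => ?_
  rw [eig_eq, ← Real.rpow_natCast, ← Real.rpow_mul (by positivity), mul_div_assoc,
    Real.mul_rpow (by positivity) (by positivity)]
  norm_num

lemma summable_eig_mul_imp {l : ℝ} (hl : 0 < l) {c : ℕ → ℝ}
    (hc : Summable fun n => eig l (n + 1) * |c n|) : Summable fun n => |c n| := by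
  refine Summable.of_nonneg_of_le (fun n => abs_nonneg _) (fun n => ?_)
    (hc.mul_left (((Real.pi / l) ^ 2)⁻¹))
  rw [← mul_assoc]
  refine le_mul_of_one_le_left (abs_nonneg _) ?_
  rw [← div_eq_inv_mul, le_div_iff₀ (by positivity), one_mul]
  exact eig_ge hl n

lemma hasDerivAt_mode (l : ℝ) (n : ℕ) (x : ℝ) :
    HasDerivAt (mode l n) (n * Real.pi / l * Real.cos (n * Real.pi / l * x)) x := by
  have h := (Real.hasDerivAt_sin (n * Real.pi / l * x)).comp x
    ((hasDerivAt_id x).const_mul (n * Real.pi / l))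
  refine h.congr_deriv ?_
  rw [mul_one, mul_comm]

lemma hasDerivAt_mul_cos (w x : ℝ) :
    HasDerivAt (fun y => w * Real.cos (w * y)) (-(w ^ 2) * Real.sin (w * x)) x := by
  have h := ((Real.hasDerivAt_cos (w * x)).comp x ((hasDerivAt_id x).const_mul w)).const_mul w
  refine h.congr_deriv ?_
  ring

lemma hasDerivAt_tsum_mode {l : ℝ} (hl : 0 < l) {c : ℕ → ℝ}
    (hc : Summable fun n => eig l (n + 1) * |c n|) (x : ℝ) :
    HasDerivAt (fun y => ∑' n, c n * mode l (n + 1) y)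
      (∑' n, c n * (((n + 1 : ℕ) : ℝ) * Real.pi / l *
        Real.cos (((n + 1 : ℕ) : ℝ) * Real.pi / l * x))) x ∧
    HasDerivAt (fun y => ∑' n, c n * (((n + 1 : ℕ) : ℝ) * Real.pi / l *
        Real.cos (((n + 1 : ℕ) : ℝ) * Real.pi / l * y)))
      (∑' n, (-eig l (n + 1) * c n) * mode l (n + 1) x) x := by
  have hfr : ∀ n, |c n| * (((n + 1 : ℕ) : ℝ) * Real.pi / l) ≤
      (Real.pi / l)⁻¹ * (eig l (n + 1) * |c n|) := by
    intro n
    have h1 := freq_ge hl n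
    have h0 : 0 < Real.pi / l := by positivity
    rw [eig_eq, ← div_eq_inv_mul, le_div_iff₀ h0]
    nlinarith [abs_nonneg (c n), mul_le_mul_of_nonneg_left h1
      (mul_nonneg (abs_nonneg (c n)) (h0.le.trans h1))]
  have hs1 : Summable fun n => |c n| * (((n + 1 : ℕ) : ℝ) * Real.pi / l) :=
    Summable.of_nonneg_of_le (fun n => by positivity) hfr (hc.mul_left _)
  have hb : ∀ n y, ‖c n * (((n + 1 : ℕ) : ℝ) * Real.pi / l *
      Real.cos (((n + 1 : ℕ) : ℝ) * Real.pi / l * y))‖ ≤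
      |c n| * (((n + 1 : ℕ) : ℝ) * Real.pi / l) := by
    intro n y
    rw [norm_mul, norm_mul, Real.norm_eq_abs, Real.norm_of_nonneg
      (by positivity : 0 ≤ ((n + 1 : ℕ) : ℝ) * Real.pi / l)]
    refine mul_le_mul_of_nonneg_left ?_ (abs_nonneg _)
    exact mul_le_of_le_one_right (by positivity) (Real.abs_cos_le_one _)
  have hd : ∀ n y, HasDerivAt (fun y => c n * (((n + 1 : ℕ) : ℝ) * Real.pi / l *
      Real.cos (((n + 1 : ℕ) : ℝ) * Real.pi / l * y)))
      ((-eig l (n + 1) * c n) * mode l (n + 1) y) y := by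
    intro n y
    refine ((hasDerivAt_mul_cos (((n + 1 : ℕ) : ℝ) * Real.pi / l) y).const_mul (c n)).congr_deriv ?_
    rw [eig_eq, mode]; ring
  have hb2 : ∀ n y, ‖(-eig l (n + 1) * c n) * mode l (n + 1) y‖ ≤ eig l (n + 1) * |c n| := by
    intro n y
    rw [norm_mul, norm_mul, norm_neg, Real.norm_of_nonneg (eig_pos hl n).le]
    exact mul_le_of_le_one_right (mul_nonneg (eig_pos hl n).le (norm_nonneg _))
      (abs_mode_le l (n + 1) y)
  exact ⟨hasDerivAt_tsum hs1 (fun n y => (hasDerivAt_mode l (n + 1) y).const_mul (c n)) hb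
      (summable_mul_mode (summable_eig_mul_imp hl hc) 0) x,
    hasDerivAt_tsum hc hd hb2 (Summable.of_norm_bounded hs1 fun n => hb n 0) x⟩

section Series
variable {l T c κ : ℝ} {k K : ℕ → ℝ → ℝ} {a : ℕ → ℝ}

lemma continuousOn_tsum_mode {S : Set ℝ} (hk : ∀ n, ContinuousOn (k n) S) (ha : Summable a)
    (hb : ∀ n, ∀ t ∈ S, |k n t| ≤ a n) :
    ContinuousOn (fun p : ℝ × ℝ => ∑' n, k n p.2 * mode l (n + 1) p.1) (univ ×ˢ S) := by
  refine continuousOn_tsum (fun n => ?_) ha fun n p hp => ?_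
  · exact ((hk n).comp continuousOn_snd fun p hp => hp.2).mul
      ((continuous_mode l (n + 1)).comp continuous_fst).continuousOn
  · rw [norm_mul]
    exact (mul_le_of_le_one_right (norm_nonneg _) (abs_mode_le l (n + 1) p.1)).trans
      (hb n p.2 hp.2)

lemma tsum_mode_zero (q : ℕ → ℝ) : ∑' n, q n * mode l (n + 1) 0 = 0 := by
  simp [mode_zero]

lemma tsum_mode_end (hl : 0 < l) (q : ℕ → ℝ) : ∑' n, q n * mode l (n + 1) l = 0 := by
  simp [mode_end hl]

lemma extendsCont_tsum (hK : ∀ n, ContinuousOn (K n) (Icc 0 T)) (ha : Summable a)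
    (hb : ∀ n, ∀ t ∈ Icc 0 T, |K n t| ≤ a n) (hkK : ∀ n, ∀ t ∈ Ioc 0 T, t ^ κ * k n t = K n t) :
    ExtendsCont (Icc 0 l ×ˢ Ioc 0 T) (Icc 0 l ×ˢ Icc 0 T)
      (fun x t => t ^ κ * ∑' n, k n t * mode l (n + 1) x) := by
  refine ⟨fun p => ∑' n, K n p.2 * mode l (n + 1) p.1,
    (continuousOn_tsum_mode hK ha hb).mono (prod_mono_left (subset_univ _)), fun p hp => ?_⟩
  simp only []
  rw [← tsum_mul_left]
  refine tsum_congr fun n => ?_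
  rw [← hkK n p.2 hp.2, mul_assoc]

lemma xPowBdd_tsum (hk : ∀ n, ContinuousOn (k n) (Ioc 0 T)) (ha : Summable a)
    (hb : ∀ n, ∀ t ∈ Ioc 0 T, |k n t| ≤ a n * t ^ (c - 1)) :
    XPowBdd l T c (fun x t => ∑' n, k n t * mode l (n + 1) x) := by
  have hK : ∀ n, ContinuousOn (fun t => t ^ (1 - c) * k n t) (Ioc 0 T) := fun n =>
    ContinuousOn.mul (fun t ht => (Real.continuousAt_rpow_const t _
      (Or.inl ht.1.ne')).continuousWithinAt) (hk n)
  have hb' : ∀ n, ∀ t ∈ Ioc 0 T, |t ^ (1 - c) * k n t| ≤ a n := fun n t ht => by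
    rw [abs_mul, abs_of_nonneg (Real.rpow_nonneg ht.1.le _)]
    refine (mul_le_mul_of_nonneg_left (hb n t ht) (Real.rpow_nonneg ht.1.le _)).trans_eq ?_
    rw [mul_left_comm, ← Real.rpow_add ht.1]; norm_num
  have hc := continuousOn_tsum_mode (l := l) hK ha hb'
  have heq : ∀ x, ∀ t ∈ Ioc 0 T, ∑' n, k n t * mode l (n + 1) x =
      t ^ (c - 1) * ∑' n, (t ^ (1 - c) * k n t) * mode l (n + 1) x := fun x t ht => by
    rw [← tsum_mul_left]
    refine tsum_congr fun n => ?_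
    rw [← mul_assoc, ← mul_assoc, ← Real.rpow_add ht.1]; norm_num
  constructor
  · refine (ContinuousOn.mul (f := fun p : ℝ × ℝ => p.2 ^ (c - 1)) ?_
      (hc.mono (prod_mono_left (subset_univ (Icc 0 l))))).congr fun p hp => heq p.1 p.2 hp.2
    exact fun p hp => (ContinuousAt.rpow_const continuousAt_snd
      (Or.inl hp.2.1.ne')).continuousWithinAt
  · refine ⟨∑' n, a n, fun x _ t ht => ?_⟩
    simp only []
    rw [heq x t ht, abs_mul, abs_of_nonneg (Real.rpow_nonneg ht.1.le _), mul_comm]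
    refine mul_le_mul_of_nonneg_right ?_ (Real.rpow_nonneg ht.1.le _)
    rw [← Real.norm_eq_abs]
    refine tsum_of_norm_bounded ha.hasSum fun n => ?_
    rw [norm_mul]
    exact (mul_le_of_le_one_right (norm_nonneg _) (abs_mode_le l (n + 1) x)).trans (hb' n t ht)

lemma summable_abs_of_bound (ha : Summable a)
    (hb : ∀ n, ∀ t ∈ Ioc 0 T, |k n t| ≤ a n * t ^ (c - 1)) {t : ℝ} (ht : t ∈ Ioc 0 T) :
    Summable fun n => |k n t| :=
  Summable.of_nonneg_of_le (fun _ => abs_nonneg _) (fun n => hb n t ht) (ha.mul_right _)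

end Series

/-! ### Forcing terms and the source built from their time derivative -/

lemma sineCoeff_integral {Y : Type*} [MeasurableSpace Y] {ν : Measure Y} [SFinite ν] {l C : ℝ}
    (hl : 0 < l) (n : ℕ) {w : Y → ℝ} (hw : Integrable w ν) {F : ℝ → Y → ℝ}
    (hF : AEStronglyMeasurable (Function.uncurry F) ((volume.restrict (Ioo 0 l)).prod ν))
    (hC : ∀ᵐ p ∂((volume.restrict (Ioo 0 l)).prod ν), |Function.uncurry F p| ≤ C) :
    sineCoeff l n (fun x => ∫ y, w y * F x y ∂ν) = ∫ y, w y * sineCoeff l n (fun x => F x y) ∂ν := by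
  set μ : Measure ℝ := volume.restrict (Ioo 0 l) with hμ
  have hi : Integrable (Function.uncurry fun x y => w y * F x y * mode l n x) (μ.prod ν) := by
    refine Integrable.mono' ((hw.norm.mul_const C).comp_snd μ) ?_ ?_
    · exact ((hw.aestronglyMeasurable.comp_snd).mul hF).mul
        ((continuous_mode l n).measurable.comp measurable_fst).aestronglyMeasurable
    · filter_upwards [hC] with p hp
      simp only [Function.uncurry] at hp ⊢
      rw [norm_mul, norm_mul]
      exact (mul_le_of_le_one_right (by positivity) (abs_mode_le l n p.1)).trans
        (mul_le_mul_of_nonneg_left hp (norm_nonneg _))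
  have hs := integral_integral_swap hi
  rw [sineCoeff, integral_eq_Ioo hl.le]
  simp only [← integral_mul_const]
  rw [hs, ← integral_const_mul]
  refine integral_congr_ae (Eventually.of_forall fun y => ?_)
  simp only [sineCoeff]
  rw [integral_eq_Ioo hl.le]
  have : ∀ x, w y * F x y * mode l n x = w y * (F x y * mode l n x) := fun x => by ring
  simp only [this]
  rw [integral_const_mul]
  ring

/-- A forcing term on `[0, l] × [0, T]`, vanishing at `x = 0, l`, with time derivative `gt` and sine
coefficients of size `M / λ_n`. -/
structure Forcing (l T M : ℝ) (g gt : ℝ → ℝ → ℝ) : Prop where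
  cont : ContinuousOn (fun p : ℝ × ℝ => g p.1 p.2) (Icc 0 l ×ˢ Icc 0 T)
  cont_t : ContinuousOn (fun p : ℝ × ℝ => gt p.1 p.2) (Icc 0 l ×ˢ Icc 0 T)
  zero_left : ∀ t ∈ Icc 0 T, g 0 t = 0
  zero_right : ∀ t ∈ Icc 0 T, g l t = 0
  t_zero_left : ∀ t ∈ Icc 0 T, gt 0 t = 0
  t_zero_right : ∀ t ∈ Icc 0 T, gt l t = 0
  coeff_primitive : ∀ n, ∀ t ∈ Icc 0 T, sineCoeff l n (fun x => g x t) =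
    sineCoeff l n (fun x => g x 0) + ∫ s in (0 : ℝ)..t, sineCoeff l n (fun x => gt x s)
  coeff_le : ∀ n, ∀ t ∈ Icc 0 T, |sineCoeff l (n + 1) (fun x => g x t)| ≤ M / eig l (n + 1)
  t_le : ∀ x ∈ Icc 0 l, ∀ t ∈ Icc 0 T, |gt x t| ≤ M

lemma continuousOn_sineCoeff {l T : ℝ} (hl : 0 < l) {g : ℝ → ℝ → ℝ}
    (hg : ContinuousOn (fun p : ℝ × ℝ => g p.1 p.2) (Icc 0 l ×ˢ Icc 0 T)) (n : ℕ) :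
    ContinuousOn (fun t => sineCoeff l n (fun x => g x t)) (Icc 0 T) := by
  obtain ⟨M, hM⟩ := (isCompact_Icc.prod isCompact_Icc).exists_bound_of_continuousOn hg
  unfold sineCoeff
  refine continuousOn_const.mul fun t₀ ht₀ => ?_
  refine intervalIntegral.continuousWithinAt_of_dominated_interval (bound := fun _ => M)
    ?_ ?_ (by simp) ?_
  · filter_upwards [self_mem_nhdsWithin] with t ht
    rw [uIoc_of_le hl.le]
    refine (ContinuousOn.mul ?_ (continuous_mode l n).continuousOn).aestronglyMeasurable
      measurableSet_Ioc
    exact hg.comp (f := fun x : ℝ => ((x, t) : ℝ × ℝ)) (by fun_prop)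
      fun x hx => ⟨Ioc_subset_Icc_self hx, ht⟩
  · filter_upwards [self_mem_nhdsWithin] with t ht
    refine Eventually.of_forall fun x hx => ?_
    rw [uIoc_of_le hl.le] at hx
    rw [norm_mul]
    exact (mul_le_of_le_one_right (norm_nonneg _) (abs_mode_le l n x)).trans
      (hM (x, t) ⟨Ioc_subset_Icc_self hx, ht⟩)
  · refine Eventually.of_forall fun x hx => ?_
    rw [uIoc_of_le hl.le] at hx
    refine ContinuousWithinAt.mul ?_ continuousWithinAt_const
    exact (hg.comp (f := fun t : ℝ => ((x, t) : ℝ × ℝ)) (by fun_prop)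
      fun t ht => ⟨Ioc_subset_Icc_self hx, ht⟩) t₀ ht₀

lemma XPowBdd.of_continuousOn {l T : ℝ} {g : ℝ → ℝ → ℝ}
    (hg : ContinuousOn (fun p : ℝ × ℝ => g p.1 p.2) (Icc 0 l ×ˢ Icc 0 T)) : XPowBdd l T 1 g := by
  obtain ⟨M, hM⟩ := (isCompact_Icc.prod isCompact_Icc).exists_bound_of_continuousOn hg
  refine ⟨hg.mono (prod_mono_right Ioc_subset_Icc_self), M, fun x hx t ht => ?_⟩
  have := hM (x, t) ⟨hx, Ioc_subset_Icc_self ht⟩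
  simpa using this

lemma tendsto_ends {l : ℝ} (hl : 0 < l) {q : ℝ → ℝ} (hq : ContinuousOn q (Icc 0 l)) (h0 : q 0 = 0)
    (h1 : q l = 0) : Tendsto q (𝓝[>] 0) (𝓝 0) ∧ Tendsto q (𝓝[<] l) (𝓝 0) := by
  constructor
  · have := hq 0 ⟨le_rfl, hl.le⟩
    unfold ContinuousWithinAt at this
    rw [h0] at this
    refine this.mono_left (nhdsWithin_le_iff.2 ?_)
    filter_upwards [Ioo_mem_nhdsGT hl] with x hx using Ioo_subset_Icc_self hx
  · have := hq l ⟨hl.le, le_rfl⟩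
    unfold ContinuousWithinAt at this
    rw [h1] at this
    refine this.mono_left (nhdsWithin_le_iff.2 ?_)
    filter_upwards [Ioo_mem_nhdsLT hl] with x hx using Ioo_subset_Icc_self hx

section Smooth
variable {l T : ℝ} {g gx gxx gt : ℝ → ℝ → ℝ}

lemma eq_primitive_of_hasDerivAt (hl : 0 < l) (hT : 0 < T)
    (hg : ContinuousOn (fun p : ℝ × ℝ => g p.1 p.2) (Icc 0 l ×ˢ Icc 0 T))
    (hgt : ContinuousOn (fun p : ℝ × ℝ => gt p.1 p.2) (Icc 0 l ×ˢ Icc 0 T))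
    (hd : ∀ x ∈ Ioo 0 l, ∀ t ∈ Ioo 0 T, HasDerivAt (fun s => g x s) (gt x t) t) :
    ∀ x ∈ Icc 0 l, ∀ t ∈ Icc 0 T, g x t = g x 0 + ∫ s in (0 : ℝ)..t, gt x s := by
  have hinteg : ∀ x ∈ Ioo 0 l, ∀ t ∈ Icc 0 T, g x t = g x 0 + ∫ s in (0 : ℝ)..t, gt x s := by
    intro x hx t ht
    have hxI := Ioo_subset_Icc_self hx
    rw [intervalIntegral.integral_eq_sub_of_hasDerivAt_of_le (f := fun s => g x s) ht.1]
    · ring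
    · exact hg.comp (f := fun s : ℝ => ((x, s) : ℝ × ℝ)) (by fun_prop)
        fun s hs => ⟨hxI, ⟨hs.1, hs.2.trans ht.2⟩⟩
    · exact fun s hs => hd x hx s ⟨hs.1, hs.2.trans_le ht.2⟩
    · refine ContinuousOn.intervalIntegrable ?_
      rw [uIcc_of_le ht.1]
      exact hgt.comp (f := fun s : ℝ => ((x, s) : ℝ × ℝ)) (by fun_prop)
        fun s hs => ⟨hxI, ⟨hs.1, hs.2.trans ht.2⟩⟩
  intro x hx t ht
  rcases ht.1.eq_or_lt with rfl | ht0
  · simp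
  have hc1 : ContinuousOn (fun x => g x t) (Icc 0 l) :=
    hg.comp (f := fun x : ℝ => ((x, t) : ℝ × ℝ)) (by fun_prop) fun x hx => ⟨hx, ht⟩
  have hc0 : ContinuousOn (fun x => g x 0) (Icc 0 l) :=
    hg.comp (f := fun x : ℝ => ((x, 0) : ℝ × ℝ)) (by fun_prop)
      fun x hx => ⟨hx, ⟨le_rfl, hT.le⟩⟩
  have hc2 := (XPowBdd.of_continuousOn hgt).continuousOn_leftInt zero_le_one one_pos
    (⟨ht0, ht.2⟩ : t ∈ Ioc 0 T)
  simp only [leftInt_one] at hc2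
  have hcl : closure (Ioo 0 l) = Icc 0 l := closure_Ioo hl.ne
  exact Set.EqOn.of_subset_closure (s := Ioo 0 l) (fun x hx => hinteg x hx t ht) hc1
    (hc0.add hc2) Ioo_subset_Icc_self hcl.symm.subset hx

/-- A function vanishing for all times has vanishing time derivative. Applied at x = 0 and x = l,
this gives ∂_t g the boundary values that make its odd extension continuous. -/
lemma timeDeriv_eq_zero (hT : 0 < T) {q qt : ℝ → ℝ} (hqt : ContinuousOn qt (Icc 0 T))
    (h0 : ∀ t ∈ Icc 0 T, q t = 0) (hp : ∀ t ∈ Icc 0 T, q t = q 0 + ∫ s in (0 : ℝ)..t, qt s) :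
    ∀ t ∈ Icc 0 T, qt t = 0 := by
  have hz : ∀ t ∈ Ioo 0 T, qt t = 0 := by
    intro t ht
    have h1 := hasDerivAt_integral_of_powBdd one_pos (powBdd_of_continuousOn hqt) ht
    have h2 : (fun t => ∫ s in (0 : ℝ)..t, qt s) =ᶠ[𝓝 t] fun _ => 0 := by
      filter_upwards [isOpen_Ioo.mem_nhds ht] with s hs
      have := hp s (Ioo_subset_Icc_self hs)
      rw [h0 s (Ioo_subset_Icc_self hs), h0 0 ⟨le_rfl, hT.le⟩] at this
      linarith
    exact (h1.congr_of_eventuallyEq h2.symm).unique (hasDerivAt_const t 0)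
  exact Set.EqOn.of_subset_closure (s := Ioo 0 T) hz hqt continuousOn_const Ioo_subset_Icc_self
    (closure_Ioo hT.ne).symm.subset

/-- The bound M / λ_n comes from g_xx by two integrations by parts at interior times and passes to t
= 0 and t = T by continuity. For ∂_t g only a sup bound is recorded. -/
lemma forcing_of_smooth (hl : 0 < l) (hT : 0 < T)
    (hg : ContinuousOn (fun p : ℝ × ℝ => g p.1 p.2) (Icc 0 l ×ˢ Icc 0 T))
    (hgxx : ContinuousOn (fun p : ℝ × ℝ => gxx p.1 p.2) (Icc 0 l ×ˢ Icc 0 T))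
    (hgt : ContinuousOn (fun p : ℝ × ℝ => gt p.1 p.2) (Icc 0 l ×ˢ Icc 0 T))
    (hd : ∀ x ∈ Ioo 0 l, ∀ t ∈ Ioo 0 T, HasDerivAt (fun y => g y t) (gx x t) x ∧
      HasDerivAt (fun y => gx y t) (gxx x t) x ∧ HasDerivAt (fun s => g x s) (gt x t) t)
    (h0 : ∀ t ∈ Icc 0 T, g 0 t = 0) (h1 : ∀ t ∈ Icc 0 T, g l t = 0) :
    ∃ M, 0 ≤ M ∧ Forcing l T M g gt := by
  have hp := eq_primitive_of_hasDerivAt hl hT hg hgt fun x hx t ht => (hd x hx t ht).2.2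
  obtain ⟨M₁, hM₁⟩ := (isCompact_Icc.prod isCompact_Icc).exists_bound_of_continuousOn hgxx
  obtain ⟨M₂, hM₂⟩ := (isCompact_Icc.prod isCompact_Icc).exists_bound_of_continuousOn hgt
  have hsl : ∀ {q : ℝ → ℝ → ℝ}, ContinuousOn (fun p : ℝ × ℝ => q p.1 p.2) (Icc 0 l ×ˢ Icc 0 T) →
      ∀ {x}, x ∈ Icc 0 l → ContinuousOn (q x) (Icc 0 T) := fun hq x hx =>
    hq.comp (f := fun s : ℝ => ((x, s) : ℝ × ℝ)) (by fun_prop) fun s hs => ⟨hx, hs⟩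
  have hsx : ∀ {q : ℝ → ℝ → ℝ}, ContinuousOn (fun p : ℝ × ℝ => q p.1 p.2) (Icc 0 l ×ˢ Icc 0 T) →
      ∀ {t}, t ∈ Icc 0 T → ContinuousOn (fun x => q x t) (Icc 0 l) := fun hq t ht =>
    hq.comp (f := fun x : ℝ => ((x, t) : ℝ × ℝ)) (by fun_prop) fun s hs => ⟨hs, ht⟩
  have hm0 : (0 : ℝ) ∈ Icc 0 l := ⟨le_rfl, hl.le⟩
  have hml : l ∈ Icc 0 l := ⟨hl.le, le_rfl⟩
  have hM₁0 : 0 ≤ M₁ := (norm_nonneg _).trans (hM₁ (0, 0) ⟨hm0, ⟨le_rfl, hT.le⟩⟩)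
  have hM₂0 : 0 ≤ M₂ := (norm_nonneg _).trans (hM₂ (0, 0) ⟨hm0, ⟨le_rfl, hT.le⟩⟩)
  refine ⟨2 * M₁ + M₂, by positivity, hg, hgt, h0, h1, timeDeriv_eq_zero hT (hsl hgt hm0) h0 (hp 0 hm0),
    timeDeriv_eq_zero hT (hsl hgt hml) h1 (hp l hml), ?_, ?_, ?_⟩
  · intro n t ht
    rcases ht.1.eq_or_lt with rfl | ht0
    · simp
    have htI : t ∈ Ioc 0 T := ⟨ht0, ht.2⟩
    have hX := XPowBdd.of_continuousOn hgt
    have e := hX.sineCoeff_leftInt hl zero_le_one one_pos htI n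
    have hc := hX.continuousOn_leftInt zero_le_one one_pos htI
    simp only [leftInt_one] at e hc
    have hu : uIcc 0 l = Icc 0 l := uIcc_of_le hl.le
    rw [← e, ← sineCoeff_add n
      (ContinuousOn.intervalIntegrable (by rw [hu]; exact hsx hg ⟨le_rfl, hT.le⟩))
      (ContinuousOn.intervalIntegrable (by rw [hu]; exact hc))]
    exact sineCoeff_congr hl n fun x hx => hp x (Ioo_subset_Icc_self hx) t ht
  · intro n
    have hI : ∀ t ∈ Ioo 0 T, |sineCoeff l (n + 1) (fun x => g x t)| ≤
        (2 * M₁ + M₂) / eig l (n + 1) := by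
      intro t ht
      have htI := Ioo_subset_Icc_self ht
      have hcg := hsx hg htI
      obtain ⟨hlim0, hliml⟩ := tendsto_ends hl hcg (h0 t htI) (h1 t htI)
      have hb : ∀ x ∈ Ioo 0 l, |gxx x t| ≤ M₁ := fun x hx =>
        hM₁ (x, t) ⟨Ioo_subset_Icc_self hx, htI⟩
      have e := sineCoeff_second_deriv hl (n + 1) (fun x hx => (hd x hx t ht).1)
        (fun x hx => (hd x hx t ht).2.1) hlim0 hliml
        ((hsx hgxx htI).mono Ioo_subset_Icc_self) hb
      have hle := abs_sineCoeff_le hl (n + 1) hb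
      rw [e, neg_mul, abs_neg, abs_mul, abs_of_pos (eig_pos hl n)] at hle
      rw [le_div_iff₀ (eig_pos hl n), mul_comm]
      linarith
    have hc : ContinuousOn (fun t => |sineCoeff l (n + 1) (fun x => g x t)|) (Icc 0 T) :=
      (continuousOn_sineCoeff hl hg (n + 1)).abs
    intro t ht
    have hcl : t ∈ closure (Ioo 0 T) := by rw [closure_Ioo hT.ne]; exact ht
    exact ContinuousWithinAt.closure_le hcl ((hc t ht).mono Ioo_subset_Icc_self)
      continuousWithinAt_const hI
  · intro x hx t ht
    have := hM₂ (x, t) ⟨hx, ht⟩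
    rw [Real.norm_eq_abs] at this
    simp only at this
    linarith

end Smooth

section ForcingLemmas
variable {l T M : ℝ} {g gt : ℝ → ℝ → ℝ}

lemma Forcing.t_coeff_le (h : Forcing l T M g gt) (hl : 0 < l) (n : ℕ) {t : ℝ}
    (ht : t ∈ Icc 0 T) : |sineCoeff l n (fun x => gt x t)| ≤ 2 * M :=
  abs_sineCoeff_le hl n fun x hx => h.t_le x (Ioo_subset_Icc_self hx) t ht

lemma Forcing.continuousOn_left (h : Forcing l T M g gt) {t : ℝ} (ht : t ∈ Icc 0 T) :
    ContinuousOn (fun x => g x t) (Icc 0 l) :=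
  h.cont.comp (f := fun x : ℝ => ((x, t) : ℝ × ℝ)) (by fun_prop) fun s hs => ⟨hs, ht⟩

lemma Forcing.powBdd_coeff (h : Forcing l T M g gt) (hl : 0 < l) (n : ℕ) :
    PowBdd T 1 (fun t => sineCoeff l n (fun x => g x t)) :=
  powBdd_of_continuousOn (continuousOn_sineCoeff hl h.cont n)

lemma Forcing.powBdd_t_coeff (h : Forcing l T M g gt) (hl : 0 < l) (n : ℕ) :
    PowBdd T 1 (fun t => sineCoeff l n (fun x => gt x t)) :=
  powBdd_of_continuousOn (continuousOn_sineCoeff hl h.cont_t n)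

/-- The time-integrated source with an integrable Mittag-Leffler kernel, as an absolutely convergent
series. -/
lemma Forcing.exists_source_series (h : Forcing l T M g gt) (hl : 0 < l)
    {δ b : ℝ} (hδ : 0 < δ) (hδ2 : δ < 2) (hb : 3 / 4 * δ < b) (hb1 : b < δ + 1) :
    ∃ H : ℝ → ℝ → ℝ, XPowBdd l T (b - 3 / 4 * δ + 1) H ∧ (∀ t, H 0 t = 0 ∧ H l t = 0) ∧
      ∀ n, ∀ t ∈ Ioc 0 T, sineCoeff l (n + 1) (fun x => H x t) =
        conv (mlKer δ (eig l (n + 1)) b) (fun s => sineCoeff l (n + 1) (fun x => gt x s)) t := by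
  have hb0 : 0 < b := by linarith
  obtain ⟨C, hC0, hC⟩ := exists_abs_mlKer_le hδ hδ2 hb0 hb1
  set k : ℕ → ℝ → ℝ := fun n => conv (mlKer δ (eig l (n + 1)) b)
    (fun s => sineCoeff l (n + 1) (fun x => gt x s)) with hk
  have hkc : ∀ n, ContinuousOn (k n) (Ioc 0 T) := fun n =>
    ((powBdd_mlKer T (eig l (n + 1)) hδ hb0).conv hb0 one_pos (h.powBdd_t_coeff hl (n + 1))).1
  -- The decay estimate with θ = 3/4: since λ_n grows like n², λ_n^{-3/4} is summable although the
  -- coefficients of ∂_t g are merely bounded, and b > 3δ/4 keeps the time singularity integrable.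
  have ha : Summable fun n : ℕ =>
      C * eig l (n + 1) ^ (-(3 / 4 : ℝ)) * (2 * M) * betaC (b - δ * (3 / 4)) 1 :=
    (((summable_eig_rpow hl (by norm_num : (1 / 2 : ℝ) < 3 / 4)).mul_left C).mul_right _).mul_right _
  have hbd : ∀ n, ∀ t ∈ Ioc 0 T, |k n t| ≤
      C * eig l (n + 1) ^ (-(3 / 4 : ℝ)) * (2 * M) * betaC (b - δ * (3 / 4)) 1 *
        t ^ (b - 3 / 4 * δ + 1 - 1) := by
    intro n t ht
    have := abs_conv_le (a := b - δ * (3 / 4)) (b := 1) (by linarith) one_pos ht.1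
      (p := mlKer δ (eig l (n + 1)) b) (k := fun s => sineCoeff l (n + 1) (fun x => gt x s))
      (A := C * eig l (n + 1) ^ (-(3 / 4 : ℝ))) (B := 2 * M)
      (fun s hs => hC _ _ s (eig_pos hl n) (by norm_num) (by norm_num) hs.1)
      (fun s hs => by
        rw [sub_self, Real.rpow_zero, mul_one]
        exact h.t_coeff_le hl (n + 1) ⟨hs.1.le, hs.2.le.trans ht.2⟩)
    convert this using 3
    ring
  refine ⟨fun x t => ∑' n, k n t * mode l (n + 1) x, xPowBdd_tsum hkc ha hbd,
    fun t => ⟨tsum_mode_zero _, tsum_mode_end hl _⟩, fun n t ht => ?_⟩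
  exact sineCoeff_tsum hl (summable_abs_of_bound ha hbd ht) n

end ForcingLemmas

/-! ### Sources for weakly decaying kernels, by averaging translates -/

/-- The source with a cosine kernel `Φ`: average over `y` of odd periodic translates by `± r y`. -/
noncomputable def cosAverage (l : ℝ) (Φ : ℝ → ℝ) (q : ℝ → ℝ → ℝ) (x r s : ℝ) : ℝ :=
  ∫ y in Ioi (0 : ℝ), Φ y *
    ((oddExt l (fun z => q z s) (x - r * y) + oddExt l (fun z => q z s) (x + r * y)) / 2)

section CosAverage
variable {l T M : ℝ} {Φ : ℝ → ℝ} {q : ℝ → ℝ → ℝ}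

lemma abs_half_oddExt_le (hl : 0 < l) (hM : ∀ x ∈ Icc 0 l, ∀ s ∈ Icc 0 T, |q x s| ≤ M) {s : ℝ}
    (hs : s ∈ Icc 0 T) (y z : ℝ) :
    |(oddExt l (fun z => q z s) y + oddExt l (fun z => q z s) z) / 2| ≤ M := by
  have h1 := abs_oddExt_le hl (fun x hx => hM x hx s hs) y
  have h2 := abs_oddExt_le hl (fun x hx => hM x hx s hs) z
  rw [abs_le] at h1 h2 ⊢
  constructor <;> linarith [h1.1, h1.2, h2.1, h2.2]

lemma continuousOn_cosAverage (hl : 0 < l) (hΦ : IntegrableOn Φ (Ioi 0))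
    (hq : ContinuousOn (fun p : ℝ × ℝ => q p.1 p.2) (Icc 0 l ×ˢ Icc 0 T))
    (h0 : ∀ s ∈ Icc 0 T, q 0 s = 0) (h1 : ∀ s ∈ Icc 0 T, q l s = 0)
    (hM : ∀ x ∈ Icc 0 l, ∀ s ∈ Icc 0 T, |q x s| ≤ M) :
    ContinuousOn (fun p : ℝ × ℝ × ℝ => cosAverage l Φ q p.1 p.2.1 p.2.2)
      (univ ×ˢ univ ×ˢ Icc 0 T) := by
  have hQ := continuousOn_oddExt hl hq h0 h1
  have hQs : ∀ s ∈ Icc 0 T, Continuous (oddExt l fun z => q z s) := fun s hs =>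
    continuous_oddExt hl (hq.comp (f := fun x : ℝ => ((x, s) : ℝ × ℝ)) (by fun_prop)
      fun x hx => ⟨hx, hs⟩) (h0 s hs) (h1 s hs)
  unfold cosAverage
  refine continuousOn_of_dominated (bound := fun y => ‖Φ y‖ * M) ?_ ?_ (hΦ.norm.mul_const M) ?_
  · intro p hp
    refine hΦ.aestronglyMeasurable.mul (Continuous.aestronglyMeasurable ?_)
    have := hQs p.2.2 hp.2.2
    exact ((this.comp (by fun_prop)).add (this.comp (by fun_prop))).div_const 2
  · intro p hp
    refine Eventually.of_forall fun y => ?_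
    rw [norm_mul]
    exact mul_le_mul_of_nonneg_left (abs_half_oddExt_le hl hM hp.2.2 _ _) (norm_nonneg _)
  · refine Eventually.of_forall fun y => continuousOn_const.mul (ContinuousOn.div_const ?_ 2)
    refine ContinuousOn.add ?_ ?_
    · exact hQ.comp (f := fun p : ℝ × ℝ × ℝ => ((p.1 - p.2.1 * y, p.2.2) : ℝ × ℝ)) (by fun_prop)
        fun p hp => ⟨mem_univ _, hp.2.2⟩
    · exact hQ.comp (f := fun p : ℝ × ℝ × ℝ => ((p.1 + p.2.1 * y, p.2.2) : ℝ × ℝ)) (by fun_prop)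
        fun p hp => ⟨mem_univ _, hp.2.2⟩

lemma abs_cosAverage_le (hl : 0 < l) (hΦ : IntegrableOn Φ (Ioi 0))
    (hM : ∀ x ∈ Icc 0 l, ∀ s ∈ Icc 0 T, |q x s| ≤ M) {s : ℝ} (hs : s ∈ Icc 0 T) (x r : ℝ) :
    |cosAverage l Φ q x r s| ≤ (∫ y in Ioi (0 : ℝ), ‖Φ y‖) * M := by
  unfold cosAverage
  rw [← integral_mul_const, ← Real.norm_eq_abs]
  refine norm_integral_le_of_norm_le (hΦ.norm.mul_const M) (Eventually.of_forall fun y => ?_)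
  rw [norm_mul]
  exact mul_le_mul_of_nonneg_left (abs_half_oddExt_le hl hM hs _ _) (norm_nonneg _)

lemma cosAverage_zero (r s : ℝ) : cosAverage l Φ q 0 r s = 0 := by
  unfold cosAverage
  simp [oddExt_neg]

lemma cosAverage_end (hl : 0 < l) (r s : ℝ) : cosAverage l Φ q l r s = 0 := by
  unfold cosAverage
  have : ∀ y, oddExt l (fun z => q z s) (l + r * y) = -oddExt l (fun z => q z s) (l - r * y) := by
    intro y
    rw [← oddExt_neg, ← oddExt_periodic hl _ (-(l - r * y))]
    congr 1; ring
  simp [this]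

lemma sineCoeff_cosAverage (hl : 0 < l) (hΦ : IntegrableOn Φ (Ioi 0))
    (hq : ContinuousOn (fun p : ℝ × ℝ => q p.1 p.2) (Icc 0 l ×ˢ Icc 0 T))
    (h0 : ∀ s ∈ Icc 0 T, q 0 s = 0) (h1 : ∀ s ∈ Icc 0 T, q l s = 0)
    (hM : ∀ x ∈ Icc 0 l, ∀ s ∈ Icc 0 T, |q x s| ≤ M) (n : ℕ) {s : ℝ} (hs : s ∈ Icc 0 T) (r : ℝ) :
    sineCoeff l n (fun x => cosAverage l Φ q x r s) =
      (∫ y in Ioi (0 : ℝ), Φ y * Real.cos ((n * Real.pi / l * r) * y)) *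
        sineCoeff l n (fun x => q x s) := by
  have hqs : ContinuousOn (fun x => q x s) (Icc 0 l) :=
    hq.comp (f := fun x : ℝ => ((x, s) : ℝ × ℝ)) (by fun_prop) fun x hx => ⟨hx, hs⟩
  have hQs : Continuous (oddExt l fun z => q z s) := continuous_oddExt hl hqs (h0 s hs) (h1 s hs)
  unfold cosAverage
  rw [sineCoeff_integral (C := M) hl n hΦ
    (F := fun x y => (oddExt l (fun z => q z s) (x - r * y) +
      oddExt l (fun z => q z s) (x + r * y)) / 2)
    (Continuous.aestronglyMeasurable (by
      unfold Function.uncurry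
      exact ((hQs.comp (by fun_prop)).add (hQs.comp (by fun_prop))).div_const 2))
    (Eventually.of_forall fun p => abs_half_oddExt_le hl hM hs _ _), ← integral_mul_const]
  refine integral_congr_ae (Eventually.of_forall fun y => ?_)
  simp only []
  rw [integral_oddExt_shift hl hqs (h0 s hs) (h1 s hs) n (r * y)]
  ring_nf

end CosAverage

/-- The time-integrated source with a merely weakly decaying Mittag-Leffler kernel, built from the
cosine representation of the kernel. -/
lemma Forcing.exists_source_kernel {l T M : ℝ} {g gt : ℝ → ℝ → ℝ} (h : Forcing l T M g gt)
    (hl : 0 < l) {δ b : ℝ} (hδ : 0 < δ) (hδ2 : δ < 2) (hb : 0 < b) (hb1 : b < 1) :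
    ∃ H : ℝ → ℝ → ℝ, XPowBdd l T (b + 1) H ∧ (∀ t, H 0 t = 0 ∧ H l t = 0) ∧
      ∀ n, ∀ t ∈ Ioc 0 T, sineCoeff l (n + 1) (fun x => H x t) =
        conv (mlKer δ (eig l (n + 1)) b) (fun s => sineCoeff l (n + 1) (fun x => gt x s)) t := by
  obtain ⟨Φ, hΦ, hΦc⟩ := exists_cosine_kernel hδ hδ2 hb hb1
  have hJc := continuousOn_cosAverage hl hΦ h.cont_t h.t_zero_left h.t_zero_right h.t_le
  have hJb := fun {s} hs x r => abs_cosAverage_le (s := s) hl hΦ h.t_le hs x r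
  set B : ℝ := (∫ y in Ioi (0 : ℝ), ‖Φ y‖) * M with hB
  have hw : Integrable (fun σ : ℝ => (1 - σ) ^ (b - 1)) (volume.restrict (Ioo 0 1)) := by
    have := (powBdd_rpow 1 b).intervalIntegrable_conv hb one_pos one_pos
      (powBdd_of_continuousOn (g := fun _ => (1 : ℝ)) continuousOn_const)
    have := (intervalIntegrable_iff_Ioo zero_le_one).1 this
    simp only [mul_one] at this
    exact this
  have hmem : ∀ {t : ℝ}, t ∈ Ioc 0 T → ∀ {σ : ℝ}, σ ∈ Ioo (0 : ℝ) 1 → t * σ ∈ Icc 0 T :=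
    fun {t} ht {σ} hσ => ⟨(mul_pos ht.1 hσ.1).le,
      (mul_le_of_le_one_right ht.1.le hσ.2.le).trans ht.2⟩
  -- The convolution rescaled to σ in (0, 1). At time t(1-σ) the kernel is a power times E(-λ_n r²)
  -- with r = (t(1-σ))^{δ/2}, that is ∫ Φ(y) cos(√λ_n r y) dy, which is the multiplier realised by
  -- `cosAverage`.
  set I : ℝ → ℝ → ℝ := fun x t => ∫ σ in Ioo (0 : ℝ) 1, (1 - σ) ^ (b - 1) *
    cosAverage l Φ gt x ((t * (1 - σ)) ^ (δ / 2)) (t * σ) with hI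
  have hδ' : 0 ≤ δ / 2 := by positivity
  refine ⟨fun x t => t ^ b * I x t, ⟨?_, ?_⟩, fun t => ⟨?_, ?_⟩, ?_⟩
  · refine ContinuousOn.mul (fun p hp => (ContinuousAt.rpow_const continuousAt_snd
      (Or.inl hp.2.1.ne')).continuousWithinAt) ?_
    refine continuousOn_of_dominated (bound := fun σ => ‖(1 - σ) ^ (b - 1)‖ * B) ?_ ?_
      (hw.norm.mul_const B) ?_
    · intro p hp
      refine hw.aestronglyMeasurable.mul ?_
      refine ContinuousOn.aestronglyMeasurable ?_ measurableSet_Ioo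
      exact hJc.comp (f := fun σ : ℝ =>
        ((p.1, (p.2 * (1 - σ)) ^ (δ / 2), p.2 * σ) : ℝ × ℝ × ℝ))
        (Continuous.continuousOn (continuous_const.prodMk
          (((by fun_prop : Continuous fun σ : ℝ => p.2 * (1 - σ)).rpow_const
            fun _ => Or.inr hδ').prodMk (by fun_prop))))
        fun σ hσ => ⟨mem_univ _, mem_univ _, hmem hp.2 hσ⟩
    · intro p hp
      filter_upwards [ae_restrict_mem measurableSet_Ioo] with σ hσ
      rw [norm_mul]
      exact mul_le_mul_of_nonneg_left (hJb (hmem hp.2 hσ) _ _) (norm_nonneg _)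
    · filter_upwards [ae_restrict_mem measurableSet_Ioo] with σ hσ
      refine continuousOn_const.mul ?_
      exact hJc.comp (f := fun p : ℝ × ℝ =>
        ((p.1, (p.2 * (1 - σ)) ^ (δ / 2), p.2 * σ) : ℝ × ℝ × ℝ))
        (Continuous.continuousOn (continuous_fst.prodMk
          (((by fun_prop : Continuous fun p : ℝ × ℝ => p.2 * (1 - σ)).rpow_const
            fun _ => Or.inr hδ').prodMk (by fun_prop))))
        fun p hp => ⟨mem_univ _, mem_univ _, hmem hp.2 hσ⟩
  · refine ⟨∫ σ in Ioo (0 : ℝ) 1, ‖(1 - σ) ^ (b - 1)‖ * B, fun x _ t ht => ?_⟩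
    rw [abs_mul, abs_of_nonneg (Real.rpow_nonneg ht.1.le _), mul_comm, add_sub_cancel_right]
    refine mul_le_mul_of_nonneg_right ?_ (Real.rpow_nonneg ht.1.le _)
    rw [← Real.norm_eq_abs]
    refine norm_integral_le_of_norm_le (hw.norm.mul_const B) ?_
    filter_upwards [ae_restrict_mem measurableSet_Ioo] with σ hσ
    rw [norm_mul]
    exact mul_le_mul_of_nonneg_left (hJb (hmem ht hσ) _ _) (norm_nonneg _)
  · simp [hI, cosAverage_zero]
  · simp [hI, cosAverage_end hl]
  · intro n t ht
    rw [sineCoeff_const_mul, hI]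
    simp only []
    rw [sineCoeff_integral (C := B) hl (n + 1) hw, conv_scaled, integral_eq_Ioo zero_le_one]
    · have ht1 : t ^ b = t * t ^ (b - 1) := by
        rw [← Real.rpow_one_add' ht.1.le (by linarith)]; ring_nf
      rw [ht1, mul_assoc, ← integral_const_mul]
      congr 1
      refine setIntegral_congr_fun measurableSet_Ioo fun σ hσ => ?_
      have h1σ : 0 < 1 - σ := by linarith [hσ.2]
      have hr : 0 < t * (1 - σ) := mul_pos ht.1 h1σ
      rw [sineCoeff_cosAverage hl hΦ h.cont_t h.t_zero_left h.t_zero_right h.t_le (n + 1)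
        (hmem ht hσ), hΦc _ (by positivity), mlKer, Real.mul_rpow ht.1.le h1σ.le (z := b - 1), mul_pow,
        ← eig_eq, ← Real.rpow_natCast ((t * (1 - σ)) ^ (δ / 2)) 2, ← Real.rpow_mul hr.le]
      rw [show δ / 2 * ((2 : ℕ) : ℝ) = δ by push_cast; ring, neg_mul]
      ring
    · rw [Measure.prod_restrict]
      refine ContinuousOn.aestronglyMeasurable ?_ (measurableSet_Ioo.prod measurableSet_Ioo)
      exact hJc.comp (f := fun p : ℝ × ℝ =>
        ((p.1, (t * (1 - p.2)) ^ (δ / 2), t * p.2) : ℝ × ℝ × ℝ))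
        (Continuous.continuousOn (continuous_fst.prodMk
          (((by fun_prop : Continuous fun p : ℝ × ℝ => t * (1 - p.2)).rpow_const
            fun _ => Or.inr hδ').prodMk (by fun_prop))))
        fun p hp => ⟨mem_univ _, mem_univ _, hmem ht hp.2⟩
    · rw [Measure.prod_restrict]
      filter_upwards [ae_restrict_mem (measurableSet_Ioo.prod measurableSet_Ioo)] with p hp
      exact hJb (hmem ht hp.2) _ _

/-! ### Sine series that may be differentiated twice in x -/

/-- The time coefficients `k n` are such that `t^κ k n` extends continuously to `[0, T]`, with
`∑ λ_n sup |t^κ k n| < ∞`. -/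
def SineField (l T κ : ℝ) (k : ℕ → ℝ → ℝ) : Prop :=
  ∃ (K : ℕ → ℝ → ℝ) (a : ℕ → ℝ), (∀ n, ContinuousOn (K n) (Icc 0 T)) ∧
    (Summable fun n => eig l (n + 1) * a n) ∧ (∀ n, ∀ t ∈ Icc 0 T, |K n t| ≤ a n) ∧
    ∀ n, ∀ t ∈ Ioc 0 T, t ^ κ * k n t = K n t

section SineField
variable {l T κ : ℝ} {k k' : ℕ → ℝ → ℝ}

lemma SineField.add (h : SineField l T κ k) (h' : SineField l T κ k') :
    SineField l T κ (fun n t => k n t + k' n t) := by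
  obtain ⟨K, a, hK, ha, hb, he⟩ := h
  obtain ⟨K', a', hK', ha', hb', he'⟩ := h'
  refine ⟨fun n t => K n t + K' n t, fun n => a n + a' n, fun n => (hK n).add (hK' n),
    (ha.add ha').congr fun n => (mul_add _ _ _).symm, fun n t ht => ?_, fun n t ht => ?_⟩
  · exact (abs_add_le _ _).trans (add_le_add (hb n t ht) (hb' n t ht))
  · rw [mul_add, he n t ht, he' n t ht]

lemma summable_of_eig_mul {a : ℕ → ℝ} (hl : 0 < l) (h0 : ∀ n, 0 ≤ a n)
    (ha : Summable fun n => eig l (n + 1) * a n) : Summable a := by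
  have := summable_eig_mul_imp hl (c := a) (ha.congr fun n => by rw [abs_of_nonneg (h0 n)])
  exact this.congr fun n => abs_of_nonneg (h0 n)

/-- The data needed for differentiating twice in `x`. -/
lemma SineField.laplacian (hl : 0 < l) (h : SineField l T κ k) :
    ∃ (K : ℕ → ℝ → ℝ) (a : ℕ → ℝ), (∀ n, ContinuousOn (K n) (Icc 0 T)) ∧ Summable a ∧
    (∀ n, ∀ t ∈ Icc 0 T, |K n t| ≤ a n) ∧
    ∀ n, ∀ t ∈ Ioc 0 T, t ^ κ * (-eig l (n + 1) * k n t) = K n t := by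
  obtain ⟨K, a, hK, ha, hb, he⟩ := h
  refine ⟨fun n t => -eig l (n + 1) * K n t, _, fun n => continuousOn_const.mul (hK n), ha,
    fun n t ht => ?_, fun n t ht => ?_⟩
  · rw [abs_mul, abs_neg, abs_of_pos (eig_pos hl n)]
    exact mul_le_mul_of_nonneg_left (hb n t ht) (eig_pos hl n).le
  · simp only []
    rw [← he n t ht]; ring

lemma SineField.base (hl : 0 < l) (hT : 0 < T) (h : SineField l T κ k) :
    ∃ (K : ℕ → ℝ → ℝ) (a : ℕ → ℝ), (∀ n, ContinuousOn (K n) (Icc 0 T)) ∧ Summable a ∧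
    (∀ n, ∀ t ∈ Icc 0 T, |K n t| ≤ a n) ∧
    ∀ n, ∀ t ∈ Ioc 0 T, t ^ κ * k n t = K n t := by
  obtain ⟨K, a, hK, ha, hb, he⟩ := h
  exact ⟨K, a, hK, summable_of_eig_mul hl (fun n => (abs_nonneg _).trans
    (hb n 0 ⟨le_rfl, hT.le⟩)) ha, hb, he⟩

lemma xPowBdd_of_weighted {K : ℕ → ℝ → ℝ} {a : ℕ → ℝ} (hK : ∀ n, ContinuousOn (K n) (Icc 0 T))
    (ha : Summable a) (hb : ∀ n, ∀ t ∈ Icc 0 T, |K n t| ≤ a n)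
    (he : ∀ n, ∀ t ∈ Ioc 0 T, t ^ κ * k n t = K n t) :
    XPowBdd l T (1 - κ) (fun x t => ∑' n, k n t * mode l (n + 1) x) ∧
      ∀ t ∈ Ioc 0 T, Summable fun n => |k n t| := by
  have hk : ∀ n, ∀ t ∈ Ioc 0 T, k n t = t ^ (-κ) * K n t := fun n t ht => by
    rw [← he n t ht, ← mul_assoc, ← Real.rpow_add ht.1]; simp
  have hc : ∀ n, ContinuousOn (k n) (Ioc 0 T) := fun n => by
    refine ContinuousOn.congr (f := fun t => t ^ (-κ) * K n t) ?_ (hk n)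
    exact ContinuousOn.mul (fun t ht => (Real.continuousAt_rpow_const t _
      (Or.inl ht.1.ne')).continuousWithinAt) ((hK n).mono Ioc_subset_Icc_self)
  have hbd : ∀ n, ∀ t ∈ Ioc 0 T, |k n t| ≤ a n * t ^ (1 - κ - 1) := fun n t ht => by
    rw [hk n t ht, abs_mul, abs_of_nonneg (Real.rpow_nonneg ht.1.le _), mul_comm,
      show 1 - κ - 1 = -κ by ring]
    exact mul_le_mul_of_nonneg_right (hb n t (Ioc_subset_Icc_self ht))
      (Real.rpow_nonneg ht.1.le _)
  exact ⟨xPowBdd_tsum hc ha hbd, fun t ht => summable_abs_of_bound ha hbd ht⟩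

lemma SineField.xPowBdd (hl : 0 < l) (hT : 0 < T) (h : SineField l T κ k) :
    XPowBdd l T (1 - κ) (fun x t => ∑' n, k n t * mode l (n + 1) x) := by
  obtain ⟨K, a, hK, ha, hb, he⟩ := h.base hl hT
  exact (xPowBdd_of_weighted hK ha hb he).1

lemma SineField.xPowBdd_xx (hl : 0 < l) (h : SineField l T κ k) :
    XPowBdd l T (1 - κ) (fun x t => ∑' n, (-eig l (n + 1) * k n t) * mode l (n + 1) x) := by
  obtain ⟨K, a, hK, ha, hb, he⟩ := h.laplacian hl
  exact (xPowBdd_of_weighted (k := fun n t => -eig l (n + 1) * k n t) hK ha hb he).1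

lemma SineField.summable (hl : 0 < l) (hT : 0 < T) (h : SineField l T κ k) {t : ℝ}
    (ht : t ∈ Ioc 0 T) : Summable fun n => |k n t| := by
  obtain ⟨K, a, hK, ha, hb, he⟩ := h.base hl hT
  exact (xPowBdd_of_weighted (l := l) hK ha hb he).2 t ht

lemma SineField.summable_xx (hl : 0 < l) (h : SineField l T κ k) {t : ℝ}
    (ht : t ∈ Ioc 0 T) : Summable fun n => |(-eig l (n + 1) * k n t)| := by
  obtain ⟨K, a, hK, ha, hb, he⟩ := h.laplacian hl
  exact (xPowBdd_of_weighted (l := l) (k := fun n t => -eig l (n + 1) * k n t) hK ha hb he).2 t ht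

lemma SineField.extendsCont (hl : 0 < l) (hT : 0 < T) (h : SineField l T κ k) :
    ExtendsCont (Icc 0 l ×ˢ Ioc 0 T) (Icc 0 l ×ˢ Icc 0 T)
      (fun x t => t ^ κ * ∑' n, k n t * mode l (n + 1) x) := by
  obtain ⟨K, a, hK, ha, hb, he⟩ := h.base hl hT
  exact extendsCont_tsum hK ha hb he

lemma SineField.extendsCont_xx (hl : 0 < l) (h : SineField l T κ k) :
    ExtendsCont (Icc 0 l ×ˢ Ioc 0 T) (Icc 0 l ×ˢ Icc 0 T)
      (fun x t => t ^ κ * ∑' n, (-eig l (n + 1) * k n t) * mode l (n + 1) x) := by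
  obtain ⟨K, a, hK, ha, hb, he⟩ := h.laplacian hl
  exact extendsCont_tsum (k := fun n t => -eig l (n + 1) * k n t) hK ha hb he

lemma SineField.hasDerivAt (hl : 0 < l) (h : SineField l T κ k) {t : ℝ}
    (ht : t ∈ Ioc 0 T) (x : ℝ) :
    DifferentiableAt ℝ (fun y => ∑' n, k n t * mode l (n + 1) y) x ∧
      DifferentiableAt ℝ (deriv fun y => ∑' n, k n t * mode l (n + 1) y) x ∧
      iteratedDeriv 2 (fun y => ∑' n, k n t * mode l (n + 1) y) x =
        ∑' n, (-eig l (n + 1) * k n t) * mode l (n + 1) x := by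
  have hs : Summable fun n => eig l (n + 1) * |k n t| :=
    (h.summable_xx hl ht).congr fun n => by
      rw [abs_mul, abs_neg, abs_of_pos (eig_pos hl n)]
  have h1 := fun x => hasDerivAt_tsum_mode hl hs x
  have hd : (deriv fun y => ∑' n, k n t * mode l (n + 1) y) =
      fun y => ∑' n, k n t * (((n + 1 : ℕ) : ℝ) * Real.pi / l *
        Real.cos (((n + 1 : ℕ) : ℝ) * Real.pi / l * y)) := funext fun y => (h1 y).1.deriv
  refine ⟨(h1 x).1.differentiableAt, ?_, ?_⟩
  · rw [hd]; exact (h1 x).2.differentiableAt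
  · rw [iteratedDeriv_succ, iteratedDeriv_one, hd]; exact (h1 x).2.deriv

end SineField

section Terms
variable {l T δ c M : ℝ}

lemma rpow_mul_mlKer {lam t : ℝ} (ht : 0 < t) :
    t ^ (1 - c) * mlKer δ lam c t = mittagLeffler δ c (-lam * t ^ δ) := by
  rw [mlKer, ← mul_assoc, ← Real.rpow_add ht]; norm_num

lemma continuous_mittagLeffler_rpow (hδ : 0 < δ) (hc : 0 < c) (lam : ℝ) :
    Continuous fun t : ℝ => mittagLeffler δ c (-lam * t ^ δ) :=
  (continuous_mittagLeffler hδ hc).comp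
    (continuous_const.mul (Real.continuous_rpow_const hδ.le))

lemma exists_abs_mittagLeffler_neg_le (hδ : 0 < δ) (hδ2 : δ < 2) (hc : 0 < c) (hc1 : c < δ + 1) :
    ∃ C, 0 ≤ C ∧ ∀ lam t : ℝ, 0 ≤ lam → 0 ≤ t → |mittagLeffler δ c (-lam * t ^ δ)| ≤ C := by
  obtain ⟨C, hC0, hC⟩ := exists_abs_mittagLeffler_le hδ hδ2 hc hc1
  refine ⟨C, hC0, fun lam t hlam ht => ?_⟩
  have hz : 0 ≤ lam * t ^ δ := mul_nonneg hlam (Real.rpow_nonneg ht _)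
  have := hC _ hz
  rw [← neg_mul] at this
  exact this.trans (div_le_self hC0 (by linarith))

lemma sineField_mlKer (hl : 0 < l) (hδ : 0 < δ) (hδ2 : δ < 2) (hc : 0 < c) (hc1 : c < δ + 1)
    {A : ℕ → ℝ} (hA : Summable fun n => eig l (n + 1) * |A n|) :
    SineField l T (1 - c) (fun n t => A n * mlKer δ (eig l (n + 1)) c t) := by
  obtain ⟨C, hC0, hC⟩ := exists_abs_mittagLeffler_neg_le hδ hδ2 hc hc1
  refine ⟨fun n t => A n * mittagLeffler δ c (-eig l (n + 1) * t ^ δ), fun n => |A n| * C,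
    fun n => (continuous_const.mul (continuous_mittagLeffler_rpow hδ hc _)).continuousOn,
    (hA.mul_right C).congr fun n => by ring, fun n t ht => ?_, fun n t ht => ?_⟩
  · rw [abs_mul]
    exact mul_le_mul_of_nonneg_left (hC _ t (eig_pos hl n).le ht.1) (abs_nonneg _)
  · rw [mul_left_comm, rpow_mul_mlKer ht.1]

/-- The weight t^{2-c} is one power of t better than the natural t^{1-c}. The decay estimate with θ
= 1/δ converts this power into a factor λ^{-1/δ}, which lets B decay more slowly than
`sineField_mlKer` would require. -/
lemma sineField_mlKer_shift (hl : 0 < l) (hδ : 1 ≤ δ) (hδ2 : δ < 2) (hc : 0 < c) (hc1 : c < δ + 1)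
    {B : ℕ → ℝ} (hB : Summable fun n => eig l (n + 1) * (|B n| * eig l (n + 1) ^ (-(1 / δ)))) :
    SineField l T (2 - c) (fun n t => B n * mlKer δ (eig l (n + 1)) c t) := by
  have hδ0 : 0 < δ := by linarith
  obtain ⟨C, hC0, hC⟩ := exists_abs_mlKer_le hδ0 hδ2 hc hc1
  have key : ∀ lam t : ℝ, 0 < t → t ^ (2 - c) * mlKer δ lam c t =
      t * mittagLeffler δ c (-lam * t ^ δ) := fun lam t ht => by
    rw [← rpow_mul_mlKer ht, ← mul_assoc]
    congr 1
    nth_rewrite 2 [← Real.rpow_one t]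
    rw [← Real.rpow_add ht]
    ring_nf
  refine ⟨fun n t => B n * (t * mittagLeffler δ c (-eig l (n + 1) * t ^ δ)),
    fun n => |B n| * eig l (n + 1) ^ (-(1 / δ)) * C, fun n =>
      (continuous_const.mul (continuous_id.mul (continuous_mittagLeffler_rpow hδ0 hc _))).continuousOn,
    (hB.mul_right C).congr fun n => by ring, fun n t ht => ?_, fun n t ht => ?_⟩
  · simp only []
    rw [abs_mul, mul_assoc]
    refine mul_le_mul_of_nonneg_left ?_ (abs_nonneg _)
    rcases ht.1.eq_or_lt with rfl | h0
    · rw [zero_mul, abs_zero]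
      exact mul_nonneg (Real.rpow_nonneg (eig_pos hl n).le _) hC0
    · rw [← key _ t h0, abs_mul, abs_of_nonneg (Real.rpow_nonneg ht.1 _)]
      refine (mul_le_mul_of_nonneg_left (hC _ (1 / δ) t (eig_pos hl n) (by positivity)
        (by rw [div_le_one hδ0]; exact hδ) h0) (Real.rpow_nonneg ht.1 _)).trans_eq ?_
      rw [mul_one_div_cancel hδ0.ne', mul_left_comm, ← Real.rpow_add h0,
        show 2 - c + (c - 1 - 1) = 0 by ring, Real.rpow_zero, mul_one, mul_comm]
  · rw [mul_left_comm, key _ t ht.1]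

/-- The coefficients of g contribute 1/λ_n and the kernel λ_n^{-3/4} (θ = 3/4), so a summable
λ_n^{-3/4} is left after two x-derivatives. The remaining power t^{κ+δ/4} gives continuity at t = 0.
-/
lemma sineField_forcing {g gt : ℝ → ℝ → ℝ} {κ : ℝ} (h : Forcing l T M g gt) (hl : 0 < l)
    (hM : 0 ≤ M) (hδ : 0 < δ) (hδ2 : δ < 2) (hκ : 0 ≤ κ) :
    SineField l T κ (fun n => conv (mlKer δ (eig l (n + 1)) δ)
      (fun s => sineCoeff l (n + 1) (fun x => g x s))) := by
  obtain ⟨C, hC0, hC⟩ := exists_abs_mlKer_le hδ hδ2 hδ (by linarith : δ < δ + 1)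
  have hbeta := betaC_pos (a := δ - δ * (3 / 4)) (b := 1) (by linarith) one_pos
  have hpos : ∀ n, 0 ≤ C * eig l (n + 1) ^ (-(3 / 4 : ℝ)) * (M / eig l (n + 1)) *
      betaC (δ - δ * (3 / 4)) 1 := fun n => by
    have := eig_pos hl n
    positivity
  have hbd : ∀ n, ∀ t ∈ Ioc 0 T, |t ^ κ * conv (mlKer δ (eig l (n + 1)) δ)
      (fun s => sineCoeff l (n + 1) (fun x => g x s)) t| ≤
      C * eig l (n + 1) ^ (-(3 / 4 : ℝ)) * (M / eig l (n + 1)) * betaC (δ - δ * (3 / 4)) 1 *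
        t ^ (κ + δ / 4) := by
    intro n t ht
    have := abs_conv_le (a := δ - δ * (3 / 4)) (b := 1) (by linarith) one_pos ht.1
      (p := mlKer δ (eig l (n + 1)) δ) (k := fun s => sineCoeff l (n + 1) (fun x => g x s))
      (A := C * eig l (n + 1) ^ (-(3 / 4 : ℝ))) (B := M / eig l (n + 1))
      (fun s hs => hC _ _ s (eig_pos hl n) (by norm_num) (by norm_num) hs.1)
      (fun s hs => by
        rw [sub_self, Real.rpow_zero, mul_one]
        exact h.coeff_le n s ⟨hs.1.le, hs.2.le.trans ht.2⟩)
    rw [abs_mul, abs_of_nonneg (Real.rpow_nonneg ht.1.le _)]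
    refine (mul_le_mul_of_nonneg_left this (Real.rpow_nonneg ht.1.le _)).trans_eq ?_
    rw [mul_left_comm, ← Real.rpow_add ht.1]
    congr 2
    ring
  have hbd' : ∀ n, ∀ t ∈ Icc 0 T, |t ^ κ * conv (mlKer δ (eig l (n + 1)) δ)
      (fun s => sineCoeff l (n + 1) (fun x => g x s)) t| ≤
      C * eig l (n + 1) ^ (-(3 / 4 : ℝ)) * (M / eig l (n + 1)) * betaC (δ - δ * (3 / 4)) 1 *
        t ^ (κ + δ / 4) := by
    intro n t ht
    rcases ht.1.eq_or_lt with rfl | h0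
    · rw [conv, intervalIntegral.integral_same, mul_zero, abs_zero,
        Real.zero_rpow (by positivity), mul_zero]
    · exact hbd n t ⟨h0, ht.2⟩
  refine ⟨fun n t => t ^ κ * conv (mlKer δ (eig l (n + 1)) δ)
      (fun s => sineCoeff l (n + 1) (fun x => g x s)) t,
    fun n => C * eig l (n + 1) ^ (-(3 / 4 : ℝ)) * (M / eig l (n + 1)) *
      betaC (δ - δ * (3 / 4)) 1 * T ^ (κ + δ / 4), fun n t ht => ?_, ?_, fun n t ht => ?_,
    fun n t ht => rfl⟩
  · rcases ht.1.eq_or_lt with rfl | h0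
    · unfold ContinuousWithinAt
      have e : (0 : ℝ) ^ κ * conv (mlKer δ (eig l (n + 1)) δ)
          (fun s => sineCoeff l (n + 1) (fun x => g x s)) 0 = 0 := by
        rw [conv, intervalIntegral.integral_same, mul_zero]
      simp only []
      rw [e]
      have hz : Tendsto (fun t : ℝ => C * eig l (n + 1) ^ (-(3 / 4 : ℝ)) * (M / eig l (n + 1)) *
          betaC (δ - δ * (3 / 4)) 1 * t ^ (κ + δ / 4)) (𝓝[Icc 0 T] 0) (𝓝 0) := by
        have := ((Real.continuous_rpow_const (by positivity : 0 ≤ κ + δ / 4)).tendsto 0).const_mul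
          (C * eig l (n + 1) ^ (-(3 / 4 : ℝ)) * (M / eig l (n + 1)) *
          betaC (δ - δ * (3 / 4)) 1)
        rw [Real.zero_rpow (by positivity), mul_zero] at this
        exact this.mono_left nhdsWithin_le_nhds
      exact squeeze_zero_norm' (by filter_upwards [self_mem_nhdsWithin] with t ht
                                   using hbd' n t ht) hz
    · have hc : ContinuousOn (fun t => t ^ κ * conv (mlKer δ (eig l (n + 1)) δ)
          (fun s => sineCoeff l (n + 1) (fun x => g x s)) t) (Ioc 0 T) :=
        (Real.continuous_rpow_const hκ).continuousOn.mul
          ((powBdd_mlKer T _ hδ hδ).conv hδ one_pos (h.powBdd_coeff hl (n + 1))).1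
      refine (hc t ⟨h0, ht.2⟩).mono_of_mem_nhdsWithin ?_
      filter_upwards [self_mem_nhdsWithin, mem_nhdsWithin_of_mem_nhds (Ioi_mem_nhds h0)] with s h1 h2
      exact ⟨h2, h1.2⟩
  · refine (((summable_eig_rpow hl (by norm_num : (1 / 2 : ℝ) < 3 / 4)).mul_left C).mul_right
      (M * betaC (δ - δ * (3 / 4)) 1 * T ^ (κ + δ / 4))).congr fun n => ?_
    have := (eig_pos hl n).ne'
    field_simp
  · exact (hbd' n t ht).trans (mul_le_mul_of_nonneg_left
      (Real.rpow_le_rpow ht.1 ht.2 (by positivity)) (hpos n))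

lemma xPowBdd_mlKer_series (hl : 0 < l) (hδ : 0 < δ) (hδ2 : δ < 2) (hc : 0 < c) (hc1 : c < δ + 1)
    {θ : ℝ} (hθ : 0 ≤ θ) (hθ1 : θ ≤ 1) {A : ℕ → ℝ}
    (hA : Summable fun n => |A n| * eig l (n + 1) ^ (-θ)) :
    XPowBdd l T (c - δ * θ)
      (fun x t => ∑' n, (A n * mlKer δ (eig l (n + 1)) c t) * mode l (n + 1) x) ∧
    ∀ n, ∀ t ∈ Ioc 0 T, sineCoeff l (n + 1)
      (fun x => ∑' n, (A n * mlKer δ (eig l (n + 1)) c t) * mode l (n + 1) x) =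
        A n * mlKer δ (eig l (n + 1)) c t := by
  obtain ⟨C, hC0, hC⟩ := exists_abs_mlKer_le hδ hδ2 hc hc1
  have hbd : ∀ n, ∀ t ∈ Ioc 0 T, |A n * mlKer δ (eig l (n + 1)) c t| ≤
      |A n| * eig l (n + 1) ^ (-θ) * C * t ^ (c - δ * θ - 1) := fun n t ht => by
    rw [abs_mul]
    refine (mul_le_mul_of_nonneg_left (hC _ θ t (eig_pos hl n) hθ hθ1 ht.1)
      (abs_nonneg _)).trans_eq ?_
    ring
  have hs := hA.mul_right C
  refine ⟨xPowBdd_tsum (k := fun n t => A n * mlKer δ (eig l (n + 1)) c t)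
    (fun n => continuousOn_const.mul (powBdd_mlKer T _ hδ hc).1) hs hbd, fun n t ht => ?_⟩
  exact sineCoeff_tsum hl (summable_abs_of_bound
    (k := fun n t => A n * mlKer δ (eig l (n + 1)) c t) hs hbd ht) n

lemma tendsto_mlKer_series (hl : 0 < l) (hT : 0 < T) (hδ : 0 < δ) (hδ2 : δ < 2) (hc : 0 < c)
    (hc1 : c < δ + 1) {A : ℕ → ℝ} (hA : Summable fun n => |A n|) (x : ℝ) :
    Tendsto (fun t => t ^ (1 - c) * ∑' n, (A n * mlKer δ (eig l (n + 1)) c t) * mode l (n + 1) x)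
      (𝓝[>] 0) (𝓝 (∑' n, A n / Real.Gamma c * mode l (n + 1) x)) := by
  obtain ⟨C, hC0, hC⟩ := exists_abs_mittagLeffler_neg_le hδ hδ2 hc hc1
  have h1 := continuousOn_tsum_mode (l := l) (S := Icc 0 T)
    (k := fun n t => A n * mittagLeffler δ c (-eig l (n + 1) * t ^ δ))
    (fun n => (continuous_const.mul (continuous_mittagLeffler_rpow hδ hc _)).continuousOn)
    (hA.mul_right C) (fun n t ht => by
      rw [abs_mul]
      exact mul_le_mul_of_nonneg_left (hC _ t (eig_pos hl n).le ht.1) (abs_nonneg _))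
  have h2 := (h1.comp (f := fun t : ℝ => ((x, t) : ℝ × ℝ)) (s := Icc 0 T) (by fun_prop)
    fun t ht => ⟨mem_univ _, ht⟩) 0 ⟨le_rfl, hT.le⟩
  unfold ContinuousWithinAt at h2
  simp only [Function.comp_def, Real.zero_rpow hδ.ne', mul_zero, mittagLeffler_zero hδ] at h2
  simp only [mul_one_div] at h2
  refine (h2.mono_left (nhdsWithin_le_iff.2 ?_)).congr' ?_
  · filter_upwards [Ioo_mem_nhdsGT hT] with t ht using Ioo_subset_Icc_self ht
  · filter_upwards [self_mem_nhdsWithin] with t ht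
    rw [← tsum_mul_left]
    refine tsum_congr fun n => ?_
    rw [← rpow_mul_mlKer ht]; ring

end Terms

/-! ### Identities checked on sine coefficients -/

lemma leftInt_eq_zero {κ t : ℝ} (hκ : 0 ≤ κ) (ht : 0 < t) {g : ℝ → ℝ} (h : ∀ s ∈ Ioc 0 t, g s = 0) :
    leftInt κ g t = 0 := by
  rw [leftInt_congr hκ ht h]
  simp [leftInt]

lemma leftInt_two {T c t : ℝ} (hc : 0 < c) {h : ℝ → ℝ} (hh : PowBdd T c h) (ht : t ∈ Ioc 0 T) :
    leftInt 2 h t = ∫ r in (0 : ℝ)..t, ∫ s in (0 : ℝ)..r, h s := by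
  have h1 : PowBdd t 1 (fun _ => (1 : ℝ)) := powBdd_of_continuousOn continuousOn_const
  rw [leftInt_eq_conv (by norm_num), ← conv_const_one]
  have e : conv (fun _ => 1) (conv (fun _ => 1) h) t = conv (fun _ => 1) (fun t => ∫ s in (0 : ℝ)..t, h s) t :=
    conv_congr ht.1 (fun _ _ => rfl) fun s _ => conv_const_one h s
  rw [← e, h1.conv_assoc one_pos one_pos hc ht.1 h1 (hh.mono ht.2)]
  refine conv_congr ht.1 (fun s hs => ?_) fun _ _ => rfl
  have := conv_powKer one_pos one_pos hs.1
  rw [powKer_one] at this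
  rw [this]; norm_num

/-- Both sides are continuous in x and vanish at 0 and l, so by completeness it suffices to compare
sine coefficients, and these commute with fractional integrals in time. -/
lemma leftInt_eq_of_coeff {l T c c' κ κ' t : ℝ} (hl : 0 < l) (hκ : 0 ≤ κ) (hκ' : 0 ≤ κ')
    (hc : 0 < c) (hc' : 0 < c') {W W' : ℝ → ℝ → ℝ} {R : ℝ → ℝ} (hW : XPowBdd l T c W)
    (hW' : XPowBdd l T c' W') (h0 : ∀ s ∈ Ioc 0 T, W 0 s = 0 ∧ W l s = 0)
    (h0' : ∀ s ∈ Ioc 0 T, W' 0 s = 0 ∧ W' l s = 0) (hR : ContinuousOn R (Icc 0 l))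
    (hR0 : R 0 = 0) (hRl : R l = 0) (ht : t ∈ Ioc 0 T)
    (hn : ∀ n, leftInt κ (fun s => sineCoeff l (n + 1) (fun x => W x s)) t =
      sineCoeff l (n + 1) R + leftInt κ' (fun s => sineCoeff l (n + 1) (fun x => W' x s)) t) :
    ∀ x ∈ Icc 0 l, leftInt κ (W x) t = R x + leftInt κ' (W' x) t := by
  have hc1 := hW.continuousOn_leftInt hκ hc ht
  have hc2 := hW'.continuousOn_leftInt hκ' hc' ht
  have hsub : ∀ s ∈ Ioc 0 t, s ∈ Ioc 0 T := fun s hs => ⟨hs.1, hs.2.trans ht.2⟩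
  have hu : uIcc 0 l = Icc 0 l := uIcc_of_le hl.le
  refine eqOn_of_sineCoeff_eq hl hc1 (hR.add hc2)
    (leftInt_eq_zero hκ ht.1 fun s hs => (h0 s (hsub s hs)).1)
    (leftInt_eq_zero hκ ht.1 fun s hs => (h0 s (hsub s hs)).2) ?_ ?_ fun n => ?_
  · rw [hR0, leftInt_eq_zero hκ' ht.1 fun s hs => (h0' s (hsub s hs)).1, add_zero]
  · rw [hRl, leftInt_eq_zero hκ' ht.1 fun s hs => (h0' s (hsub s hs)).2, add_zero]
  · rw [hW.sineCoeff_leftInt hl hκ hc ht, hn n,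
      sineCoeff_add (n + 1) (ContinuousOn.intervalIntegrable (by rwa [hu]))
        (ContinuousOn.intervalIntegrable (by rwa [hu])), hW'.sineCoeff_leftInt hl hκ' hc' ht]

lemma XPowBdd.intervalIntegrable_left {l T c t : ℝ} (hl : 0 < l) {W : ℝ → ℝ → ℝ}
    (hW : XPowBdd l T c W) (ht : t ∈ Ioc 0 T) : IntervalIntegrable (fun x => W x t) volume 0 l :=
  ContinuousOn.intervalIntegrable (by
    rw [uIcc_of_le hl.le]; exact hW.continuousOn_left ht)

lemma tendsto_rpow_nhdsGT {p : ℝ} (hp : 0 < p) : Tendsto (fun t : ℝ => t ^ p) (𝓝[>] 0) (𝓝 0) := by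
  have := (Real.continuous_rpow_const hp.le).tendsto 0
  rw [Real.zero_rpow hp.ne'] at this
  exact this.mono_left nhdsWithin_le_nhds

/-! ### The parabolic half -/

section Half
variable {l T M δ γ : ℝ} {g gt : ℝ → ℝ → ℝ}

lemma summable_coeff_zero (h : Forcing l T M g gt) (hl : 0 < l) (hT : 0 < T) :
    Summable fun n => |sineCoeff l (n + 1) (fun x => g x 0)| := by
  refine Summable.of_nonneg_of_le (fun _ => abs_nonneg _)
    (fun n => h.coeff_le n 0 ⟨le_rfl, hT.le⟩)
    (((summable_eig_rpow hl (by norm_num : (1 / 2 : ℝ) < 1)).mul_left M).congr fun n => ?_)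
  rw [Real.rpow_neg_one, div_eq_mul_inv]

/-- Time coefficient of the parabolic half. -/
noncomputable def parabolicCoeff (l δ γ : ℝ) (g : ℝ → ℝ → ℝ) (τ : ℕ → ℝ) (n : ℕ) (t : ℝ) : ℝ :=
  τ n * mlKer δ (eig l (n + 1)) γ t +
    conv (mlKer δ (eig l (n + 1)) δ) (fun s => sineCoeff l (n + 1) (fun x => g x s)) t

lemma sineField_parabolic (h : Forcing l T M g gt) (hl : 0 < l) (hM : 0 ≤ M)
    (hδ : 0 < δ) (hδ1 : δ < 1) (hδγ : δ ≤ γ) (hγ1 : γ ≤ 1) {τ : ℕ → ℝ}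
    (hτ : Summable fun n => eig l (n + 1) * |τ n|) :
    SineField l T (1 - γ) (parabolicCoeff l δ γ g τ) :=
  (sineField_mlKer hl hδ (by linarith) (by linarith) (by linarith) hτ).add
    (sineField_forcing h hl hM hδ (by linarith) (by linarith))

/-- The source is assembled from the three pieces of `leftInt_mode_one`: the series in τ of order δ,
the series in g(·, 0) of order δ+1-γ, and the convolution with ∂_t g. In the limit of t^{1-δ} h' the
first piece survives, the last one does not, and the second one survives exactly when its order
drops to δ, that is when γ = 1. -/
theorem exists_parabolic_source (h : Forcing l T M g gt) (hl : 0 < l) (hT : 0 < T) (hM : 0 ≤ M)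
    (hδ : 0 < δ) (hδ1 : δ < 1) (hδγ : δ ≤ γ) (hγ1 : γ ≤ 1) {τ : ℕ → ℝ}
    (hτ : Summable fun n => eig l (n + 1) * |τ n|) :
    ∃ (c : ℝ) (h' : ℝ → ℝ → ℝ), 0 < c ∧ XPowBdd l T c h' ∧
      (∀ x ∈ Icc 0 l, ∀ t ∈ Ioc 0 T,
        leftInt (1 - γ) (fun t => ∑' n, parabolicCoeff l δ γ g τ n t * mode l (n + 1) x) t =
          (∑' n, τ n * mode l (n + 1) x) + ∫ s in (0 : ℝ)..t, h' x s) ∧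
      (∀ x ∈ Icc 0 l, ∀ t ∈ Ioc 0 T, leftInt (γ - δ) (h' x) t = g x t +
          ∑' n, (-eig l (n + 1) * parabolicCoeff l δ γ g τ n t) * mode l (n + 1) x) ∧
      ∀ x ∈ Icc 0 l, Tendsto (fun t => t ^ (1 - δ) * h' x t) (𝓝[>] 0)
        (𝓝 (∑' n, ((-eig l (n + 1) * τ n +
          if γ = 1 then sineCoeff l (n + 1) (fun x => g x 0) else 0) / Real.Gamma δ) *
            mode l (n + 1) x)) := by
  have hγ0 : 0 < γ := by linarith
  have hb : 0 < δ + 1 - γ := by linarith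
  have hδ2 : δ < 2 := by linarith
  have hSF := sineField_parabolic h hl hM hδ hδ1 hδγ hγ1 hτ
  have hU := hSF.xPowBdd hl hT
  have hUxx := hSF.xPowBdd_xx hl
  have hUc : ∀ n, ∀ t ∈ Ioc 0 T, sineCoeff l (n + 1)
      (fun x => ∑' n, parabolicCoeff l δ γ g τ n t * mode l (n + 1) x) =
      parabolicCoeff l δ γ g τ n t := fun n t ht => sineCoeff_tsum hl (hSF.summable hl hT ht) n
  have hUxxc : ∀ n, ∀ t ∈ Ioc 0 T, sineCoeff l (n + 1)
      (fun x => ∑' n, (-eig l (n + 1) * parabolicCoeff l δ γ g τ n t) * mode l (n + 1) x) =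
      -eig l (n + 1) * parabolicCoeff l δ γ g τ n t := fun n t ht =>
    sineCoeff_tsum hl (hSF.summable_xx hl ht) n
  have hτa := summable_eig_mul_imp hl hτ
  have hg0 := summable_coeff_zero h hl hT
  obtain ⟨H, hH, hH0, hHc⟩ := h.exists_source_series hl hδ hδ2
    (by linarith : 3 / 4 * δ < δ + 1 - γ) (by linarith)
  have hlt : Summable fun n => |(-eig l (n + 1) * τ n)| := hτ.congr fun n => by
    rw [abs_mul, abs_neg, abs_of_pos (eig_pos hl n)]
  obtain ⟨hS1, hS1c⟩ := xPowBdd_mlKer_series (T := T) hl hδ hδ2 hδ (by linarith : δ < δ + 1)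
    le_rfl zero_le_one (A := fun n => -eig l (n + 1) * τ n) (by simpa using hlt)
  obtain ⟨hS2, hS2c⟩ := xPowBdd_mlKer_series (T := T) hl hδ hδ2 hb (by linarith)
    le_rfl zero_le_one (A := fun n => sineCoeff l (n + 1) (fun x => g x 0)) (by simpa using hg0)
  rw [mul_zero, sub_zero] at hS1 hS2
  have hS2' := hS2.weaken (by linarith : δ ≤ δ + 1 - γ)
  have hH' := hH.weaken (by linarith : δ ≤ δ + 1 - γ - 3 / 4 * δ + 1)
  set S1 : ℝ → ℝ → ℝ := fun x t => ∑' n, (-eig l (n + 1) * τ n *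
    mlKer δ (eig l (n + 1)) δ t) * mode l (n + 1) x with hS1d
  set S2 : ℝ → ℝ → ℝ := fun x t => ∑' n, (sineCoeff l (n + 1) (fun x => g x 0) *
    mlKer δ (eig l (n + 1)) (δ + 1 - γ) t) * mode l (n + 1) x with hS2d
  have hh := (hS1.add hS2').add hH'
  have hhc : ∀ n, ∀ t ∈ Ioc 0 T, sineCoeff l (n + 1) (fun x => S1 x t + S2 x t + H x t) =
      (-eig l (n + 1) * τ n * mlKer δ (eig l (n + 1)) δ t +
        sineCoeff l (n + 1) (fun x => g x 0) * mlKer δ (eig l (n + 1)) (δ + 1 - γ) t) +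
      conv (mlKer δ (eig l (n + 1)) (δ + 1 - γ))
        (fun s => sineCoeff l (n + 1) (fun x => gt x s)) t := fun n t ht => by
    rw [sineCoeff_add (n + 1) ((hS1.add hS2').intervalIntegrable_left hl ht)
      (hH.intervalIntegrable_left hl ht), sineCoeff_add (n + 1) (hS1.intervalIntegrable_left hl ht)
      (hS2.intervalIntegrable_left hl ht), hS1c n t ht, hS2c n t ht, hHc n t ht]
  have hz : ∀ s ∈ Ioc 0 T, (S1 0 s + S2 0 s + H 0 s = 0) ∧ S1 l s + S2 l s + H l s = 0 := by
    intro s _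
    rw [hS1d, hS2d]
    simp only [tsum_mode_zero, tsum_mode_end hl, (hH0 s).1, (hH0 s).2, add_zero, and_self]
  have hgt : ∀ n, ∀ t ∈ Ioc 0 T,
      ContinuousOn (fun s => sineCoeff l (n + 1) (fun x => gt x s)) (Icc 0 t) := fun n t ht =>
    (continuousOn_sineCoeff hl h.cont_t (n + 1)).mono (Icc_subset_Icc_right ht.2)
  have hgp : ∀ n, ∀ t ∈ Ioc 0 T, ∀ s ∈ Icc 0 t, sineCoeff l (n + 1) (fun x => g x s) =
      sineCoeff l (n + 1) (fun x => g x 0) +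
        ∫ r in (0 : ℝ)..s, sineCoeff l (n + 1) (fun x => gt x r) := fun n t ht s hs =>
    h.coeff_primitive (n + 1) s ⟨hs.1, hs.2.trans ht.2⟩
  have hsub : ∀ {t}, t ∈ Ioc 0 T → ∀ s ∈ Ioc 0 t, s ∈ Ioc 0 T :=
    fun ht s hs => ⟨hs.1, hs.2.trans ht.2⟩
  refine ⟨δ, fun x t => S1 x t + S2 x t + H x t, hδ, hh, ?_, ?_, ?_⟩
  · intro x hx t ht
    have := leftInt_eq_of_coeff hl (by linarith : 0 ≤ 1 - γ) zero_le_one (by linarith) hδ hU hh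
      (fun s _ => ⟨tsum_mode_zero _, tsum_mode_end hl _⟩) hz
      (R := fun x => ∑' n, τ n * mode l (n + 1) x) (continuous_tsum_mode hτa).continuousOn
      (tsum_mode_zero _) (tsum_mode_end hl _) ht (fun n => ?_) x hx
    · rw [leftInt_one] at this
      exact this
    · rw [sineCoeff_tsum hl hτa,
        leftInt_congr (by linarith) ht.1 (fun s hs => hUc n s (hsub ht s hs)),
        leftInt_congr zero_le_one ht.1 (fun s hs => hhc n s (hsub ht s hs))]
      exact leftInt_mode_one hδ hγ0 hγ1 (τ n) ht.1 (hgt n t ht) (hgp n t ht)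
        ((h.powBdd_coeff hl (n + 1)).mono ht.2)
  · intro x hx t ht
    have htI := Ioc_subset_Icc_self ht
    have := leftInt_eq_of_coeff hl (by linarith : 0 ≤ γ - δ) le_rfl hδ (by linarith) hh hUxx hz
      (fun s _ => ⟨tsum_mode_zero _, tsum_mode_end hl _⟩)
      (R := fun x => g x t) (h.continuousOn_left htI) (h.zero_left t htI) (h.zero_right t htI)
      ht (fun n => ?_) x hx
    · rw [leftInt_zero] at this
      exact this
    · rw [leftInt_zero, hUxxc n t ht,
        leftInt_congr (by linarith) ht.1 (fun s hs => hhc n s (hsub ht s hs)),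
        leftInt_modeSource_one hδ hδγ hγ1 (τ n) ht.1 (hgt n t ht)
          (g := fun s => sineCoeff l (n + 1) (fun x => g x s)) (hgp n t ht), parabolicCoeff]
      ring
  · intro x hx
    have t1 := tendsto_mlKer_series hl hT hδ hδ2 hδ (by linarith : δ < δ + 1) hlt x
    have t2 := tendsto_mlKer_series hl hT hδ hδ2 hb (by linarith) hg0 x
    have t3 : Tendsto (fun t => t ^ (1 - δ) * H x t) (𝓝[>] 0) (𝓝 0) := by
      obtain ⟨-, C, hC⟩ := hH
      have hp : 0 < (1 - δ) + (δ + 1 - γ - 3 / 4 * δ + 1 - 1) := by linarith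
      have := (tendsto_rpow_nhdsGT hp).const_mul C
      rw [mul_zero] at this
      refine squeeze_zero_norm' ?_ this
      filter_upwards [Ioo_mem_nhdsGT hT] with t ht
      rw [norm_mul, Real.norm_of_nonneg (Real.rpow_nonneg ht.1.le _), Real.rpow_add ht.1,
        mul_left_comm]
      exact mul_le_mul_of_nonneg_left (hC x hx t (Ioo_subset_Ioc_self ht))
        (Real.rpow_nonneg ht.1.le _)
    have t2' : Tendsto (fun t => t ^ (1 - γ) * (t ^ (1 - (δ + 1 - γ)) * S2 x t)) (𝓝[>] 0)
        (𝓝 (∑' n, (if γ = 1 then sineCoeff l (n + 1) (fun x => g x 0) else 0) / Real.Gamma δ *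
          mode l (n + 1) x)) := by
      split_ifs with hγ
      · have : δ + 1 - γ = δ := by rw [hγ]; ring
        rw [this] at t2
        refine t2.congr fun t => ?_
        rw [hS2d]
        simp only [this]
        rw [hγ, sub_self, Real.rpow_zero, one_mul]
      · have hp : 0 < 1 - γ := by
          rcases hγ1.lt_or_eq with h | h
          · linarith
          · exact absurd h hγ
        have := (tendsto_rpow_nhdsGT hp).mul t2
        simpa using this
    have tt := (t1.add t2').add t3
    rw [add_zero, ← Summable.tsum_add] at tt
    · refine (tt.congr' ?_).trans_eq ?_
      · filter_upwards [self_mem_nhdsWithin] with t ht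
        rw [← mul_assoc (t ^ (1 - γ)), ← Real.rpow_add ht,
          show 1 - γ + (1 - (δ + 1 - γ)) = 1 - δ by ring]
        ring
      · congr 2
        ext n
        ring
    · refine summable_mul_mode ((hlt.mul_right (|Real.Gamma δ|⁻¹)).congr fun n => ?_) x
      rw [abs_div, div_eq_mul_inv]
    · refine summable_mul_mode ?_ x
      split_ifs
      · refine (hg0.mul_right (|Real.Gamma δ|⁻¹)).congr fun n => ?_
        rw [abs_div, div_eq_mul_inv]
      · simp

end Half

/-! ### The hyperbolic half -/

section Half
variable {l T M δ γ : ℝ} {g gt : ℝ → ℝ → ℝ}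

/-- Time coefficient of the hyperbolic half. -/
noncomputable def hyperbolicCoeff (l δ γ : ℝ) (g : ℝ → ℝ → ℝ) (A B : ℕ → ℝ) (n : ℕ) (t : ℝ) : ℝ :=
  (A n * mlKer δ (eig l (n + 1)) (γ - 1) t + B n * mlKer δ (eig l (n + 1)) γ t) +
    conv (mlKer δ (eig l (n + 1)) δ) (fun s => sineCoeff l (n + 1) (fun x => g x s)) t

lemma sineField_hyperbolic (h : Forcing l T M g gt) (hl : 0 < l) (hM : 0 ≤ M)
    (hδ : 1 < δ) (hδ2 : δ < 2) (hδγ : δ < γ) (hγ2 : γ ≤ 2) {A B : ℕ → ℝ}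
    (hA : Summable fun n => eig l (n + 1) * |A n|)
    (hB : Summable fun n => eig l (n + 1) * (|B n| * eig l (n + 1) ^ (-(1 / δ)))) :
    SineField l T (2 - γ) (hyperbolicCoeff l δ γ g A B) := by
  have h1 := sineField_mlKer (T := T) hl (by linarith : 0 < δ) hδ2 (by linarith : 0 < γ - 1)
    (by linarith) hA
  rw [show 1 - (γ - 1) = 2 - γ by ring] at h1
  exact (h1.add (sineField_mlKer_shift hl hδ.le hδ2 (by linarith) (by linarith) hB)).add
    (sineField_forcing h hl hM (by linarith) hδ2 (by linarith))

/-- The splitting of the parabolic case with an additional series for the slope B. The coefficients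
λ_n B_n are summable only after a factor λ_n^{-θ} has been borrowed from the kernel, which lowers
its order from δ to δ - δθ, still positive because θ < 1. -/
theorem exists_hyperbolic_source (h : Forcing l T M g gt) (hl : 0 < l) (hT : 0 < T) (hM : 0 ≤ M)
    (hδ : 1 < δ) (hδ2 : δ < 2) (hδγ : δ < γ) (hγ2 : γ ≤ 2) {A B : ℕ → ℝ}
    (hA : Summable fun n => eig l (n + 1) * |A n|)
    (hB : Summable fun n => eig l (n + 1) * (|B n| * eig l (n + 1) ^ (-(1 / δ))))
    (hB1 : Summable fun n => |B n|)
    {θ : ℝ} (hθ0 : 0 ≤ θ) (hθ1 : θ < 1)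
    (hBθ : Summable fun n => |(-eig l (n + 1) * B n)| * eig l (n + 1) ^ (-θ)) :
    ∃ (c : ℝ) (h' : ℝ → ℝ → ℝ), 0 < c ∧ XPowBdd l T c h' ∧
      (∀ x ∈ Icc 0 l, ∀ t ∈ Ioc 0 T,
        leftInt (2 - γ) (fun t => ∑' n, hyperbolicCoeff l δ γ g A B n t * mode l (n + 1) x) t =
          (∑' n, A n * mode l (n + 1) x) + (∑' n, B n * mode l (n + 1) x) * t +
            ∫ r in (0 : ℝ)..t, ∫ s in (0 : ℝ)..r, h' x s) ∧
      (∀ x ∈ Icc 0 l, ∀ t ∈ Ioc 0 T, leftInt (γ - δ) (h' x) t = g x t +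
          ∑' n, (-eig l (n + 1) * hyperbolicCoeff l δ γ g A B n t) * mode l (n + 1) x) := by
  have hδ0 : 0 < δ := by linarith
  have hδ1 : 0 < δ - 1 := by linarith
  have hγ0 : 1 < γ := by linarith
  have hb : 0 < δ + 1 - γ := by linarith
  have hSF := sineField_hyperbolic h hl hM hδ hδ2 hδγ hγ2 hA hB
  have hU := hSF.xPowBdd hl hT
  have hUxx := hSF.xPowBdd_xx hl
  have hUc : ∀ n, ∀ t ∈ Ioc 0 T, sineCoeff l (n + 1)
      (fun x => ∑' n, hyperbolicCoeff l δ γ g A B n t * mode l (n + 1) x) =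
      hyperbolicCoeff l δ γ g A B n t := fun n t ht => sineCoeff_tsum hl (hSF.summable hl hT ht) n
  have hUxxc : ∀ n, ∀ t ∈ Ioc 0 T, sineCoeff l (n + 1)
      (fun x => ∑' n, (-eig l (n + 1) * hyperbolicCoeff l δ γ g A B n t) * mode l (n + 1) x) =
      -eig l (n + 1) * hyperbolicCoeff l δ γ g A B n t := fun n t ht =>
    sineCoeff_tsum hl (hSF.summable_xx hl ht) n
  have hAa := summable_eig_mul_imp hl hA
  have hg0 := summable_coeff_zero h hl hT
  -- Here b = δ+1-γ lies in (0, 1) because δ < γ, and it may be smaller than δ/2, where no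
  -- admissible θ would make the series converge absolutely; hence the cosine kernel.
  obtain ⟨H, hH, hH0, hHc⟩ := h.exists_source_kernel hl hδ0 hδ2 hb (by linarith)
  have hlA : Summable fun n => |(-eig l (n + 1) * A n)| := hA.congr fun n => by
    rw [abs_mul, abs_neg, abs_of_pos (eig_pos hl n)]
  obtain ⟨hS0, hS0c⟩ := xPowBdd_mlKer_series (T := T) hl hδ0 hδ2 hδ1 (by linarith)
    le_rfl zero_le_one (A := fun n => -eig l (n + 1) * A n) (by simpa using hlA)
  obtain ⟨hS1, hS1c⟩ := xPowBdd_mlKer_series (T := T) hl hδ0 hδ2 hδ0 (by linarith : δ < δ + 1)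
    hθ0 hθ1.le (A := fun n => -eig l (n + 1) * B n) hBθ
  obtain ⟨hS2, hS2c⟩ := xPowBdd_mlKer_series (T := T) hl hδ0 hδ2 hb (by linarith)
    le_rfl zero_le_one (A := fun n => sineCoeff l (n + 1) (fun x => g x 0)) (by simpa using hg0)
  rw [mul_zero, sub_zero] at hS0 hS2
  have hθδ : 0 < δ - δ * θ := by nlinarith
  set c : ℝ := min (min (δ - 1) (δ - δ * θ)) (δ + 1 - γ) with hcd
  have hc : 0 < c := lt_min (lt_min hδ1 hθδ) hb
  have hS0' := hS0.weaken ((min_le_left _ _).trans (min_le_left _ _) : c ≤ δ - 1)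
  have hS1' := hS1.weaken ((min_le_left _ _).trans (min_le_right _ _) : c ≤ δ - δ * θ)
  have hS2' := hS2.weaken (min_le_right _ _ : c ≤ δ + 1 - γ)
  have hH' := hH.weaken ((min_le_right _ _ : c ≤ δ + 1 - γ).trans (by linarith) :
    c ≤ δ + 1 - γ + 1)
  set S0 : ℝ → ℝ → ℝ := fun x t => ∑' n, (-eig l (n + 1) * A n *
    mlKer δ (eig l (n + 1)) (δ - 1) t) * mode l (n + 1) x with hS0d
  set S1 : ℝ → ℝ → ℝ := fun x t => ∑' n, (-eig l (n + 1) * B n *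
    mlKer δ (eig l (n + 1)) δ t) * mode l (n + 1) x with hS1d
  set S2 : ℝ → ℝ → ℝ := fun x t => ∑' n, (sineCoeff l (n + 1) (fun x => g x 0) *
    mlKer δ (eig l (n + 1)) (δ + 1 - γ) t) * mode l (n + 1) x with hS2d
  have hh := ((hS0'.add hS1').add hS2').add hH'
  have hhc : ∀ n, ∀ t ∈ Ioc 0 T, sineCoeff l (n + 1) (fun x => S0 x t + S1 x t + S2 x t + H x t) =
      ((-eig l (n + 1) * A n * mlKer δ (eig l (n + 1)) (δ - 1) t +
        -eig l (n + 1) * B n * mlKer δ (eig l (n + 1)) δ t) +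
        sineCoeff l (n + 1) (fun x => g x 0) * mlKer δ (eig l (n + 1)) (δ + 1 - γ) t) +
      conv (mlKer δ (eig l (n + 1)) (δ + 1 - γ))
        (fun s => sineCoeff l (n + 1) (fun x => gt x s)) t := fun n t ht => by
    rw [sineCoeff_add (n + 1) (((hS0'.add hS1').add hS2').intervalIntegrable_left hl ht)
      (hH.intervalIntegrable_left hl ht),
      sineCoeff_add (n + 1) ((hS0'.add hS1').intervalIntegrable_left hl ht)
      (hS2.intervalIntegrable_left hl ht), sineCoeff_add (n + 1) (hS0.intervalIntegrable_left hl ht)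
      (hS1.intervalIntegrable_left hl ht), hS0c n t ht, hS1c n t ht, hS2c n t ht, hHc n t ht]
  have hz : ∀ s ∈ Ioc 0 T, (S0 0 s + S1 0 s + S2 0 s + H 0 s = 0) ∧
      S0 l s + S1 l s + S2 l s + H l s = 0 := by
    intro s _
    rw [hS0d, hS1d, hS2d]
    simp only [tsum_mode_zero, tsum_mode_end hl, (hH0 s).1, (hH0 s).2, add_zero, and_self]
  have hgt : ∀ n, ∀ t ∈ Ioc 0 T,
      ContinuousOn (fun s => sineCoeff l (n + 1) (fun x => gt x s)) (Icc 0 t) := fun n t ht =>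
    (continuousOn_sineCoeff hl h.cont_t (n + 1)).mono (Icc_subset_Icc_right ht.2)
  have hgp : ∀ n, ∀ t ∈ Ioc 0 T, ∀ s ∈ Icc 0 t, sineCoeff l (n + 1) (fun x => g x s) =
      sineCoeff l (n + 1) (fun x => g x 0) +
        ∫ r in (0 : ℝ)..s, sineCoeff l (n + 1) (fun x => gt x r) := fun n t ht s hs =>
    h.coeff_primitive (n + 1) s ⟨hs.1, hs.2.trans ht.2⟩
  have hsub : ∀ {t}, t ∈ Ioc 0 T → ∀ s ∈ Ioc 0 t, s ∈ Ioc 0 T :=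
    fun ht s hs => ⟨hs.1, hs.2.trans ht.2⟩
  have h2 : (0 : ℝ) ≤ 2 := by norm_num
  refine ⟨c, fun x t => S0 x t + S1 x t + S2 x t + H x t, hc, hh, ?_, ?_⟩
  · intro x hx t ht
    have hcA := continuous_tsum_mode (l := l) hAa
    have hcB : Continuous fun x => t * ∑' n, B n * mode l (n + 1) x :=
      continuous_const.mul (continuous_tsum_mode (l := l) hB1)
    have := leftInt_eq_of_coeff hl (by linarith : 0 ≤ 2 - γ) h2 (by linarith) hc hU hh
      (fun s _ => ⟨tsum_mode_zero _, tsum_mode_end hl _⟩) hz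
      (R := fun x => (∑' n, A n * mode l (n + 1) x) + t * ∑' n, B n * mode l (n + 1) x)
      (hcA.add hcB).continuousOn
      (by rw [tsum_mode_zero, tsum_mode_zero]; ring)
      (by rw [tsum_mode_end hl, tsum_mode_end hl]; ring) ht (fun n => ?_) x hx
    · rw [leftInt_two hc (hh.powBdd hx) ht] at this
      rw [this]; ring
    · rw [sineCoeff_add (n + 1) (hcA.intervalIntegrable 0 l)
        (hcB.intervalIntegrable 0 l), sineCoeff_const_mul,
        sineCoeff_tsum hl hAa, sineCoeff_tsum hl hB1,
        leftInt_congr (by linarith) ht.1 (fun s hs => hUc n s (hsub ht s hs)),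
        leftInt_congr h2 ht.1 (fun s hs => hhc n s (hsub ht s hs)), mul_comm t]
      exact leftInt_mode_two hδ hγ0 hγ2 (A n) (B n) ht.1 (hgt n t ht) (hgp n t ht)
        ((h.powBdd_coeff hl (n + 1)).mono ht.2)
  · intro x hx t ht
    have htI := Ioc_subset_Icc_self ht
    have := leftInt_eq_of_coeff hl (by linarith : 0 ≤ γ - δ) le_rfl hc (by linarith) hh hUxx hz
      (fun s _ => ⟨tsum_mode_zero _, tsum_mode_end hl _⟩)
      (R := fun x => g x t) (h.continuousOn_left htI) (h.zero_left t htI) (h.zero_right t htI)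
      ht (fun n => ?_) x hx
    · rw [leftInt_zero] at this
      exact this
    · rw [leftInt_zero, hUxxc n t ht,
        leftInt_congr (by linarith) ht.1 (fun s hs => hhc n s (hsub ht s hs)),
        leftInt_modeSource_two hδ hδγ.le hγ2 (A n) (B n) ht.1 (hgt n t ht)
          (g := fun s => sineCoeff l (n + 1) (fun x => g x s)) (hgp n t ht), hyperbolicCoeff]
      ring

end Half

/-! ### Sine coefficients of the data -/

lemma AdmissibleF.forcing_pos {l T : ℝ} (hl : 0 < l) (hT : 0 < T) {f : ℝ → ℝ → ℝ}
    (hf : AdmissibleF l T f) : ∃ gt M, 0 ≤ M ∧ Forcing l T M f gt := by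
  obtain ⟨fx, fxx, ft, h1, -, h3, h4, hd, hz, -⟩ := hf
  have hs : Icc 0 l ×ˢ Icc 0 T ⊆ Icc 0 l ×ˢ Icc (-T) T :=
    prod_mono_right (Icc_subset_Icc_left (by linarith))
  obtain ⟨M, hM, h⟩ := forcing_of_smooth hl hT (h1.mono hs) (h3.mono hs) (h4.mono hs)
    (fun x hx t ht => hd x hx t ⟨by linarith [ht.1], ht.2⟩)
    (fun t ht => (hz t ⟨by linarith [ht.1], ht.2⟩).1)
    (fun t ht => (hz t ⟨by linarith [ht.1], ht.2⟩).2.1)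
  exact ⟨ft, M, hM, h⟩

lemma AdmissibleF.forcing_neg {l T : ℝ} (hl : 0 < l) (hT : 0 < T) {f : ℝ → ℝ → ℝ}
    (hf : AdmissibleF l T f) : ∃ gt M, 0 ≤ M ∧ Forcing l T M (fun x s => f x (-s)) gt := by
  obtain ⟨fx, fxx, ft, h1, -, h3, h4, hd, hz, -⟩ := hf
  have hc : Continuous fun p : ℝ × ℝ => ((p.1, -p.2) : ℝ × ℝ) := by fun_prop
  have hm : MapsTo (fun p : ℝ × ℝ => ((p.1, -p.2) : ℝ × ℝ)) (Icc 0 l ×ˢ Icc 0 T)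
      (Icc 0 l ×ˢ Icc (-T) T) := fun p hp => ⟨hp.1, by linarith [hp.2.2], by linarith [hp.2.1]⟩
  obtain ⟨M, hM, h⟩ := forcing_of_smooth (g := fun x s => f x (-s)) (gx := fun x s => fx x (-s))
    (gxx := fun x s => fxx x (-s)) (gt := fun x s => -ft x (-s)) hl hT
    (h1.comp hc.continuousOn hm) (h3.comp hc.continuousOn hm) (h4.comp hc.continuousOn hm).neg
    (fun x hx t ht => by
      have := hd x hx (-t) ⟨by linarith [ht.2], by linarith [ht.1]⟩
      refine ⟨this.1, this.2.1, ?_⟩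
      exact (this.2.2.comp t (hasDerivAt_neg t)).congr_deriv (by ring))
    (fun t ht => (hz (-t) ⟨by linarith [ht.2], by linarith [ht.1]⟩).1)
    (fun t ht => (hz (-t) ⟨by linarith [ht.2], by linarith [ht.1]⟩).2.1)
  exact ⟨_, M, hM, h⟩

lemma exists_bound_of_tendsto_ends {l a b : ℝ} {q : ℝ → ℝ}
    (hq : ContinuousOn q (Ioo 0 l)) (h0 : Tendsto q (𝓝[>] 0) (𝓝 a))
    (h1 : Tendsto q (𝓝[<] l) (𝓝 b)) : ∃ C, ∀ x ∈ Ioo 0 l, |q x| ≤ C := by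
  obtain ⟨C, hC⟩ := isCompact_Icc.exists_bound_of_continuousOn
    (continuousOn_Icc_extendFrom_Ioo hq h0 h1)
  refine ⟨C, fun x hx => ?_⟩
  have := hC x (Ioo_subset_Icc_self hx)
  rwa [extendFrom_extends hq x hx] at this

/-- Four integrations by parts in two pairs, the one-sided limits at the ends making ψ'' and ψ''''
bounded on the open interval and killing the boundary terms. -/
lemma AdmissiblePsi.coeff_le {l : ℝ} (hl : 0 < l) {ψ : ℝ → ℝ} (h : AdmissiblePsi l ψ) :
    ∃ C, 0 ≤ C ∧ ∀ n, |sineCoeff l (n + 1) ψ| ≤ C / eig l (n + 1) ^ 2 := by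
  have hd : ∀ k : ℕ, k < 4 → ∀ x ∈ Ioo 0 l,
      HasDerivAt (iteratedDeriv k ψ) (iteratedDeriv (k + 1) ψ x) x := by
    intro k hk x hx
    have h1 := h.contDiff.differentiableOn_iteratedDerivWithin (m := k) (by exact_mod_cast hk)
      isOpen_Ioo.uniqueDiffOn
    have h2 := (h1.congr fun y hy =>
      (iteratedDerivWithin_of_isOpen (n := k) (f := ψ) isOpen_Ioo hy).symm).differentiableAt
      (isOpen_Ioo.mem_nhds hx)
    rw [iteratedDeriv_succ]
    exact h2.hasDerivAt
  have hc : ∀ k : ℕ, k ≤ 4 → ContinuousOn (iteratedDeriv k ψ) (Ioo 0 l) := fun k hk =>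
    (h.contDiff.continuousOn_iteratedDerivWithin (m := k) (by exact_mod_cast hk)
      isOpen_Ioo.uniqueDiffOn).congr fun y hy =>
      (iteratedDerivWithin_of_isOpen (n := k) (f := ψ) isOpen_Ioo hy).symm
  obtain ⟨C2, hC2⟩ := exists_bound_of_tendsto_ends (hc 2 (by norm_num)) h.d2_left h.d2_right
  obtain ⟨C4, hC4⟩ := exists_bound_of_tendsto_ends (hc 4 le_rfl) h.d4_left h.d4_right
  obtain ⟨t0, t1⟩ := tendsto_ends hl h.cont h.zero_left h.zero_right
  have hC40 : 0 ≤ C4 := (abs_nonneg _).trans (hC4 (l / 2) ⟨by linarith, by linarith⟩)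
  refine ⟨2 * C4, by positivity, fun n => ?_⟩
  have e1 := sineCoeff_second_deriv hl (n + 1) (q := ψ)
    (fun x hx => by simpa using hd 0 (by norm_num) x hx) (hd 1 (by norm_num)) t0 t1
    (hc 2 (by norm_num)) hC2
  have e2 := sineCoeff_second_deriv hl (n + 1) (hd 2 (by norm_num)) (hd 3 (by norm_num))
    h.d2_left h.d2_right (hc 4 le_rfl) hC4
  have hb := abs_sineCoeff_le hl (n + 1) hC4
  have hp := eig_pos hl n
  rw [show (3 + 1 : ℕ) = 4 from rfl] at e2
  rw [show (1 + 1 : ℕ) = 2 from rfl] at e1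
  rw [e2, e1, abs_mul, abs_mul, abs_neg, abs_of_pos hp] at hb
  rw [le_div_iff₀ (by positivity)]
  linarith

lemma exists_pos_le_abs_of_tendsto {a : ℕ → ℝ} {L : ℝ} (hL : L ≠ 0) (h : Tendsto a atTop (𝓝 L))
    (h0 : ∀ n, a n ≠ 0) : ∃ c, 0 < c ∧ ∀ n, c ≤ |a n| := by
  obtain ⟨C, hC⟩ := (Metric.isBounded_range_of_tendsto _ (h.inv₀ hL)).exists_norm_le
  have hC' : ∀ n, |a n|⁻¹ ≤ C := fun n => by
    have := hC _ (mem_range_self n)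
    rwa [Real.norm_eq_abs, abs_inv] at this
  have hCp : 0 < C := lt_of_lt_of_le (inv_pos.2 (abs_pos.2 (h0 0))) (hC' 0)
  refine ⟨C⁻¹, inv_pos.2 hCp, fun n => ?_⟩
  rw [inv_le_comm₀ hCp (abs_pos.2 (h0 n))]
  exact hC' n

/-! ### The determinant and the decay of τ and ν -/

/-- The determinant of the nonlocal condition in mode `m`. -/
noncomputable def detCoeff (l T δ₁ γ₁ δ₂ γ₂ : ℝ) (m : ℕ) : ℝ :=
  mlKer δ₂ (eig l m) (γ₂ - 1) T + eig l m / Real.Gamma δ₁ * mlKer δ₂ (eig l m) γ₂ T -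
    mlKer δ₁ (eig l m) γ₁ T

/-- The contribution of `f(·, 0)` to the conjugation condition, present only if `γ₁ = 1`. -/
noncomputable def initialSource (l γ₁ : ℝ) (f : ℝ → ℝ → ℝ) (m : ℕ) : ℝ :=
  if γ₁ = 1 then sineCoeff l m (fun x => f x 0) else 0

/-- Right-hand side of the nonlocal condition in mode `m`. -/
noncomputable def dataCoeff (l T δ₁ γ₁ δ₂ γ₂ : ℝ) (f : ℝ → ℝ → ℝ) (ψ : ℝ → ℝ) (m : ℕ) : ℝ :=
  sineCoeff l m ψ + conv (mlKer δ₁ (eig l m) δ₁) (fun s => sineCoeff l m (fun x => f x s)) T -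
    conv (mlKer δ₂ (eig l m) δ₂) (fun s => sineCoeff l m (fun x => f x (-s))) T +
    initialSource l γ₁ f m / Real.Gamma δ₁ * mlKer δ₂ (eig l m) γ₂ T

/-- The coefficient `ν` determined by `τ` through the conjugation condition. -/
noncomputable def nuCoeff (l δ₁ γ₁ : ℝ) (f : ℝ → ℝ → ℝ) (m : ℕ) (τ : ℝ) : ℝ :=
  (-eig l m * τ + initialSource l γ₁ f m) / Real.Gamma δ₁

lemma nonlocal_iff (l T δ₁ γ₁ δ₂ γ₂ : ℝ) (f : ℝ → ℝ → ℝ) (ψ : ℝ → ℝ) (m : ℕ) (τ : ℝ) :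
    (τ * mlKer δ₂ (eig l m) (γ₂ - 1) T + (-nuCoeff l δ₁ γ₁ f m τ) * mlKer δ₂ (eig l m) γ₂ T +
      conv (mlKer δ₂ (eig l m) δ₂) (fun s => sineCoeff l m (fun x => f x (-s))) T =
    τ * mlKer δ₁ (eig l m) γ₁ T +
      conv (mlKer δ₁ (eig l m) δ₁) (fun s => sineCoeff l m (fun x => f x s)) T +
      sineCoeff l m ψ) ↔
    τ * detCoeff l T δ₁ γ₁ δ₂ γ₂ m = dataCoeff l T δ₁ γ₁ δ₂ γ₂ f ψ m := by
  unfold detCoeff dataCoeff nuCoeff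
  constructor <;> intro h <;> linear_combination h

section Estimates
variable {l T δ₁ γ₁ δ₂ γ₂ : ℝ}

lemma exists_abs_mlKer_le_eig (hl : 0 < l) {δ c : ℝ} (hδ : 0 < δ) (hδ2 : δ < 2) (hc : 0 < c)
    (hc1 : c < δ + 1) (hT : 0 < T) :
    ∃ C, 0 ≤ C ∧ ∀ n, |mlKer δ (eig l (n + 1)) c T| ≤ C * eig l (n + 1) ^ (-1 : ℝ) := by
  obtain ⟨C, hC0, hC⟩ := exists_abs_mlKer_le hδ hδ2 hc hc1
  refine ⟨C * T ^ (c - δ * 1 - 1), by positivity, fun n => ?_⟩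
  refine (hC _ 1 T (eig_pos hl n) zero_le_one le_rfl hT).trans_eq (by ring)

/-- By `mlKer_eq`, λ_n times the kernel of order γ₂ is a fixed power kernel minus the kernel of
order γ₂-δ₂, and every Mittag-Leffler kernel at time T tends to 0. The determinant therefore has a
positive limit, and a sequence of nonzero numbers with nonzero limit is bounded away from 0. -/
lemma exists_pos_le_abs_det (hl : 0 < l) (hT : 0 < T) (hδ₁ : 0 < δ₁) (hδ₁1 : δ₁ < 1)
    (hδγ₁ : δ₁ ≤ γ₁) (hγ₁1 : γ₁ ≤ 1) (hδ₂ : 1 < δ₂) (hδ₂2 : δ₂ < 2) (hδγ₂ : δ₂ < γ₂)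
    (hγ₂2 : γ₂ ≤ 2) (h0 : ∀ n, detCoeff l T δ₁ γ₁ δ₂ γ₂ (n + 1) ≠ 0) :
    ∃ c, 0 < c ∧ ∀ n, c ≤ |detCoeff l T δ₁ γ₁ δ₂ γ₂ (n + 1)| := by
  have hδ₂0 : 0 < δ₂ := by linarith
  have hκ : 0 < γ₂ - δ₂ := by linarith
  have hlim : Tendsto (fun n : ℕ => eig l (n + 1) ^ (-1 : ℝ)) atTop (𝓝 0) :=
    (summable_eig_rpow hl (by norm_num : (1 / 2 : ℝ) < 1)).tendsto_atTop_zero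
  have key : ∀ {δ c : ℝ}, 0 < δ → δ < 2 → 0 < c → c < δ + 1 →
      Tendsto (fun n : ℕ => mlKer δ (eig l (n + 1)) c T) atTop (𝓝 0) := by
    intro δ c h1 h2 h3 h4
    obtain ⟨C, -, hC⟩ := exists_abs_mlKer_le_eig hl h1 h2 h3 h4 hT
    have := hlim.const_mul C
    rw [mul_zero] at this
    exact squeeze_zero_norm hC this
  have hk1 := key hδ₂0 hδ₂2 (by linarith : 0 < γ₂ - 1) (by linarith)
  have hk2 := key hδ₂0 hδ₂2 hκ (by linarith)
  have hk3 := key hδ₁ (by linarith) (by linarith : 0 < γ₁) (by linarith)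
  have heq : ∀ n, detCoeff l T δ₁ γ₁ δ₂ γ₂ (n + 1) = mlKer δ₂ (eig l (n + 1)) (γ₂ - 1) T +
      (Real.Gamma δ₁)⁻¹ * (powKer (γ₂ - δ₂) T - mlKer δ₂ (eig l (n + 1)) (γ₂ - δ₂) T) -
      mlKer δ₁ (eig l (n + 1)) γ₁ T := fun n => by
    have := mlKer_eq (eig l (n + 1)) (γ₂ - δ₂) hδ₂0 hT
    rw [show δ₂ + (γ₂ - δ₂) = γ₂ by ring] at this
    rw [detCoeff, this]; ring
  have ht := (hk1.add ((tendsto_const_nhds.sub hk2).const_mul (Real.Gamma δ₁)⁻¹)).sub hk3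
    (f := fun n : ℕ => mlKer δ₂ (eig l (n + 1)) (γ₂ - 1) T +
      (Real.Gamma δ₁)⁻¹ * (powKer (γ₂ - δ₂) T - mlKer δ₂ (eig l (n + 1)) (γ₂ - δ₂) T))
  have hΓ := Real.Gamma_pos_of_pos hδ₁
  have hΓ2 := Real.Gamma_pos_of_pos hκ
  refine exists_pos_le_abs_of_tendsto ?_ (ht.congr fun n => (heq n).symm) h0
  have : 0 < powKer (γ₂ - δ₂) T := div_pos (Real.rpow_pos_of_pos hT _) hΓ2
  rw [zero_add, sub_zero, sub_zero]
  positivity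

lemma eig_rpow_le {p q : ℝ} (hl : 0 < l) (hpq : p ≤ q) (n : ℕ) :
    eig l (n + 1) ^ p ≤ ((Real.pi / l) ^ 2) ^ (p - q) * eig l (n + 1) ^ q := by
  have h0 : 0 < (Real.pi / l) ^ 2 := by positivity
  have hp := eig_pos hl n
  have : eig l (n + 1) ^ p = eig l (n + 1) ^ (p - q) * eig l (n + 1) ^ q := by
    rw [← Real.rpow_add hp]; ring_nf
  rw [this]
  exact mul_le_mul_of_nonneg_right
    (Real.rpow_le_rpow_of_nonpos h0 (eig_ge hl n) (by linarith)) (Real.rpow_nonneg hp.le _)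

lemma exists_abs_conv_forcing_le {M δ θ : ℝ} {g gt : ℝ → ℝ → ℝ} (h : Forcing l T M g gt)
    (hl : 0 < l) (hT : 0 < T) (hM : 0 ≤ M) (hδ : 0 < δ) (hδ2 : δ < 2) (hθ : 0 ≤ θ) (hθ1 : θ < 1) :
    ∃ C, 0 ≤ C ∧ ∀ n, |conv (mlKer δ (eig l (n + 1)) δ)
      (fun s => sineCoeff l (n + 1) (fun x => g x s)) T| ≤ C * eig l (n + 1) ^ (-1 - θ) := by
  obtain ⟨C, hC0, hC⟩ := exists_abs_mlKer_le hδ hδ2 hδ (by linarith : δ < δ + 1)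
  have hpos : 0 < δ - δ * θ := by nlinarith
  have hbeta := betaC_pos hpos one_pos
  refine ⟨C * M * betaC (δ - δ * θ) 1 * T ^ (δ - δ * θ + 1 - 1), by positivity, fun n => ?_⟩
  have := abs_conv_le (a := δ - δ * θ) (b := 1) hpos one_pos hT
      (p := mlKer δ (eig l (n + 1)) δ) (k := fun s => sineCoeff l (n + 1) (fun x => g x s))
      (A := C * eig l (n + 1) ^ (-θ)) (B := M / eig l (n + 1))
      (fun s hs => hC _ _ s (eig_pos hl n) hθ hθ1.le hs.1)
      (fun s hs => by
        rw [sub_self, Real.rpow_zero, mul_one]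
        exact h.coeff_le n s ⟨hs.1.le, hs.2.le⟩)
  refine this.trans_eq ?_
  rw [show -1 - θ = -θ + -1 by ring, Real.rpow_add (eig_pos hl n), Real.rpow_neg_one]
  ring

/-- Decay of the coefficients `τ` and `ν`. -/
lemma exists_coeff_bounds (hl : 0 < l) (hT : 0 < T) (hδ₁ : 0 < δ₁) (hδ₁1 : δ₁ < 1)
    (hδγ₁ : δ₁ ≤ γ₁) (hγ₁1 : γ₁ ≤ 1) (hδ₂ : 1 < δ₂) (hδ₂2 : δ₂ < 2) (hδγ₂ : δ₂ < γ₂)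
    (hγ₂2 : γ₂ ≤ 2) (h0 : ∀ n, detCoeff l T δ₁ γ₁ δ₂ γ₂ (n + 1) ≠ 0) {f : ℝ → ℝ → ℝ} {ψ : ℝ → ℝ}
    (hf : AdmissibleF l T f) (hψ : AdmissiblePsi l ψ) {θ : ℝ} (hθ : 0 ≤ θ) (hθ1 : θ < 1)
    {τ : ℕ → ℝ} (hτ : ∀ n, τ n * detCoeff l T δ₁ γ₁ δ₂ γ₂ (n + 1) =
      dataCoeff l T δ₁ γ₁ δ₂ γ₂ f ψ (n + 1)) :
    ∃ C, ∀ n, |τ n| ≤ C * eig l (n + 1) ^ (-1 - θ) ∧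
      |nuCoeff l δ₁ γ₁ f (n + 1) (τ n)| ≤ C * eig l (n + 1) ^ (-θ) := by
  obtain ⟨gp, Mp, hMp, hp⟩ := hf.forcing_pos hl hT
  obtain ⟨gm, Mm, hMm, hm⟩ := hf.forcing_neg hl hT
  obtain ⟨c, hc, hdet⟩ := exists_pos_le_abs_det hl hT hδ₁ hδ₁1 hδγ₁ hγ₁1 hδ₂ hδ₂2 hδγ₂ hγ₂2 h0
  obtain ⟨C1, hC1, h1⟩ := hψ.coeff_le hl
  obtain ⟨C2, hC2, h2⟩ := exists_abs_conv_forcing_le hp hl hT hMp hδ₁ (by linarith) hθ hθ1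
  obtain ⟨C3, hC3, h3⟩ := exists_abs_conv_forcing_le hm hl hT hMm (by linarith) hδ₂2 hθ hθ1
  obtain ⟨C4, hC4, h4⟩ := exists_abs_mlKer_le_eig hl (by linarith) hδ₂2 (by linarith : 0 < γ₂)
    (by linarith) hT
  have hΓ := Real.Gamma_pos_of_pos hδ₁
  set G := Real.Gamma δ₁ with hG
  set P := ((Real.pi / l) ^ 2) ^ (-2 - (-1 - θ)) with hP
  set P' := ((Real.pi / l) ^ 2) ^ (-1 - (-θ)) with hP'
  have hP0 : 0 ≤ P := by positivity
  have hP'0 : 0 ≤ P' := by positivity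
  have hsrc : ∀ n, |initialSource l γ₁ f (n + 1)| ≤ Mp * eig l (n + 1) ^ (-1 : ℝ) := by
    intro n
    have hb := hp.coeff_le n 0 ⟨le_rfl, hT.le⟩
    rw [Real.rpow_neg_one, ← div_eq_mul_inv]
    unfold initialSource
    split_ifs
    · exact hb
    · rw [abs_zero]; exact div_nonneg hMp (eig_pos hl n).le
  have hsq : ∀ n, eig l (n + 1) ^ (-1 : ℝ) * eig l (n + 1) ^ (-1 : ℝ) ≤
      P * eig l (n + 1) ^ (-1 - θ) := fun n => by
    rw [← Real.rpow_add (eig_pos hl n), show (-1 : ℝ) + -1 = -2 by norm_num]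
    exact eig_rpow_le hl (by linarith) n
  -- ψ contributes λ^{-2}, the two forcing convolutions λ^{-1-θ}, and the initial source times its
  -- kernel λ^{-1} λ^{-1}. The slowest rate, λ^{-1-θ}, is passed on to τ, and ν loses one power of λ
  -- against it.
  set D := C1 * P + C2 + C3 + Mp / G * C4 * P with hD
  have hD0 : 0 ≤ D := by positivity
  have hdata : ∀ n, |dataCoeff l T δ₁ γ₁ δ₂ γ₂ f ψ (n + 1)| ≤ D * eig l (n + 1) ^ (-1 - θ) := by
    intro n
    have b1 : |sineCoeff l (n + 1) ψ| ≤ C1 * P * eig l (n + 1) ^ (-1 - θ) := by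
      refine (h1 n).trans ?_
      rw [div_eq_mul_inv, mul_assoc]
      refine mul_le_mul_of_nonneg_left ((le_of_eq ?_).trans (hsq n)) hC1
      rw [Real.rpow_neg_one, ← mul_inv, sq]
    have b4 : |initialSource l γ₁ f (n + 1) / G * mlKer δ₂ (eig l (n + 1)) γ₂ T| ≤
        Mp / G * C4 * P * eig l (n + 1) ^ (-1 - θ) := by
      rw [abs_mul, abs_div, abs_of_pos hΓ]
      calc |initialSource l γ₁ f (n + 1)| / G * |mlKer δ₂ (eig l (n + 1)) γ₂ T|
          ≤ (Mp * eig l (n + 1) ^ (-1 : ℝ)) / G * (C4 * eig l (n + 1) ^ (-1 : ℝ)) := by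
            have e1 := hsrc n
            have e2 := h4 n
            exact mul_le_mul (div_le_div_of_nonneg_right e1 hΓ.le) e2 (abs_nonneg _)
              (div_nonneg ((abs_nonneg _).trans e1) hΓ.le)
        _ = Mp / G * C4 * (eig l (n + 1) ^ (-1 : ℝ) * eig l (n + 1) ^ (-1 : ℝ)) := by ring
        _ ≤ Mp / G * C4 * (P * eig l (n + 1) ^ (-1 - θ)) :=
            mul_le_mul_of_nonneg_left (hsq n) (by positivity)
        _ = _ := by ring
    have b2 := h2 n
    have b3 := h3 n
    rw [abs_le] at b1 b2 b3 b4 ⊢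
    unfold dataCoeff
    rw [hD, add_mul, add_mul, add_mul]
    constructor <;> linarith [b1.1, b1.2, b2.1, b2.2, b3.1, b3.2, b4.1, b4.2]
  have hτb : ∀ n, |τ n| ≤ D / c * eig l (n + 1) ^ (-1 - θ) := by
    intro n
    have e : |τ n| * |detCoeff l T δ₁ γ₁ δ₂ γ₂ (n + 1)| ≤ D * eig l (n + 1) ^ (-1 - θ) := by
      rw [← abs_mul, hτ n]; exact hdata n
    rw [div_mul_eq_mul_div, le_div_iff₀ hc]
    exact (mul_le_mul_of_nonneg_left (hdet n) (abs_nonneg _)).trans e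
  have hνb : ∀ n, |nuCoeff l δ₁ γ₁ f (n + 1) (τ n)| ≤
      (D / c + Mp * P') / G * eig l (n + 1) ^ (-θ) := by
    intro n
    have hpn := eig_pos hl n
    unfold nuCoeff
    rw [abs_div, abs_of_pos hΓ, div_mul_eq_mul_div]
    refine div_le_div_of_nonneg_right ((abs_add_le _ _).trans ?_) hΓ.le
    rw [abs_mul, abs_neg, abs_of_pos hpn, add_mul]
    refine add_le_add ?_ ?_
    · refine (mul_le_mul_of_nonneg_left (hτb n) hpn.le).trans_eq ?_
      rw [mul_left_comm]
      congr 1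
      nth_rewrite 1 [← Real.rpow_one (eig l (n + 1))]
      rw [← Real.rpow_add hpn]
      ring_nf
    · refine (hsrc n).trans ?_
      rw [mul_assoc]
      exact mul_le_mul_of_nonneg_left (eig_rpow_le hl (by linarith) n) hMp
  refine ⟨max (D / c) ((D / c + Mp * P') / G), fun n => ⟨(hτb n).trans ?_, (hνb n).trans ?_⟩⟩
  · exact mul_le_mul_of_nonneg_right (le_max_left _ _) (Real.rpow_nonneg (eig_pos hl n).le _)
  · exact mul_le_mul_of_nonneg_right (le_max_right _ _) (Real.rpow_nonneg (eig_pos hl n).le _)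

end Estimates

/-! ### The problem as two left-sided halves -/

/-- The conditions on one of the two halves of the domain, in the left-sided form. -/
structure HalfSolution (l T : ℝ) (N : ℕ) (α β μ κ : ℝ) (g v : ℝ → ℝ → ℝ) : Prop where
  reg : ExtendsCont (Icc 0 l ×ˢ Ioc 0 T) (Icc 0 l ×ˢ Icc 0 T) (fun x t => t ^ κ * v x t)
  exists_D : ∀ x ∈ Ioo 0 l, LeftHilferExists N α β μ T (v x)
  reg_D : ExtendsCont (Ioo 0 l ×ˢ Ioo 0 T) (Icc 0 l ×ˢ Icc 0 T)
    (fun x t => t ^ κ * leftHilfer N α β μ (v x) t)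
  diff_x : ∀ x ∈ Ioo 0 l, ∀ t ∈ Ioo 0 T,
    DifferentiableAt ℝ (fun y => v y t) x ∧ DifferentiableAt ℝ (deriv (fun y => v y t)) x
  cont_xx : ContinuousOn (fun p : ℝ × ℝ => iteratedDeriv 2 (fun y => v y p.2) p.1)
    (Ioo 0 l ×ˢ Ioo 0 T)
  eqn : ∀ x ∈ Ioo 0 l, ∀ t ∈ Ioo 0 T,
    leftHilfer N α β μ (v x) t - iteratedDeriv 2 (fun y => v y t) x = g x t
  bdry : ∀ t ∈ Ioc 0 T, v 0 t = 0 ∧ v l t = 0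

lemma extendsCont_reflect {X Y S K S' K' : Set ℝ} {g g' : ℝ → ℝ → ℝ}
    (h : ExtendsCont (X ×ˢ S) (Y ×ˢ K) g) (hS : ∀ t ∈ S', -t ∈ S) (hK : ∀ t ∈ K', -t ∈ K)
    (hg : ∀ x t, g' x t = g x (-t)) : ExtendsCont (X ×ˢ S') (Y ×ˢ K') g' := by
  obtain ⟨G, hG, he⟩ := h
  refine ⟨fun p => G (p.1, -p.2), hG.comp (by fun_prop) fun p hp => ⟨hp.1, hK _ hp.2⟩,
    fun p hp => ?_⟩
  rw [hg, ← he (p.1, -p.2) ⟨hp.1, hS _ hp.2⟩]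

/-- Reflection leaves the second-order operator unchanged but reverses the sign of a first
derivative, whence the -c in the last condition. -/
lemma isSolution_iff {l T α₁ β₁ μ₁ α₂ β₂ μ₂ : ℝ} {f : ℝ → ℝ → ℝ} {ψ : ℝ → ℝ} {u : ℝ → ℝ → ℝ} :
    IsSolution l T α₁ β₁ μ₁ α₂ β₂ μ₂ f ψ u ↔
      HalfSolution l T 1 α₁ β₁ μ₁ (1 - gam 1 β₁ μ₁) f u ∧
      HalfSolution l T 2 α₂ β₂ μ₂ (2 - gam 2 β₂ μ₂) (fun x s => f x (-s)) (fun x s => u x (-s)) ∧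
      (∀ x ∈ Icc 0 l, u x (-T) = u x T + ψ x) ∧
      (∀ x ∈ Icc 0 l, ∃ c : ℝ,
        Tendsto (leftInt (1 - gam 1 β₁ μ₁) (u x)) (𝓝[>] 0) (𝓝 c) ∧
        Tendsto (leftInt (2 - gam 2 β₂ μ₂) (fun s => u x (-s))) (𝓝[>] 0) (𝓝 c)) ∧
      ∀ x ∈ Ioo 0 l, ∃ c : ℝ,
        Tendsto (fun t => t ^ (1 - del α₁ β₁ μ₁) * deriv (leftInt (1 - gam 1 β₁ μ₁) (u x)) t)
          (𝓝[>] 0) (𝓝 c) ∧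
        Tendsto (deriv (leftInt (2 - gam 2 β₂ μ₂) (fun s => u x (-s)))) (𝓝[>] 0) (𝓝 (-c)) := by
  have hR : ∀ x, rightInt (2 - gam 2 β₂ μ₂) (u x) =
      fun t => leftInt (2 - gam 2 β₂ μ₂) (fun s => u x (-s)) (-t) := fun x =>
    funext fun t => rightInt_eq _ _ _
  have hdR : ∀ x t, deriv (rightInt (2 - gam 2 β₂ μ₂) (u x)) t =
      -deriv (leftInt (2 - gam 2 β₂ μ₂) (fun s => u x (-s))) (-t) := fun x t => by
    rw [hR, deriv_comp_neg]
  have hneg : ∀ {t}, t ∈ Ioo 0 T → -t ∈ Ioo (-T) 0 := fun ht =>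
    ⟨by linarith [ht.2], by linarith [ht.1]⟩
  have hneg' : ∀ {t}, t ∈ Ioo (-T) 0 → -t ∈ Ioo 0 T := fun ht =>
    ⟨by linarith [ht.2], by linarith [ht.1]⟩
  have hc1 : ∀ x c, Tendsto (fun t => deriv (rightInt (2 - gam 2 β₂ μ₂) (u x)) t) (𝓝[<] 0) (𝓝 c) ↔
      Tendsto (deriv (leftInt (2 - gam 2 β₂ μ₂) (fun s => u x (-s)))) (𝓝[>] 0) (𝓝 (-c)) := by
    intro x c
    simp only [hdR]
    rw [tendsto_reflect (F := fun t => -deriv (leftInt (2 - gam 2 β₂ μ₂) (fun s => u x (-s))) t)]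
    exact ⟨fun h => by simpa using h.neg, fun h => by simpa using h.neg⟩
  have hc0 : ∀ x c, Tendsto (fun t => rightInt (2 - gam 2 β₂ μ₂) (u x) t) (𝓝[<] 0) (𝓝 c) ↔
      Tendsto (leftInt (2 - gam 2 β₂ μ₂) (fun s => u x (-s))) (𝓝[>] 0) (𝓝 c) := by
    intro x c
    simp only [rightInt_eq]
    exact tendsto_reflect
  constructor
  · intro h
    refine ⟨⟨h.reg_u_pos, h.exists_D_pos, h.reg_D_pos, fun x hx t ht => h.diff_x x hx t (Or.inr ht),
        h.cont_xx.mono (prod_mono_right subset_union_right), h.eq_pos,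
        fun t ht => h.bdry t (Or.inr ht)⟩,
      ⟨?_, fun x hx => (rightHilferExists_iff ..).1 (h.exists_D_neg x hx), ?_,
        fun x hx t ht => h.diff_x x hx (-t) (Or.inl (hneg ht)), ?_, ?_,
        fun t ht => h.bdry (-t) (Or.inl ⟨by linarith [ht.2], by linarith [ht.1]⟩)⟩,
      h.nonlocal, fun x hx => ?_, fun x hx => ?_⟩
    · exact extendsCont_reflect h.reg_u_neg (fun t ht => ⟨by linarith [ht.2], by linarith [ht.1]⟩)
        (fun t ht => ⟨by linarith [ht.2], by linarith [ht.1]⟩) fun x t => by rw [neg_neg]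
    · exact extendsCont_reflect h.reg_D_neg (fun t ht => hneg ht)
        (fun t ht => ⟨by linarith [ht.2], by linarith [ht.1]⟩)
        fun x t => by rw [rightHilfer_two_eq, neg_neg]
    · exact h.cont_xx.comp (f := fun p : ℝ × ℝ => ((p.1, -p.2) : ℝ × ℝ)) (by fun_prop)
        fun p hp => ⟨hp.1, Or.inl (hneg hp.2)⟩
    · intro x hx t ht
      have := h.eq_neg x hx (-t) (hneg ht)
      rwa [rightHilfer_two_eq, neg_neg] at this
    · obtain ⟨c, h1, h2⟩ := h.conj₀ x hx
      exact ⟨c, h1, (hc0 x c).1 h2⟩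
    · obtain ⟨c, h1, h2⟩ := h.conj₁ x hx
      exact ⟨c, h1, (hc1 x c).1 h2⟩
  · rintro ⟨h, h', hn, h0, h1⟩
    refine ⟨h.reg, ?_, h.exists_D, fun x hx => (rightHilferExists_iff ..).2 (h'.exists_D x hx),
      h.reg_D, ?_, ?_, ?_, h.eqn, ?_, ?_, hn, fun x hx => ?_, fun x hx => ?_⟩
    · exact extendsCont_reflect h'.reg (fun t ht => ⟨by linarith [ht.2], by linarith [ht.1]⟩)
        (fun t ht => ⟨by linarith [ht.2], by linarith [ht.1]⟩) fun x t => by rw [neg_neg]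
    · exact extendsCont_reflect h'.reg_D (fun t ht => hneg' ht)
        (fun t ht => ⟨by linarith [ht.2], by linarith [ht.1]⟩)
        fun x t => by rw [rightHilfer_two_eq]
    · rintro x hx t (ht | ht)
      · have := h'.diff_x x hx (-t) (hneg' ht)
        simpa only [neg_neg] using this
      · exact h.diff_x x hx t ht
    · rw [prod_union]
      refine ContinuousOn.union_of_isOpen ?_ h.cont_xx (isOpen_Ioo.prod isOpen_Ioo)
        (isOpen_Ioo.prod isOpen_Ioo)
      have := h'.cont_xx.comp (f := fun p : ℝ × ℝ => ((p.1, -p.2) : ℝ × ℝ)) (s := Ioo 0 l ×ˢ Ioo (-T) 0)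
        (by fun_prop) fun p hp => ⟨hp.1, hneg' hp.2⟩
      simpa only [Function.comp_def, neg_neg] using this
    · intro x hx t ht
      have := h'.eqn x hx (-t) (hneg' ht)
      rw [rightHilfer_two_eq]
      simpa only [neg_neg] using this
    · rintro t (ht | ht)
      · have := h'.bdry (-t) ⟨by linarith [ht.2], by linarith [ht.1]⟩
        simpa only [neg_neg] using this
      · exact h.bdry t ht
    · obtain ⟨c, h1, h2⟩ := h0 x hx
      exact ⟨c, h1, (hc0 x c).2 h2⟩
    · obtain ⟨c, h2, h3⟩ := h1 x hx
      exact ⟨c, h2, (hc1 x c).2 h3⟩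

/-- A sine field solving the equation of one half satisfies all conditions of that half. -/
lemma halfSolution_of_sineField {l T α β μ κ : ℝ} {N : ℕ} {g v : ℝ → ℝ → ℝ} {k : ℕ → ℝ → ℝ}
    (hl : 0 < l) (hT : 0 < T) (hκ : 0 ≤ κ) (hk : SineField l T κ k)
    (hg : ContinuousOn (fun p : ℝ × ℝ => g p.1 p.2) (Icc 0 l ×ˢ Icc 0 T))
    (hv : ∀ x, ∀ t ∈ Ioc 0 T, v x t = ∑' n, k n t * mode l (n + 1) x)
    (hD : ∀ x ∈ Icc 0 l, LeftHilferExists N α β μ T (v x) ∧ ∀ t ∈ Ioo 0 T,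
      leftHilfer N α β μ (v x) t =
        g x t + ∑' n, (-eig l (n + 1) * k n t) * mode l (n + 1) x) :
    HalfSolution l T N α β μ κ g v := by
  have hvt : ∀ t ∈ Ioc 0 T, (fun y => v y t) = fun y => ∑' n, k n t * mode l (n + 1) y :=
    fun t ht => funext fun y => hv y t ht
  have hd := fun t (ht : t ∈ Ioo 0 T) x => hk.hasDerivAt hl (Ioo_subset_Ioc_self ht) x
  refine ⟨?_, fun x hx => (hD x (Ioo_subset_Icc_self hx)).1, ?_, ?_, ?_, ?_, ?_⟩
  · obtain ⟨G, hG, he⟩ := hk.extendsCont hl hT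
    exact ⟨G, hG, fun p hp => by simp only [he p hp, hv p.1 p.2 hp.2]⟩
  · obtain ⟨G, hG, he⟩ := hk.extendsCont_xx hl
    refine ⟨fun p => p.2 ^ κ * g p.1 p.2 + G p, ContinuousOn.add (ContinuousOn.mul
      (continuous_snd.rpow_const fun _ => Or.inr hκ).continuousOn hg) hG, fun p hp => ?_⟩
    simp only []
    rw [he p ⟨Ioo_subset_Icc_self hp.1, Ioo_subset_Ioc_self hp.2⟩,
      (hD p.1 (Ioo_subset_Icc_self hp.1)).2 p.2 hp.2]
    ring
  · intro x _ t ht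
    rw [hvt t (Ioo_subset_Ioc_self ht)]
    exact ⟨(hd t ht x).1, (hd t ht x).2.1⟩
  · refine ((hk.xPowBdd_xx hl).1.mono (prod_mono Ioo_subset_Icc_self Ioo_subset_Ioc_self)).congr
      fun p hp => ?_
    simp only []
    rw [hvt p.2 (Ioo_subset_Ioc_self hp.2), (hd p.2 hp.2 p.1).2.2]
  · intro x hx t ht
    rw [hvt t (Ioo_subset_Ioc_self ht), (hd t ht x).2.2, (hD x (Ioo_subset_Icc_self hx)).2 t ht]
    ring
  · intro t ht
    rw [hv 0 t ht, hv l t ht]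
    exact ⟨tsum_mode_zero _, tsum_mode_end hl _⟩

/-! ### Existence -/

section Existence
variable {l T α β μ : ℝ} {g gt v : ℝ → ℝ → ℝ} {M : ℝ}

lemma HalfSolution.of_parabolic (h : Forcing l T M g gt) (hl : 0 < l) (hT : 0 < T) (hM : 0 ≤ M)
    (hδ : 0 < del α β μ) (hδ1 : del α β μ < 1) (hδγ : del α β μ ≤ gam 1 β μ) (hγ1 : gam 1 β μ ≤ 1)
    {τ : ℕ → ℝ} (hτ : Summable fun n => eig l (n + 1) * |τ n|)
    (hv : ∀ x, ∀ t ∈ Ioc 0 T, v x t =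
      ∑' n, parabolicCoeff l (del α β μ) (gam 1 β μ) g τ n t * mode l (n + 1) x) :
    HalfSolution l T 1 α β μ (1 - gam 1 β μ) g v ∧
    ∀ x ∈ Icc 0 l,
      Tendsto (leftInt (1 - gam 1 β μ) (v x)) (𝓝[>] 0) (𝓝 (∑' n, τ n * mode l (n + 1) x)) ∧
      Tendsto (fun t => t ^ (1 - del α β μ) * deriv (leftInt (1 - gam 1 β μ) (v x)) t) (𝓝[>] 0)
        (𝓝 (∑' n, nuCoeff l (del α β μ) (gam 1 β μ) g (n + 1) (τ n) * mode l (n + 1) x)) := by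
  have hSF := sineField_parabolic h hl hM hδ hδ1 hδγ hγ1 hτ
  obtain ⟨c, h', hc, hh, hV, hS, hlim⟩ := exists_parabolic_source h hl hT hM hδ hδ1 hδγ hγ1 hτ
  have e0 : (1 - μ) * ((1 : ℕ) - β) = 1 - gam 1 β μ := by unfold gam; push_cast; ring
  have e1 : μ * ((1 : ℕ) - α) = gam 1 β μ - del α β μ := by unfold gam del; push_cast; ring
  have hκ : 0 ≤ 1 - gam 1 β μ := by linarith
  have hVv : ∀ x ∈ Icc 0 l, ∀ t ∈ Ioo 0 T, leftInt (1 - gam 1 β μ) (v x) t =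
      (∑' n, τ n * mode l (n + 1) x) + ∫ s in (0 : ℝ)..t, h' x s := fun x hx t ht => by
    rw [leftInt_congr hκ ht.1 (fun s hs => hv x s ⟨hs.1, hs.2.trans ht.2.le⟩)]
    exact hV x hx t (Ioo_subset_Ioc_self ht)
  refine ⟨halfSolution_of_sineField hl hT hκ hSF h.cont hv fun x hx => ?_, fun x hx => ⟨?_, ?_⟩⟩
  · have hvp : PowBdd T (1 - (1 - gam 1 β μ)) (v x) :=
      ((hSF.xPowBdd hl hT).powBdd hx).congr fun t ht => hv x t ht
    obtain ⟨h1, h2⟩ := leftHilferExists_one (α := α) (β := β) (μ := μ) hc (by linarith)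
      (hh.powBdd hx) hvp (by rw [e0]; exact hκ) (by rw [e1]; linarith)
      (fun t ht => by rw [e0]; exact hVv x hx t ht)
    refine ⟨h1, fun t ht => ?_⟩
    rw [h2 t ht, e1, hS x hx t (Ioo_subset_Ioc_self ht)]
  · have := (tendsto_integral_of_powBdd hT hc (hh.powBdd hx)).const_add
      (∑' n, τ n * mode l (n + 1) x)
    rw [add_zero] at this
    refine this.congr' ?_
    filter_upwards [Ioo_mem_nhdsGT hT] with t ht using (hVv x hx t ht).symm
  · refine ((hlim x hx).congr' ?_)
    filter_upwards [Ioo_mem_nhdsGT hT] with t ht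
    rw [(deriv_leftInt_one hc (hh.powBdd hx) (hVv x hx) ht).deriv]

lemma HalfSolution.of_hyperbolic (h : Forcing l T M g gt) (hl : 0 < l) (hT : 0 < T) (hM : 0 ≤ M)
    (hδ : 1 < del α β μ) (hδ2 : del α β μ < 2) (hδγ : del α β μ < gam 2 β μ) (hγ2 : gam 2 β μ ≤ 2)
    {A B : ℕ → ℝ} (hA : Summable fun n => eig l (n + 1) * |A n|)
    (hB : Summable fun n => eig l (n + 1) * (|B n| * eig l (n + 1) ^ (-(1 / del α β μ))))
    (hB1 : Summable fun n => |B n|) {θ : ℝ} (hθ0 : 0 ≤ θ) (hθ1 : θ < 1)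
    (hBθ : Summable fun n => |(-eig l (n + 1) * B n)| * eig l (n + 1) ^ (-θ))
    (hv : ∀ x, ∀ t ∈ Ioc 0 T, v x t =
      ∑' n, hyperbolicCoeff l (del α β μ) (gam 2 β μ) g A B n t * mode l (n + 1) x) :
    HalfSolution l T 2 α β μ (2 - gam 2 β μ) g v ∧
    ∀ x ∈ Icc 0 l,
      Tendsto (leftInt (2 - gam 2 β μ) (v x)) (𝓝[>] 0) (𝓝 (∑' n, A n * mode l (n + 1) x)) ∧
      Tendsto (deriv (leftInt (2 - gam 2 β μ) (v x))) (𝓝[>] 0)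
        (𝓝 (∑' n, B n * mode l (n + 1) x)) := by
  have hSF := sineField_hyperbolic h hl hM hδ hδ2 hδγ hγ2 hA hB
  obtain ⟨c, h', hc, hh, hV, hS⟩ :=
    exists_hyperbolic_source h hl hT hM hδ hδ2 hδγ hγ2 hA hB hB1 hθ0 hθ1 hBθ
  have e0 : (1 - μ) * ((2 : ℕ) - β) = 2 - gam 2 β μ := by unfold gam; push_cast; ring
  have e1 : μ * ((2 : ℕ) - α) = gam 2 β μ - del α β μ := by unfold gam del; push_cast; ring
  have hκ : 0 ≤ 2 - gam 2 β μ := by linarith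
  have hVv : ∀ x ∈ Icc 0 l, ∀ t ∈ Ioo 0 T, leftInt (2 - gam 2 β μ) (v x) t =
      (∑' n, A n * mode l (n + 1) x) + (∑' n, B n * mode l (n + 1) x) * t +
        ∫ r in (0 : ℝ)..t, ∫ s in (0 : ℝ)..r, h' x s := fun x hx t ht => by
    rw [leftInt_congr hκ ht.1 (fun s hs => hv x s ⟨hs.1, hs.2.trans ht.2.le⟩)]
    exact hV x hx t (Ioo_subset_Ioc_self ht)
  refine ⟨halfSolution_of_sineField hl hT hκ hSF h.cont hv fun x hx => ?_, fun x hx => ⟨?_, ?_⟩⟩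
  · have hvp : PowBdd T (1 - (2 - gam 2 β μ)) (v x) :=
      ((hSF.xPowBdd hl hT).powBdd hx).congr fun t ht => hv x t ht
    obtain ⟨h1, h2⟩ := leftHilferExists_two (α := α) (β := β) (μ := μ) hc (by linarith)
      (hh.powBdd hx) hvp (by rw [e0]; exact hκ) (by rw [e1]; linarith)
      (fun t ht => by rw [e0]; exact hVv x hx t ht)
    refine ⟨h1, fun t ht => ?_⟩
    rw [h2 t ht, e1, hS x hx t (Ioo_subset_Ioc_self ht)]
  · have hid : Tendsto (fun t : ℝ => t) (𝓝[>] 0) (𝓝 0) := tendsto_id.mono_left nhdsWithin_le_nhds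
    have := ((hid.const_mul (∑' n, B n * mode l (n + 1) x)).const_add
      (∑' n, A n * mode l (n + 1) x)).add (tendsto_integral_of_powBdd hT one_pos
        (powBdd_integral hc (hh.powBdd hx)))
    rw [mul_zero, add_zero, add_zero] at this
    refine this.congr' ?_
    filter_upwards [Ioo_mem_nhdsGT hT] with t ht using (hVv x hx t ht).symm
  · have := (tendsto_integral_of_powBdd hT hc (hh.powBdd hx)).const_add
      (∑' n, B n * mode l (n + 1) x)
    rw [add_zero] at this
    refine this.congr' ?_
    filter_upwards [Ioo_mem_nhdsGT hT] with t ht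
    rw [(deriv_leftInt_two hc (hh.powBdd hx) (hVv x hx) ht).deriv]

end Existence

/-- Ranges of the exponents. -/
structure ExponentRange (α₁ β₁ μ₁ α₂ β₂ μ₂ : ℝ) : Prop where
  del₁_pos : 0 < del α₁ β₁ μ₁
  del₁_lt : del α₁ β₁ μ₁ < 1
  del₁_le : del α₁ β₁ μ₁ ≤ gam 1 β₁ μ₁
  gam₁_le : gam 1 β₁ μ₁ ≤ 1
  del₂_gt : 1 < del α₂ β₂ μ₂
  del₂_lt : del α₂ β₂ μ₂ < 2
  del₂_lt_gam : del α₂ β₂ μ₂ < gam 2 β₂ μ₂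
  gam₂_le : gam 2 β₂ μ₂ ≤ 2

/-- Each δ_i is a convex combination of α_i and β_i, and γ_i - δ_i = μ_i (i - α_i), i - γ_i = (1 -
μ_i)(i - β_i). The strict inequality δ₂ < γ₂ comes from μ₂ > 0 and α₂ < 2. -/
lemma exponentRange {α₁ β₁ μ₁ α₂ β₂ μ₂ : ℝ}
    (hα₁ : 0 < α₁ ∧ α₁ < 1) (hβ₁ : 0 < β₁ ∧ β₁ < 1) (hμ₁ : 0 ≤ μ₁ ∧ μ₁ ≤ 1)
    (hα₂ : 1 < α₂ ∧ α₂ < 2) (hβ₂ : 1 < β₂ ∧ β₂ < 2) (hμ₂ : 0 < μ₂ ∧ μ₂ ≤ 1) :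
    ExponentRange α₁ β₁ μ₁ α₂ β₂ μ₂ := by
  have key : ∀ {a b c μ : ℝ}, 0 ≤ μ → μ ≤ 1 → a < c → b < c → b + μ * (a - b) < c := by
    intro a b c μ h0 h1 ha hb
    rcases h0.eq_or_lt with rfl | h0
    · simpa using hb
    · nlinarith [mul_pos h0 (sub_pos.2 ha), mul_nonneg (sub_nonneg.2 h1) (sub_pos.2 hb).le]
  have key' : ∀ {a b c μ : ℝ}, 0 ≤ μ → μ ≤ 1 → c < a → c < b → c < b + μ * (a - b) := by
    intro a b c μ h0 h1 ha hb
    have := key (a := -a) (b := -b) (c := -c) h0 h1 (by linarith) (by linarith)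
    linarith
  constructor
  · exact key' hμ₁.1 hμ₁.2 hα₁.1 hβ₁.1
  · exact key hμ₁.1 hμ₁.2 hα₁.2 hβ₁.2
  · unfold del gam; push_cast
    nlinarith [mul_nonneg hμ₁.1 (sub_pos.2 hα₁.2).le]
  · unfold gam; push_cast
    nlinarith [mul_nonneg (sub_nonneg.2 hμ₁.2) (sub_pos.2 hβ₁.2).le]
  · exact key' hμ₂.1.le hμ₂.2 hα₂.1 hβ₂.1
  · exact key hμ₂.1.le hμ₂.2 hα₂.2 hβ₂.2
  · unfold del gam; push_cast
    nlinarith [mul_pos hμ₂.1 (sub_pos.2 hα₂.2)]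
  · unfold gam; push_cast
    nlinarith [mul_nonneg (sub_nonneg.2 hμ₂.2) (sub_pos.2 hβ₂.2).le]

theorem exists_solution {l T α₁ β₁ μ₁ α₂ β₂ μ₂ : ℝ} (hl : 0 < l) (hT : 0 < T)
    (hE : ExponentRange α₁ β₁ μ₁ α₂ β₂ μ₂) {f : ℝ → ℝ → ℝ} {ψ : ℝ → ℝ}
    (hf : AdmissibleF l T f) (hψ : AdmissiblePsi l ψ)
    (h0 : ∀ n, detCoeff l T (del α₁ β₁ μ₁) (gam 1 β₁ μ₁) (del α₂ β₂ μ₂) (gam 2 β₂ μ₂) (n + 1) ≠ 0)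
    {τ : ℕ → ℝ} (hτ : ∀ n, τ n *
      detCoeff l T (del α₁ β₁ μ₁) (gam 1 β₁ μ₁) (del α₂ β₂ μ₂) (gam 2 β₂ μ₂) (n + 1) =
      dataCoeff l T (del α₁ β₁ μ₁) (gam 1 β₁ μ₁) (del α₂ β₂ μ₂) (gam 2 β₂ μ₂) f ψ (n + 1)) :
    ∃ u : ℝ → ℝ → ℝ, IsSolution l T α₁ β₁ μ₁ α₂ β₂ μ₂ f ψ u ∧ ∀ x,
      (∀ t ∈ Ioc 0 T, HasSum (fun n : ℕ => coeffPos l α₁ β₁ μ₁ f (n + 1) (τ n) t *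
        mode l (n + 1) x) (u x t)) ∧
      (∀ t ∈ Ico (-T) 0, HasSum (fun n : ℕ => coeffNeg l α₂ β₂ μ₂ f (n + 1) (τ n)
        (nuCoeff l (del α₁ β₁ μ₁) (gam 1 β₁ μ₁) f (n + 1) (τ n)) t * mode l (n + 1) x)
        (u x t)) := by
  obtain ⟨h1, h2, h3, h4, h5, h6, h7, h8⟩ := id hE
  set δ₁ := del α₁ β₁ μ₁ with hδ₁
  set γ₁ := gam 1 β₁ μ₁ with hγ₁
  set δ₂ := del α₂ β₂ μ₂ with hδ₂
  set γ₂ := gam 2 β₂ μ₂ with hγ₂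
  obtain ⟨gp, Mp, hMp, hp⟩ := hf.forcing_pos hl hT
  obtain ⟨gm, Mm, hMm, hm⟩ := hf.forcing_neg hl hT
  have hd2 : 1 / 2 < 1 / δ₂ := one_div_lt_one_div_of_lt (by linarith) h6
  -- A rate θ < 1 satisfying 2θ - 1 > 1/2 and θ + 1/δ₂ - 1 > 1/2, which are the exponents that
  -- appear in the summability conditions on B below. The second is possible because δ₂ < 2.
  set θ : ℝ := (1 + max (3 / 4) (3 / 2 - 1 / δ₂)) / 2 with hθ
  have hmx : max (3 / 4) (3 / 2 - 1 / δ₂) < 1 := max_lt (by norm_num) (by linarith)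
  have hm1 : 3 / 4 ≤ max (3 / 4) (3 / 2 - 1 / δ₂) := le_max_left _ _
  have hm2 : 3 / 2 - 1 / δ₂ ≤ max (3 / 4) (3 / 2 - 1 / δ₂) := le_max_right _ _
  have hθ1 : θ < 1 := by rw [hθ]; linarith
  have hθ34 : 3 / 4 < θ := by rw [hθ]; linarith
  have hθδ : 3 / 2 - 1 / δ₂ < θ := by rw [hθ]; linarith
  obtain ⟨C, hC⟩ := exists_coeff_bounds hl hT h1 h2 h3 h4 h5 h6 h7 h8 h0 hf hψ
    (by linarith : 0 ≤ θ) hθ1 hτ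
  set ν : ℕ → ℝ := fun n => nuCoeff l δ₁ γ₁ f (n + 1) (τ n) with hν
  -- The slope at 0 changes sign when the lower half is reflected.
  set B : ℕ → ℝ := fun n => -ν n with hB
  have hBb : ∀ n, |B n| ≤ C * eig l (n + 1) ^ (-θ) := fun n => by
    rw [hB, abs_neg]; exact (hC n).2
  have hmul : ∀ n (p : ℝ), eig l (n + 1) * eig l (n + 1) ^ p = eig l (n + 1) ^ (1 + p) :=
    fun n p => by rw [Real.rpow_add (eig_pos hl n), Real.rpow_one]
  have sτ : Summable fun n => eig l (n + 1) * |τ n| := by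
    refine Summable.of_nonneg_of_le (fun n => mul_nonneg (eig_pos hl n).le (abs_nonneg _))
      (fun n => mul_le_mul_of_nonneg_left (hC n).1 (eig_pos hl n).le)
      (((summable_eig_rpow hl (by linarith : 1 / 2 < θ)).mul_left C).congr fun n => ?_)
    rw [mul_left_comm, hmul]; ring_nf
  have sB1 : Summable fun n => |B n| :=
    Summable.of_nonneg_of_le (fun n => abs_nonneg _) hBb
      ((summable_eig_rpow hl (by linarith : 1 / 2 < θ)).mul_left C)
  have sB : Summable fun n => eig l (n + 1) * (|B n| * eig l (n + 1) ^ (-(1 / δ₂))) := by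
    have hnn := fun n => Real.rpow_nonneg (eig_pos hl n).le (-(1 / δ₂))
    refine Summable.of_nonneg_of_le (fun n => mul_nonneg (eig_pos hl n).le
      (mul_nonneg (abs_nonneg _) (hnn n)))
      (fun n => mul_le_mul_of_nonneg_left (mul_le_mul_of_nonneg_right (hBb n) (hnn n))
        (eig_pos hl n).le)
      (((summable_eig_rpow hl (by linarith : 1 / 2 < θ + 1 / δ₂ - 1)).mul_left C).congr fun n => ?_)
    rw [mul_assoc, ← Real.rpow_add (eig_pos hl n), mul_left_comm, hmul]; ring_nf
  have sBθ : Summable fun n => |(-eig l (n + 1) * B n)| * eig l (n + 1) ^ (-θ) := by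
    have hnn := fun n => Real.rpow_nonneg (eig_pos hl n).le (-θ)
    refine Summable.of_nonneg_of_le (fun n => mul_nonneg (abs_nonneg _) (hnn n)) (fun n => ?_)
      (((summable_eig_rpow hl (by linarith : 1 / 2 < 2 * θ - 1)).mul_left C))
    rw [abs_mul, abs_neg, abs_of_pos (eig_pos hl n)]
    refine (mul_le_mul_of_nonneg_right (mul_le_mul_of_nonneg_left (hBb n)
      (eig_pos hl n).le) (hnn n)).trans_eq ?_
    rw [mul_left_comm, hmul, mul_assoc, ← Real.rpow_add (eig_pos hl n)]; ring_nf
  set U₁ : ℝ → ℝ → ℝ := fun x t => ∑' n, parabolicCoeff l δ₁ γ₁ f τ n t * mode l (n + 1) x with hU₁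
  set U₂ : ℝ → ℝ → ℝ := fun x t =>
    ∑' n, hyperbolicCoeff l δ₂ γ₂ (fun x s => f x (-s)) τ B n t * mode l (n + 1) x with hU₂
  set u : ℝ → ℝ → ℝ := fun x t => if 0 < t then U₁ x t else U₂ x (-t) with hu
  have hup : ∀ x, ∀ t ∈ Ioc 0 T, u x t = U₁ x t := fun x t ht => if_pos ht.1
  have hum : ∀ x, ∀ t ∈ Ioc 0 T, u x (-t) = U₂ x t := fun x t ht => by
    rw [hu]; simp only []
    rw [if_neg (by linarith [ht.1]), neg_neg]
  have hSF1 := sineField_parabolic hp hl hMp h1 h2 h3 h4 sτ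
  have hSF2 := sineField_hyperbolic hm hl hMm h5 h6 h7 h8 sτ sB
  obtain ⟨H1, L1⟩ := HalfSolution.of_parabolic (v := u) hp hl hT hMp h1 h2 h3 h4 sτ hup
  obtain ⟨H2, L2⟩ := HalfSolution.of_hyperbolic (v := fun x s => u x (-s)) hm hl hT hMm h5 h6 h7 h8
    sτ sB sB1 (by linarith : 0 ≤ θ) hθ1 sBθ hum
  have hTm : T ∈ Ioc 0 T := ⟨hT, le_rfl⟩
  refine ⟨u, isSolution_iff.2 ⟨H1, H2, ?_, ?_, ?_⟩, fun x => ⟨fun t ht => ?_, fun t ht => ?_⟩⟩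
  · intro x hx
    rw [hup x T hTm, hum x T hTm]
    have s1 := hSF1.summable hl hT hTm
    have s2 := hSF2.summable hl hT hTm
    have c1 : Continuous fun x => U₁ x T := continuous_tsum_mode s1
    have c2 : Continuous fun x => U₂ x T := continuous_tsum_mode s2
    have hui : uIcc 0 l = Icc 0 l := uIcc_of_le hl.le
    refine eqOn_of_sineCoeff_eq hl c2.continuousOn (r := fun x => U₁ x T + ψ x)
      (c1.continuousOn.add hψ.cont) (tsum_mode_zero _) (tsum_mode_end hl _) ?_ ?_ (fun n => ?_) x hx
    · rw [hψ.zero_left, add_zero]; exact tsum_mode_zero _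
    · rw [hψ.zero_right, add_zero]; exact tsum_mode_end hl _
    · rw [sineCoeff_add (n + 1) (c1.intervalIntegrable 0 l)
        (ContinuousOn.intervalIntegrable (by rw [hui]; exact hψ.cont)), hU₁, hU₂,
        sineCoeff_tsum hl s1, sineCoeff_tsum hl s2]
      exact (nonlocal_iff l T δ₁ γ₁ δ₂ γ₂ f ψ (n + 1) (τ n)).2 (hτ n)
  · intro x hx
    exact ⟨_, (L1 x hx).1, (L2 x hx).1⟩
  · intro x hx
    have hxI := Ioo_subset_Icc_self hx
    refine ⟨_, (L1 x hxI).2, ?_⟩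
    convert (L2 x hxI).2 using 2
    rw [← tsum_neg]
    exact tsum_congr fun n => (neg_mul _ _).symm
  · rw [hup x t ht]
    have := (summable_mul_mode (l := l) (hSF1.summable hl hT ht) x).hasSum
    simp only [coeffPos_eq]
    exact this
  · have ht' : -t ∈ Ioc 0 T := ⟨by linarith [ht.2], by linarith [ht.1]⟩
    have e := hum x (-t) ht'
    rw [neg_neg] at e
    rw [e]
    have := (summable_mul_mode (l := l) (hSF2.summable hl hT ht') x).hasSum
    simp only [coeffNeg_eq]
    exact this

/-! ### Abel-Volterra equations -/

lemma mlKer_lam_zero {δ : ℝ} (hδ : 0 < δ) (b : ℝ) : mlKer δ 0 b = powKer b := by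
  ext t
  rw [mlKer, neg_zero, zero_mul, mittagLeffler_zero hδ, powKer, mul_one_div]

lemma leftInt_leftInt {a b c t : ℝ} (ha : 0 ≤ a) (hb : 0 ≤ b) (hc : 0 < c) (ht : 0 < t) {v : ℝ → ℝ}
    (hv : PowBdd t c v) : leftInt a (leftInt b v) t = leftInt (a + b) v t := by
  rcases ha.eq_or_lt with rfl | ha
  · rw [leftInt_zero, zero_add]
  rcases hb.eq_or_lt with rfl | hb
  · rw [leftInt_zero, add_zero]
  rw [leftInt_eq_conv hb, leftInt_eq_conv ha, leftInt_eq_conv (by linarith),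
    (powBdd_powKer t a).conv_assoc ha hb hc ht (powBdd_powKer t b) hv]
  exact conv_congr ht (fun s hs => conv_powKer ha hb hs.1) fun _ _ => rfl

/-- Applying I^{1-κ} to both sides gives equal primitives, which are then differentiated. -/
lemma leftInt_injective {T c κ : ℝ} (hc : 0 < c) (hκ : 0 ≤ κ) (hκ1 : κ ≤ 1) {v r : ℝ → ℝ}
    (hv : PowBdd T c v) (hr : PowBdd T c r)
    (h : ∀ t ∈ Ioo 0 T, leftInt κ v t = leftInt κ r t) : ∀ t ∈ Ioo 0 T, v t = r t := by
  have h1 : ∀ t ∈ Ioo 0 T, ∫ s in (0 : ℝ)..t, v s = ∫ s in (0 : ℝ)..t, r s := by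
    intro t ht
    have ev := leftInt_leftInt (sub_nonneg.2 hκ1) hκ hc ht.1 (hv.mono ht.2.le)
    have er := leftInt_leftInt (sub_nonneg.2 hκ1) hκ hc ht.1 (hr.mono ht.2.le)
    rw [sub_add_cancel, leftInt_one] at ev er
    rw [← ev, ← er]
    exact leftInt_congr (sub_nonneg.2 hκ1) ht.1 fun s hs => h s ⟨hs.1, hs.2.trans_lt ht.2⟩
  intro t ht
  refine (hasDerivAt_integral_of_powBdd hc hv ht).unique
    ((hasDerivAt_integral_of_powBdd hc hr ht).congr_of_eventuallyEq ?_)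
  filter_upwards [isOpen_Ioo.mem_nhds ht] with s hs using h1 s hs

/-- The inverse of 1 + λ I^δ is 1 - λ times convolution with the Mittag-Leffler kernel of order δ.
This amounts to saying that this kernel convolved with v + λ I^δ v gives I^δ v, which is `mlKer_eq`
at b = δ. -/
lemma volterra_resolvent {T δ lam c : ℝ} (hδ : 0 < δ) (hc : 0 < c) {v r : ℝ → ℝ}
    (hv : PowBdd T c v)
    (h : ∀ t ∈ Ioo 0 T, r t = v t + lam * conv (powKer δ) v t) :
    ∀ t ∈ Ioo 0 T, v t = r t - lam * conv (mlKer δ lam δ) r t := by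
  intro t ht
  have hvt := hv.mono ht.2.le
  have hk := powBdd_mlKer t lam hδ hδ
  have hp := powBdd_powKer t δ
  have e1 : conv (mlKer δ lam δ) r t = conv (powKer δ) v t := by
    rw [conv_congr ht.1 (fun _ _ => rfl) (fun s hs => h s ⟨hs.1, hs.2.trans ht.2⟩),
      conv_add (hk.intervalIntegrable_conv hδ hc ht.1 hvt)
        (hk.intervalIntegrable_conv hδ (by linarith : 0 < δ + c) ht.1
          ((hp.conv hδ hc hvt).const_mul lam)), conv_const_mul,
      hk.conv_assoc hδ hδ hc ht.1 hp hvt]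
    have e2 : conv (conv (mlKer δ lam δ) (powKer δ)) v t = conv (mlKer δ lam (δ + δ)) v t :=
      conv_congr ht.1 (fun s hs => by
        rw [conv_comm, conv_powKer_mlKer lam hδ hδ hδ hs.1]) fun _ _ => rfl
    have hk2 := powBdd_mlKer t lam hδ (by linarith : 0 < δ + δ)
    rw [e2, conv_comm (mlKer δ lam δ), conv_comm (mlKer δ lam (δ + δ)), conv_comm (powKer δ),
      ← conv_const_mul, ← conv_add (hvt.intervalIntegrable_conv hc hδ ht.1 hk)
        (hvt.intervalIntegrable_conv hc (by linarith : 0 < δ + δ) ht.1 (hk2.const_mul lam))]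
    refine conv_congr ht.1 (fun _ _ => rfl) fun s hs => ?_
    have := mlKer_eq lam δ hδ hs.1
    linarith
  rw [e1, h t ht]; ring

/-- The solution of the linear Abel-Volterra equation with power data. -/
lemma volterra_solution {T δ lam c a b A B : ℝ} (hδ : 0 < δ) (hc : 0 < c) (ha : 0 < a) (hb : 0 < b)
    {v g : ℝ → ℝ} (hv : PowBdd T c v) (hg : PowBdd T 1 g)
    (h : ∀ t ∈ Ioo 0 T, v t = A * powKer a t + B * powKer b t +
      conv (powKer δ) (fun s => g s + (-lam) * v s) t) :
    ∀ t ∈ Ioo 0 T, v t = A * mlKer δ lam a t + B * mlKer δ lam b t +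
      conv (mlKer δ lam δ) g t := by
  have hr : ∀ t ∈ Ioo 0 T, (A * powKer a t + B * powKer b t) + conv (powKer δ) g t =
      v t + lam * conv (powKer δ) v t := by
    intro t ht
    have e := h t ht
    have hp := powBdd_powKer t δ
    rw [conv_add (hp.intervalIntegrable_conv hδ one_pos ht.1 (hg.mono ht.2.le))
      (hp.intervalIntegrable_conv hδ hc ht.1 ((hv.mono ht.2.le).const_mul _)),
      conv_const_mul] at e
    linarith
  intro t ht
  have hk := powBdd_mlKer t lam hδ hδ
  have hgt := hg.mono ht.2.le
  have hp := powBdd_powKer t δ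
  rw [volterra_resolvent hδ hc hv hr t ht,
    conv_add (hk.intervalIntegrable_conv hδ (lt_min ha hb) ht.1
      ((((powBdd_powKer t a).const_mul A).weaken (min_le_left a b)).add
        (((powBdd_powKer t b).const_mul B).weaken (min_le_right a b))))
      (hk.intervalIntegrable_conv hδ (by linarith : 0 < δ + 1) ht.1 (hp.conv hδ one_pos hgt)),
    conv_add (hk.intervalIntegrable_conv hδ ha ht.1 ((powBdd_powKer t a).const_mul A))
      (hk.intervalIntegrable_conv hδ hb ht.1 ((powBdd_powKer t b).const_mul B)),
    conv_const_mul, conv_const_mul, conv_comm _ (powKer a), conv_comm _ (powKer b),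
    conv_powKer_mlKer lam hδ hδ ha ht.1, conv_powKer_mlKer lam hδ hδ hb ht.1,
    hk.conv_assoc hδ hδ one_pos ht.1 hp hgt, mlKer_eq lam a hδ ht.1, mlKer_eq lam b hδ ht.1,
    add_comm a δ, add_comm b δ]
  have e2 : conv (conv (mlKer δ lam δ) (powKer δ)) g t = conv (mlKer δ lam (δ + δ)) g t :=
    conv_congr ht.1 (fun s hs => by
      rw [conv_comm, conv_powKer_mlKer lam hδ hδ hδ hs.1]) fun _ _ => rfl
  have e3 : conv (mlKer δ lam δ) g t = conv (powKer δ) g t + (-lam) * conv (mlKer δ lam (δ + δ)) g t := by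
    rw [conv_comm (mlKer δ lam δ), conv_comm (mlKer δ lam (δ + δ)), conv_comm (powKer δ),
      ← conv_const_mul, ← conv_add (hgt.intervalIntegrable_conv one_pos hδ ht.1 hp)
        (hgt.intervalIntegrable_conv one_pos (by linarith : 0 < δ + δ) ht.1
          ((powBdd_mlKer t lam hδ (by linarith)).const_mul _))]
    refine conv_congr ht.1 (fun _ _ => rfl) fun s hs => ?_
    rw [mlKer_eq lam δ hδ hs.1]; ring
  rw [e2, e3]; ring

/-! ### Integrating the Hilfer equation in time -/

/-- Inversion of a fractional integral of order less than one. -/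
lemma integral_eq_leftInt_of_leftInt_eq {T κ c : ℝ} (hκ : 0 ≤ κ) (hκ1 : κ < 1) (hc : 0 < c)
    {D G : ℝ → ℝ} (hD : Measurable D)
    (hinteg : ∀ t ∈ Ioo 0 T, κ = 0 ∨
      IntervalIntegrable (fun z => (t - z) ^ (κ - 1) * D z) volume 0 t)
    (hG : ∀ t ∈ Ioo 0 T, leftInt κ D t = G t) (hGp : PowBdd T c G) :
    ∀ t ∈ Ioo 0 T, IntervalIntegrable D volume 0 t ∧
      ∫ s in (0 : ℝ)..t, D s = leftInt (1 - κ) G t := by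
  intro t ht
  rcases hκ.eq_or_lt with rfl | hκ
  · simp only [leftInt_zero] at hG
    have hGt : PowBdd t c D := (hGp.mono ht.2.le).congr fun s hs => hG s ⟨hs.1, hs.2.trans_lt ht.2⟩
    refine ⟨hGt.intervalIntegrable hc ht.1, ?_⟩
    rw [sub_zero, ← leftInt_one]
    exact leftInt_congr zero_le_one ht.1 fun s hs => hG s ⟨hs.1, hs.2.trans_lt ht.2⟩
  -- Integrability of D up to t is extracted from convergence of the fractional integral at the
  -- later time (t + T)/2, whose kernel is continuous and positive on [0, t] and can be divided out.
  · have ht' : (t + T) / 2 ∈ Ioo 0 T := ⟨by linarith [ht.1, ht.2], by linarith [ht.2]⟩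
    have htt : t < (t + T) / 2 := by linarith [ht.2]
    have hi := (hinteg _ ht').resolve_left hκ.ne'
    have hDi : IntervalIntegrable D volume 0 t := by
      rw [intervalIntegrable_iff_Ioo ht.1.le, ← integrableOn_Icc_iff_integrableOn_Ioo]
      rw [intervalIntegrable_iff_Ioo ht'.1.le, ← integrableOn_Icc_iff_integrableOn_Ioo] at hi
      have hcont : ContinuousOn (fun z : ℝ => ((t + T) / 2 - z) ^ (1 - κ)) (Icc 0 t) :=
        ((by fun_prop : Continuous fun z : ℝ => (t + T) / 2 - z).rpow_const
          fun _ => Or.inr (by linarith)).continuousOn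
      refine ((hi.mono_set (Icc_subset_Icc_right htt.le)).continuousOn_mul hcont
        isCompact_Icc).congr_fun (fun z hz => ?_) measurableSet_Icc
      have : 0 < (t + T) / 2 - z := by linarith [hz.2]
      simp only []
      rw [← mul_assoc, ← Real.rpow_add this]; norm_num
    refine ⟨hDi, ?_⟩
    have h1κ : 0 < 1 - κ := by linarith
    have e1 : leftInt (1 - κ) G t = conv (powKer (1 - κ)) (conv (powKer κ) D) t := by
      rw [leftInt_eq_conv h1κ]
      refine conv_congr ht.1 (fun _ _ => rfl) fun s hs => ?_
      rw [← hG s ⟨hs.1, hs.2.trans ht.2⟩, leftInt_eq_conv hκ]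
    rw [e1, conv_assoc h1κ hκ ht.1 (powBdd_powKer t _) (powBdd_powKer t κ)
      hD.aestronglyMeasurable, ← conv_const_one]
    · refine conv_congr ht.1 (fun s hs => ?_) fun _ _ => rfl
      rw [conv_powKer h1κ hκ hs.1, sub_add_cancel, powKer_one]
    · have := (intervalIntegrable_iff_Ioo ht.1.le).1 hDi
      simpa using this

lemma eq_add_integral_deriv {T c : ℝ} {w : ℝ → ℝ} (hw : ∀ t ∈ Ioo 0 T, DifferentiableAt ℝ w t)
    (hi : ∀ t ∈ Ioo 0 T, IntervalIntegrable (deriv w) volume 0 t)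
    (hc : Tendsto w (𝓝[>] 0) (𝓝 c)) {t : ℝ} (ht : t ∈ Ioo 0 T) :
    w t = c + ∫ s in (0 : ℝ)..t, deriv w s := by
  rw [intervalIntegral.integral_eq_sub_of_hasDerivAt_of_tendsto ht.1
    (fun s hs => (hw s ⟨hs.1, hs.2.trans ht.2⟩).hasDerivAt) (hi t ht) hc
    ((hw t ht).continuousAt.tendsto.mono_left nhdsWithin_le_nhds)]
  ring

/-- Pointwise integrated form of the equation, first order. -/
lemma leftInt_eq_of_hilfer_one {T α β μ c P : ℝ} (hκ : 0 ≤ μ * ((1 : ℕ) - α))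
    (hκ1 : μ * ((1 : ℕ) - α) < 1) (hc : 0 < c) {v G : ℝ → ℝ} (hv : LeftHilferExists 1 α β μ T v)
    (hG : ∀ t ∈ Ioo 0 T, leftHilfer 1 α β μ v t = G t) (hGp : PowBdd T c G)
    (hP : Tendsto (leftInt ((1 - μ) * ((1 : ℕ) - β)) v) (𝓝[>] 0) (𝓝 P)) :
    ∀ t ∈ Ioo 0 T, leftInt ((1 - μ) * ((1 : ℕ) - β)) v t =
      P + leftInt (1 - μ * ((1 : ℕ) - α)) G t := by
  obtain ⟨-, hd, hinteg⟩ := hv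
  unfold leftHilfer at hG
  rw [iteratedDeriv_one] at hG hinteg
  have hinv := integral_eq_leftInt_of_leftInt_eq hκ hκ1 hc (measurable_deriv _) hinteg hG hGp
  have hd0 := hd 0 (by norm_num)
  rw [iteratedDeriv_zero] at hd0
  intro t ht
  rw [eq_add_integral_deriv hd0 (fun s hs => (hinv s hs).1) hP ht, (hinv t ht).2]

/-- Pointwise integrated form of the equation, second order. -/
lemma leftInt_eq_of_hilfer_two {T α β μ c P Q : ℝ} (hκ : 0 ≤ μ * ((2 : ℕ) - α))
    (hκ1 : μ * ((2 : ℕ) - α) < 1) (hc : 0 < c) {v G : ℝ → ℝ} (hv : LeftHilferExists 2 α β μ T v)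
    (hG : ∀ t ∈ Ioo 0 T, leftHilfer 2 α β μ v t = G t) (hGp : PowBdd T c G)
    (hP : Tendsto (leftInt ((1 - μ) * ((2 : ℕ) - β)) v) (𝓝[>] 0) (𝓝 P))
    (hQ : Tendsto (deriv (leftInt ((1 - μ) * ((2 : ℕ) - β)) v)) (𝓝[>] 0) (𝓝 Q)) :
    ∀ t ∈ Ioo 0 T, leftInt ((1 - μ) * ((2 : ℕ) - β)) v t =
      P + Q * t + leftInt (2 - μ * ((2 : ℕ) - α)) G t := by
  obtain ⟨-, hd, hinteg⟩ := hv
  unfold leftHilfer at hG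
  rw [iteratedDeriv_succ, iteratedDeriv_one] at hG hinteg
  have hinv := integral_eq_leftInt_of_leftInt_eq hκ hκ1 hc (measurable_deriv _) hinteg hG hGp
  have hd0 := hd 0 (by norm_num)
  have hd1 := hd 1 (by norm_num)
  rw [iteratedDeriv_zero] at hd0
  rw [iteratedDeriv_one] at hd1
  have h1κ : 0 < 1 - μ * ((2 : ℕ) - α) := by linarith
  set w := leftInt ((1 - μ) * ((2 : ℕ) - β)) v with hw
  have hw1 : ∀ t ∈ Ioo 0 T, deriv w t = Q + leftInt (1 - μ * ((2 : ℕ) - α)) G t := fun t ht => by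
    rw [eq_add_integral_deriv hd1 (fun s hs => (hinv s hs).1) hQ ht, (hinv t ht).2]
  have hI : PowBdd T (1 - μ * ((2 : ℕ) - α) + c) (leftInt (1 - μ * ((2 : ℕ) - α)) G) := by
    rw [leftInt_eq_conv h1κ]
    exact (powBdd_powKer T _).conv h1κ hc hGp
  have hii : ∀ t ∈ Ioo 0 T, IntervalIntegrable (leftInt (1 - μ * ((2 : ℕ) - α)) G) volume 0 t :=
    fun t ht => (hI.mono ht.2.le).intervalIntegrable (by linarith) ht.1
  have hcongr : ∀ t ∈ Ioo 0 T, EqOn (deriv w) (fun s => Q + leftInt (1 - μ * ((2 : ℕ) - α)) G s)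
      (Ioo 0 t) := fun t ht s hs => hw1 s ⟨hs.1, hs.2.trans ht.2⟩
  have hwi : ∀ t ∈ Ioo 0 T, IntervalIntegrable (deriv w) volume 0 t := fun t ht => by
    rw [intervalIntegrable_iff_Ioo ht.1.le]
    exact ((intervalIntegrable_iff_Ioo ht.1.le).1 (intervalIntegrable_const.add (hii t ht))).congr_fun
      (hcongr t ht).symm measurableSet_Ioo
  intro t ht
  rw [eq_add_integral_deriv hd0 hwi hP ht, integral_eq_Ioo ht.1.le,
    setIntegral_congr_fun measurableSet_Ioo (hcongr t ht), ← integral_eq_Ioo ht.1.le,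
    intervalIntegral.integral_add intervalIntegrable_const (hii t ht),
    intervalIntegral.integral_const, ← leftInt_one (leftInt _ G),
    leftInt_leftInt zero_le_one h1κ.le hc ht.1 (hGp.mono ht.2.le)]
  rw [show 1 + (1 - μ * ((2 : ℕ) - α)) = 2 - μ * ((2 : ℕ) - α) by ring, sub_zero, smul_eq_mul]
  ring

/-- A power-weighted derivative limit determines the power-weighted limit of the function. -/
lemma tendsto_div_rpow {δ L : ℝ} (hδ : 0 < δ) {F D : ℝ → ℝ}
    (hF : ∀ᶠ t in 𝓝[>] 0, HasDerivAt F (D t) t) (hF0 : Tendsto F (𝓝[>] 0) (𝓝 0))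
    (hD : Tendsto (fun t => t ^ (1 - δ) * D t) (𝓝[>] 0) (𝓝 L)) :
    Tendsto (fun t => F t / t ^ δ) (𝓝[>] 0) (𝓝 (L / δ)) := by
  refine HasDerivAt.lhopital_zero_nhdsGT hF
    (g' := fun t => δ * t ^ (δ - 1)) ?_ ?_ hF0 (tendsto_rpow_nhdsGT hδ) ?_
  · filter_upwards [self_mem_nhdsWithin] with t ht
    exact Real.hasDerivAt_rpow_const (Or.inl (ne_of_gt ht))
  · filter_upwards [self_mem_nhdsWithin] with t ht
    exact mul_ne_zero hδ.ne' (Real.rpow_pos_of_pos ht _).ne'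
  · refine (hD.div_const δ).congr' ?_
    filter_upwards [self_mem_nhdsWithin] with t ht
    rw [show 1 - δ = -(δ - 1) by ring, Real.rpow_neg (le_of_lt ht)]
    have := (Real.rpow_pos_of_pos (show (0 : ℝ) < t from ht) (δ - 1)).ne'
    field_simp

lemma XPowBdd.congr {l T c : ℝ} {W W' : ℝ → ℝ → ℝ} (h : XPowBdd l T c W)
    (he : ∀ x ∈ Icc 0 l, ∀ t ∈ Ioc 0 T, W' x t = W x t) : XPowBdd l T c W' := by
  obtain ⟨hc, C, hC⟩ := h
  exact ⟨hc.congr fun p hp => he p.1 hp.1 p.2 hp.2, C, fun x hx t ht => by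
    rw [he x hx t ht]; exact hC x hx t ht⟩

lemma xPowBdd_of_continuousOn_weight {l T : ℝ} (κ : ℝ) {G : ℝ × ℝ → ℝ}
    (hG : ContinuousOn G (Icc 0 l ×ˢ Icc 0 T)) :
    XPowBdd l T (1 - κ) (fun x t => t ^ (-κ) * G (x, t)) := by
  obtain ⟨M, hM⟩ := (isCompact_Icc.prod isCompact_Icc).exists_bound_of_continuousOn hG
  refine ⟨ContinuousOn.mul (fun p hp => (ContinuousAt.rpow_const continuousAt_snd
      (Or.inl hp.2.1.ne')).continuousWithinAt) (hG.mono (prod_mono_right Ioc_subset_Icc_self)),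
    M, fun x hx t ht => ?_⟩
  rw [abs_mul, abs_of_nonneg (Real.rpow_nonneg ht.1.le _), mul_comm, show 1 - κ - 1 = -κ by ring]
  exact mul_le_mul_of_nonneg_right (hM (x, t) ⟨hx, Ioc_subset_Icc_self ht⟩)
    (Real.rpow_nonneg ht.1.le _)

lemma rpow_neg_mul_rpow_mul {t : ℝ} (ht : 0 < t) (κ y : ℝ) : t ^ (-κ) * (t ^ κ * y) = y := by
  rw [← mul_assoc, ← Real.rpow_add ht]; simp

/-- Every term on the right is a fractional integral of order κ, so injectivity cancels I^κ and
leaves a Volterra equation with power data. Continuity extends its solution formula from (0, T) to t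
= T, where the nonlocal condition lives. -/
lemma coeff_of_integrated {T κ δ lam a b A B : ℝ} (hκ : 0 ≤ κ) (hκ1 : κ < 1) (hδ : 0 < δ)
    (ha : 1 - κ ≤ a) (hb : 1 - κ ≤ b) {v g : ℝ → ℝ} (hv : PowBdd T (1 - κ) v) (hg : PowBdd T 1 g)
    (h : ∀ t ∈ Ioo 0 T, leftInt κ v t = A * powKer (κ + a) t + B * powKer (κ + b) t +
      leftInt (κ + δ) (fun s => g s + (-lam) * v s) t) :
    ∀ t ∈ Ioc 0 T, v t = A * mlKer δ lam a t + B * mlKer δ lam b t + conv (mlKer δ lam δ) g t := by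
  have hc : 0 < 1 - κ := by linarith
  have ha0 : 0 < a := by linarith
  have hb0 : 0 < b := by linarith
  have hq : PowBdd T (1 - κ) (fun s => g s + (-lam) * v s) :=
    (hg.weaken (by linarith)).add (hv.const_mul _)
  have kA := fun t => (powBdd_powKer t a).const_mul A
  have kB := fun t => (powBdd_powKer t b).const_mul B
  have kAB : ∀ t, PowBdd t (1 - κ) (fun s => A * powKer a s + B * powKer b s) := fun t =>
    ((kA t).weaken ha).add ((kB t).weaken hb)
  have kC := (powBdd_powKer T δ).conv hδ hc hq
  have hR := (kAB T).add (kC.weaken (by linarith : 1 - κ ≤ δ + (1 - κ)))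
  have hlp : ∀ {t b}, 0 < t → 0 < b → leftInt κ (powKer b) t = powKer (κ + b) t := fun ht hb => by
    rw [← mlKer_lam_zero hδ, leftInt_mlKer 0 hδ hb hκ ht, mlKer_lam_zero hδ]
  have e1 := leftInt_injective hc hκ hκ1.le hv hR fun t ht => by
    rw [h t ht, leftInt_add_of_powBdd hκ ht.1 hc (by linarith : 0 < δ + (1 - κ)) (kAB t)
      (kC.mono ht.2.le), leftInt_add_of_powBdd hκ ht.1 ha0 hb0 (kA t) (kB t),
      leftInt_const_mul, leftInt_const_mul, hlp ht.1 ha0, hlp ht.1 hb0, ← leftInt_eq_conv hδ,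
      leftInt_leftInt hκ hδ.le hc ht.1 (hq.mono ht.2.le)]
  have e2 := volterra_solution hδ hc ha0 hb0 hv hg e1
  intro t ht
  have hT : 0 < T := ht.1.trans_le ht.2
  refine Set.EqOn.of_subset_closure (s := Ioo 0 T) (t := Ioc 0 T) e2 hv.1 ?_ Ioo_subset_Ioc_self
    ?_ ht
  · exact ((continuousOn_const.mul (powBdd_mlKer T lam hδ ha0).1).add
      (continuousOn_const.mul (powBdd_mlKer T lam hδ hb0).1)).add
      ((powBdd_mlKer T lam hδ hδ).conv hδ one_pos hg).1
  · rw [closure_Ioo hT.ne]; exact Ioc_subset_Icc_self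

/-! ### Time coefficients of an arbitrary solution -/

section Half
variable {l T α β μ κ : ℝ} {N : ℕ} {g v : ℝ → ℝ → ℝ}

lemma HalfSolution.xPowBdd (h : HalfSolution l T N α β μ κ g v) : XPowBdd l T (1 - κ) v := by
  obtain ⟨G, hG, he⟩ := h.reg
  refine (xPowBdd_of_continuousOn_weight κ hG).congr fun x hx t ht => ?_
  rw [he (x, t) ⟨hx, ht⟩]
  exact (rpow_neg_mul_rpow_mul ht.1 κ _).symm

/-- The weighted Hilfer derivative extends continuously, so at each fixed time v_xx is the
difference of two functions continuous up to the boundary. It is therefore bounded, and integration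
by parts turns it into -λ_n times the coefficient of v. -/
lemma HalfSolution.exists_source (h : HalfSolution l T N α β μ κ g v) (hl : 0 < l)
    (hg : ContinuousOn (fun p : ℝ × ℝ => g p.1 p.2) (Icc 0 l ×ˢ Icc 0 T)) :
    ∃ G : ℝ → ℝ → ℝ, XPowBdd l T (1 - κ) G ∧
      (∀ x ∈ Ioo 0 l, ∀ t ∈ Ioo 0 T, leftHilfer N α β μ (v x) t = G x t) ∧
      ∀ n, ∀ t ∈ Ioo 0 T, sineCoeff l n (fun x => G x t) =
        sineCoeff l n (fun x => g x t) + (-eig l n) * sineCoeff l n (fun x => v x t) := by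
  obtain ⟨G, hG, he⟩ := h.reg_D
  have hX := xPowBdd_of_continuousOn_weight κ hG
  have heq : ∀ x ∈ Ioo 0 l, ∀ t ∈ Ioo 0 T,
      leftHilfer N α β μ (v x) t = t ^ (-κ) * G (x, t) := fun x hx t ht => by
    rw [he (x, t) ⟨hx, ht⟩]; exact (rpow_neg_mul_rpow_mul ht.1 κ _).symm
  refine ⟨_, hX, heq, fun n t ht => ?_⟩
  have htI := Ioo_subset_Ioc_self ht
  have hgt : ContinuousOn (fun x => g x t) (Icc 0 l) :=
    hg.comp (f := fun x : ℝ => ((x, t) : ℝ × ℝ)) (by fun_prop)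
      fun x hx => ⟨hx, Ioo_subset_Icc_self ht⟩
  have hGt := hX.continuousOn_left htI
  have hxx : ∀ x ∈ Ioo 0 l, iteratedDeriv 2 (fun y => v y t) x =
      t ^ (-κ) * G (x, t) - g x t := fun x hx => by
    rw [← heq x hx t ht, ← h.eqn x hx t ht]; ring
  obtain ⟨M, hM⟩ := isCompact_Icc.exists_bound_of_continuousOn (hGt.sub hgt)
  obtain ⟨t0, t1⟩ := tendsto_ends hl (h.xPowBdd.continuousOn_left htI) (h.bdry t htI).1
    (h.bdry t htI).2
  have e := sineCoeff_second_deriv hl n (fun x hx => (h.diff_x x hx t ht).1.hasDerivAt)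
    (r := iteratedDeriv 2 (fun y => v y t)) (fun x hx => by
      rw [iteratedDeriv_succ, iteratedDeriv_one]; exact (h.diff_x x hx t ht).2.hasDerivAt) t0 t1
    (((hGt.sub hgt).mono Ioo_subset_Icc_self).congr hxx)
    (fun x hx => by rw [hxx x hx]; exact hM x (Ioo_subset_Icc_self hx))
  have hu : uIcc 0 l = Icc 0 l := uIcc_of_le hl.le
  have hgi : IntervalIntegrable (fun x => g x t) volume 0 l :=
    ContinuousOn.intervalIntegrable (by rwa [hu])
  have hGi := hX.intervalIntegrable_left hl htI
  have e2 : IntervalIntegrable (iteratedDeriv 2 (fun y => v y t)) volume 0 l := by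
    rw [intervalIntegrable_iff_Ioo hl.le]
    exact ((intervalIntegrable_iff_Ioo hl.le).1 (hGi.sub hgi)).congr_fun
      (fun x hx => (hxx x hx).symm) measurableSet_Ioo
  rw [← e, ← sineCoeff_add n hgi e2]
  exact sineCoeff_congr hl n fun x hx => by rw [hxx x hx]; ring

end Half

section One
variable {l T α β μ M : ℝ} {g gt v : ℝ → ℝ → ℝ} {c d : ℝ → ℝ}

/-- The integrated equation, pointwise in `x` and in each mode. -/
lemma HalfSolution.integrated_one (h : HalfSolution l T 1 α β μ (1 - gam 1 β μ) g v)
    (hF : Forcing l T M g gt) (hl : 0 < l) (hδ : 0 < del α β μ)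
    (hδγ : del α β μ ≤ gam 1 β μ) (hγ1 : gam 1 β μ ≤ 1)
    (hc : ∀ x ∈ Ioo 0 l, Tendsto (leftInt (1 - gam 1 β μ) (v x)) (𝓝[>] 0) (𝓝 (c x))) :
    ∃ G : ℝ → ℝ → ℝ, XPowBdd l T (gam 1 β μ) G ∧
      (∀ x ∈ Ioo 0 l, ∀ t ∈ Ioo 0 T, leftInt (1 - gam 1 β μ) (v x) t =
        c x + leftInt (1 - gam 1 β μ + del α β μ) (G x) t) ∧
      (∀ n, ∀ t ∈ Ioo 0 T, leftInt (1 - gam 1 β μ) (fun s => sineCoeff l n (fun x => v x s)) t =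
        sineCoeff l n c + leftInt (1 - gam 1 β μ + del α β μ)
          (fun s => sineCoeff l n (fun x => g x s) + (-eig l n) * sineCoeff l n (fun x => v x s)) t) ∧
      ∀ n, ∀ t ∈ Ioo 0 T, sineCoeff l n (fun x => leftInt (1 - gam 1 β μ + del α β μ) (G x) t) =
        leftInt (1 - gam 1 β μ) (fun s => sineCoeff l n (fun x => v x s)) t - sineCoeff l n c := by
  have e0 : (1 - μ) * ((1 : ℕ) - β) = 1 - gam 1 β μ := by unfold gam; push_cast; ring
  have e1 : μ * ((1 : ℕ) - α) = gam 1 β μ - del α β μ := by unfold gam del; push_cast; ring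
  obtain ⟨G, hG, hGe, hGc⟩ := h.exists_source hl hF.cont
  rw [sub_sub_cancel] at hG
  have hv := h.xPowBdd
  rw [sub_sub_cancel] at hv
  have hγ0 : 0 < gam 1 β μ := by linarith
  have hκ : 0 ≤ 1 - gam 1 β μ := by linarith
  have hκ' : 0 ≤ 1 - gam 1 β μ + del α β μ := by linarith
  have hpt : ∀ x ∈ Ioo 0 l, ∀ t ∈ Ioo 0 T, leftInt (1 - gam 1 β μ) (v x) t =
      c x + leftInt (1 - gam 1 β μ + del α β μ) (G x) t := by
    intro x hx t ht
    have := leftInt_eq_of_hilfer_one (by rw [e1]; linarith) (by rw [e1]; linarith) hγ0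
      (h.exists_D x hx) (hGe x hx) (hG.powBdd (Ioo_subset_Icc_self hx))
      (by rw [e0]; exact hc x hx) t ht
    rw [e0, e1, show 1 - (gam 1 β μ - del α β μ) = 1 - gam 1 β μ + del α β μ by ring] at this
    exact this
  have hI : ∀ n, ∀ t ∈ Ioo 0 T, sineCoeff l n (fun x => leftInt (1 - gam 1 β μ + del α β μ) (G x) t) =
      leftInt (1 - gam 1 β μ) (fun s => sineCoeff l n (fun x => v x s)) t - sineCoeff l n c := by
    intro n t ht
    have htI := Ioo_subset_Ioc_self ht
    have hu : uIcc 0 l = Icc 0 l := uIcc_of_le hl.le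
    have i1 : IntervalIntegrable (fun x => leftInt (1 - gam 1 β μ) (v x) t) volume 0 l :=
      ContinuousOn.intervalIntegrable (by rw [hu]; exact hv.continuousOn_leftInt hκ hγ0 htI)
    have i2 : IntervalIntegrable (fun x => leftInt (1 - gam 1 β μ + del α β μ) (G x) t) volume 0 l :=
      ContinuousOn.intervalIntegrable (by rw [hu]; exact hG.continuousOn_leftInt hκ' hγ0 htI)
    -- The limit c carries no regularity of its own; at any fixed t the integrated equation exhibits
    -- it on (0, l) as a difference of functions continuous on [0, l].
    have : sineCoeff l n c = sineCoeff l n (fun x => leftInt (1 - gam 1 β μ) (v x) t +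
        (-1) * leftInt (1 - gam 1 β μ + del α β μ) (G x) t) :=
      sineCoeff_congr hl n fun x hx => by rw [hpt x hx t ht]; ring
    rw [this, sineCoeff_add n i1 (i2.const_mul _), sineCoeff_const_mul,
      hv.sineCoeff_leftInt hl hκ hγ0 htI]
    ring
  refine ⟨G, hG, hpt, fun n t ht => ?_, hI⟩
  have e := hI n t ht
  rw [hG.sineCoeff_leftInt hl hκ' hγ0 (Ioo_subset_Ioc_self ht),
    leftInt_congr hκ' ht.1 fun s hs => hGc n s ⟨hs.1, hs.2.trans_lt ht.2⟩] at e
  linarith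

lemma HalfSolution.coeff_one (h : HalfSolution l T 1 α β μ (1 - gam 1 β μ) g v)
    (hF : Forcing l T M g gt) (hl : 0 < l) (hδ : 0 < del α β μ)
    (hδγ : del α β μ ≤ gam 1 β μ) (hγ1 : gam 1 β μ ≤ 1)
    (hc : ∀ x ∈ Ioo 0 l, Tendsto (leftInt (1 - gam 1 β μ) (v x)) (𝓝[>] 0) (𝓝 (c x))) (n : ℕ) :
    ∀ t ∈ Ioc 0 T, sineCoeff l n (fun x => v x t) =
      sineCoeff l n c * mlKer (del α β μ) (eig l n) (gam 1 β μ) t +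
      conv (mlKer (del α β μ) (eig l n) (del α β μ)) (fun s => sineCoeff l n (fun x => g x s)) t := by
  obtain ⟨G, hG, hpt, hm, -⟩ := h.integrated_one hF hl hδ hδγ hγ1 hc
  intro t ht
  have := coeff_of_integrated (κ := 1 - gam 1 β μ) (a := gam 1 β μ) (b := gam 1 β μ)
    (A := sineCoeff l n c) (B := 0) (lam := eig l n) (by linarith) (by linarith) hδ (by linarith)
    (by linarith) (h.xPowBdd.powBdd_sineCoeff hl n) (hF.powBdd_coeff hl n) (fun t ht => by
      rw [hm n t ht, sub_add_cancel, powKer_one]; ring) t ht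
  rw [this]; ring

lemma tendsto_rpow_mul_mlKer {δ lam c : ℝ} (hδ : 0 < δ) (hc : 0 < c) :
    Tendsto (fun t => t ^ (1 - c) * mlKer δ lam c t) (𝓝[>] 0) (𝓝 (1 / Real.Gamma c)) := by
  have h := (continuous_mittagLeffler_rpow hδ hc lam).tendsto 0
  rw [Real.zero_rpow hδ.ne', mul_zero, mittagLeffler_zero hδ] at h
  refine (h.mono_left nhdsWithin_le_nhds).congr' ?_
  filter_upwards [self_mem_nhdsWithin] with t ht using (rpow_mul_mlKer ht).symm

lemma PowBdd.tendsto_rpow_mul {T c p : ℝ} (hT : 0 < T) {k : ℝ → ℝ} (hk : PowBdd T c k)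
    (hp : 1 - c < p) : Tendsto (fun t => t ^ p * k t) (𝓝[>] 0) (𝓝 0) := by
  obtain ⟨-, C, hC⟩ := hk
  have := (tendsto_rpow_nhdsGT (by linarith : 0 < p + (c - 1))).const_mul C
  rw [mul_zero] at this
  refine squeeze_zero_norm' ?_ this
  filter_upwards [Ioo_mem_nhdsGT hT] with t ht
  rw [norm_mul, Real.norm_of_nonneg (Real.rpow_nonneg ht.1.le _), Real.rpow_add ht.1, mul_left_comm]
  exact mul_le_mul_of_nonneg_left (hC t (Ioo_subset_Ioc_self ht)) (Real.rpow_nonneg ht.1.le _)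

/-- The kernel of order δ+1-γ is less singular than t^{δ-1} unless γ = 1, so only in that case does
g₀ reach the limit. -/
lemma tendsto_modeSource_one {T δ γ lam τ g₀ : ℝ} (hT : 0 < T) (hδ : 0 < δ) (hδ1 : δ < 1)
    (hγ1 : γ ≤ 1) {g' : ℝ → ℝ} (hg' : PowBdd T 1 g') :
    Tendsto (fun t => t ^ (1 - δ) * (((-lam * τ) * mlKer δ lam δ t +
      g₀ * mlKer δ lam (δ + 1 - γ) t) + conv (mlKer δ lam (δ + 1 - γ)) g' t)) (𝓝[>] 0)
      (𝓝 ((-lam * τ + if γ = 1 then g₀ else 0) / Real.Gamma δ)) := by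
  have hb : 0 < δ + 1 - γ := by linarith
  have t1 := (tendsto_rpow_mul_mlKer (lam := lam) hδ hδ).const_mul (-lam * τ)
  have t3 := ((powBdd_mlKer T lam hδ hb).conv hb one_pos hg').tendsto_rpow_mul hT
    (p := 1 - δ) (by linarith)
  have t2 : Tendsto (fun t => t ^ (1 - δ) * mlKer δ lam (δ + 1 - γ) t) (𝓝[>] 0)
      (𝓝 (if γ = 1 then 1 / Real.Gamma δ else 0)) := by
    split_ifs with hγ
    · rw [hγ, add_sub_cancel_right]; exact tendsto_rpow_mul_mlKer hδ hδ
    · have : γ < 1 := lt_of_le_of_ne hγ1 hγ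
      exact (powBdd_mlKer T lam hδ hb).tendsto_rpow_mul hT (by linarith)
  have := (t1.add (t2.const_mul g₀)).add t3
  convert this using 2
  · ring
  · split_ifs <;> ring

/-- The limit defining d holds pointwise in x, with no bound allowing it to pass under the integral.
By l'Hôpital it is δ times the limit of (I^{1-γ} v - c) / t^δ, and that quotient equals I^{1-γ+δ} G
/ t^δ, which is uniformly bounded. Dominated convergence applies to it, and the result is compared
with the explicit time coefficient. -/
lemma HalfSolution.nu_coeff (h : HalfSolution l T 1 α β μ (1 - gam 1 β μ) g v)
    (hF : Forcing l T M g gt) (hl : 0 < l) (hT : 0 < T) (hδ : 0 < del α β μ) (hδ1 : del α β μ < 1)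
    (hδγ : del α β μ ≤ gam 1 β μ) (hγ1 : gam 1 β μ ≤ 1)
    (hc : ∀ x ∈ Ioo 0 l, Tendsto (leftInt (1 - gam 1 β μ) (v x)) (𝓝[>] 0) (𝓝 (c x)))
    (hd : ∀ x ∈ Ioo 0 l, Tendsto (fun t => t ^ (1 - del α β μ) *
      deriv (leftInt (1 - gam 1 β μ) (v x)) t) (𝓝[>] 0) (𝓝 (d x))) (n : ℕ) :
    sineCoeff l n d = nuCoeff l (del α β μ) (gam 1 β μ) g n (sineCoeff l n c) := by
  have e0 : (1 - μ) * ((1 : ℕ) - β) = 1 - gam 1 β μ := by unfold gam; push_cast; ring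
  have hco := h.coeff_one hF hl hδ hδγ hγ1 hc n
  obtain ⟨G, hG, hpt, -, hI⟩ := h.integrated_one hF hl hδ hδγ hγ1 hc
  set δ := del α β μ with hδd
  set γ := gam 1 β μ with hγd
  have hγ0 : 0 < γ := by linarith
  have hκ' : 0 < 1 - γ + δ := by linarith
  have hb : 0 < δ + 1 - γ := by linarith
  have hlimx : ∀ x ∈ Ioo 0 l, Tendsto (fun t => leftInt (1 - γ + δ) (G x) t / t ^ δ) (𝓝[>] 0)
      (𝓝 (d x / δ)) := by
    intro x hx
    have hdiff := (h.exists_D x hx).2.1 0 (by norm_num)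
    rw [iteratedDeriv_zero, e0] at hdiff
    have hF0 : Tendsto (fun t => leftInt (1 - γ) (v x) t - c x) (𝓝[>] 0) (𝓝 0) := by
      have := (hc x hx).sub_const (c x)
      rwa [sub_self] at this
    refine (tendsto_div_rpow hδ ?_ hF0 (hd x hx)).congr' ?_
    · filter_upwards [Ioo_mem_nhdsGT hT] with t ht using (hdiff t ht).hasDerivAt.sub_const _
    · filter_upwards [Ioo_mem_nhdsGT hT] with t ht
      rw [hpt x hx t ht, add_sub_cancel_left]
  obtain ⟨-, C, hC⟩ := id hG
  have hbd : ∀ x ∈ Icc 0 l, ∀ t ∈ Ioo 0 T, |leftInt (1 - γ + δ) (G x) t / t ^ δ| ≤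
      |1 / Real.Gamma (1 - γ + δ)| * C * betaC (1 - γ + δ) γ := by
    intro x hx t ht
    have := abs_conv_le (p := powKer (1 - γ + δ)) (k := G x) (A := |1 / Real.Gamma (1 - γ + δ)|)
      hκ' hγ0 ht.1
      (fun s hs => by
        rw [powKer, div_eq_mul_one_div, abs_mul, abs_of_nonneg (Real.rpow_nonneg hs.1.le _),
          mul_comm])
      (fun s hs => hC x hx s ⟨hs.1, hs.2.le.trans ht.2.le⟩)
    rw [show 1 - γ + δ + γ - 1 = δ by ring] at this
    rw [leftInt_eq_conv hκ', abs_div, abs_of_pos (Real.rpow_pos_of_pos ht.1 δ),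
      div_le_iff₀ (Real.rpow_pos_of_pos ht.1 δ)]
    exact this
  have hlim1 : Tendsto (fun t => sineCoeff l n (fun x => leftInt (1 - γ + δ) (G x) t / t ^ δ))
      (𝓝[>] 0) (𝓝 (sineCoeff l n fun x => d x / δ)) := by
    unfold sineCoeff
    refine Tendsto.const_mul _ ?_
    simp only [integral_eq_Ioo hl.le]
    refine tendsto_integral_filter_of_dominated_convergence
      (fun _ => |1 / Real.Gamma (1 - γ + δ)| * C * betaC (1 - γ + δ) γ) ?_ ?_ ?_ ?_
    · filter_upwards [Ioo_mem_nhdsGT hT] with t ht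
      refine ContinuousOn.aestronglyMeasurable ?_ measurableSet_Ioo
      exact (((hG.continuousOn_leftInt hκ'.le hγ0 (Ioo_subset_Ioc_self ht)).mono
        Ioo_subset_Icc_self).div_const _).mul (continuous_mode l n).continuousOn
    · filter_upwards [Ioo_mem_nhdsGT hT] with t ht
      filter_upwards [ae_restrict_mem measurableSet_Ioo] with x hx
      rw [norm_mul]
      exact (mul_le_of_le_one_right (norm_nonneg _) (abs_mode_le l n x)).trans
        (hbd x (Ioo_subset_Icc_self hx) t ht)
    · exact integrable_const _
    · filter_upwards [ae_restrict_mem measurableSet_Ioo] with x hx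
      exact (hlimx x hx).mul_const _
  set g' : ℝ → ℝ := fun s => sineCoeff l n (fun x => gt x s) with hg'
  have hgc : ContinuousOn g' (Icc 0 T) := continuousOn_sineCoeff hl hF.cont_t n
  set hs : ℝ → ℝ := fun t => ((-eig l n * sineCoeff l n c) * mlKer δ (eig l n) δ t +
      sineCoeff l n (fun x => g x 0) * mlKer δ (eig l n) (δ + 1 - γ) t) +
      conv (mlKer δ (eig l n) (δ + 1 - γ)) g' t with hhs
  have hsp : PowBdd T δ hs :=
    (((powBdd_mlKer T _ hδ hδ).const_mul _).add
      (((powBdd_mlKer T _ hδ hb).const_mul _).weaken (by linarith))).add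
      (((powBdd_mlKer T _ hδ hb).conv hb one_pos (powBdd_of_continuousOn hgc)).weaken (by linarith))
  have hlim2 := tendsto_div_rpow hδ (F := fun t => ∫ s in (0 : ℝ)..t, hs s) (D := hs)
    (by filter_upwards [Ioo_mem_nhdsGT hT] with t ht using hasDerivAt_integral_of_powBdd hδ hsp ht)
    (tendsto_integral_of_powBdd hT hδ hsp)
    (tendsto_modeSource_one hT hδ hδ1 hγ1 (powBdd_of_continuousOn hgc))
  -- The coefficient of the quotient, recomputed from the formula for the time coefficient: it is
  -- the primitive of the explicit source `hs` divided by t^δ, whose limit is already known.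
  have heq : ∀ᶠ t in 𝓝[>] (0 : ℝ), (∫ s in (0 : ℝ)..t, hs s) / t ^ δ =
      sineCoeff l n (fun x => leftInt (1 - γ + δ) (G x) t / t ^ δ) := by
    filter_upwards [Ioo_mem_nhdsGT hT] with t ht
    have e1 : (fun x => leftInt (1 - γ + δ) (G x) t / t ^ δ) =
        fun x => (t ^ δ)⁻¹ * leftInt (1 - γ + δ) (G x) t := by
      ext x; rw [div_eq_inv_mul]
    rw [e1, sineCoeff_const_mul, hI n t ht,
      leftInt_congr (by linarith) ht.1 (fun s hs => hco s ⟨hs.1, hs.2.trans ht.2.le⟩),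
      leftInt_mode_one hδ hγ0 hγ1 _ ht.1 (hgc.mono (Icc_subset_Icc_right ht.2.le))
        (g := fun s => sineCoeff l n (fun x => g x s))
        (fun s hs => hF.coeff_primitive n s ⟨hs.1, hs.2.trans ht.2.le⟩)
        ((hF.powBdd_coeff hl n).mono ht.2.le), add_sub_cancel_left, leftInt_one, div_eq_inv_mul]
  have huniq := tendsto_nhds_unique (hlim2.congr' heq) hlim1
  have e2 : (fun x => d x / δ) = fun x => δ⁻¹ * d x := by ext x; rw [div_eq_inv_mul]
  rw [e2, sineCoeff_const_mul, div_eq_inv_mul] at huniq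
  have := mul_left_cancel₀ (inv_ne_zero hδ.ne') huniq
  rw [← this]
  rfl

end One

section Two
variable {l T α β μ M : ℝ} {g gt v : ℝ → ℝ → ℝ} {c d : ℝ → ℝ}

lemma HalfSolution.coeff_two (h : HalfSolution l T 2 α β μ (2 - gam 2 β μ) g v)
    (hF : Forcing l T M g gt) (hl : 0 < l) (hT : 0 < T) (hδ : 1 < del α β μ)
    (hδγ : del α β μ < gam 2 β μ) (hγ2 : gam 2 β μ ≤ 2)
    (hc : ∀ x ∈ Ioo 0 l, Tendsto (leftInt (2 - gam 2 β μ) (v x)) (𝓝[>] 0) (𝓝 (c x)))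
    (hd : ∀ x ∈ Ioo 0 l, Tendsto (deriv (leftInt (2 - gam 2 β μ) (v x))) (𝓝[>] 0) (𝓝 (d x)))
    (n : ℕ) :
    ∀ t ∈ Ioc 0 T, sineCoeff l n (fun x => v x t) =
      sineCoeff l n c * mlKer (del α β μ) (eig l n) (gam 2 β μ - 1) t +
      sineCoeff l n d * mlKer (del α β μ) (eig l n) (gam 2 β μ) t +
      conv (mlKer (del α β μ) (eig l n) (del α β μ)) (fun s => sineCoeff l n (fun x => g x s)) t := by
  have e0 : (1 - μ) * ((2 : ℕ) - β) = 2 - gam 2 β μ := by unfold gam; push_cast; ring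
  have e1 : μ * ((2 : ℕ) - α) = gam 2 β μ - del α β μ := by unfold gam del; push_cast; ring
  obtain ⟨G, hG, hGe, hGc⟩ := h.exists_source hl hF.cont
  have hv := h.xPowBdd
  have hγ0 : 0 < 1 - (2 - gam 2 β μ) := by linarith
  have hκ : 0 ≤ 2 - gam 2 β μ := by linarith
  have hκ' : 0 ≤ 2 - gam 2 β μ + del α β μ := by linarith
  have hpt : ∀ x ∈ Ioo 0 l, ∀ t ∈ Ioo 0 T, leftInt (2 - gam 2 β μ) (v x) t =
      c x + d x * t + leftInt (2 - gam 2 β μ + del α β μ) (G x) t := by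
    intro x hx t ht
    have := leftInt_eq_of_hilfer_two (by rw [e1]; linarith) (by rw [e1]; linarith) hγ0
      (h.exists_D x hx) (hGe x hx) (hG.powBdd (Ioo_subset_Icc_self hx))
      (by rw [e0]; exact hc x hx) (by rw [e0]; exact hd x hx) t ht
    rw [e0, e1, show 2 - (gam 2 β μ - del α β μ) = 2 - gam 2 β μ + del α β μ by ring] at this
    exact this
  have hu : uIcc 0 l = Icc 0 l := uIcc_of_le hl.le
  set W : ℝ → ℝ → ℝ := fun t x => leftInt (2 - gam 2 β μ) (v x) t +
    (-1) * leftInt (2 - gam 2 β μ + del α β μ) (G x) t with hW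
  have i1 : ∀ t ∈ Ioo 0 T, IntervalIntegrable (fun x => leftInt (2 - gam 2 β μ) (v x) t) volume 0 l :=
    fun t ht => ContinuousOn.intervalIntegrable
      (by rw [hu]; exact hv.continuousOn_leftInt hκ hγ0 (Ioo_subset_Ioc_self ht))
  have i2 : ∀ t ∈ Ioo 0 T,
      IntervalIntegrable (fun x => leftInt (2 - gam 2 β μ + del α β μ) (G x) t) volume 0 l :=
    fun t ht => ContinuousOn.intervalIntegrable
      (by rw [hu]; exact hG.continuousOn_leftInt hκ' hγ0 (Ioo_subset_Ioc_self ht))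
  have iW : ∀ t ∈ Ioo 0 T, IntervalIntegrable (W t) volume 0 l := fun t ht =>
    (i1 t ht).add ((i2 t ht).const_mul (-1))
  have hWe : ∀ x ∈ Ioo 0 l, ∀ t ∈ Ioo 0 T, W t x = c x + d x * t := fun x hx t ht => by
    rw [hW]; simp only []
    rw [hpt x hx t ht]; ring
  have hT2 : T / 2 ∈ Ioo 0 T := ⟨by linarith, by linarith⟩
  have hT4 : T / 4 ∈ Ioo 0 T := ⟨by linarith, by linarith⟩
  -- `W` is affine in t with slope d, so the difference of its values at T/2 and T/4, multiplied by
  -- 4/T, shows that d is integrable.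
  have hdi : IntervalIntegrable d volume 0 l := by
    rw [intervalIntegrable_iff_Ioo hl.le]
    refine ((intervalIntegrable_iff_Ioo hl.le).1 (((iW _ hT2).sub (iW _ hT4)).const_mul
      (4 / T))).congr_fun (fun x hx => ?_) measurableSet_Ioo
    simp only []
    rw [hWe x hx _ hT2, hWe x hx _ hT4]
    field_simp
    ring
  have hm : ∀ t ∈ Ioo 0 T, leftInt (2 - gam 2 β μ) (fun s => sineCoeff l n (fun x => v x s)) t =
      sineCoeff l n c + sineCoeff l n d * t + leftInt (2 - gam 2 β μ + del α β μ)
        (fun s => sineCoeff l n (fun x => g x s) + (-eig l n) * sineCoeff l n (fun x => v x s)) t := by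
    intro t ht
    have htI := Ioo_subset_Ioc_self ht
    have ec : sineCoeff l n c = sineCoeff l n (fun x => W t x + (-t) * d x) :=
      sineCoeff_congr hl n fun x hx => by rw [hWe x hx t ht]; ring
    rw [ec, sineCoeff_add n (iW t ht) (hdi.const_mul _), sineCoeff_const_mul, hW,
      sineCoeff_add n (i1 t ht) ((i2 t ht).const_mul _), sineCoeff_const_mul,
      hv.sineCoeff_leftInt hl hκ hγ0 htI, hG.sineCoeff_leftInt hl hκ' hγ0 htI,
      leftInt_congr hκ' ht.1 fun s hs => hGc n s ⟨hs.1, hs.2.trans_lt ht.2⟩]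
    ring
  have hpk2 : ∀ t : ℝ, powKer 2 t = t := fun t => by
    unfold powKer; rw [Real.Gamma_two]; norm_num
  intro t ht
  exact coeff_of_integrated (κ := 2 - gam 2 β μ) (a := gam 2 β μ - 1) (b := gam 2 β μ)
    (A := sineCoeff l n c) (B := sineCoeff l n d) (lam := eig l n) hκ (by linarith) (by linarith)
    (by linarith) (by linarith) (hv.powBdd_sineCoeff hl n) (hF.powBdd_coeff hl n) (fun t ht => by
      rw [hm t ht, sub_add_cancel, show 2 - gam 2 β μ + (gam 2 β μ - 1) = 1 by ring, powKer_one,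
        hpk2]
      ring) t ht

end Two

/-! ### Uniqueness -/

section Uniqueness
variable {l T α₁ β₁ μ₁ α₂ β₂ μ₂ : ℝ} {f : ℝ → ℝ → ℝ} {ψ : ℝ → ℝ}

/-- The sine coefficients of a solution are determined by the data. -/
lemma IsSolution.sineCoeff_eq {v : ℝ → ℝ → ℝ} (hl : 0 < l) (hT : 0 < T)
    (hE : ExponentRange α₁ β₁ μ₁ α₂ β₂ μ₂) (hf : AdmissibleF l T f) (hψ : AdmissiblePsi l ψ)
    (hv : IsSolution l T α₁ β₁ μ₁ α₂ β₂ μ₂ f ψ v) (n : ℕ) :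
    ∃ τ : ℝ, τ * detCoeff l T (del α₁ β₁ μ₁) (gam 1 β₁ μ₁) (del α₂ β₂ μ₂) (gam 2 β₂ μ₂) n =
        dataCoeff l T (del α₁ β₁ μ₁) (gam 1 β₁ μ₁) (del α₂ β₂ μ₂) (gam 2 β₂ μ₂) f ψ n ∧
      ∀ t ∈ Ioc 0 T,
        sineCoeff l n (fun x => v x t) =
          τ * mlKer (del α₁ β₁ μ₁) (eig l n) (gam 1 β₁ μ₁) t +
          conv (mlKer (del α₁ β₁ μ₁) (eig l n) (del α₁ β₁ μ₁))
            (fun s => sineCoeff l n (fun x => f x s)) t ∧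
        sineCoeff l n (fun x => v x (-t)) =
          τ * mlKer (del α₂ β₂ μ₂) (eig l n) (gam 2 β₂ μ₂ - 1) t +
          (-nuCoeff l (del α₁ β₁ μ₁) (gam 1 β₁ μ₁) f n τ) *
            mlKer (del α₂ β₂ μ₂) (eig l n) (gam 2 β₂ μ₂) t +
          conv (mlKer (del α₂ β₂ μ₂) (eig l n) (del α₂ β₂ μ₂))
            (fun s => sineCoeff l n (fun x => f x (-s))) t := by
  obtain ⟨hp, hm, hnl, h0, h1⟩ := isSolution_iff.1 hv
  obtain ⟨gp, Mp, -, hFp⟩ := hf.forcing_pos hl hT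
  obtain ⟨gm, Mm, -, hFm⟩ := hf.forcing_neg hl hT
  choose! c hc hc' using h0
  choose! d hd hd' using h1
  have hcp : ∀ x ∈ Ioo 0 l, _ := fun x hx => hc x (Ioo_subset_Icc_self hx)
  have hcm : ∀ x ∈ Ioo 0 l, _ := fun x hx => hc' x (Ioo_subset_Icc_self hx)
  have kp := hp.coeff_one hFp hl hE.del₁_pos hE.del₁_le hE.gam₁_le hcp n
  have kν := hp.nu_coeff hFp hl hT hE.del₁_pos hE.del₁_lt hE.del₁_le hE.gam₁_le hcp hd n
  have kd : sineCoeff l n (fun x => -d x) =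
      -nuCoeff l (del α₁ β₁ μ₁) (gam 1 β₁ μ₁) f n (sineCoeff l n c) := by
    rw [← kν, ← neg_one_mul (sineCoeff l n d), ← sineCoeff_const_mul]
    simp only [neg_one_mul]
  have km := hm.coeff_two hFm hl hT hE.del₂_gt hE.del₂_lt_gam hE.gam₂_le hcm (d := fun x => -d x) hd' n
  rw [kd] at km
  refine ⟨sineCoeff l n c, (nonlocal_iff ..).1 ?_, fun t ht => ⟨kp t ht, km t ht⟩⟩
  have hTT : T ∈ Ioc 0 T := ⟨hT, le_rfl⟩
  rw [← km T hTT, ← kp T hTT, sineCoeff_congr hl n fun x hx => hnl x (Ioo_subset_Icc_self hx),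
    sineCoeff_add n (hp.xPowBdd.intervalIntegrable_left hl hTT)
      (ContinuousOn.intervalIntegrable (by rw [uIcc_of_le hl.le]; exact hψ.cont))]

/-- In each mode the equation for τ has a nonzero determinant, so two solutions share τ, hence ν and
all their sine coefficients; completeness at each fixed time concludes. -/
theorem IsSolution.unique {u v : ℝ → ℝ → ℝ} (hl : 0 < l) (hT : 0 < T)
    (hE : ExponentRange α₁ β₁ μ₁ α₂ β₂ μ₂) (hf : AdmissibleF l T f) (hψ : AdmissiblePsi l ψ)
    (h0 : ∀ n, detCoeff l T (del α₁ β₁ μ₁) (gam 1 β₁ μ₁) (del α₂ β₂ μ₂) (gam 2 β₂ μ₂) (n + 1) ≠ 0)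
    (hv : IsSolution l T α₁ β₁ μ₁ α₂ β₂ μ₂ f ψ v) (hu : IsSolution l T α₁ β₁ μ₁ α₂ β₂ μ₂ f ψ u) :
    ∀ x ∈ Icc 0 l, ∀ t ∈ Ico (-T) 0 ∪ Ioc 0 T, v x t = u x t := by
  have hco : ∀ n, ∀ t ∈ Ioc 0 T,
      sineCoeff l (n + 1) (fun x => v x t) = sineCoeff l (n + 1) (fun x => u x t) ∧
      sineCoeff l (n + 1) (fun x => v x (-t)) = sineCoeff l (n + 1) (fun x => u x (-t)) := by
    intro n t ht
    obtain ⟨τ, hτ, kv⟩ := hv.sineCoeff_eq hl hT hE hf hψ (n + 1)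
    obtain ⟨τ', hτ', ku⟩ := hu.sineCoeff_eq hl hT hE hf hψ (n + 1)
    obtain rfl : τ = τ' := mul_right_cancel₀ (h0 n) (hτ.trans hτ'.symm)
    exact ⟨(kv t ht).1.trans (ku t ht).1.symm, (kv t ht).2.trans (ku t ht).2.symm⟩
  obtain ⟨vp, vm, -⟩ := isSolution_iff.1 hv
  obtain ⟨up, um, -⟩ := isSolution_iff.1 hu
  rintro x hx t (ht | ht)
  · have ht' : -t ∈ Ioc 0 T := ⟨by linarith [ht.2], by linarith [ht.1]⟩
    have := eqOn_of_sineCoeff_eq hl (vm.xPowBdd.continuousOn_left ht')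
      (um.xPowBdd.continuousOn_left ht') (vm.bdry _ ht').1 (vm.bdry _ ht').2 (um.bdry _ ht').1
      (um.bdry _ ht').2 (fun n => (hco n _ ht').2) x hx
    simpa only [neg_neg] using this
  · exact eqOn_of_sineCoeff_eq hl (vp.xPowBdd.continuousOn_left ht)
      (up.xPowBdd.continuousOn_left ht) (vp.bdry _ ht).1 (vp.bdry _ ht).2 (up.bdry _ ht).1
      (up.bdry _ ht).2 (fun n => (hco n _ ht).1) x hx

end Uniqueness

end MixedHilfer

theorem theorem1 (l T α₁ β₁ μ₁ α₂ β₂ μ₂ : ℝ) (hl : 0 < l) (hT : 0 < T)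
    (hα₁ : 0 < α₁ ∧ α₁ < 1) (hβ₁ : 0 < β₁ ∧ β₁ < 1) (hμ₁ : 0 ≤ μ₁ ∧ μ₁ ≤ 1)
    (hα₂ : 1 < α₂ ∧ α₂ < 2) (hβ₂ : 1 < β₂ ∧ β₂ < 2) (hμ₂ : 0 < μ₂ ∧ μ₂ ≤ 1)
    (hΔ : ∀ n : ℕ, 1 ≤ n → MixedHilfer.Delta l T α₁ β₁ μ₁ α₂ β₂ μ₂ n ≠ 0)
    (ψ : ℝ → ℝ) (hψ : MixedHilfer.AdmissiblePsi l ψ)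
    (f : ℝ → ℝ → ℝ) (hf : MixedHilfer.AdmissibleF l T f) :
    ∃ u : ℝ → ℝ → ℝ,
      MixedHilfer.IsSolution l T α₁ β₁ μ₁ α₂ β₂ μ₂ f ψ u ∧
      MixedHilfer.IsSineSeries l T α₁ β₁ μ₁ α₂ β₂ μ₂ f u ∧
      ∀ v : ℝ → ℝ → ℝ, MixedHilfer.IsSolution l T α₁ β₁ μ₁ α₂ β₂ μ₂ f ψ v →
        ∀ x ∈ Set.Icc 0 l, ∀ t ∈ Set.Ico (-T) 0 ∪ Set.Ioc 0 T, v x t = u x t := by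
  have hE := MixedHilfer.exponentRange hα₁ hβ₁ hμ₁ hα₂ hβ₂ hμ₂
  have h0 : ∀ n : ℕ, MixedHilfer.detCoeff l T (MixedHilfer.del α₁ β₁ μ₁) (MixedHilfer.gam 1 β₁ μ₁)
      (MixedHilfer.del α₂ β₂ μ₂) (MixedHilfer.gam 2 β₂ μ₂) (n + 1) ≠ 0 := fun n => by
    have := hΔ (n + 1) n.succ_pos
    rwa [MixedHilfer.Delta_eq] at this
  -- Only the values at m ≥ 1 enter the series; the value at m = 0 is irrelevant.
  let τ : ℕ → ℝ := fun m =>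
    MixedHilfer.dataCoeff l T (MixedHilfer.del α₁ β₁ μ₁) (MixedHilfer.gam 1 β₁ μ₁)
      (MixedHilfer.del α₂ β₂ μ₂) (MixedHilfer.gam 2 β₂ μ₂) f ψ m /
    MixedHilfer.detCoeff l T (MixedHilfer.del α₁ β₁ μ₁) (MixedHilfer.gam 1 β₁ μ₁)
      (MixedHilfer.del α₂ β₂ μ₂) (MixedHilfer.gam 2 β₂ μ₂) m
  obtain ⟨u, hu, hs⟩ := MixedHilfer.exists_solution (τ := fun n => τ (n + 1)) hl hT hE hf hψ h0
    fun n => div_mul_cancel₀ _ (h0 n)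
  exact ⟨u, hu, ⟨τ, fun m => MixedHilfer.nuCoeff l (MixedHilfer.del α₁ β₁ μ₁)
    (MixedHilfer.gam 1 β₁ μ₁) f m (τ m), fun x _ => hs x⟩,
    fun v hv => hv.unique hl hT hE hf hψ h0 hu⟩
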